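/- **Setting.** Let $M$ be a closed 3-manifold presented as an open book $M=W(h)\cup_{\mathrm{Id}}(\partial W\times D)$: $W$ is a compact connected surface with boundary circles indexed by $i=1,\dots,n$, $h:W\to W$ is a diffeomorphism equal to the identity near $\partial W$, $W(h)$ is its mapping torus with angular coordinate $\phi\in\mathbb R/2\pi\mathbb Z$, and the solid tori $\partial W\times D$ carry coordinates $(\theta,r,\phi)$ with $\theta\in\mathbb R/2\pi\mathbb Z$ and $(r,\phi)$ polar coordinates. These coordinates are also used on a collar $\{1\le r<R\}$ of $\partial W(h)$, $R>1$. The binding is $K=\bigcup_i K_i=\{r=0\}$, and the page $F_\alpha$ is the set $\{\phi=\alpha\}$ in $M\setminus K$. Let $(\lambda_\delta)_{0\le\delta<1}$ be a smooth family of 1-forms on $M$ such that, for some $\varepsilon\in(0,1)$ and $0<\rho<1-\varepsilon$: * for $0<\delta<1$, $\lambda_\delta$ is a contact form, $d\lambda_\delta$ is an area form on each page, and the Reeb vector fields $X_\delta$ extend to a family of vector fields $(X_\delta)_{0\le\delta<1}$ that is smooth up to $\delta=0$; * on the $i$-th tube $\{0\le r<R\}$, for all $0\le\delta<1$, $\lambda_\delta=\gamma_1(\delta,r)\,d\theta+\gamma_2(\delta,r)\,d\phi$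 (with $\gamma_1,\gamma_2$ depending on $i$). For $0<r<R$ (only for $0<r<1-\varepsilon$ if $\delta=0$) we have $\gamma_1'<0$ and $\mu:=\gamma_1\gamma_2'-\gamma_1'\gamma_2>0$, primes denoting $r$-derivatives. For $1-\varepsilon\le r<R$ we have $\gamma_2(\delta,r)=1$ and $\gamma_1(0,r)=0$; * for $r<\rho$ the functions $\gamma_1,\gamma_2$ do not depend on $\delta$ and form a local model: $\gamma_1$, $\gamma_2$, $\gamma_2/r^2$ are smooth functions on the disk; $\mu>0$ and $\gamma_1'<0$ for $r>0$; $\gamma_1(0)>0$; $\lim_{r\to0}\mu/r=\gamma_1(0)\gamma_2''(0)>0$; $\kappa=\gamma_1''(0)/\gamma_2''(0)\notin\mathbb Z$ and $\kappa\le-\frac12$; $(\gamma_2''\gamma_1'-\gamma_1''\gamma_2')/\mu^2=O(r)$ as $r\to 0$; * $\lambda_0=d\phi$ on the complement of $\{r<1-\varepsilon\}$. **Claim.** There are 1. a smooth family $(\tilde J_\delta)_{0\le\delta<1}$ of $\mathbb R$-invariant almost complex structures on $\mathbb R\times M$ with $\tilde J_\delta(X_\delta)=-\partial/\partial\tau$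 ($\tau$ the coordinate on $\mathbb R$) and $\tilde J_\delta(\ker\lambda_\delta)=\ker\lambda_\delta$, such that $\tilde J_\delta|_{\ker\lambda_\delta}$ is $d\lambda_\delta$-compatible whenever $\lambda_\delta$ is a contact form (that is, $(v,w)\mapsto d\lambda_\delta(v,\tilde J_\delta w)$ is a positive definite symmetric form on $\ker\lambda_\delta$); 2. a closed connected surface $S$, distinct points $p_1,\dots,p_n\in S$, $\dot S=S\setminus\{p_1,\dots,p_n\}$, and a smooth family of embeddings $u_\alpha:\dot S\to M$, $\alpha\in\mathbb R$, with $u_\alpha(\dot S)=F_\alpha$; 3. a smooth family of smooth functions $a_\alpha:\dot S\to\mathbb R$; 4. a smooth family of complex structures $j_\alpha$ on $S$ which, in fixed coordinates on disjoint disks around the punctures $p_i$ (independent of $\alpha$), are the standard one; equivalently, standard on $[0,\infty)\times S^1$ in coordinates $z=e^{-(s+it)}$; such that: * for every $\alpha$, $\tilde u_\alpha=(a_\alpha,u_\alpha):\dot S\to\mathbb R\times M$ is a proper embedding, is $\tilde J_0$-holomorphic ($T\tilde u_\alpha\circ j_\alpha=\tilde J_0\circ T\tilde u_\alpha$), and has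 finite energy $\sup_\varphi\int_{\dot S}\tilde u_\alpha^*d(\varphi\lambda_0)<\infty$, where $\varphi$ runs over the smooth functions $\mathbb R\to[0,1]$ with $\varphi'\ge0$; * all punctures are positive: $a_\alpha(z)\to+\infty$ as $z\to p_i$; * the maps $u_\alpha$ are transverse to $X_0$, and the translates $c+\tilde u_\alpha(\dot S)$ ($c\in\mathbb R$, $0\le\alpha\le2\pi$) together with the cylinders $\mathbb R\times K_i$ over the binding orbits are the leaves of a finite energy foliation of $\mathbb R\times M$. This means a smooth foliation by surfaces, invariant under $\mathbb R$-translations, each of whose leaves is either a cylinder $\mathbb R\times K_i$ or the image of a proper embedded finite energy $\tilde J_0$-holomorphic curve, defined on a closed Riemann surface minus finitely many points, whose projection to $M$ is transverse to $X_0$; * there is a neighbourhood $U$ of $\{p_1,\dots,p_n\}$ such that for all $\alpha$ and all $0\le\delta<1$ the map $\tilde u_\alpha$ is $\tilde J_\delta$-holomorphic on $U\setminus\{p_1,\dots,p_n\}$. -/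

import Mathlib

open Set Topology Filter
open scoped Manifold ContDiff ENNReal

universe w v

/-! ### Forms and almost complex structures on a three-manifold -/

section Forms

variable {M : Type*} [TopologicalSpace M] [ChartedSpace (EuclideanSpace ℝ (Fin 3)) M]

variable (M) in
/-- A (not necessarily continuous) 1-form on the three-manifold `M`. -/
abbrev OneForm : Type _ := ∀ p : M, TangentSpace (𝓡 3) p →L[ℝ] ℝ

variable (M) in
/-- A (not necessarily continuous) vector field on `M`. -/
abbrev VField : Type _ := ∀ p : M, TangentSpace (𝓡 3) p

variable (M) in
/-- An `ℝ`-invariant field of endomorphisms of `T(ℝ × M)`. At `(τ, p)` the tangent space is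
`ℝ × T_p M`, the first factor being spanned by `∂/∂τ`; invariance under translations of `ℝ` is
expressed by the fact that the endomorphism depends on `p` only, not on `τ`. -/
abbrev InvEndField : Type _ :=
  ∀ p : M, (ℝ × TangentSpace (𝓡 3) p) →L[ℝ] (ℝ × TangentSpace (𝓡 3) p)

/-- The coordinate expression of a 1-form in the preferred chart at `p`. -/
noncomputable def chartForm (lam : OneForm M) (p : M) (x : EuclideanSpace ℝ (Fin 3)) :
    EuclideanSpace ℝ (Fin 3) →L[ℝ] ℝ :=
  (lam ((extChartAt (𝓡 3) p).symm x)).comp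
    (mfderiv 𝓘(ℝ, EuclideanSpace ℝ (Fin 3)) (𝓡 3) (extChartAt (𝓡 3) p).symm x)

/-- The exterior derivative `dλ` at `p`, as a bilinear map, computed in the preferred chart at `p`
(whose differential at `p` is the identification of `T_p M` with `ℝ³`). -/
noncomputable def extD (lam : OneForm M) (p : M) (v w : TangentSpace (𝓡 3) p) : ℝ :=
  let D : EuclideanSpace ℝ (Fin 3) →L[ℝ] EuclideanSpace ℝ (Fin 3) →L[ℝ] ℝ :=
    fderiv ℝ (chartForm lam p) (extChartAt (𝓡 3) p p)
  D v w - D w v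

/-- The 3-form `λ ∧ dλ`. -/
noncomputable def wedgeD (lam : OneForm M) (p : M) (u v w : TangentSpace (𝓡 3) p) : ℝ :=
  lam p u * extD lam p v w + lam p v * extD lam p w u + lam p w * extD lam p u v

/-- `λ` is a contact form: `λ ∧ dλ` vanishes at no point. -/
def IsContactForm (lam : OneForm M) : Prop :=
  ∀ p : M, ∃ u v w : TangentSpace (𝓡 3) p, wedgeD lam p u v w ≠ 0

/-- `X` is the Reeb vector field of `λ`: `i_X dλ = 0` and `λ(X) = 1`. -/
def IsReeb (lam : OneForm M) (X : VField M) : Prop :=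
  ∀ p : M, (∀ v : TangentSpace (𝓡 3) p, extD lam p (X p) v = 0) ∧ lam p (X p) = 1

/-- The family of 1-forms `λ_δ`, `0 ≤ δ < 1`, is smooth in `δ` and in the point. -/
def SmoothFormFamily [IsManifold (𝓡 3) ∞ M] (lam : ℝ → OneForm M) : Prop :=
  ContMDiffOn (𝓘(ℝ, ℝ).prod (𝓡 3).tangent) 𝓘(ℝ, ℝ) ∞
    (fun q : ℝ × TangentBundle (𝓡 3) M ↦ lam q.1 q.2.proj q.2.snd) (Ico 0 1 ×ˢ univ)

/-- The family of vector fields `X_δ`, `0 ≤ δ < 1`, is smooth in `δ` and in the point. -/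
def SmoothFieldFamily [IsManifold (𝓡 3) ∞ M] (X : ℝ → VField M) : Prop :=
  ContMDiffOn (𝓘(ℝ, ℝ).prod (𝓡 3)) (𝓡 3).tangent ∞
    (fun q : ℝ × M ↦ (⟨q.2, X q.1 q.2⟩ : TangentBundle (𝓡 3) M)) (Ico 0 1 ×ˢ univ)

/-- `(J̃_δ)`, `0 ≤ δ < 1`, is a smooth family of (`ℝ`-invariant) almost complex structures on
`ℝ × M`. -/
def IsAlmostComplexFamily [IsManifold (𝓡 3) ∞ M] (J : ℝ → InvEndField M) : Prop :=
  (∀ δ ∈ Ico (0 : ℝ) 1, ∀ (p : M) (v : ℝ × TangentSpace (𝓡 3) p), J δ p (J δ p v) = -v) ∧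
  ContMDiffOn (𝓘(ℝ, ℝ).prod (𝓘(ℝ, ℝ).prod (𝓡 3).tangent)) (𝓘(ℝ, ℝ).prod (𝓡 3).tangent) ∞
    (fun q : ℝ × (ℝ × TangentBundle (𝓡 3) M) ↦
      ((J q.1 q.2.2.proj (q.2.1, q.2.2.snd)).1,
        (⟨q.2.2.proj, (J q.1 q.2.2.proj (q.2.1, q.2.2.snd)).2⟩ : TangentBundle (𝓡 3) M)))
    (Ico 0 1 ×ˢ univ)

/-- `J̃` maps `ker λ` (a subbundle of `TM ⊆ T(ℝ × M)`) to itself. -/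
def PreservesKer (lam : OneForm M) (J : InvEndField M) : Prop :=
  ∀ (p : M) (v : TangentSpace (𝓡 3) p), lam p v = 0 →
    (J p (0, v)).1 = 0 ∧ lam p (J p (0, v)).2 = 0

/-- The restriction of `J̃` to `ker λ` is `dλ`-compatible: `(v, w) ↦ dλ(v, J w)` is a positive
definite (symmetric) bilinear form on each fibre of `ker λ`. -/
def IsCompatible (lam : OneForm M) (J : InvEndField M) : Prop :=
  ∀ (p : M) (v w : TangentSpace (𝓡 3) p), lam p v = 0 → lam p w = 0 →
    extD lam p v (J p (0, w)).2 = extD lam p w (J p (0, v)).2 ∧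
    (v ≠ 0 → 0 < extD lam p v (J p (0, v)).2)

end Forms

/-! ### Open books and the normal form of the family of 1-forms -/

/-- An abstract open book presentation `M = W(h) ∪ (∂W × D)` of the 3-manifold `M`, with `n`
binding circles.

`F` is the abstract page `W ∪ (∂W × (0, 1])`: the interior surface obtained from the compact
surface `W` by attaching half-open annuli to its boundary circles. The annuli, enlarged by a collar
of `∂W` in `W`, are parametrised by `pageEnd i (r, θ)` with `0 < r < R`, where `1 < R` and `θ` is
`2π`-periodic, so that `W` is the compact complement of the annuli `0 < r < 1`.
The monodromy `h` is the identity near `∂W` and is extended by the identity over the annuli.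
The map `mt` induces a diffeomorphism of the mapping torus of `h` (the quotient of `F × ℝ`
by `(x, t) ∼ (h x, t + 2π)`) onto the complement of the binding. The map `tube i (θ, z)` induces an
embedding of the solid torus `S¹ × D_R` as a neighbourhood of the `i`-th binding circle `z = 0`;
in polar coordinates `z = r e^{iφ}`, the angle `φ` is the coordinate of the mapping torus. -/
structure OpenBook (M : Type*) [TopologicalSpace M] [ChartedSpace (EuclideanSpace ℝ (Fin 3)) M]
    (F : Type*) [TopologicalSpace F] [ChartedSpace ℂ F] (n : ℕ) where
  R : ℝ
  one_lt_R : 1 < R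
  pageEnd : Fin n → ℝ × ℝ → F
  pageEnd_smooth : ∀ i,
    ContMDiffOn 𝓘(ℝ, ℝ × ℝ) 𝓘(ℝ, ℂ) ∞ (pageEnd i) (Ioo 0 R ×ˢ univ)
  pageEnd_deriv : ∀ i, ∀ x ∈ Ioo 0 R ×ˢ (univ : Set ℝ),
    Function.Bijective (mfderiv 𝓘(ℝ, ℝ × ℝ) 𝓘(ℝ, ℂ) (pageEnd i) x)
  pageEnd_eq_iff : ∀ i j, ∀ r ∈ Ioo 0 R, ∀ r' ∈ Ioo 0 R, ∀ θ θ' : ℝ,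
    pageEnd i (r, θ) = pageEnd j (r', θ') ↔
      i = j ∧ r = r' ∧ ∃ k : ℤ, θ' = θ + 2 * Real.pi * k
  compact_core : IsCompact (⋃ i, pageEnd i '' (Ioo 0 1 ×ˢ univ))ᶜ
  h : F ≃ₘ^∞⟮𝓘(ℝ, ℂ), 𝓘(ℝ, ℂ)⟯ F
  h_pageEnd : ∀ i, ∀ r ∈ Ioo 0 R, ∀ θ : ℝ, h (pageEnd i (r, θ)) = pageEnd i (r, θ)
  mt : F × ℝ → M
  mt_smooth : ContMDiff (𝓘(ℝ, ℂ).prod 𝓘(ℝ, ℝ)) (𝓡 3) ∞ mt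
  mt_deriv : ∀ x, Function.Bijective (mfderiv (𝓘(ℝ, ℂ).prod 𝓘(ℝ, ℝ)) (𝓡 3) mt x)
  mt_eq_iff : ∀ (x y : F) (t s : ℝ), mt (x, t) = mt (y, s) ↔
    ∃ k : ℤ, s = t + 2 * Real.pi * k ∧ y = ((h.toEquiv : Equiv.Perm F) ^ k) x
  tube : Fin n → ℝ × ℂ → M
  tube_smooth : ∀ i,
    ContMDiffOn 𝓘(ℝ, ℝ × ℂ) (𝓡 3) ∞ (tube i) (univ ×ˢ Metric.ball 0 R)
  tube_deriv : ∀ i, ∀ x ∈ (univ : Set ℝ) ×ˢ Metric.ball (0 : ℂ) R,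
    Function.Bijective (mfderiv 𝓘(ℝ, ℝ × ℂ) (𝓡 3) (tube i) x)
  tube_eq_iff : ∀ i j, ∀ z ∈ Metric.ball (0 : ℂ) R, ∀ z' ∈ Metric.ball (0 : ℂ) R, ∀ θ θ' : ℝ,
    tube i (θ, z) = tube j (θ', z') ↔
      i = j ∧ z = z' ∧ ∃ k : ℤ, θ' = θ + 2 * Real.pi * k
  mt_pageEnd : ∀ i, ∀ r ∈ Ioo 0 R, ∀ θ φ : ℝ,
    mt (pageEnd i (r, θ), φ) = tube i (θ, r * Complex.exp (φ * Complex.I))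
  compl_range_mt : (range mt)ᶜ = ⋃ i, tube i '' (univ ×ˢ {0})

namespace OpenBook

variable {M : Type*} [TopologicalSpace M] [ChartedSpace (EuclideanSpace ℝ (Fin 3)) M]
  {F : Type*} [TopologicalSpace F] [ChartedSpace ℂ F] {n : ℕ}

/-- The page with angle `α`. -/
def page (B : OpenBook M F n) (α : ℝ) : Set M := range fun x : F ↦ B.mt (x, α)

/-- The `i`-th binding circle. -/
def binding (B : OpenBook M F n) (i : Fin n) : Set M := B.tube i '' (univ ×ˢ {0})

/-- The 1-form `λ` equals `γ₁(r) dθ + γ₂(r) dφ` on the `i`-th tube, where `z = r e^{iφ}` and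
`r² dφ = x dy - y dx` (at `z = 0` this reads `γ₁(0) dθ`). -/
def HasTubeForm (B : OpenBook M F n) (i : Fin n) (lam : OneForm M) (γ₁ γ₂ : ℝ → ℝ) : Prop :=
  ∀ (θ : ℝ), ∀ z ∈ Metric.ball (0 : ℂ) B.R, ∀ w : ℝ × ℂ,
    lam (B.tube i (θ, z)) (mfderiv 𝓘(ℝ, ℝ × ℂ) (𝓡 3) (B.tube i) (θ, z) w) =
      γ₁ ‖z‖ * w.1 + γ₂ ‖z‖ / ‖z‖ ^ 2 * ((starRingEnd ℂ) z * w.2).im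

/-- `dλ` restricts to an area form on each page. -/
def IsAreaFormOnPages (B : OpenBook M F n) (lam : OneForm M) : Prop :=
  ∀ (x : F) (t : ℝ) (v w : ℂ), LinearIndependent ℝ ![v, w] →
    extD lam (B.mt (x, t))
      (mfderiv (𝓘(ℝ, ℂ).prod 𝓘(ℝ, ℝ)) (𝓡 3) B.mt (x, t) (v, (0 : ℝ)))
      (mfderiv (𝓘(ℝ, ℂ).prod 𝓘(ℝ, ℝ)) (𝓡 3) B.mt (x, t) (w, (0 : ℝ))) ≠ 0

end OpenBook

/-- `μ = γ₁ γ₂' - γ₁' γ₂`. -/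
noncomputable def profileMu (γ₁ γ₂ : ℝ → ℝ) (r : ℝ) : ℝ :=
  γ₁ r * deriv γ₂ r - deriv γ₁ r * γ₂ r

/-- The (one-sided) second derivative at `0` of a function on `[0, ∞)`. -/
noncomputable def secondDerivZero (γ : ℝ → ℝ) : ℝ := iteratedDerivWithin 2 γ (Ici 0) 0

/-- `γ₁(r) dθ + γ₂(r) dφ` is a local model near the binding, on the disk of radius `ρ`. -/
structure IsLocalModel (γ₁ γ₂ : ℝ → ℝ) (ρ : ℝ) : Prop where
  smooth₁ : ContDiffOn ℝ ∞ (fun z : ℂ ↦ γ₁ ‖z‖) (Metric.ball 0 ρ)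
  smooth₂ : ContDiffOn ℝ ∞ (fun z : ℂ ↦ γ₂ ‖z‖) (Metric.ball 0 ρ)
  smooth₂_div : ∃ g : ℂ → ℝ, ContDiffOn ℝ ∞ g (Metric.ball 0 ρ) ∧
    ∀ z ∈ Metric.ball (0 : ℂ) ρ, γ₂ ‖z‖ = ‖z‖ ^ 2 * g z
  mu_pos : ∀ r ∈ Ioo 0 ρ, 0 < profileMu γ₁ γ₂ r
  zero_pos : 0 < γ₁ 0
  deriv_neg : ∀ r ∈ Ioo 0 ρ, deriv γ₁ r < 0
  mu_lim : Tendsto (fun r ↦ profileMu γ₁ γ₂ r / r) (𝓝[>] 0) (𝓝 (γ₁ 0 * secondDerivZero γ₂))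
  mu_lim_pos : 0 < γ₁ 0 * secondDerivZero γ₂
  kappa_not_int : ∀ k : ℤ, secondDerivZero γ₁ / secondDerivZero γ₂ ≠ k
  kappa_le : secondDerivZero γ₁ / secondDerivZero γ₂ ≤ -(1 / 2)
  order : (fun r ↦ (deriv (deriv γ₂) r * deriv γ₁ r - deriv (deriv γ₁) r * deriv γ₂ r) /
    (profileMu γ₁ γ₂ r) ^ 2) =O[𝓝[>] 0] fun r ↦ r

/-- A family `(λ_δ)`, `0 ≤ δ < 1`, of 1-forms adapted to an open book: contact forms supported by
the open book for `δ > 0`, degenerating to the confoliation form `λ_0`, which is `dφ` away from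
the binding, and equal to a fixed local model near the binding.

On the tubes `λ_δ = γ₁(δ, r) dθ + γ₂(δ, r) dφ`. As this makes the binding circles closed orbits with
the right orientation, `area` says that `λ_δ` is a contact form supported by the open book.
`X` is the family of Reeb vector fields, which converges (smoothly) to a limit `X_0` as `δ → 0`. -/
structure AdaptedFamily {M : Type*} [TopologicalSpace M]
    [ChartedSpace (EuclideanSpace ℝ (Fin 3)) M] [IsManifold (𝓡 3) ∞ M]
    {F : Type*} [TopologicalSpace F] [ChartedSpace ℂ F] {n : ℕ} (B : OpenBook M F n) where
  lam : ℝ → OneForm M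
  X : ℝ → VField M
  γ₁ : Fin n → ℝ → ℝ → ℝ
  γ₂ : Fin n → ℝ → ℝ → ℝ
  /-- The local model lives on `r < ρ`, and `λ_0 = dφ` for `r ≥ 1 - ε`. -/
  ρ : ℝ
  ε : ℝ
  ρ_pos : 0 < ρ
  ε_pos : 0 < ε
  ρ_lt : ρ < 1 - ε
  lam_smooth : SmoothFormFamily lam
  contact : ∀ δ ∈ Ioo (0 : ℝ) 1, IsContactForm (lam δ)
  area : ∀ δ ∈ Ioo (0 : ℝ) 1, B.IsAreaFormOnPages (lam δ)
  X_smooth : SmoothFieldFamily X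
  reeb : ∀ δ ∈ Ioo (0 : ℝ) 1, IsReeb (lam δ) (X δ)
  tube_form : ∀ δ ∈ Ico (0 : ℝ) 1, ∀ i, B.HasTubeForm i (lam δ) (γ₁ i δ) (γ₂ i δ)
  local_model : ∀ i, IsLocalModel (γ₁ i 0) (γ₂ i 0) ρ
  local_const : ∀ δ ∈ Ico (0 : ℝ) 1, ∀ i, ∀ r ∈ Ico 0 ρ,
    γ₁ i δ r = γ₁ i 0 r ∧ γ₂ i δ r = γ₂ i 0 r
  turning : ∀ δ ∈ Ico (0 : ℝ) 1, ∀ i, ∀ r ∈ Ioo 0 B.R, (δ = 0 → r < 1 - ε) →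
    0 < profileMu (γ₁ i δ) (γ₂ i δ) r ∧ deriv (γ₁ i δ) r < 0
  outer : ∀ δ ∈ Ico (0 : ℝ) 1, ∀ i, ∀ r ∈ Ico (1 - ε) B.R, γ₂ i δ r = 1
  outer_zero : ∀ i, ∀ r ∈ Ico (1 - ε) B.R, γ₁ i 0 r = 0
  lam_zero : ∀ x ∉ ⋃ i, B.pageEnd i '' (Ioo 0 (1 - ε) ×ˢ univ), ∀ (t : ℝ) (v : ℂ) (s : ℝ),
    lam 0 (B.mt (x, t)) (mfderiv (𝓘(ℝ, ℂ).prod 𝓘(ℝ, ℝ)) (𝓡 3) B.mt (x, t) (v, s)) = s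

/-! ### Pseudoholomorphic curves on punctured surfaces -/

section Curves

variable {M : Type*} [TopologicalSpace M] [ChartedSpace (EuclideanSpace ℝ (Fin 3)) M]
  {S : Type*} [TopologicalSpace S] [ChartedSpace ℂ S]

variable (S) in
/-- A field of endomorphisms of the tangent spaces of the surface `S`. -/
abbrev SurfEndField : Type _ := ∀ z : S, TangentSpace 𝓘(ℝ, ℂ) z →L[ℝ] TangentSpace 𝓘(ℝ, ℂ) z

/-- `(j_α)` is a smooth family of complex structures on the surface `S`. -/
def IsComplexFamily [IsManifold 𝓘(ℝ, ℂ) ∞ S] (j : ℝ → SurfEndField S) : Prop :=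
  (∀ (α : ℝ) (z : S) (v : TangentSpace 𝓘(ℝ, ℂ) z), j α z (j α z v) = -v) ∧
  ContMDiff (𝓘(ℝ, ℝ).prod 𝓘(ℝ, ℂ).tangent) 𝓘(ℝ, ℂ).tangent ∞
    (fun q : ℝ × TangentBundle 𝓘(ℝ, ℂ) S ↦
      (⟨q.2.proj, j q.1 q.2.proj q.2.snd⟩ : TangentBundle 𝓘(ℝ, ℂ) S))

/-- The differential of `ũ = (a, u) : S → ℝ × M`. -/
noncomputable def curveDeriv (a : S → ℝ) (u : S → M) (z : S) (v : TangentSpace 𝓘(ℝ, ℂ) z) :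
    ℝ × TangentSpace (𝓡 3) (u z) :=
  ((mfderiv 𝓘(ℝ, ℂ) 𝓘(ℝ, ℝ) a z v : ℝ), mfderiv 𝓘(ℝ, ℂ) (𝓡 3) u z v)

/-- `ũ = (a, u)` is `J̃`-holomorphic at `z`: `Tũ ∘ j = J̃ ∘ Tũ`. -/
def IsHolomorphicAt (J : InvEndField M) (j : SurfEndField S) (a : S → ℝ) (u : S → M) (z : S) :
    Prop :=
  ∀ v : TangentSpace 𝓘(ℝ, ℂ) z, curveDeriv a u z (j z v) = J (u z) (curveDeriv a u z v)

/-- The integral `∫_U |η|` of the absolute value of a 2-form `η` over a subset `U` of the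
surface `S`: the supremum of the integrals over finite families of disjoint Borel pieces of `U`,
each contained in the domain of a chart. -/
noncomputable def twoFormMass
    (η : ∀ z : S, TangentSpace 𝓘(ℝ, ℂ) z → TangentSpace 𝓘(ℝ, ℂ) z → ℝ) (U : Set S) : ℝ≥0∞ :=
  ⨆ (N : ℕ) (c : Fin N → S) (P : Fin N → Set ℂ)
    (_ : ∀ k, MeasurableSet (P k) ∧ P k ⊆ (extChartAt 𝓘(ℝ, ℂ) (c k)).target ∧
      (extChartAt 𝓘(ℝ, ℂ) (c k)).symm '' P k ⊆ U)
    (_ : Pairwise fun k l ↦ Disjoint ((extChartAt 𝓘(ℝ, ℂ) (c k)).symm '' P k)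
      ((extChartAt 𝓘(ℝ, ℂ) (c l)).symm '' P l)),
    ∑ k, ∫⁻ x in P k, ENNReal.ofReal
      |η ((extChartAt 𝓘(ℝ, ℂ) (c k)).symm x)
        (mfderiv 𝓘(ℝ, ℂ) 𝓘(ℝ, ℂ) (extChartAt 𝓘(ℝ, ℂ) (c k)).symm x (1 : ℂ))
        (mfderiv 𝓘(ℝ, ℂ) 𝓘(ℝ, ℂ) (extChartAt 𝓘(ℝ, ℂ) (c k)).symm x Complex.I)|

/-- The 2-form `ũ^* d(φ λ) = φ'(a) da ∧ u^*λ + φ(a) u^*dλ` on the surface. -/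
noncomputable def energyForm (lam : OneForm M) (φ : ℝ → ℝ) (a : S → ℝ) (u : S → M) (z : S)
    (v w : TangentSpace 𝓘(ℝ, ℂ) z) : ℝ :=
  deriv φ (a z) *
      ((curveDeriv a u z v).1 * lam (u z) (curveDeriv a u z w).2 -
        (curveDeriv a u z w).1 * lam (u z) (curveDeriv a u z v).2) +
    φ (a z) * extD lam (u z) (curveDeriv a u z v).2 (curveDeriv a u z w).2

/-- The energy `E(ũ) = sup_φ ∫ ũ^* d(φ λ)` over `U`, where `φ : ℝ → [0, 1]` runs through the smooth
functions with `φ' ≥ 0`. On pseudoholomorphic curves the integrands are nonnegative with respect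
to the orientation by the complex structure, so that taking absolute values changes nothing. -/
noncomputable def energy (lam : OneForm M) (a : S → ℝ) (u : S → M) (U : Set S) : ℝ≥0∞ :=
  ⨆ (φ : ℝ → ℝ) (_ : ContDiff ℝ ∞ φ) (_ : ∀ s, φ s ∈ Icc (0 : ℝ) 1) (_ : ∀ s, 0 ≤ deriv φ s),
    twoFormMass (energyForm lam φ a u) U

/-- `(a, u) : S ∖ Γ → ℝ × M` is a smooth, proper, embedded `J̃`-holomorphic curve of finite
energy. The values of `a` and `u` on `Γ` are irrelevant. -/
structure IsEmbeddedFiniteEnergyCurve (lam : OneForm M) (J : InvEndField M) (Γ : Set S)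
    (j : SurfEndField S) (a : S → ℝ) (u : S → M) : Prop where
  smooth_a : ContMDiffOn 𝓘(ℝ, ℂ) 𝓘(ℝ, ℝ) ∞ a Γᶜ
  smooth_u : ContMDiffOn 𝓘(ℝ, ℂ) (𝓡 3) ∞ u Γᶜ
  holomorphic : ∀ z ∈ Γᶜ, IsHolomorphicAt J j a u z
  embedding : IsEmbedding fun z : (Γᶜ : Set S) ↦ (a z, u z)
  immersion : ∀ z ∈ Γᶜ, Function.Injective (curveDeriv a u z)
  proper : IsProperMap fun z : (Γᶜ : Set S) ↦ (a z, u z)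
  finite_energy : energy lam a u Γᶜ < ⊤

/-- The projection `u` of the curve is transverse to the vector field `X` on `S ∖ Γ`. -/
def IsTransverseTo (X : VField M) (Γ : Set S) (u : S → M) : Prop :=
  ∀ z ∈ Γᶜ, X (u z) ∉ range (mfderiv 𝓘(ℝ, ℂ) (𝓡 3) u z)

end Curves

/-! ### Finite energy foliations -/

/-- `ℱ` is (the set of leaves of) a smooth foliation of `ℝ × M` by surfaces: a partition into
path-connected leaves such that every point lies in a foliated chart, in which each leaf is
a countable union of plaques. -/
structure IsSurfaceFoliation {M : Type*} [TopologicalSpace M]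
    [ChartedSpace (EuclideanSpace ℝ (Fin 3)) M] (ℱ : Set (Set (ℝ × M))) : Prop where
  connected : ∀ L ∈ ℱ, IsPathConnected L
  partition : ∀ q : ℝ × M, ∃! L : Set (ℝ × M), L ∈ ℱ ∧ q ∈ L
  charts : ∀ q : ℝ × M, ∃ Θ : OpenPartialHomeomorph (ℝ × M) (ℂ × ℂ), q ∈ Θ.source ∧
    Θ.target = Metric.ball (0 : ℂ) 1 ×ˢ Metric.ball (0 : ℂ) 1 ∧
    ContMDiffOn (𝓘(ℝ, ℝ).prod (𝓡 3)) 𝓘(ℝ, ℂ × ℂ) ∞ Θ Θ.source ∧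
    ContMDiffOn 𝓘(ℝ, ℂ × ℂ) (𝓘(ℝ, ℝ).prod (𝓡 3)) ∞ Θ.symm Θ.target ∧
    ∀ L ∈ ℱ, ∃ C : Set ℂ, C.Countable ∧ L ∩ Θ.source = Θ.source ∩ Θ ⁻¹' {x | x.2 ∈ C}

/-- `ℱ` is a finite energy foliation of `ℝ × M` with binding orbits `K i`: a foliation, invariant
under translations of `ℝ`, whose leaves are the cylinders `ℝ × K i` and the images of embedded
finite energy `J̃`-holomorphic curves `(a, u)`, defined on finitely punctured closed Riemann
surfaces `(S, j)`, with `u` transverse to `X`. -/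
structure IsFiniteEnergyFoliation {M : Type v} [TopologicalSpace M]
    [ChartedSpace (EuclideanSpace ℝ (Fin 3)) M] [IsManifold (𝓡 3) ∞ M] (lam : OneForm M)
    (X : VField M) (J : InvEndField M) {n : ℕ} (K : Fin n → Set M) (ℱ : Set (Set (ℝ × M))) :
    Prop where
  foliation : IsSurfaceFoliation ℱ
  invariant : ∀ L ∈ ℱ, ∀ c : ℝ, (fun q : ℝ × M ↦ (c + q.1, q.2)) '' L ∈ ℱ
  leaves : ∀ L ∈ ℱ, (∃ i, L = univ ×ˢ K i) ∨
    ∃ (S : Type w) (_ : TopologicalSpace S) (_ : ChartedSpace ℂ S)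
      (_ : IsManifold 𝓘(ℝ, ℂ) ∞ S) (_ : CompactSpace S) (_ : T2Space S) (_ : ConnectedSpace S)
      (Γ : Set S) (j : SurfEndField S) (a : S → ℝ) (u : S → M),
      Γ.Finite ∧ IsComplexFamily (fun _ ↦ j) ∧ IsEmbeddedFiniteEnergyCurve lam J Γ j a u ∧
      IsTransverseTo X Γ u ∧ L = (fun z ↦ (a z, u z)) '' Γᶜ

/-! The curves can be written down explicitly, and the almost complex structures are built around
them. For every `δ`, including `δ = 0`, the Reeb field `X_δ` is transverse to the pages
(`reebHat_snd_ne_zero`), so projection along `X_δ` identifies `ker λ_δ` with the tangent planes of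
the pages. One smooth family of complex structures `j_α` on the pages therefore induces complex
structures on `ker λ_δ` for all `δ` at once, and the requirement `J̃ X_δ = -∂/∂τ` determines the
rest of `J̃_δ` (`kerEndo`, `acs`). Because `i_X dλ = 0`, the form `dλ_δ` on `ker λ_δ` is the
restriction of `dλ_δ` to the page, an area form whose sign does not change with `δ > 0`;
compatibility thus only requires `j_α` to have the right orientation (`extD_kerEndo`). For this
`J̃_δ` a graph `(a, u_α)` over a page is holomorphic as soon as `da = λ_δ ∘ j_α` along the page
(`isHolomorphicAt_of_eq`).

For `δ = 0` this equation is an ordinary differential equation. Away from the binding `λ_0 = dφ`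
vanishes on the pages and `a` is constant. On an end set `j ∂_r = -β(r) ∂_θ`: the equation becomes
`a' = -β γ₁`, and `f e^{-iθ}` with `f' = β f` is a holomorphic coordinate. Near the binding `β = μ /
(r γ₁ (-γ₁'))` is the choice for which the structure on `ker λ` becomes multiplication by `i` on the
`z`-component in the tube, so that it extends smoothly over `z = 0` (`tubeEndo_polar`,
`kerEndo_tube`). Then `a' = -(1/r) μ/(-γ₁')`. By Hadamard's lemma for radial functions `μ/(-γ₁')` is
smooth on the disk with a positive value `c` at the centre, whence `a = -c log r - p` with `p`
smooth on the disk (`IsLocalModel.exists_primitive`, `exists_endProfile`). So `a → +∞` and `f → 0`: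
the end is a punctured disk, its puncture is positive, and it can be filled (`PuncturedEnds`). As
nothing depends on `δ` for small `r`, the curve is `J̃_δ`-holomorphic there for all `δ`.

The structures `j_α` must have the prescribed form on the ends and be equivariant under the
monodromy. They are rotations by a right angle for the metric induced by a map of the mapping torus
to a Euclidean space that is immersive on each page, and that on the ends is the polar coordinate
map `f e^{iθ}` (`nonempty_pageComplex`).

The energy is bounded because `ũ^* d(φ λ_0)` vanishes on the core and equals `d(φ(c + a) γ₁ dθ)` on
an end, where `φ(c + a) γ₁` decreases and takes values in `[0, γ₁(0)]` (`energy_leaf_lt_top`). The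
translates of the curves and the cylinders over the binding partition `ℝ × M`. The foliation is
smooth at the binding because the coordinates `s = τ + p(r)` and `w = e^{s/c} z` straighten it:
every translate becomes `w = const` and the cylinder becomes `w = 0` (`mem_leaf_tube`). -/

set_option linter.unusedSectionVars false

/-! ### The inverse function theorem on manifolds. -/

section Inverse

variable {E : Type*} [NormedAddCommGroup E] [NormedSpace ℝ E] [CompleteSpace E]
  {H : Type*} [TopologicalSpace H] {I : ModelWithCorners ℝ E H} [I.Boundaryless]
  {N : Type*} [TopologicalSpace N] [ChartedSpace H N] [IsManifold I ∞ N]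
  {E' : Type*} [NormedAddCommGroup E'] [NormedSpace ℝ E'] [CompleteSpace E']
  {H' : Type*} [TopologicalSpace H'] {I' : ModelWithCorners ℝ E' H'} [I'.Boundaryless]
  {N' : Type*} [TopologicalSpace N'] [ChartedSpace H' N'] [IsManifold I' ∞ N']
  {E'' : Type*} [NormedAddCommGroup E''] [NormedSpace ℝ E'']
  {H'' : Type*} [TopologicalSpace H''] {I'' : ModelWithCorners ℝ E'' H''}
  {N'' : Type*} [TopologicalSpace N''] [ChartedSpace H'' N'']

/-- A bijective continuous linear map between Banach spaces as an equivalence. -/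
noncomputable def ContinuousLinearMap.equivOfBijective (f : E →L[ℝ] E')
    (hf : Function.Bijective f) : E ≃L[ℝ] E' :=
  ContinuousLinearEquiv.ofBijective f (LinearMap.ker_eq_bot.2 hf.1) (LinearMap.range_eq_top.2 hf.2)

@[simp] theorem ContinuousLinearMap.coe_equivOfBijective (f : E →L[ℝ] E')
    (hf : Function.Bijective f) : (f.equivOfBijective hf : E →L[ℝ] E') = f :=
  ContinuousLinearEquiv.coe_ofBijective f _ _

variable (I I') in
/-- The derivative `mfderiv`, viewed as a map between the model vector spaces. -/
noncomputable def mder (f : N → N') (x : N) : E →L[ℝ] E' := mfderiv I I' f x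

theorem mder_eq_fderiv (f : E → E') (x : E) : mder 𝓘(ℝ, E) 𝓘(ℝ, E') f x = fderiv ℝ f x :=
  mfderiv_eq_fderiv

theorem mder_comp {g : N' → N''} {f : N → N'} (x : N) (hg : MDifferentiableAt I' I'' g (f x))
    (hf : MDifferentiableAt I I' f x) :
    mder I I'' (g ∘ f) x = (mder I' I'' g (f x)).comp (mder I I' f x) :=
  mfderiv_comp x hg hf

theorem mder_comp_apply {g : N' → N''} {f : N → N'} (x : N)
    (hg : MDifferentiableAt I' I'' g (f x))
    (hf : MDifferentiableAt I I' f x) (v : E) :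
    mder I I'' (fun y ↦ g (f y)) x v = mder I' I'' g (f x) (mder I I' f x v) :=
  DFunLike.congr_fun (mder_comp x hg hf) v

theorem mder_congr {f g : N → N'} {x : N} (h : f =ᶠ[𝓝 x] g) : mder I I' f x = mder I I' g x :=
  h.mfderiv_eq

theorem mder_eq_fderiv_written {f : N → N'} {x : N} (hf : MDifferentiableAt I I' f x) :
    mder I I' f x = fderiv ℝ (writtenInExtChartAt I I' x f) (extChartAt I x x) := by
  unfold mder
  rw [hf.mfderiv, I.range_eq_univ, fderivWithin_univ]

theorem hasFDerivAt_written {f : N → N'} {x : N} (hf : MDifferentiableAt I I' f x) :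
    HasFDerivAt (writtenInExtChartAt I I' x f) (mder I I' f x) (extChartAt I x x) := by
  have := hf.hasMFDerivAt.2
  rw [I.range_eq_univ] at this
  exact this.hasFDerivAt Filter.univ_mem

variable (I) in
/-- The preferred chart with values in the model vector space. -/
noncomputable def modelChart (x : N) : OpenPartialHomeomorph N E :=
  (chartAt H x).trans I.toHomeomorph.toOpenPartialHomeomorph

theorem coe_modelChart (x : N) : (modelChart I x : N → E) = extChartAt I x := rfl
theorem modelChart_source (x : N) : (modelChart I x).source = (extChartAt I x).source := by
  simp [modelChart]
theorem modelChart_target (x : N) : (modelChart I x).target = (extChartAt I x).target := by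
  rw [extChartAt_target]
  simp only [modelChart, OpenPartialHomeomorph.trans_target, I.range_eq_univ, inter_univ]
  simp
  rfl

/-- The inverse function theorem on manifolds. -/
theorem exists_openPartialHomeomorph_of_bijective_mder {f : N → N'} {x : N} {U : Set N}
    (hU : IsOpen U) (hx : x ∈ U) (hf : ContMDiffOn I I' ∞ f U)
    (hd : Function.Bijective (mder I I' f x)) :
    ∃ e : OpenPartialHomeomorph N N', x ∈ e.source ∧ e.source ⊆ U ∧ (e : N → N') = f ∧
      ContMDiffAt I' I ∞ e.symm (f x) := by
  have hfx : ContMDiffAt I I' ∞ f x := (hf x hx).contMDiffAt (hU.mem_nhds hx)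
  have hmd : MDifferentiableAt I I' f x := hfx.mdifferentiableAt (by simp)
  have hg : ContDiffAt ℝ ∞ (writtenInExtChartAt I I' x f) (extChartAt I x x) := by
    have := (contMDiffAt_iff.1 hfx).2
    rw [I.range_eq_univ] at this
    exact this.contDiffAt Filter.univ_mem
  have hgd : HasFDerivAt (writtenInExtChartAt I I' x f)
      ((mder I I' f x).equivOfBijective hd : E →L[ℝ] E') (extChartAt I x x) := by
    rw [ContinuousLinearMap.coe_equivOfBijective]
    exact hasFDerivAt_written hmd
  let g := hg.toOpenPartialHomeomorph _ hgd (by simp)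
  have hgc : (g : E → E') = writtenInExtChartAt I I' x f := rfl
  have hg0 : extChartAt I x x ∈ g.source :=
    ContDiffAt.mem_toOpenPartialHomeomorph_source hg hgd (by simp)
  let e0 := ((modelChart I x).trans g).trans (modelChart I' (f x)).symm
  have hV : IsOpen (U ∩ f ⁻¹' (modelChart I' (f x)).source) :=
    hf.continuousOn.isOpen_inter_preimage hU (modelChart I' (f x)).open_source
  -- The composite of charts agrees with `f` only at points of `U` that `f` sends into the chart at
  -- `f x`.
  let e1 := e0.restrOpen _ hV
  have hx1 : x ∈ e1.source := by
    simp only [e1, e0, OpenPartialHomeomorph.restrOpen_source, OpenPartialHomeomorph.trans_source,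
      mem_inter_iff, mem_preimage, OpenPartialHomeomorph.symm_source, modelChart_source,
      modelChart_target, coe_modelChart, OpenPartialHomeomorph.coe_trans, Function.comp]
    refine ⟨⟨⟨mem_extChartAt_source x, hg0⟩, ?_⟩, hx, mem_extChartAt_source _⟩
    rw [hgc]
    simp [writtenInExtChartAt]
  have hmem : ∀ y ∈ e1.source, y ∈ U ∧ y ∈ (extChartAt I x).source ∧
      f y ∈ (extChartAt I' (f x)).source := by
    intro y hy
    simp only [e1, e0, OpenPartialHomeomorph.restrOpen_source, OpenPartialHomeomorph.trans_source,
      mem_inter_iff, mem_preimage, OpenPartialHomeomorph.symm_source, modelChart_source,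
      modelChart_target, coe_modelChart, OpenPartialHomeomorph.coe_trans, Function.comp] at hy
    exact ⟨hy.2.1, hy.1.1.1, hy.2.2⟩
  have heq : EqOn e1 f e1.source := by
    intro y hy
    obtain ⟨-, h1, h2⟩ := hmem y hy
    change (extChartAt I' (f x)).symm (writtenInExtChartAt I I' x f (extChartAt I x y)) = f y
    simp only [writtenInExtChartAt, Function.comp]
    rw [(extChartAt I x).left_inv h1, (extChartAt I' (f x)).left_inv h2]
  -- The forward map is replaced by `f` itself, so that the coercion of the result is `f` everywhere
  -- and not only on the source.
  refine ⟨{ toFun := f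
            invFun := e1.symm
            source := e1.source
            target := e1.target
            map_source' := fun y hy ↦ by rw [← heq hy]; exact e1.map_source hy
            map_target' := fun y hy ↦ e1.map_target hy
            left_inv' := fun y hy ↦ by rw [← heq hy]; exact e1.left_inv hy
            right_inv' := fun y hy ↦ by rw [← heq (e1.map_target hy)]; exact e1.right_inv hy
            open_source := e1.open_source
            open_target := e1.open_target
            continuousOn_toFun := hf.continuousOn.mono fun y hy ↦ (hmem y hy).1
            continuousOn_invFun := e1.continuousOn_symm }, hx1, fun y hy ↦ (hmem y hy).1, rfl, ?_⟩
  have hginv : ContDiffAt ℝ ∞ g.symm (extChartAt I' (f x) (f x)) := by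
    have := ContDiffAt.to_localInverse hg hgd (by simp)
    have h : writtenInExtChartAt I I' x f (extChartAt I x x) = extChartAt I' (f x) (f x) := by
      simp [writtenInExtChartAt]
    rw [h] at this
    exact this
  have hg1 : g.symm (extChartAt I' (f x) (f x)) = extChartAt I x x := by
    have := g.left_inv hg0
    rwa [hgc, writtenInExtChartAt, Function.comp, Function.comp, extChartAt_to_inv] at this
  change ContMDiffAt I' I ∞ ((extChartAt I x).symm ∘ g.symm ∘ extChartAt I' (f x)) (f x)
  refine ContMDiffAt.comp (I' := 𝓘(ℝ, E)) _ ?_ (ContMDiffAt.comp (I' := 𝓘(ℝ, E')) _ ?_ ?_)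
  · rw [Function.comp, hg1]
    exact (contMDiffOn_extChartAt_symm x).contMDiffAt (extChartAt_target_mem_nhds x)
  · exact hginv.contMDiffAt
  · exact contMDiffAt_extChartAt

/-- Smoothness of the inverse at the single point `f x` spreads to the whole target: the theorem is
applied again at every point of the source, and the new local inverse agrees with the old one nearby
because `e` is injective on its source. -/
theorem exists_localInverse {f : N → N'} {x : N} {U : Set N}
    (hU : IsOpen U) (hx : x ∈ U) (hf : ContMDiffOn I I' ∞ f U)
    (hd : ∀ x ∈ U, Function.Bijective (mder I I' f x)) :
    ∃ e : OpenPartialHomeomorph N N', x ∈ e.source ∧ e.source ⊆ U ∧ (e : N → N') = f ∧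
      ContMDiffOn I' I ∞ e.symm e.target := by
  obtain ⟨e, hxe, heU, hef, -⟩ := exists_openPartialHomeomorph_of_bijective_mder hU hx hf (hd x hx)
  refine ⟨e, hxe, heU, hef, fun y hy ↦ ?_⟩
  have hxs := e.map_target hy
  obtain ⟨e', hxe', heU', hef', he'⟩ := exists_openPartialHomeomorph_of_bijective_mder
    e.open_source hxs (hf.mono heU) (hd _ (heU hxs))
  have hfy : f (e.symm y) = y := by rw [← hef]; exact e.right_inv hy
  rw [hfy] at he'
  refine (he'.congr_of_eventuallyEq ?_).contMDiffWithinAt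
  have hy' : y ∈ e'.target := by
    rw [← hfy, ← hef']; exact e'.map_source hxe'
  filter_upwards [e'.open_target.mem_nhds hy'] with z hz
  have h1 := heU' (e'.map_target hz)
  have h2 := e'.right_inv hz
  rw [hef', ← hef] at h2
  conv_lhs => rw [← h2]
  exact e.left_inv h1

/-- The global form of the inverse function theorem for an injective map. -/
theorem exists_openPartialHomeomorph_of_injOn [Nonempty N] {f : N → N'} {U : Set N}
    (hU : IsOpen U) (hf : ContMDiffOn I I' ∞ f U)
    (hd : ∀ x ∈ U, Function.Bijective (mder I I' f x)) (hinj : InjOn f U) :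
    ∃ e : OpenPartialHomeomorph N N', e.source = U ∧ e.target = f '' U ∧ (e : N → N') = f ∧
      ContMDiffOn I' I ∞ e.symm e.target := by
  have hloc : ∀ V ⊆ U, IsOpen V → IsOpen (f '' V) := by
    intro V hVU hV
    rw [isOpen_iff_mem_nhds]
    rintro _ ⟨x, hx, rfl⟩
    obtain ⟨e, hxe, heV, rfl, -⟩ := exists_openPartialHomeomorph_of_bijective_mder hV hx
      (hf.mono hVU) (hd x (hVU hx))
    refine mem_of_superset (e.open_target.mem_nhds (e.map_source hxe)) ?_
    rw [← e.image_source_eq_target]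
    exact image_mono heV
  let p : PartialEquiv N N' := hinj.toPartialEquiv
  let e : OpenPartialHomeomorph N N' :=
    { p with
      open_source := hU
      open_target := hloc U subset_rfl hU
      continuousOn_toFun := hf.continuousOn
      -- Continuity of the inverse is openness of `f`, which is a local statement and was obtained
      -- in `hloc`.
      continuousOn_invFun := by
        rw [continuousOn_iff']
        intro t ht
        refine ⟨f '' (U ∩ t), hloc _ inter_subset_left (hU.inter ht), ?_⟩
        ext y
        constructor
        · rintro ⟨hy1, hy2⟩
          exact ⟨⟨p.symm y, ⟨p.map_target hy2, hy1⟩, p.right_inv hy2⟩, hy2⟩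
        · rintro ⟨⟨x, hx, rfl⟩, hy2⟩
          refine ⟨?_, hy2⟩
          change p.symm (p x) ∈ t
          rw [p.left_inv hx.1]
          exact hx.2 }
  refine ⟨e, rfl, rfl, rfl, ?_⟩
  intro y hy
  have hxU := e.map_target hy
  obtain ⟨e', hxe, heU, hef, he⟩ := exists_openPartialHomeomorph_of_bijective_mder hU hxU
      hf (hd _ hxU)
  have hfy : f (e.symm y) = y := e.right_inv hy
  rw [hfy] at he
  refine (he.congr_of_eventuallyEq ?_).contMDiffWithinAt
  have hy' : y ∈ e'.target := by
    rw [← hfy, ← hef]; exact e'.map_source hxe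
  filter_upwards [e'.open_target.mem_nhds hy', e.open_target.mem_nhds hy] with z hz hz'
  apply hinj (e.map_target hz') (heU (e'.map_target hz))
  have h1 := e.right_inv hz'
  have h2 := e'.right_inv hz
  rw [hef] at h2
  rw [h2]
  exact h1

end Inverse

/-! ### Pullbacks of forms, vector fields and fields of endomorphisms. -/

section TangentMaps

variable {E : Type*} [NormedAddCommGroup E] [NormedSpace ℝ E] [FiniteDimensional ℝ E]
  {E' : Type*} [NormedAddCommGroup E'] [NormedSpace ℝ E'] [FiniteDimensional ℝ E']
  {H' : Type*} [TopologicalSpace H'] {I' : ModelWithCorners ℝ E' H'} [I'.Boundaryless]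
  {N : Type*} [TopologicalSpace N] [ChartedSpace H' N] [IsManifold I' ∞ N]
  {EQ : Type*} [NormedAddCommGroup EQ] [NormedSpace ℝ EQ]
  {HQ : Type*} [TopologicalSpace HQ] {IQ : ModelWithCorners ℝ EQ HQ}
  {Q : Type*} [TopologicalSpace Q] [ChartedSpace HQ Q]

/-- The tangent map of `ψ` composed with a smooth pair (point, vector) in `E`. Through it,
smoothness of maps into a tangent bundle is reduced to smoothness between vector spaces. -/
theorem ContMDiffWithinAt.mk_mder {ψ : E → N} {O : Set E} (hO : IsOpen O)
    (hψ : ContMDiffOn 𝓘(ℝ, E) I' ∞ ψ O) {y w : Q → E} {s : Set Q} {q : Q} (hq : y q ∈ O)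
    (hy : ContMDiffWithinAt IQ 𝓘(ℝ, E) ∞ y s q) (hw : ContMDiffWithinAt IQ 𝓘(ℝ, E) ∞ w s q) :
    ContMDiffWithinAt IQ I'.tangent ∞
      (fun q ↦ (⟨ψ (y q), mder 𝓘(ℝ, E) I' ψ (y q) (w q)⟩ : TangentBundle I' N)) s q := by
  have h1 := hψ.contMDiffOn_tangentMapWithin (m := ∞) (by simp) hO.uniqueMDiffOn
  have h2 : ContMDiffWithinAt IQ (𝓘(ℝ, E).tangent) ∞
      (fun q ↦ (⟨y q, w q⟩ : TangentBundle 𝓘(ℝ, E) E)) s q := by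
    apply Bundle.contMDiffWithinAt_totalSpace.2
    refine ⟨hy, ?_⟩
    convert! hw with y
    simp
  have h3 := (h1.contMDiffAt (x := (⟨y q, w q⟩ : TangentBundle 𝓘(ℝ, E) E)) 
    ((hO.preimage (FiberBundle.continuous_proj E _)).mem_nhds hq)).comp_contMDiffWithinAt q h2
  refine h3.congr_of_eventuallyEq ?_ ?_
  · filter_upwards [hy.continuousWithinAt.preimage_mem_nhdsWithin (hO.mem_nhds hq)] with q' hq'
    simp only [tangentMapWithin, Function.comp]
    rw [mfderivWithin_of_isOpen hO hq']
    rfl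
  · simp only [tangentMapWithin, Function.comp]
    rw [mfderivWithin_of_isOpen hO hq]
    rfl

/-- The counterpart of `ContMDiffWithinAt.mk_mder`: it reads off the components of a tangent vector
of `N` in the coordinates `σ`. -/
theorem contMDiffOn_mder_snd {σ : N → E} {U : Set N} (hU : IsOpen U)
    (hσ : ContMDiffOn I' 𝓘(ℝ, E) ∞ σ U) :
    ContMDiffOn I'.tangent 𝓘(ℝ, E) ∞
      (fun v : TangentBundle I' N ↦ mder I' 𝓘(ℝ, E) σ v.proj v.snd) 
      ((Bundle.TotalSpace.proj) ⁻¹' U) := by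
  have h1 := hσ.contMDiffOn_tangentMapWithin (m := ∞) (by simp) hU.uniqueMDiffOn
  have h2 := (contMDiff_snd_tangentBundle_modelSpace (n := ∞) E 𝓘(ℝ, E)).comp_contMDiffOn h1
  refine h2.congr fun v hv ↦ ?_
  simp only [tangentMapWithin, Function.comp]
  rw [mfderivWithin_of_isOpen hU hv]
  rfl

variable {P : Type*} [NormedAddCommGroup P] [NormedSpace ℝ P]

theorem inverse_mder_eq {ψ : E → N} {y : E} {e : OpenPartialHomeomorph E N} (hψ : (e : E → N) = ψ)
    (hy : y ∈ e.source) (hd : MDifferentiableAt 𝓘(ℝ, E) I' ψ y)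
    (hs : MDifferentiableAt I' 𝓘(ℝ, E) e.symm (ψ y)) (w : E) :
    mder I' 𝓘(ℝ, E) e.symm (ψ y) (mder 𝓘(ℝ, E) I' ψ y w) = w := by
  rw [← mder_comp_apply y hs hd]
  have : (fun y ↦ e.symm (ψ y)) =ᶠ[𝓝 y] id := by
    filter_upwards [e.open_source.mem_nhds hy] with z hz
    rw [← hψ]; exact e.left_inv hz
  rw [mder_congr this, mder_eq_fderiv, fderiv_id]
  rfl

/-- The pullback of a 1-form under a map. -/
noncomputable def pullForm (I' : ModelWithCorners ℝ E' H')
    (lam : ∀ p : N, TangentSpace I' p →L[ℝ] ℝ) (ψ : E → N) (y : E) :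
    E →L[ℝ] ℝ :=
  ContinuousLinearMap.comp (M₂ := E') (lam (ψ y)) (mder 𝓘(ℝ, E) I' ψ y)

/-- Smoothness of `lam` means smoothness as a function on the tangent bundle. It is tested on the
vectors `Dψ(y) w` with `w` fixed, and finite dimension of `E` turns this into smoothness of the
operator-valued map. -/
theorem contDiffOn_pullForm {lam : P → ∀ p : N, TangentSpace I' p →L[ℝ] ℝ} {S : Set P}
    (hlam : ContMDiffOn (𝓘(ℝ, P).prod I'.tangent) 𝓘(ℝ, ℝ) ∞
      (fun q : P × TangentBundle I' N ↦ lam q.1 q.2.proj q.2.snd) (S ×ˢ univ))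
    {ψ : E → N} {O : Set E} (hO : IsOpen O) (hψ : ContMDiffOn 𝓘(ℝ, E) I' ∞ ψ O) :
    ContDiffOn ℝ ∞ (fun q : P × E ↦ pullForm I' (lam q.1) ψ q.2) (S ×ˢ O) := by
  rw [contDiffOn_clm_apply]
  intro w
  rw [← contMDiffOn_iff_contDiffOn]
  intro q hq
  have h := ContMDiffWithinAt.mk_mder (IQ := 𝓘(ℝ, P × E)) hO hψ (s := S ×ˢ O) (q := q)
    (y := Prod.snd) (w := fun _ ↦ w) hq.2 contDiff_snd.contMDiff.contMDiffAt.contMDiffWithinAt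
    contMDiffWithinAt_const
  have h1 : ContMDiffWithinAt 𝓘(ℝ, P × E) 𝓘(ℝ, P) ∞ Prod.fst (S ×ˢ O) q :=
    contDiff_fst.contMDiff.contMDiffAt.contMDiffWithinAt
  exact (hlam _ ⟨hq.1, mem_univ _⟩).comp q (h1.prodMk h) fun q' hq' ↦ ⟨hq'.1, mem_univ _⟩

/-- The pullback of a vector field under a local diffeomorphism. -/
noncomputable def pullField (I' : ModelWithCorners ℝ E' H')
    (X : ∀ p : N, TangentSpace I' p) (ψ : E → N) (y : E) : E :=
  (mder 𝓘(ℝ, E) I' ψ y).inverse (X (ψ y))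

theorem inverse_apply_of_bijective {D : E →L[ℝ] E'} (hD : Function.Bijective D) (w : E) :
    D.inverse (D w) = w := by
  have : D = (D.equivOfBijective hD : E →L[ℝ] E') := by simp
  conv_lhs => rw [this, ContinuousLinearMap.inverse_equiv]
  exact (D.equivOfBijective hD).symm_apply_apply w

theorem apply_inverse_of_bijective {D : E →L[ℝ] E'} (hD : Function.Bijective D) (w : E') :
    D (D.inverse w) = w := by
  obtain ⟨u, rfl⟩ := hD.2 w
  rw [inverse_apply_of_bijective hD]

theorem mder_pullField {X : ∀ p : N, TangentSpace I' p} {ψ : E → N} {y : E}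
    (hd : Function.Bijective (mder 𝓘(ℝ, E) I' ψ y)) :
    mder 𝓘(ℝ, E) I' ψ y (pullField I' X ψ y) = X (ψ y) :=
  apply_inverse_of_bijective hd (X (ψ y) : E')

/-- Near each point the pulled back field is `X` with the derivative of a smooth local inverse of
`ψ` applied to it. The operator inverse in the definition is thereby never differentiated. -/
theorem contDiffOn_pullField {X : P → ∀ p : N, TangentSpace I' p} {S : Set P}
    (hX : ContMDiffOn (𝓘(ℝ, P).prod I') I'.tangent ∞
      (fun q : P × N ↦ (⟨q.2, X q.1 q.2⟩ : TangentBundle I' N)) (S ×ˢ univ))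
    {ψ : E → N} {O : Set E} (hO : IsOpen O) (hψ : ContMDiffOn 𝓘(ℝ, E) I' ∞ ψ O)
    (hd : ∀ y ∈ O, Function.Bijective (mder 𝓘(ℝ, E) I' ψ y)) :
    ContDiffOn ℝ ∞ (fun q : P × E ↦ pullField I' (X q.1) ψ q.2) (S ×ˢ O) := by
  rw [← contMDiffOn_iff_contDiffOn]
  intro q hq
  obtain ⟨e, hye, heO, hef, hes⟩ := exists_localInverse hO hq.2 hψ hd
  have hyt : ψ q.2 ∈ e.target := by rw [← hef]; exact e.map_source hye
  have h1 : ContMDiffWithinAt 𝓘(ℝ, P × E) 𝓘(ℝ, P) ∞ Prod.fst (S ×ˢ O) q :=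
    contDiff_fst.contMDiff.contMDiffAt.contMDiffWithinAt
  have h2 : ContMDiffWithinAt 𝓘(ℝ, P × E) I' ∞ (fun q : P × E ↦ ψ q.2) (S ×ˢ O) q :=
    (hψ _ hq.2).comp q contDiff_snd.contMDiff.contMDiffAt.contMDiffWithinAt fun q' hq' ↦ hq'.2
  have h3 : ContMDiffWithinAt 𝓘(ℝ, P × E) I'.tangent ∞
      (fun q : P × E ↦ (⟨ψ q.2, X q.1 (ψ q.2)⟩ : TangentBundle I' N)) (S ×ˢ O) q :=
    ContMDiffWithinAt.comp (t := S ×ˢ univ) (g := fun q : P × N ↦ (⟨q.2, X q.1 q.2⟩ : TangentBundle I' N))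
      (f := fun q : P × E ↦ (q.1, ψ q.2)) q (hX (q.1, ψ q.2) ⟨hq.1, mem_univ _⟩) (h1.prodMk h2)
      fun q' hq' ↦ ⟨hq'.1, mem_univ _⟩
  have h4 := ((contMDiffOn_mder_snd e.open_target hes).contMDiffAt
    (x := (⟨ψ q.2, X q.1 (ψ q.2)⟩ : TangentBundle I' N))
    ((e.open_target.preimage (FiberBundle.continuous_proj E' _)).mem_nhds hyt)).comp_contMDiffWithinAt
    q h3
  refine h4.congr_of_eventuallyEq_of_mem ?_ hq
  have hev : ∀ᶠ q' : P × E in 𝓝[S ×ˢ O] q, q'.2 ∈ e.source :=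
    continuous_snd.continuousWithinAt.preimage_mem_nhdsWithin (e.open_source.mem_nhds hye)
  filter_upwards [hev, self_mem_nhdsWithin] with q' hq' hqO
  have h5 := inverse_mder_eq (I' := I') hef hq'
    (((hψ _ hqO.2).contMDiffAt (hO.mem_nhds hqO.2)).mdifferentiableAt (by simp))
    (((hes _ (by rw [← hef]; exact e.map_source hq')).contMDiffAt
      (e.open_target.mem_nhds (by rw [← hef]; exact e.map_source hq'))).mdifferentiableAt (by simp))
    (pullField I' (X q'.1) ψ q'.2)
  rw [mder_pullField (hd _ hqO.2)] at h5
  exact h5.symm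

/-- A tangent vector is taken apart by a local inverse of `ψ`, acted on by the local representative
`Y'`, and reassembled by `Dψ`. Linearity of `Y` is not needed, so that an affine term such as `τ X`
may be absorbed, with `τ` as a further parameter. The same lemma serves for `J̃` on `M` and for `j`
on the closed surface. -/
theorem contMDiffWithinAt_endoField {Y : P → ∀ p : N, TangentSpace I' p → TangentSpace I' p}
    {S : Set P} {ψ : E → N} {O : Set E} (hO : IsOpen O) (hψ : ContMDiffOn 𝓘(ℝ, E) I' ∞ ψ O)
    (hd : ∀ y ∈ O, Function.Bijective (mder 𝓘(ℝ, E) I' ψ y)) {Y' : P × (E × E) → E}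
    (hY' : ContDiffOn ℝ ∞ Y' (S ×ˢ (O ×ˢ univ)))
    (hY : ∀ q ∈ S, ∀ y ∈ O, ∀ w : E, Y q (ψ y) (mder 𝓘(ℝ, E) I' ψ y w : E') =
      mder 𝓘(ℝ, E) I' ψ y (Y' (q, (y, w))))
    {q₀ : P} (hq₀ : q₀ ∈ S) {v₀ : TangentBundle I' N} {y₀ : E} (hy₀ : y₀ ∈ O)
    (hv₀ : v₀.proj = ψ y₀) :
    ContMDiffWithinAt (𝓘(ℝ, P).prod I'.tangent) I'.tangent ∞
      (fun q : P × TangentBundle I' N ↦ (⟨q.2.proj, Y q.1 q.2.proj q.2.snd⟩ : TangentBundle I' N))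
      (S ×ˢ univ) (q₀, v₀) := by
  obtain ⟨e, hye, heO, hef, hes⟩ := exists_localInverse hO hy₀ hψ hd
  have hyt : v₀.proj ∈ e.target := by rw [hv₀, ← hef]; exact e.map_source hye
  have hproj : Continuous (Bundle.TotalSpace.proj : TangentBundle I' N → N) :=
    FiberBundle.continuous_proj E' _
  have hT : IsOpen ((Bundle.TotalSpace.proj : TangentBundle I' N → N) ⁻¹' e.target) :=
    e.open_target.preimage hproj
  have hP : ContMDiff I'.tangent I' ∞ (Bundle.TotalSpace.proj : TangentBundle I' N → N) :=
    Bundle.contMDiff_proj _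
  have h1 : ContMDiffAt I'.tangent 𝓘(ℝ, E) ∞ (fun v : TangentBundle I' N ↦ e.symm v.proj) v₀ :=
    (hes.contMDiffAt (e.open_target.mem_nhds hyt)).comp v₀ hP.contMDiffAt
  have h2 := (contMDiffOn_mder_snd e.open_target hes).contMDiffAt (hT.mem_nhds hyt)
  have h1' : ContMDiffWithinAt (𝓘(ℝ, P).prod I'.tangent) 𝓘(ℝ, E) ∞
      (fun q : P × TangentBundle I' N ↦ e.symm q.2.proj) (S ×ˢ univ) (q₀, v₀) :=
    (h1.comp (q₀, v₀) contMDiffAt_snd).contMDiffWithinAt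
  have h2' : ContMDiffWithinAt (𝓘(ℝ, P).prod I'.tangent) 𝓘(ℝ, E) ∞
      (fun q : P × TangentBundle I' N ↦ mder I' 𝓘(ℝ, E) e.symm q.2.proj q.2.snd)
      (S ×ˢ univ) (q₀, v₀) :=
    (h2.comp (q₀, v₀) contMDiffAt_snd).contMDiffWithinAt
  have hy1 : e.symm v₀.proj = y₀ := by rw [hv₀, ← hef]; exact e.left_inv hye
  have hev : ∀ᶠ q : P × TangentBundle I' N in 𝓝[S ×ˢ univ] (q₀, v₀), q.2.proj ∈ e.target :=
    (hproj.comp continuous_snd).continuousWithinAt.preimage_mem_nhdsWithin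
      (e.open_target.mem_nhds hyt)
  have h3 : ContMDiffWithinAt (𝓘(ℝ, P).prod I'.tangent) 𝓘(ℝ, E) ∞
      (fun q : P × TangentBundle I' N ↦
        Y' (q.1, (e.symm q.2.proj, mder I' 𝓘(ℝ, E) e.symm q.2.proj q.2.snd)))
      (S ×ˢ univ) (q₀, v₀) := by
    have h4 := (hY'.contMDiffOn (q₀, (e.symm v₀.proj, mder I' 𝓘(ℝ, E) e.symm v₀.proj v₀.snd))
      ⟨hq₀, by rw [hy1]; exact hy₀, mem_univ _⟩)
    refine (ContMDiffWithinAt.comp' (I' := 𝓘(ℝ, P × (E × E)))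
      (g := Y') (f := fun q : P × TangentBundle I' N ↦
        (q.1, (e.symm q.2.proj, mder I' 𝓘(ℝ, E) e.symm q.2.proj q.2.snd))) (q₀, v₀) h4
      (contMDiffWithinAt_fst.prodMk_space (h1'.prodMk_space h2'))).mono_of_mem_nhdsWithin
      (inter_mem self_mem_nhdsWithin ?_)
    filter_upwards [hev, self_mem_nhdsWithin] with q hq hqS
    exact ⟨hqS.1, heO (e.map_target hq), mem_univ _⟩
  have h5 := ContMDiffWithinAt.mk_mder hO hψ (by rw [hy1]; exact hy₀) h1' h3
  refine h5.congr_of_eventuallyEq_of_mem ?_ ⟨hq₀, mem_univ _⟩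
  filter_upwards [hev, self_mem_nhdsWithin] with q hq hqS
  have hs := e.map_target hq
  have hr : ψ (e.symm q.2.proj) = q.2.proj := by rw [← hef]; exact e.right_inv hq
  have h6 : mder 𝓘(ℝ, E) I' ψ (e.symm q.2.proj) (mder I' 𝓘(ℝ, E) e.symm q.2.proj q.2.snd) =
      q.2.snd := by
    have hd1 := ((hψ _ (heO hs)).contMDiffAt (hO.mem_nhds (heO hs))).mdifferentiableAt
      (by simp : (∞ : ℕ∞ω) ≠ 0)
    refine (mder_comp_apply _ hd1
      ((hes.contMDiffAt (e.open_target.mem_nhds hq)).mdifferentiableAt (by simp)) _).symm.trans ?_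
    have : (fun p ↦ ψ (e.symm p)) =ᶠ[𝓝 q.2.proj] id := by
      filter_upwards [e.open_target.mem_nhds hq] with z hz
      rw [← hef]; exact e.right_inv hz
    rw [mder_congr this]
    exact DFunLike.congr_fun (mfderiv_id (I := I') (x := q.2.proj)) q.2.snd
  have h7 := hY q.1 hqS.1 _ (heO hs) (mder I' 𝓘(ℝ, E) e.symm q.2.proj q.2.snd)
  rw [h6] at h7
  -- The base points `ψ (e.symm p)` and `p` are only propositionally equal; they are generalised so
  -- that the equality in the total space can be proved by substitution.
  have : ∀ (p p' : N) (v : E') (z : E'), p' = p → Y q.1 p' v = z →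
      (⟨p, Y q.1 p v⟩ : TangentBundle I' N) = ⟨p', z⟩ := by
    rintro p _ v z rfl rfl; rfl
  exact this _ _ _ _ hr h7

end TangentMaps
-- Exterior derivatives in arbitrary parametrisations.
section ExteriorDerivative
theorem two_le_infty : (2 : ℕ∞ω) ≤ (⊤ : ℕ∞) :=
  show ((2 : ℕ∞) : ℕ∞ω) ≤ ((⊤ : ℕ∞) : ℕ∞ω) from WithTop.coe_le_coe.2 le_top

variable {M : Type*} [TopologicalSpace M] [ChartedSpace (EuclideanSpace ℝ (Fin 3)) M]
  [IsManifold (𝓡 3) ∞ M]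
  {E : Type*} [NormedAddCommGroup E] [NormedSpace ℝ E] [FiniteDimensional ℝ E]

/-- Partial derivatives of a family that is smooth up to the boundary of the parameter range. -/
theorem hasFDerivAt_slice {G : Type*} [NormedAddCommGroup G] [NormedSpace ℝ G]
    {f : ℝ × E → G} {O : Set E} (hO : IsOpen O) (hf : ContDiffOn ℝ ∞ f (Ico 0 1 ×ˢ O))
    {δ : ℝ} (hδ : δ ∈ Ico (0 : ℝ) 1) {y : E} (hy : y ∈ O) :
    HasFDerivAt (fun y ↦ f (δ, y))
      ((fderivWithin ℝ f (Ico 0 1 ×ˢ O) (δ, y)).comp (ContinuousLinearMap.inr ℝ ℝ E)) y := by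
  have h1 : HasFDerivWithinAt f (fderivWithin ℝ f (Ico 0 1 ×ˢ O) (δ, y)) (Ico 0 1 ×ˢ O) (δ, y) :=
    ((hf (δ, y) ⟨hδ, hy⟩).differentiableWithinAt (by simp)).hasFDerivWithinAt
  have h2 : HasFDerivWithinAt (fun y : E ↦ (δ, y)) (ContinuousLinearMap.inr ℝ ℝ E) O y :=
    (hasFDerivAt_prodMk_right δ y).hasFDerivWithinAt
  exact (h1.comp y h2 fun z hz ↦ ⟨hδ, hz⟩).hasFDerivAt (hO.mem_nhds hy)

/-- At `δ = 0` the family is smooth only from one side. The set `Ico 0 1 ×ˢ O` has unique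
derivatives, so `fderivWithin` is smooth there, and its restriction to the `E`-directions is the
ordinary derivative of the slice because `O` is open. -/
theorem contDiffOn_fderiv_slice {G : Type*} [NormedAddCommGroup G] [NormedSpace ℝ G]
    {f : ℝ × E → G} {O : Set E} (hO : IsOpen O) (hf : ContDiffOn ℝ ∞ f (Ico 0 1 ×ˢ O)) :
    ContDiffOn ℝ ∞ (fun q : ℝ × E ↦ fderiv ℝ (fun y ↦ f (q.1, y)) q.2) (Ico 0 1 ×ˢ O) := by
  have hu : UniqueDiffOn ℝ (Ico (0 : ℝ) 1 ×ˢ O) := (uniqueDiffOn_Ico 0 1).prod hO.uniqueDiffOn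
  have h1 : ContDiffOn ℝ ∞ (fderivWithin ℝ f (Ico 0 1 ×ˢ O)) (Ico 0 1 ×ˢ O) :=
    hf.fderivWithin hu (by simp)
  refine (h1.clm_comp (g := fderivWithin ℝ f (Ico 0 1 ×ˢ O))
    (f := fun _ ↦ ContinuousLinearMap.inr ℝ ℝ E) contDiffOn_const).congr fun q hq ↦ ?_
  exact (hasFDerivAt_slice hO hf hq.1 hq.2).fderiv

theorem contDiffOn_slice {G : Type*} [NormedAddCommGroup G] [NormedSpace ℝ G]
    {f : ℝ × E → G} {S : Set ℝ} {O : Set E} (hf : ContDiffOn ℝ ∞ f (S ×ˢ O))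
    {δ : ℝ} (hδ : δ ∈ S) : ContDiffOn ℝ ∞ (fun y ↦ f (δ, y)) O :=
  hf.comp (contDiff_prodMk_right δ).contDiffOn fun _ hy ↦ ⟨hδ, hy⟩

/-- The exterior derivative of the pullback of a 1-form. -/
noncomputable def pullD (lam : OneForm M) (ψ : E → M) (y v w : E) : ℝ :=
  fderiv ℝ (pullForm (𝓡 3) lam ψ) y v w - fderiv ℝ (pullForm (𝓡 3) lam ψ) y w v

/-- Naturality of `d`. If `c` is the chart expression of `ψ` and `K` that of the form, the pullback
is `K(c) ∘ Dc`; the terms with the second derivative of `c` are symmetric and drop out of the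
antisymmetrisation. Since `E` is arbitrary, `dλ` may be computed in polar coordinates, in a tube, or
in a chart of the page times `ℝ`. -/
theorem extD_mder {lam : ℝ → OneForm M} (hl : SmoothFormFamily lam) {δ : ℝ}
    (hδ : δ ∈ Ico (0 : ℝ) 1) {ψ : E → M} {O : Set E} (hO : IsOpen O)
    (hψ : ContMDiffOn 𝓘(ℝ, E) (𝓡 3) ∞ ψ O) {y : E} (hy : y ∈ O) (v w : E) :
    extD (lam δ) (ψ y) (mder 𝓘(ℝ, E) (𝓡 3) ψ y v) (mder 𝓘(ℝ, E) (𝓡 3) ψ y w) =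
      pullD (lam δ) ψ y v w := by
  set p := ψ y with hp
  let φ := extChartAt (𝓡 3) p
  let K : EuclideanSpace ℝ (Fin 3) → EuclideanSpace ℝ (Fin 3) →L[ℝ] ℝ := chartForm (lam δ) p
  let c : E → EuclideanSpace ℝ (Fin 3) := fun z ↦ φ (ψ z)
  have hψy : ContMDiffAt 𝓘(ℝ, E) (𝓡 3) ∞ ψ y := (hψ y hy).contMDiffAt (hO.mem_nhds hy)
  have hU : IsOpen (O ∩ ψ ⁻¹' φ.source) :=
    hψ.continuousOn.isOpen_inter_preimage hO (isOpen_extChartAt_source p)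
  have hyU : y ∈ O ∩ ψ ⁻¹' φ.source := ⟨hy, mem_extChartAt_source p⟩
  have hφt : IsOpen φ.target := isOpen_extChartAt_target p
  have hsymm : ContMDiffOn 𝓘(ℝ, EuclideanSpace ℝ (Fin 3)) (𝓡 3) ∞ φ.symm φ.target :=
    contMDiffOn_extChartAt_symm p
  have hK : ContDiffOn ℝ ∞ K φ.target := by
    have := contDiffOn_slice (contDiffOn_pullForm hl hφt hsymm) hδ
    exact this
  have hc : ContDiffOn ℝ ∞ c (O ∩ ψ ⁻¹' φ.source) := by
    rw [← contMDiffOn_iff_contDiffOn]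
    exact (contMDiffOn_extChartAt (x := p)).comp (hψ.mono inter_subset_left)
      (fun z hz ↦ (extChartAt_source (𝓡 3) p) ▸ hz.2)
  have hcy : c y ∈ φ.target := φ.map_source hyU.2
  have hKd : HasFDerivAt K (fderiv ℝ K (c y)) (c y) :=
    ((hK.contDiffAt (hφt.mem_nhds hcy)).differentiableAt (by simp)).hasFDerivAt
  have hcA : ContDiffAt ℝ ∞ c y := hc.contDiffAt (hU.mem_nhds hyU)
  have hcd : HasFDerivAt c (fderiv ℝ c y) y := (hcA.differentiableAt (by simp)).hasFDerivAt
  have hc2 : HasFDerivAt (fderiv ℝ c) (fderiv ℝ (fderiv ℝ c) y) y :=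
    ((hcA.fderiv_right (m := ∞) (by simp)).differentiableAt (by simp)).hasFDerivAt
  have hpull : pullForm (𝓡 3) (lam δ) ψ =ᶠ[𝓝 y] fun z ↦ (K (c z)).comp (fderiv ℝ c z) := by
    filter_upwards [hU.mem_nhds hyU] with z hz
    have hψz : ψ z = φ.symm (c z) := (φ.left_inv hz.2).symm
    have hev : ψ =ᶠ[𝓝 z] fun z ↦ φ.symm (c z) := by
      filter_upwards [hU.mem_nhds hz] with z' hz'
      exact (φ.left_inv hz'.2).symm
    have h1 : mder 𝓘(ℝ, E) (𝓡 3) ψ z =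
        (mder 𝓘(ℝ, EuclideanSpace ℝ (Fin 3)) (𝓡 3) φ.symm (c z)).comp (fderiv ℝ c z) := by
      rw [mder_congr hev, ← mder_eq_fderiv]
      exact mder_comp z ((hsymm.contMDiffAt (hφt.mem_nhds (φ.map_source hz.2))).mdifferentiableAt
        (by simp)) ((hc.contDiffAt (hU.mem_nhds hz)).contMDiffAt.mdifferentiableAt (by simp))
    ext w
    unfold pullForm
    rw [h1, hψz]
    rfl
  have hder : HasFDerivAt (pullForm (𝓡 3) (lam δ) ψ) _ y :=
    ((hKd.comp y hcd).clm_comp hc2).congr_of_eventuallyEq hpull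
  have hmder : mder 𝓘(ℝ, E) (𝓡 3) ψ y = fderiv ℝ c y := by
    rw [mder_eq_fderiv_written (hψy.mdifferentiableAt (by simp))]
    rfl
  have hsym : fderiv ℝ (fderiv ℝ c) y v w = fderiv ℝ (fderiv ℝ c) y w v :=
    (hcA.isSymmSndFDerivAt (by simpa using two_le_infty)).eq v w
  unfold pullD
  rw [hder.fderiv]
  have hext : extD (lam δ) p (mder 𝓘(ℝ, E) (𝓡 3) ψ y v) (mder 𝓘(ℝ, E) (𝓡 3) ψ y w) =
      fderiv ℝ K (c y) (fderiv ℝ c y v) (fderiv ℝ c y w) -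
      fderiv ℝ K (c y) (fderiv ℝ c y w) (fderiv ℝ c y v) := by
    rw [hmder]; rfl
  rw [hext]
  simp [hsym]

theorem contDiffOn_pullD {lam : ℝ → OneForm M} (hl : SmoothFormFamily lam) {ψ : E → M}
    {O : Set E} (hO : IsOpen O) (hψ : ContMDiffOn 𝓘(ℝ, E) (𝓡 3) ∞ ψ O) (v w : E) :
    ContDiffOn ℝ ∞ (fun q : ℝ × E ↦ pullD (lam q.1) ψ q.2 v w) (Ico 0 1 ×ˢ O) := by
  have := contDiffOn_fderiv_slice hO (contDiffOn_pullForm hl hO hψ)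
  unfold pullD
  exact ((this.clm_apply contDiffOn_const).clm_apply contDiffOn_const).sub
    ((this.clm_apply contDiffOn_const).clm_apply contDiffOn_const)

end ExteriorDerivative

/-! ### Smooth dependence of integrals on parameters. -/

section ParametricIntegral

-- The integral is the value at `0` of the convolution of the indicator function of `[0, 1]` with `x
-- ↦ b(x) f(-x, p)`. The bump function `b` equals `1` where the indicator sees it and makes the
-- second factor compactly supported, as the theorem on convolutions with parameters requires.
open scoped Convolution in
theorem contDiff_parametric_integral {P G : Type*} [NormedAddCommGroup P] [NormedSpace ℝ P]
    [NormedAddCommGroup G] [NormedSpace ℝ G] {f : ℝ × P → G} (hf : ContDiff ℝ ∞ f) :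
    ContDiff ℝ ∞ fun p ↦ ∫ t in (0 : ℝ)..1, f (t, p) := by
  let b : ContDiffBump (0 : ℝ) := ⟨2, 3, by norm_num, by norm_num⟩
  let g : P → ℝ → G := fun p x ↦ b x • f (-x, p)
  let φ : ℝ → ℝ := (Icc (0 : ℝ) 1).indicator fun _ ↦ 1
  have hg : ContDiffOn ℝ ∞ ↿g (univ ×ˢ univ) := by
    have : ContDiff ℝ ∞ fun q : P × ℝ ↦ b q.2 • f (-q.2, q.1) :=
      (b.contDiff.comp contDiff_snd).smul (hf.comp (contDiff_snd.neg.prodMk contDiff_fst))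
    exact this.contDiffOn
  have hφ : MeasureTheory.LocallyIntegrable φ MeasureTheory.volume := by
    have : MeasureTheory.IntegrableOn (fun _ : ℝ ↦ (1 : ℝ)) (Icc (0 : ℝ) 1) := by simp
    exact (this.integrable_indicator measurableSet_Icc).locallyIntegrable
  have h := MeasureTheory.contDiffOn_convolution_right_with_param_comp (𝕜 := ℝ) (n := ⊤) (s := univ)
    (μ := MeasureTheory.volume) (v := fun _ : P ↦ (0 : ℝ))
    (ContinuousLinearMap.lsmul ℝ ℝ : ℝ →L[ℝ] G →L[ℝ] G) contDiffOn_const (f := φ) (g := g)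
    (k := Metric.closedBall 0 3) isOpen_univ (isCompact_closedBall 0 3) (by
      intro p x _ hx
      have : b x = 0 := b.zero_of_le_dist (le_of_lt (by simpa using hx))
      simp [g, this]) hφ hg
  rw [contDiffOn_univ] at h
  convert! h using 2 with p
  rw [MeasureTheory.convolution_def, intervalIntegral.integral_of_le zero_le_one,
    ← MeasureTheory.integral_Icc_eq_integral_Ioc,
    ← MeasureTheory.integral_indicator measurableSet_Icc]
  congr 1
  ext t
  by_cases ht : t ∈ Icc (0 : ℝ) 1
  · have : b (-t) = 1 := b.one_of_mem_closedBall (by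
      simp only [Metric.mem_closedBall, dist_zero_right, norm_neg, Real.norm_eq_abs]
      rw [abs_of_nonneg ht.1]; change t ≤ 2; linarith [ht.2])
    simp [φ, ht, g, this]
  · simp [φ, ht]

end ParametricIntegral

/-! ### Hadamard's lemma and primitives for radial functions on the disk. -/

section Radial

/-- The derivative of a radial function along the real direction. -/
theorem fderiv_radial_one {f : ℝ → ℝ} {G : ℂ → ℝ} {ρ : ℝ} (hG : ContDiff ℝ ∞ G)
    (hGf : ∀ z ∈ Metric.ball (0 : ℂ) ρ, G z = f ‖z‖) {z : ℂ} (hz : z ∈ Metric.ball (0 : ℂ) ρ)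
    (hz0 : z ≠ 0) : DifferentiableAt ℝ f ‖z‖ ∧ fderiv ℝ G z 1 = deriv f ‖z‖ / ‖z‖ * z.re := by
  have hzn : 0 < ‖z‖ := norm_pos_iff.2 hz0
  have hzρ : ‖z‖ < ρ := by simpa using hz
  have hf : DifferentiableAt ℝ f ‖z‖ := by
    have h1 : DifferentiableAt ℝ (fun x : ℝ ↦ G (x : ℂ)) ‖z‖ :=
      ((hG.differentiable (by simp)).comp Complex.ofRealCLM.differentiable).differentiableAt
    refine h1.congr_of_eventuallyEq ?_
    filter_upwards [Ioo_mem_nhds hzn hzρ] with x hx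
    rw [hGf _ (by simpa [abs_of_pos hx.1] using hx.2)]
    simp [abs_of_pos hx.1]
  refine ⟨hf, ?_⟩
  have hn : HasFDerivAt (fun z : ℂ ↦ ‖z‖) (fderiv ℝ (fun z : ℂ ↦ ‖z‖) z) z :=
    ((contDiffAt_norm ℝ hz0 (n := 1)).differentiableAt (by simp)).hasFDerivAt
  have hcomp : HasFDerivAt (fun z : ℂ ↦ f ‖z‖) _ z := hf.hasDerivAt.comp_hasFDerivAt z hn
  have hev : G =ᶠ[𝓝 z] fun z ↦ f ‖z‖ := by
    filter_upwards [Metric.isOpen_ball.mem_nhds hz] with w hw using hGf w hw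
  rw [hev.fderiv_eq, hcomp.fderiv]
  have hsq : HasFDerivAt (fun z : ℂ ↦ ‖z‖ ^ 2) _ z := hn.pow 2
  have hsq' : HasFDerivAt (fun z : ℂ ↦ ‖z‖ ^ 2) _ z := (hasStrictFDerivAt_norm_sq z).hasFDerivAt
  have h2 := DFunLike.congr_fun (hsq.unique hsq') (1 : ℂ)
  have h3 : ‖z‖ * fderiv ℝ (fun z : ℂ ↦ ‖z‖) z 1 = z.re := by
    simp [Complex.inner] at h2
    linarith
  have h4 : fderiv ℝ (fun z : ℂ ↦ ‖z‖) z 1 = z.re / ‖z‖ := by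
    field_simp; linarith
  simp only [smul_apply, h4, smul_eq_mul]
  ring

/-- A cutoff. Halving the radius costs nothing, since only germs at the binding matter, and globally
smooth functions spare the later integrals any condition on domains. -/
theorem exists_global_radial {E : Type*} [NormedAddCommGroup E] [NormedSpace ℝ E]
    [FiniteDimensional ℝ E] {ρ : ℝ} (hρ : 0 < ρ) {h : E → ℝ}
    (hh : ContDiffOn ℝ ∞ h (Metric.ball 0 ρ)) :
    ∃ G : E → ℝ, ContDiff ℝ ∞ G ∧ ∀ z ∈ Metric.ball (0 : E) (ρ / 2), G z = h z := by
  let b : ContDiffBump (0 : E) := ⟨ρ / 2, 3 * ρ / 4, by linarith, by linarith⟩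
  refine ⟨fun z ↦ b z * h z, ?_, fun z hz ↦ ?_⟩
  · rw [contDiff_iff_contDiffAt]
    intro z
    by_cases hz : z ∈ Metric.ball (0 : E) ρ
    · exact b.contDiff.contDiffAt.mul (hh.contDiffAt (Metric.isOpen_ball.mem_nhds hz))
    · have : (fun z ↦ b z * h z) =ᶠ[𝓝 z] fun _ ↦ 0 := by
        have hz' : z ∈ (Metric.closedBall (0 : E) (3 * ρ / 4))ᶜ := by
          simp only [mem_compl_iff, Metric.mem_closedBall, dist_zero_right, Metric.mem_ball] at hz ⊢
          intro h; apply hz; linarith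
        filter_upwards [Metric.isClosed_closedBall.isOpen_compl.mem_nhds hz'] with w hw
        have : b w = 0 := b.zero_of_le_dist (by
          simp only [mem_compl_iff, Metric.mem_closedBall, not_le] at hw
          exact hw.le)
        simp [this]
      exact contDiffAt_const.congr_of_eventuallyEq this
  · have : b z = 1 := b.one_of_mem_closedBall (Metric.ball_subset_closedBall hz)
    simp [this]

/-- The one-sided derivative in `secondDerivZero` sees only `[0, ∞)`, where `f` coincides with the
restriction of the smooth function `G` to the real axis. -/
theorem secondDerivZero_eq {f : ℝ → ℝ} {G : ℂ → ℝ} {ρ : ℝ} (hρ : 0 < ρ) (hG : ContDiff ℝ ∞ G)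
    (hGf : ∀ z ∈ Metric.ball (0 : ℂ) ρ, G z = f ‖z‖) :
    secondDerivZero f = fderiv ℝ (fun z ↦ fderiv ℝ G z 1) 0 1 := by
  let g : ℝ → ℝ := fun x ↦ G (x : ℂ)
  have hg : ContDiff ℝ ∞ g := hG.comp Complex.ofRealCLM.contDiff
  have hd1 : ∀ x, deriv g x = fderiv ℝ G (x : ℂ) 1 := fun x ↦ by
    have h1 : HasDerivAt g _ x := ((hG.differentiable (by simp)).differentiableAt.hasFDerivAt
      (x := (x : ℂ))).comp_hasDerivAt x Complex.ofRealCLM.hasDerivAt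
    rw [h1.deriv]; simp
  have hG1 : ContDiff ℝ ∞ fun z ↦ fderiv ℝ G z 1 :=
    (hG.fderiv_right (m := ∞) (by simp)).clm_apply contDiff_const
  have hd2 : deriv (deriv g) 0 = fderiv ℝ (fun z ↦ fderiv ℝ G z 1) 0 1 := by
    rw [funext hd1]
    have h1 : HasDerivAt (fun x : ℝ ↦ fderiv ℝ G (x : ℂ) 1) _ 0 :=
      ((hG1.differentiable (by simp)).differentiableAt.hasFDerivAt
      (x := ((0 : ℝ) : ℂ))).comp_hasDerivAt (0 : ℝ) Complex.ofRealCLM.hasDerivAt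
    rw [h1.deriv]; simp
  rw [← hd2, secondDerivZero]
  have hev : f =ᶠ[𝓝[Ici 0] 0] g := by
    filter_upwards [self_mem_nhdsWithin, mem_nhdsWithin_of_mem_nhds (Iio_mem_nhds hρ)] with x hx hx'
    have hx0 : (0 : ℝ) ≤ x := hx
    simp only [g]
    rw [hGf _ (by simpa [abs_of_nonneg hx0] using hx')]
    simp [abs_of_nonneg hx0]
  rw [hev.iteratedDerivWithin_eq (by simpa using hev.self_of_nhdsWithin self_mem_Ici),
    iteratedDerivWithin_eq_iteratedDeriv (uniqueDiffOn_Ici 0)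
      (hg.contDiffAt.of_le two_le_infty) self_mem_Ici, iteratedDeriv_succ, iteratedDeriv_one]

/-- Hadamard's lemma for radial functions: `f'(r) / r` is a smooth function on the disk. -/
theorem exists_deriv_div_smooth {f : ℝ → ℝ} {G : ℂ → ℝ} {ρ : ℝ} (hρ : 0 < ρ) (hG : ContDiff ℝ ∞ G)
    (hGf : ∀ z ∈ Metric.ball (0 : ℂ) ρ, G z = f ‖z‖) :
    ∃ A : ℂ → ℝ, ContDiff ℝ ∞ A ∧ A 0 = secondDerivZero f ∧
      ∀ z ∈ Metric.ball (0 : ℂ) ρ, z ≠ 0 → A z = deriv f ‖z‖ / ‖z‖ := by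
  let G1 : ℂ → ℝ := fun z ↦ fderiv ℝ G z 1
  have hG1 : ContDiff ℝ ∞ G1 :=
    (hG.fderiv_right (m := ∞) (by simp)).clm_apply contDiff_const
  let G2 : ℂ → ℝ := fun z ↦ fderiv ℝ G1 z 1
  have hG2 : ContDiff ℝ ∞ G2 :=
    (hG1.fderiv_right (m := ∞) (by simp)).clm_apply contDiff_const
  -- For `t` from `0` to `1` the point `m (t, z) = t Re z + i Im z` moves horizontally from the
  -- imaginary axis to `z`. Hence `Re z · A z` is the increment of `∂_x G` along this segment, while
  -- `∂_x G = (f'(r)/r) x` for radial `G`.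
  let m : ℝ × ℂ → ℂ := fun q ↦ (q.1 * q.2.re : ℝ) + (q.2.im : ℝ) * Complex.I
  have hm : ContDiff ℝ ∞ m := by
    have hre : ContDiff ℝ ∞ fun q : ℝ × ℂ ↦ q.2.re := Complex.reCLM.contDiff.comp contDiff_snd
    have him : ContDiff ℝ ∞ fun q : ℝ × ℂ ↦ q.2.im := Complex.imCLM.contDiff.comp contDiff_snd
    exact (Complex.ofRealCLM.contDiff.comp (contDiff_fst.mul hre)).add
      ((Complex.ofRealCLM.contDiff.comp him).mul contDiff_const)
  let A : ℂ → ℝ := fun z ↦ ∫ t in (0 : ℝ)..1, G2 (m (t, z))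
  have hA : ContDiff ℝ ∞ A := contDiff_parametric_integral (hG2.comp hm)
  have hA0 : A 0 = secondDerivZero f := by
    rw [secondDerivZero_eq hρ hG hGf]
    simp [A, m, G2, G1]
  have hmain : ∀ z ∈ Metric.ball (0 : ℂ) ρ, z.re ≠ 0 → A z = deriv f ‖z‖ / ‖z‖ := by
    intro z hz hre
    have hz0 : z ≠ 0 := fun h ↦ hre (by simp [h])
    have hder : ∀ t : ℝ, HasDerivAt (fun t : ℝ ↦ G1 (m (t, z))) (z.re * G2 (m (t, z))) t := by
      intro t
      have h1 : HasDerivAt (fun t : ℝ ↦ m (t, z)) (z.re : ℂ) t := by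
        have : HasDerivAt (fun t : ℝ ↦ ((t * z.re : ℝ) : ℂ)) ((1 * z.re : ℝ) : ℂ) t :=
          ((hasDerivAt_id t).mul_const z.re).ofReal_comp
        simpa [m] using this.add_const ((z.im : ℂ) * Complex.I)
      have h2 := ((hG1.differentiable (by simp)).differentiableAt.hasFDerivAt
        (x := m (t, z))).comp_hasDerivAt t h1
      have h3 : fderiv ℝ G1 (m (t, z)) (z.re : ℂ) = z.re * G2 (m (t, z)) := by
        have : (z.re : ℂ) = z.re • (1 : ℂ) := by simp
        rw [this, map_smul, smul_eq_mul]
      rwa [h3] at h2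
    have hint : ∫ t in (0 : ℝ)..1, z.re * G2 (m (t, z)) = G1 (m (1, z)) - G1 (m (0, z)) :=
      intervalIntegral.integral_eq_sub_of_hasDerivAt (fun t _ ↦ hder t)
        ((continuous_const.mul (hG2.continuous.comp (hm.continuous.comp
          (continuous_id.prodMk continuous_const)))).intervalIntegrable _ _)
    rw [intervalIntegral.integral_const_mul] at hint
    have hm1 : m (1, z) = z := by simp [m, Complex.re_add_im]
    -- `∂_x G` vanishes on the imaginary axis: at the origin because `G` is even along the real
    -- axis, elsewhere by the radial formula with `x = 0`.
    have hm0 : G1 (m (0, z)) = 0 := by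
      by_cases him : z.im = 0
      · have h0 : m (0, z) = 0 := by simp [m, him]
        rw [h0]
        have hre0 : ∀ x : ℝ, x ∈ Ioo (-ρ) ρ → G (x : ℂ) = G ((-x : ℝ) : ℂ) := fun x hx ↦ by
          rw [hGf _ (by simpa using abs_lt.2 hx), hGf _ (by simpa using abs_lt.2 hx)]
          simp
        have h1 : HasDerivAt (fun x : ℝ ↦ G (x : ℂ)) (G1 0) 0 := by
          have := ((hG.differentiable (by simp)).differentiableAt.hasFDerivAt
            (x := ((0 : ℝ) : ℂ))).comp_hasDerivAt (0 : ℝ) Complex.ofRealCLM.hasDerivAt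
          simpa [G1] using! this
        have h2 : HasDerivAt (fun x : ℝ ↦ G (((-x : ℝ)) : ℂ)) (-G1 0) 0 := by
          have h1' : HasDerivAt (fun x : ℝ ↦ G (x : ℂ)) (G1 0) (-0) := by simpa using h1
          have h3 := h1'.scomp (0 : ℝ) (hasDerivAt_neg (0 : ℝ))
          rw [neg_one_smul] at h3
          exact h3
        have hev : (fun x : ℝ ↦ G (x : ℂ)) =ᶠ[𝓝 0] fun x : ℝ ↦ G (((-x : ℝ)) : ℂ) := by
          filter_upwards [Ioo_mem_nhds (neg_lt_zero.2 hρ) hρ] with x hx using hre0 x hx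
        have := h1.unique (h2.congr_of_eventuallyEq hev)
        linarith
      · have hne : m (0, z) ≠ 0 := by simp [m, him]
        have hmb : m (0, z) ∈ Metric.ball (0 : ℂ) ρ := by
          have h1 : ‖m (0, z)‖ = |z.im| := by simp [m]
          simp only [Metric.mem_ball, dist_zero_right] at hz ⊢
          rw [h1]
          exact (Complex.abs_im_le_norm z).trans_lt hz
        have := (fderiv_radial_one hG hGf hmb hne).2
        simp only [G1]
        rw [this]
        simp [m]
    rw [hm1, hm0, sub_zero] at hint
    have h5 := (fderiv_radial_one hG hGf hz hz0).2
    have h6 : z.re * A z = deriv f ‖z‖ / ‖z‖ * z.re := hint.trans h5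
    exact mul_left_cancel₀ hre (h6.trans (mul_comm _ _))
  refine ⟨A, hA, hA0, fun z hz hz0 ↦ ?_⟩
  by_cases hre : z.re = 0
  · -- approximate by points off the imaginary axis
    have hzn : 0 < ‖z‖ := norm_pos_iff.2 hz0
    have hzρ : ‖z‖ < ρ := by simpa using hz
    have hfd : ContinuousAt (deriv f) ‖z‖ := by
      have hg : ContDiff ℝ ∞ fun x : ℝ ↦ G (x : ℂ) := hG.comp Complex.ofRealCLM.contDiff
      have hc : Continuous (deriv fun x : ℝ ↦ G (x : ℂ)) := hg.continuous_deriv (by simp)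
      refine hc.continuousAt.congr ?_
      filter_upwards [Ioo_mem_nhds hzn hzρ] with x hx
      refine Filter.EventuallyEq.deriv_eq ?_
      filter_upwards [Ioo_mem_nhds hx.1 hx.2] with w hw
      rw [hGf _ (by simpa [abs_of_pos hw.1] using hw.2)]
      simp [abs_of_pos hw.1]
    have hR : Tendsto (fun w : ℂ ↦ deriv f ‖w‖ / ‖w‖) (𝓝 z) (𝓝 (deriv f ‖z‖ / ‖z‖)) :=
      (ContinuousAt.comp (f := fun w : ℂ ↦ ‖w‖) hfd continuous_norm.continuousAt).div
        continuous_norm.continuousAt hzn.ne'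
    refine tendsto_nhds_unique_of_frequently_eq hA.continuous.continuousAt hR ?_
    have hseq : Tendsto (fun n : ℕ ↦ z + ((1 / ((n : ℝ) + 1) : ℝ) : ℂ)) atTop (𝓝 z) := by
      have h1 : Tendsto (fun n : ℕ ↦ ((1 / ((n : ℝ) + 1) : ℝ) : ℂ)) atTop (𝓝 ((0 : ℝ) : ℂ)) :=
        (Complex.continuous_ofReal.tendsto 0).comp tendsto_one_div_add_atTop_nhds_zero_nat
      simpa using h1.const_add z
    refine hseq.frequently (Eventually.frequently ?_)
    filter_upwards [hseq.eventually (Metric.isOpen_ball.mem_nhds hz)] with n hn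
    refine hmain _ hn ?_
    have : (0 : ℝ) < 1 / ((n : ℝ) + 1) := by positivity
    simp only [Complex.add_re, hre, zero_add, Complex.ofReal_re]
    exact this.ne'
  · exact hmain z hz hre

/-- A smooth radial primitive of `(q(r) - q(0)) / r`. -/
theorem exists_radial_primitive {q : ℂ → ℝ} (hq : ContDiff ℝ ∞ q) {ρ : ℝ}
    (hqr : ∀ z ∈ Metric.ball (0 : ℂ) ρ, q z = q (‖z‖ : ℝ)) :
    ∃ p : ℝ → ℝ, ContDiffOn ℝ ∞ (fun z : ℂ ↦ p ‖z‖) (Metric.ball 0 ρ) ∧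
      ∀ r ∈ Ioo 0 ρ, HasDerivAt p ((q (r : ℂ) - q 0) / r) r := by
  -- Two integrations: `t Φ(t, z) = q(tz) - q(0)`, so `P(z) = ∫ (q(tz) - q(0))/t dt` over `[0, 1]`
  -- is manifestly smooth, and on the real axis it is the primitive of `(q(u) - q(0))/u` from `0`.
  let D : ℝ × (ℝ × ℂ) → ℝ := fun a ↦ fderiv ℝ q ((a.1 * a.2.1) • a.2.2) a.2.2
  have hD : ContDiff ℝ ∞ D :=
    ((hq.fderiv_right (m := ∞) (by simp)).comp ((contDiff_fst.mul
      (contDiff_fst.comp contDiff_snd)).smul (contDiff_snd.comp contDiff_snd))).clm_apply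
      (contDiff_snd.comp contDiff_snd)
  let Φ : ℝ × ℂ → ℝ := fun b ↦ ∫ s in (0 : ℝ)..1, D (s, b)
  have hΦ : ContDiff ℝ ∞ Φ := contDiff_parametric_integral hD
  let P : ℂ → ℝ := fun z ↦ ∫ t in (0 : ℝ)..1, Φ (t, z)
  have hP : ContDiff ℝ ∞ P := contDiff_parametric_integral hΦ
  have hΦ1 : ∀ t z, t * Φ (t, z) = q (t • z) - q 0 := by
    intro t z
    have hder : ∀ s : ℝ, HasDerivAt (fun s : ℝ ↦ q ((s * t) • z)) (t * D (s, (t, z))) s := by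
      intro s
      have h1 : HasDerivAt (fun s : ℝ ↦ (s * t) • z) ((1 * t) • z) s :=
        ((hasDerivAt_id s).mul_const t).smul_const z
      have h2 := ((hq.differentiable (by simp)).differentiableAt.hasFDerivAt
        (x := (s * t) • z)).comp_hasDerivAt s h1
      rw [map_smul, one_mul, smul_eq_mul] at h2
      exact h2
    have hint := intervalIntegral.integral_eq_sub_of_hasDerivAt (a := 0) (b := 1)
      (fun s _ ↦ hder s) ((continuous_const.mul (hD.continuous.comp
        (continuous_id.prodMk continuous_const))).intervalIntegrable _ _)
    rw [intervalIntegral.integral_const_mul] at hint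
    simpa using hint
  have hPr : ∀ z ∈ Metric.ball (0 : ℂ) ρ, P z = P (‖z‖ : ℝ) := by
    intro z hz
    refine intervalIntegral.integral_congr_ae (MeasureTheory.ae_of_all _ fun t ht ↦ ?_)
    rw [uIoc_of_le zero_le_one] at ht
    have ht0 : t ≠ 0 := ht.1.ne'
    apply mul_left_cancel₀ ht0
    rw [hΦ1, hΦ1]
    have hzρ : ‖z‖ < ρ := by simpa using hz
    have htz : ‖t • z‖ < ρ := by
      rw [norm_smul, Real.norm_eq_abs, abs_of_pos ht.1]
      nlinarith [norm_nonneg z, ht.2]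
    have h2 : q (t • z) = q (t • ((‖z‖ : ℝ) : ℂ)) := by
      rw [hqr _ (by simpa using htz), hqr (t • ((‖z‖ : ℝ) : ℂ)) (by simpa using htz)]
      simp
    rw [h2]
  refine ⟨fun r ↦ P (r : ℂ), ?_, fun r hr ↦ ?_⟩
  · exact hP.contDiffOn.congr fun z hz ↦ (hPr z hz).symm
  · let K : ℝ → ℝ := fun u ↦ Φ (u, 1)
    have hK : Continuous K := hΦ.continuous.comp (continuous_id.prodMk continuous_const)
    have hPK : ∀ x : ℝ, P (x : ℂ) = ∫ u in (0 : ℝ)..x, K u := by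
      intro x
      have h1 : ∀ t : ℝ, Φ (t, (x : ℂ)) = x * K (t * x) := by
        intro t
        simp only [Φ, K]
        rw [← intervalIntegral.integral_const_mul]
        refine intervalIntegral.integral_congr fun s _ ↦ ?_
        simp only [D]
        have h2 : (x : ℂ) = x • (1 : ℂ) := by simp
        rw [h2, map_smul, smul_eq_mul, smul_smul, mul_assoc]
      simp only [P, h1]
      rw [intervalIntegral.integral_const_mul]
      have := intervalIntegral.smul_integral_comp_mul_right K x (a := 0) (b := 1)
      simp at this ⊢
    have h3 : HasDerivAt (fun x : ℝ ↦ ∫ u in (0 : ℝ)..x, K u) (K r) r :=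
      intervalIntegral.integral_hasDerivAt_right (hK.intervalIntegrable _ _)
        (hK.stronglyMeasurableAtFilter _ _) hK.continuousAt
    have h4 : K r = (q (r : ℂ) - q 0) / r := by
      rw [eq_div_iff hr.1.ne', mul_comm]
      simpa using hΦ1 r 1
    rw [← h4]
    exact h3.congr_of_eventuallyEq (Eventually.of_forall hPK)

end Radial

/-! ### Asymptotics of the local model at the binding. -/

section LocalModel

variable {γ₁ γ₂ : ℝ → ℝ} {ρ : ℝ}

theorem eventually_Ioo_nhdsGT {ρ : ℝ} (hρ : 0 < ρ) : ∀ᶠ r in 𝓝[>] (0 : ℝ), r ∈ Ioo 0 ρ :=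
  Ioo_mem_nhdsGT hρ

theorem tendsto_ofReal_nhdsGT : Tendsto (fun r : ℝ ↦ (r : ℂ)) (𝓝[>] 0) (𝓝 0) := by
  have := (Complex.continuous_ofReal.tendsto 0).mono_left (nhdsWithin_le_nhds (s := Ioi 0))
  simpa using this

theorem ofReal_mem_ball {r ρ : ℝ} (hr : r ∈ Ioo 0 ρ) : (r : ℂ) ∈ Metric.ball (0 : ℂ) ρ := by
  simpa [abs_of_pos hr.1] using hr.2

/-- The functions `γ'(r)/r` extend over the disk with central value `γ''(0)`. The sign of `A₂ 0` is
that of `γ₁(0) γ₂''(0)`. The value `A₁ 0` is a limit of negative numbers, and it is not `0` because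
otherwise `κ = 0`, against `κ ≤ -1/2`. -/
theorem IsLocalModel.exists_quotients (h : IsLocalModel γ₁ γ₂ ρ) (hρ : 0 < ρ) :
    ∃ A₁ A₂ : ℂ → ℝ, ContDiff ℝ ∞ A₁ ∧ ContDiff ℝ ∞ A₂ ∧ A₁ 0 < 0 ∧ 0 < A₂ 0 ∧
      (∀ z ∈ Metric.ball (0 : ℂ) (ρ / 2), z ≠ 0 → A₁ z = deriv γ₁ ‖z‖ / ‖z‖) ∧
      (∀ z ∈ Metric.ball (0 : ℂ) (ρ / 2), z ≠ 0 → A₂ z = deriv γ₂ ‖z‖ / ‖z‖) := by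
  obtain ⟨G₁, hG₁, hG₁'⟩ := exists_global_radial hρ h.smooth₁
  obtain ⟨G₂, hG₂, hG₂'⟩ := exists_global_radial hρ h.smooth₂
  obtain ⟨A₁, hA₁, hA₁0, hA₁'⟩ := exists_deriv_div_smooth (half_pos hρ) hG₁ hG₁'
  obtain ⟨A₂, hA₂, hA₂0, hA₂'⟩ := exists_deriv_div_smooth (half_pos hρ) hG₂ hG₂'
  have h2 : 0 < A₂ 0 := by
    rw [hA₂0]; exact pos_of_mul_pos_right h.mu_lim_pos h.zero_pos.le
  refine ⟨A₁, A₂, hA₁, hA₂, lt_of_le_of_ne ?_ ?_, h2, hA₁', hA₂'⟩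
  · refine le_of_tendsto (hA₁.continuous.continuousAt.tendsto.comp tendsto_ofReal_nhdsGT) ?_
    filter_upwards [eventually_Ioo_nhdsGT (half_pos hρ)] with r hr
    simp only [Function.comp]
    rw [hA₁' _ (ofReal_mem_ball hr) (by simpa using hr.1.ne')]
    simp only [Complex.norm_real, Real.norm_eq_abs, abs_of_pos hr.1]
    exact (div_neg_of_neg_of_pos (h.deriv_neg r ⟨hr.1, by linarith [hr.2]⟩) hr.1).le
  · intro h0
    have := h.kappa_le
    rw [← hA₁0, h0, zero_div] at this
    norm_num at this

theorem IsLocalModel.zero₂ (h : IsLocalModel γ₁ γ₂ ρ) (hρ : 0 < ρ) : γ₂ 0 = 0 := by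
  obtain ⟨g, -, hg⟩ := h.smooth₂_div
  simpa using hg 0 (by simpa using hρ)

theorem IsLocalModel.continuousAt_zero (h : IsLocalModel γ₁ γ₂ ρ) (hρ : 0 < ρ) :
    Tendsto γ₁ (𝓝[>] 0) (𝓝 (γ₁ 0)) ∧ Tendsto γ₂ (𝓝[>] 0) (𝓝 (γ₂ 0)) := by
  have key : ∀ γ : ℝ → ℝ, ContDiffOn ℝ ∞ (fun z : ℂ ↦ γ ‖z‖) (Metric.ball 0 ρ) →
      Tendsto γ (𝓝[>] 0) (𝓝 (γ 0)) := by
    intro γ hγ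
    have h1 : ContinuousAt (fun z : ℂ ↦ γ ‖z‖) 0 :=
      (hγ.contDiffAt (Metric.ball_mem_nhds 0 hρ)).continuousAt
    have h2 := h1.tendsto.comp tendsto_ofReal_nhdsGT
    simp only [norm_zero] at h2
    refine h2.congr' ?_
    filter_upwards [self_mem_nhdsWithin] with r hr
    simp [abs_of_pos (show (0 : ℝ) < r from hr)]
  exact ⟨key _ h.smooth₁, key _ h.smooth₂⟩

/-- L'Hôpital's rule: `γ₂(r)/r²` tends to `γ₂''(0)/2`. This number gives the area form that `dλ`
induces on the disk at a point of the binding. -/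
theorem IsLocalModel.div_pos (h : IsLocalModel γ₁ γ₂ ρ) (hρ : 0 < ρ) {g : ℂ → ℝ}
    (hg : ContDiffOn ℝ ∞ g (Metric.ball 0 ρ))
    (hg' : ∀ z ∈ Metric.ball (0 : ℂ) ρ, γ₂ ‖z‖ = ‖z‖ ^ 2 * g z) : 0 < g 0 := by
  obtain ⟨A₁, A₂, -, hA₂, -, h2, -, hA₂'⟩ := h.exists_quotients hρ
  have hT : Tendsto (fun r ↦ deriv γ₂ r / deriv (fun r : ℝ ↦ r ^ 2) r) (𝓝[>] 0)
      (𝓝 (A₂ 0 / 2)) := by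
    refine Tendsto.congr' ?_
      ((hA₂.continuous.continuousAt.tendsto.comp tendsto_ofReal_nhdsGT).div_const 2)
    filter_upwards [eventually_Ioo_nhdsGT (half_pos hρ)] with r hr
    simp only [Function.comp]
    rw [hA₂' _ (ofReal_mem_ball hr) (by simpa using hr.1.ne')]
    simp only [Complex.norm_real, Real.norm_eq_abs, abs_of_pos hr.1]
    have := hr.1.ne'
    simp
    field_simp
  have hdiff : ∀ᶠ r in 𝓝[>] (0 : ℝ), DifferentiableAt ℝ γ₂ r := by
    filter_upwards [eventually_Ioo_nhdsGT (half_pos hρ)] with r hr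
    by_contra hnd
    obtain ⟨G₂, hG₂, hG₂'⟩ := exists_global_radial hρ h.smooth₂
    have := (fderiv_radial_one hG₂ hG₂' (ofReal_mem_ball hr) (by simpa using hr.1.ne')).1
    simp only [Complex.norm_real, Real.norm_eq_abs, abs_of_pos hr.1] at this
    exact hnd this
  have hL := deriv.lhopital_zero_nhdsGT (f := γ₂) (g := fun r : ℝ ↦ r ^ 2) hdiff (by
      filter_upwards [self_mem_nhdsWithin] with r hr
      simpa using (show (0 : ℝ) < r from hr).ne') (by
      simpa [h.zero₂ hρ] using (h.continuousAt_zero hρ).2) (by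
      have : Continuous fun r : ℝ ↦ r ^ 2 := by fun_prop
      simpa using (this.tendsto 0).mono_left (nhdsWithin_le_nhds (s := Ioi 0))) hT
  have hG : Tendsto (fun r : ℝ ↦ g (r : ℂ)) (𝓝[>] 0) (𝓝 (g 0)) :=
    (hg.contDiffAt (Metric.ball_mem_nhds 0 hρ)).continuousAt.tendsto.comp tendsto_ofReal_nhdsGT
  have : g 0 = A₂ 0 / 2 := by
    refine tendsto_nhds_unique (hG.congr' ?_) hL
    filter_upwards [eventually_Ioo_nhdsGT hρ] with r hr
    have h3 := hg' _ (ofReal_mem_ball hr)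
    simp only [Complex.norm_real, Real.norm_eq_abs, abs_of_pos hr.1] at h3
    rw [h3]
    have := hr.1.ne'
    field_simp
  rw [this]; positivity

/-- The reciprocal of the angular speed of the Reeb field is a smooth radial function near the
binding, up to a logarithm a primitive of its quotient by `r` is smooth on the disk. -/
theorem IsLocalModel.exists_primitive (h : IsLocalModel γ₁ γ₂ ρ) (hρ : 0 < ρ) :
    ∃ ρ' ∈ Ioo 0 ρ, ∃ c > (0 : ℝ), ∃ p : ℝ → ℝ,
      ContDiffOn ℝ ∞ (fun z : ℂ ↦ p ‖z‖) (Metric.ball 0 ρ') ∧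
      (∀ r ∈ Ioo 0 ρ', HasDerivAt p ((profileMu γ₁ γ₂ r / (-deriv γ₁ r) - c) / r) r) ∧
      Tendsto (fun r ↦ profileMu γ₁ γ₂ r / (-deriv γ₁ r)) (𝓝[>] 0) (𝓝 c) := by
  obtain ⟨A₁, A₂, hA₁, hA₂, h1, h2, hA₁', hA₂'⟩ := h.exists_quotients hρ
  obtain ⟨G₁, hG₁, hG₁'⟩ := exists_global_radial hρ h.smooth₁
  obtain ⟨G₂, hG₂, hG₂'⟩ := exists_global_radial hρ h.smooth₂
  obtain ⟨ρ₁, hρ₁, hρ₁'⟩ := Metric.mem_nhds_iff.1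
    (hA₁.continuous.continuousAt.eventually (Iio_mem_nhds h1))
  let ρ₂ := min ρ₁ (ρ / 2)
  have hρ₂ : 0 < ρ₂ := lt_min hρ₁ (half_pos hρ)
  -- The quotient `μ/(-γ₁')` with numerator and denominator divided by `r`. The denominator is now
  -- positive at the centre, and the value there is `c = γ₁(0) γ₂''(0)/(-γ₁''(0))`.
  let k : ℂ → ℝ := fun z ↦ (G₁ z * A₂ z - A₁ z * G₂ z) / (-A₁ z)
  have hk : ContDiffOn ℝ ∞ k (Metric.ball 0 ρ₂) := by
    refine ((hG₁.mul hA₂).sub (hA₁.mul hG₂)).contDiffOn.div hA₁.neg.contDiffOn fun z hz ↦ ?_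
    have : A₁ z < 0 := hρ₁' (Metric.ball_subset_ball (min_le_left _ _) hz)
    linarith
  have hkr : ∀ z ∈ Metric.ball (0 : ℂ) ρ₂, z ≠ 0 →
      k z = profileMu γ₁ γ₂ ‖z‖ / (-deriv γ₁ ‖z‖) := by
    intro z hz hz0
    have hz' : z ∈ Metric.ball (0 : ℂ) (ρ / 2) := Metric.ball_subset_ball (min_le_right _ _) hz
    have hn : ‖z‖ ≠ 0 := norm_ne_zero_iff.2 hz0
    have hd : deriv γ₁ ‖z‖ < 0 := h.deriv_neg _ ⟨norm_pos_iff.2 hz0, by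
      have : ‖z‖ < ρ / 2 := by simpa using hz'
      linarith⟩
    have hd' := hd.ne
    simp only [k, hG₁' z hz', hG₂' z hz', hA₁' z hz' hz0, hA₂' z hz' hz0, profileMu]
    field_simp
  obtain ⟨q, hq, hqk⟩ := exists_global_radial hρ₂ hk
  have hb : ∀ z ∈ Metric.ball (0 : ℂ) (ρ₂ / 2), z ∈ Metric.ball (0 : ℂ) ρ₂ := fun z hz ↦
    Metric.ball_subset_ball (by linarith) hz
  have hqr : ∀ z ∈ Metric.ball (0 : ℂ) (ρ₂ / 2), q z = q (‖z‖ : ℝ) := by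
    intro z hz
    have hz' : ((‖z‖ : ℝ) : ℂ) ∈ Metric.ball (0 : ℂ) (ρ₂ / 2) := by simpa using hz
    by_cases hz0 : z = 0
    · simp [hz0]
    · rw [hqk _ hz, hqk _ hz', hkr _ (hb _ hz) hz0, hkr _ (hb _ hz') (by simpa using hz0)]
      simp
  obtain ⟨p, hp, hp'⟩ := exists_radial_primitive hq hqr
  have hq0 : 0 < q 0 := by
    rw [hqk 0 (by simpa using hρ₂)]
    have hG20 : G₂ 0 = 0 := by rw [hG₂' 0 (by simpa using hρ), norm_zero, h.zero₂ hρ]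
    have hG10 : G₁ 0 = γ₁ 0 := by rw [hG₁' 0 (by simpa using hρ), norm_zero]
    simp only [k, hG20, hG10, mul_zero, sub_zero]
    exact _root_.div_pos (mul_pos h.zero_pos h2) (by linarith)
  have hqe : ∀ r ∈ Ioo 0 (ρ₂ / 2), q (r : ℂ) = profileMu γ₁ γ₂ r / (-deriv γ₁ r) := by
    intro r hr
    rw [hqk _ (ofReal_mem_ball hr), hkr _ (hb _ (ofReal_mem_ball hr)) (by simpa using hr.1.ne')]
    simp [abs_of_pos hr.1]
  refine ⟨ρ₂ / 2, ⟨by positivity, ?_⟩, q 0, hq0, p, hp, fun r hr ↦ ?_, ?_⟩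
  · have : ρ₂ ≤ ρ / 2 := min_le_right _ _
    linarith
  · rw [← hqe r hr]; exact hp' r hr
  · refine (hq.continuous.continuousAt.tendsto.comp tendsto_ofReal_nhdsGT).congr' ?_
    filter_upwards [eventually_Ioo_nhdsGT (half_pos hρ₂)] with r hr using hqe r hr

end LocalModel

/-! ### Rotations by a right angle for pulled back metrics. -/

section QuarterTurn

variable {V₁ V₂ : Type*} [NormedAddCommGroup V₁] [InnerProductSpace ℝ V₁]
  [NormedAddCommGroup V₂] [InnerProductSpace ℝ V₂]
  {W : Type*} [AddCommGroup W] [Module ℝ W]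

/-- The standard inner product on a triple product. -/
def tripleInner (a b : V₁ × ℝ × V₂) : ℝ :=
  inner ℝ a.1 b.1 + a.2.1 * b.2.1 + inner ℝ a.2.2 b.2.2

theorem tripleInner_comm (a b : V₁ × ℝ × V₂) : tripleInner a b = tripleInner b a := by
  simp only [tripleInner, real_inner_comm, mul_comm]

theorem tripleInner_add_left (a b c : V₁ × ℝ × V₂) :
    tripleInner (a + b) c = tripleInner a c + tripleInner b c := by
  simp only [tripleInner, Prod.fst_add, Prod.snd_add, inner_add_left]; ring

theorem tripleInner_smul_left (r : ℝ) (a b : V₁ × ℝ × V₂) :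
    tripleInner (r • a) b = r * tripleInner a b := by
  simp only [tripleInner, Prod.smul_fst, Prod.smul_snd, inner_smul_left, smul_eq_mul]
  simp; ring

theorem tripleInner_add_right (a b c : V₁ × ℝ × V₂) :
    tripleInner a (b + c) = tripleInner a b + tripleInner a c := by
  rw [tripleInner_comm, tripleInner_add_left, tripleInner_comm b, tripleInner_comm c]

theorem tripleInner_smul_right (r : ℝ) (a b : V₁ × ℝ × V₂) :
    tripleInner a (r • b) = r * tripleInner a b := by
  rw [tripleInner_comm, tripleInner_smul_left, tripleInner_comm b]

theorem tripleInner_self_pos {a : V₁ × ℝ × V₂} (ha : a ≠ 0) : 0 < tripleInner a a := by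
  have h1 : 0 ≤ inner ℝ a.1 a.1 := real_inner_self_nonneg
  have h2 : 0 ≤ inner ℝ a.2.2 a.2.2 := real_inner_self_nonneg
  have h3 := mul_self_nonneg a.2.1
  rcases lt_or_eq_of_le (add_nonneg (add_nonneg h1 h3) h2) with h | h
  · exact h
  · exfalso; apply ha
    have e1 : inner ℝ a.1 a.1 = 0 := by linarith
    have e2 : a.2.1 * a.2.1 = 0 := by linarith
    have e3 : inner ℝ a.2.2 a.2.2 = 0 := by linarith
    exact Prod.ext (inner_self_eq_zero.1 e1) (Prod.ext (mul_self_eq_zero.1 e2)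
      (inner_self_eq_zero.1 e3))

theorem contDiff_tripleInner :
    ContDiff ℝ ∞ fun q : (V₁ × ℝ × V₂) × (V₁ × ℝ × V₂) ↦ tripleInner q.1 q.2 := by
  unfold tripleInner
  have h1 := (contDiff_fst (𝕜 := ℝ) (E := V₁ × ℝ × V₂) (F := V₁ × ℝ × V₂) (n := ∞))
  have h2 := (contDiff_snd (𝕜 := ℝ) (E := V₁ × ℝ × V₂) (F := V₁ × ℝ × V₂) (n := ∞))
  exact ((h1.fst.inner ℝ h2.fst).add (h1.snd.fst.mul h2.snd.fst)).add
    (h1.snd.snd.inner ℝ h2.snd.snd)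

/-- The Gram determinant of two vectors. -/
def gramDet (a b : V₁ × ℝ × V₂) : ℝ :=
  tripleInner a a * tripleInner b b - tripleInner a b ^ 2

/-- The rotation by a right angle of a plane with basis `b₁`, `b₂`, for the metric pulled back by
`L`; the sign of `s` tells the orientation of the basis. -/
noncomputable def quarterTurn (L : W → V₁ × ℝ × V₂) (s : ℝ) (b₁ b₂ v : W) : W :=
  (s / |s| / √(gramDet (L b₁) (L b₂))) •
    (tripleInner (L v) (L b₁) • b₂ - tripleInner (L v) (L b₂) • b₁)

/-- The formula is natural by inspection; neither linearity of `L` nor injectivity of `D` enters. -/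
theorem quarterTurn_map {W' : Type*} [AddCommGroup W'] [Module ℝ W'] (D : W →ₗ[ℝ] W')
    (L : W' → V₁ × ℝ × V₂) (L' : W → V₁ × ℝ × V₂) (hL : ∀ v, L (D v) = L' v) (s : ℝ)
    (b₁ b₂ v : W) : quarterTurn L s (D b₁) (D b₂) (D v) = D (quarterTurn L' s b₁ b₂ v) := by
  simp only [quarterTurn, hL, map_smul, map_sub]

/-- Gram–Schmidt: the vector `-⟨b₁, b₂⟩ b₁ + |b₁|² b₂` is nonzero and its squared length is `|b₁|²`
times the Gram determinant. -/
theorem gramDet_pos (L : W →ₗ[ℝ] V₁ × ℝ × V₂) (hL : Function.Injective L) {b₁ b₂ : W}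
    (h : ∀ x y : ℝ, x • b₁ + y • b₂ = 0 → x = 0 ∧ y = 0) : 0 < gramDet (L b₁) (L b₂) := by
  have hb₁ : b₁ ≠ 0 := fun h0 ↦ one_ne_zero (h 1 0 (by simp [h0])).1
  have h11 : 0 < tripleInner (L b₁) (L b₁) :=
    tripleInner_self_pos (fun h0 ↦ hb₁ (hL (h0.trans (map_zero L).symm)))
  set x := tripleInner (L b₁) (L b₂) with hx
  set y := tripleInner (L b₁) (L b₁) with hy
  have hw : (-x) • b₁ + y • b₂ ≠ 0 := fun h0 ↦ h11.ne' (h _ _ h0).2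
  have h22 := tripleInner_self_pos (a := L ((-x) • b₁ + y • b₂))
    (fun h0 ↦ hw (hL (h0.trans (map_zero L).symm)))
  rw [map_add, map_smul, map_smul] at h22
  simp only [tripleInner_add_left, tripleInner_add_right, tripleInner_smul_left,
    tripleInner_smul_right, tripleInner_comm (L b₂) (L b₁)] at h22
  rw [← hx, ← hy] at h22
  have : 0 < y * (y * tripleInner (L b₂) (L b₂) - x ^ 2) := by nlinarith
  exact (pos_iff_pos_of_mul_pos this).1 h11

/-- The quarter turn does not depend on the basis. -/
theorem quarterTurn_eq (L : W →ₗ[ℝ] V₁ × ℝ × V₂) {s : ℝ}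
    (e₁ e₂ : W) (p q r t : ℝ) (hdet : p * t - q * r ≠ 0) (v : W) :
    quarterTurn L (s * (p * t - q * r)) (p • e₁ + q • e₂) (r • e₁ + t • e₂) v =
      quarterTurn L s e₁ e₂ v := by
  set d := p * t - q * r with hd
  -- A change of basis with determinant `d` multiplies the vector part by `d`, the square root by
  -- `|d|`, and the sign of `s` by that of `d`; these factors cancel. In the degenerate cases both
  -- sides are `0`.
  have hg : gramDet (L (p • e₁ + q • e₂)) (L (r • e₁ + t • e₂)) =
      d ^ 2 * gramDet (L e₁) (L e₂) := by
    simp only [gramDet, map_add, map_smul, tripleInner_add_left, tripleInner_add_right,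
      tripleInner_smul_left, tripleInner_smul_right, tripleInner_comm (L e₂) (L e₁), hd]
    ring
  have hv : tripleInner (L v) (L (p • e₁ + q • e₂)) • (r • e₁ + t • e₂) -
      tripleInner (L v) (L (r • e₁ + t • e₂)) • (p • e₁ + q • e₂) =
      d • (tripleInner (L v) (L e₁) • e₂ - tripleInner (L v) (L e₂) • e₁) := by
    simp only [map_add, map_smul, tripleInner_add_right, tripleInner_smul_right, hd]
    module
  unfold quarterTurn
  rw [hg, hv, smul_smul, Real.sqrt_mul (sq_nonneg d), Real.sqrt_sq_eq_abs, abs_mul]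
  congr 1
  have hd' : |d| ≠ 0 := abs_ne_zero.2 hdet
  have hdd : |d| * |d| = d * d := abs_mul_abs_self d
  by_cases hs : s = 0
  · simp [hs]
  by_cases hg0 : √(gramDet (L e₁) (L e₂)) = 0
  · simp [hg0]
  have hs' : |s| ≠ 0 := abs_ne_zero.2 hs
  field_simp
  linear_combination -hdd

/-- The case of an orthogonal, negatively oriented basis with lengths `x` and `y`. It is applied to
`∂_r`, `∂_θ` with lengths `β f` and `f`, so that `x / y = β`. -/
theorem quarterTurn_basis_fst (L : W → V₁ × ℝ × V₂) {s : ℝ} {b₁ b₂ : W} (hs : s < 0) {x y : ℝ}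
    (hx : 0 < x) (hy : 0 < y) (h₁ : tripleInner (L b₁) (L b₁) = x ^ 2)
    (h₂ : tripleInner (L b₂) (L b₂) = y ^ 2) (h₁₂ : tripleInner (L b₁) (L b₂) = 0) :
    quarterTurn L s b₁ b₂ b₁ = -(x / y) • b₂ ∧ quarterTurn L s b₁ b₂ b₂ = (y / x) • b₁ := by
  have hg : √(gramDet (L b₁) (L b₂)) = x * y := by
    rw [gramDet, h₁, h₂, h₁₂, ← Real.sqrt_sq (mul_pos hx hy).le]
    congr 1; ring
  have hsn : s / |s| = -1 := by
    rw [abs_of_neg hs, div_neg, div_self hs.ne]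
  unfold quarterTurn
  rw [hg, hsn]
  constructor
  · rw [h₁, h₁₂, zero_smul, sub_zero, smul_smul]
    congr 1; field_simp
  · rw [tripleInner_comm, h₁₂, h₂, zero_smul, zero_sub, ← neg_smul, smul_smul]
    congr 1; field_simp

end QuarterTurn

/-! ### Quarter turns of the plane. -/

section QuarterTurnComplex

variable {V₁ V₂ : Type*} [NormedAddCommGroup V₁] [InnerProductSpace ℝ V₁]
  [NormedAddCommGroup V₂] [InnerProductSpace ℝ V₂]

/-- The determinant of two vectors of the plane `ℂ`. -/
def planeDet (v w : ℂ) : ℝ := v.re * w.im - v.im * w.re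

theorem smul_one_add_smul_I (v : ℂ) : v.re • (1 : ℂ) + v.im • Complex.I = v := by
  apply Complex.ext <;> simp

theorem quarterTurn_eq_standard (L : ℂ →ₗ[ℝ] V₁ × ℝ × V₂) (s : ℝ) {b₁ b₂ : ℂ}
    (h : planeDet b₁ b₂ ≠ 0) (v : ℂ) :
    quarterTurn L (s * planeDet b₁ b₂) b₁ b₂ v = quarterTurn L s 1 Complex.I v := by
  have := quarterTurn_eq L (s := s) 1 Complex.I b₁.re b₁.im b₂.re b₂.im h v
  rwa [smul_one_add_smul_I, smul_one_add_smul_I] at this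

theorem gramDet_standard_pos (L : ℂ →ₗ[ℝ] V₁ × ℝ × V₂) (hL : Function.Injective L) :
    0 < gramDet (L 1) (L Complex.I) := by
  refine gramDet_pos L hL fun x y h ↦ ?_
  have h1 := congrArg Complex.re h
  have h2 := congrArg Complex.im h
  simp at h1 h2
  exact ⟨h1, h2⟩

/-- In the basis `1`, `i` the matrix has trace `0`, and its determinant `c² (EG - F²)` is `1` by the
choice of the factor `c`; the square is then `-1`. -/
theorem quarterTurn_quarterTurn (L : ℂ →ₗ[ℝ] V₁ × ℝ × V₂) (hL : Function.Injective L) {s : ℝ}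
    (hs : s ≠ 0) (v : ℂ) :
    quarterTurn L s 1 Complex.I (quarterTurn L s 1 Complex.I v) = -v := by
  have hg := gramDet_standard_pos L hL
  set e := L 1 with he
  set f := L Complex.I with hf
  have hLv : ∀ v : ℂ, L v = v.re • e + v.im • f := fun v ↦ by
    rw [he, hf, ← map_smul, ← map_smul, ← map_add, smul_one_add_smul_I]
  have hsq : √(gramDet e f) ^ 2 = tripleInner e e * tripleInner f f - tripleInner e f ^ 2 :=
    Real.sq_sqrt hg.le
  have hs2 : (s / |s|) ^ 2 = 1 := by rw [div_pow, sq_abs, div_self (pow_ne_zero 2 hs)]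
  have hg0 : √(gramDet e f) ≠ 0 := (Real.sqrt_pos.2 hg).ne'
  set c := s / |s| / √(gramDet e f) with hc
  have hc2 : c ^ 2 * (tripleInner e e * tripleInner f f - tripleInner e f ^ 2) = 1 := by
    rw [← hsq, hc, div_pow, hs2]; field_simp
  have hre : ∀ v : ℂ, (quarterTurn L s 1 Complex.I v).re = -(c * tripleInner (L v) f) ∧
      (quarterTurn L s 1 Complex.I v).im = c * tripleInner (L v) e := fun v ↦ by
    simp [quarterTurn, ← he, ← hf, ← hc]
  apply Complex.ext
  · rw [(hre _).1, hLv (quarterTurn L s 1 Complex.I v), (hre v).1, (hre v).2, hLv v]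
    simp only [tripleInner_add_left, tripleInner_smul_left, tripleInner_comm f e, Complex.neg_re]
    linear_combination (-v.re) * hc2
  · rw [(hre _).2, hLv (quarterTurn L s 1 Complex.I v), (hre v).1, (hre v).2, hLv v]
    simp only [tripleInner_add_left, tripleInner_smul_left, tripleInner_comm f e, Complex.neg_im]
    linear_combination (-v.im) * hc2

/-- The determinant of `v` and its rotation is a factor with the sign of `s` times the squared
length of `L v`. -/
theorem planeDet_quarterTurn_pos (L : ℂ →ₗ[ℝ] V₁ × ℝ × V₂) (hL : Function.Injective L) {s : ℝ}
    (hs : s ≠ 0) {v : ℂ} (hv : v ≠ 0) : 0 < s * planeDet v (quarterTurn L s 1 Complex.I v) := by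
  have hg := gramDet_standard_pos L hL
  have hLv : L v = v.re • L 1 + v.im • L Complex.I := by
    rw [← map_smul, ← map_smul, ← map_add, smul_one_add_smul_I]
  have h1 : 0 < tripleInner (L v) (L v) :=
    tripleInner_self_pos fun h0 ↦ hv (hL (h0.trans (map_zero L).symm))
  have h2 : s * planeDet v (quarterTurn L s 1 Complex.I v) =
      (s * s / |s|) / √(gramDet (L 1) (L Complex.I)) * tripleInner (L v) (L v) := by
    have hLL : tripleInner (L v) (L v) =
        v.re * tripleInner (L v) (L 1) + v.im * tripleInner (L v) (L Complex.I) := by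
      nth_rewrite 2 [hLv]
      rw [tripleInner_add_right, tripleInner_smul_right, tripleInner_smul_right]
    rw [hLL]
    simp only [planeDet, quarterTurn]
    simp
    ring
  rw [h2]
  have := Real.sqrt_pos.2 hg
  have hss : 0 < s * s := mul_self_pos.2 hs
  have hs' := abs_pos.2 hs
  positivity

/-- `quarterTurn` as a linear map. -/
noncomputable def quarterTurnCLM (L : ℂ →L[ℝ] V₁ × ℝ × V₂) (s : ℝ) : ℂ →L[ℝ] ℂ :=
  LinearMap.toContinuousLinearMap
    { toFun := quarterTurn L s 1 Complex.I
      map_add' := fun v w ↦ by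
        simp only [quarterTurn, map_add, tripleInner_add_left]; module
      map_smul' := fun c v ↦ by
        simp only [quarterTurn, map_smul, tripleInner_smul_left, RingHom.id_apply]; module }

theorem quarterTurnCLM_apply (L : ℂ →L[ℝ] V₁ × ℝ × V₂) (s : ℝ) (v : ℂ) :
    quarterTurnCLM L s v = quarterTurn L s 1 Complex.I v := rfl

theorem quarterTurnCLM_eq (L : ℂ →L[ℝ] V₁ × ℝ × V₂) (s : ℝ) {b₁ b₂ : ℂ}
    (h : planeDet b₁ b₂ ≠ 0) (v : ℂ) :
    quarterTurnCLM L s v = quarterTurn L (s * planeDet b₁ b₂) b₁ b₂ v :=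
  (quarterTurn_eq_standard (L : ℂ →ₗ[ℝ] V₁ × ℝ × V₂) s h v).symm

/-- Absolute value and square root are smooth at the values that occur: `s` does not vanish, and the
Gram determinant is positive since `L` is injective. -/
theorem ContDiffOn.quarterTurn {E : Type*} [NormedAddCommGroup E] [NormedSpace ℝ E] {O : Set E}
    {L : E → ℂ →L[ℝ] V₁ × ℝ × V₂} {s : E → ℝ} (hL : ContDiffOn ℝ ∞ L O) (hs : ContDiffOn ℝ ∞ s O)
    (hinj : ∀ y ∈ O, Function.Injective (L y)) (hs0 : ∀ y ∈ O, s y ≠ 0) :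
    ContDiffOn ℝ ∞ (fun y ↦ quarterTurnCLM (L y) (s y)) O := by
  rw [contDiffOn_clm_apply]
  intro v
  simp only [quarterTurnCLM_apply]
  unfold _root_.quarterTurn
  have hT : ∀ a b : ℂ, ContDiffOn ℝ ∞ (fun y ↦ tripleInner (L y a) (L y b)) O := fun a b ↦
    contDiff_tripleInner.comp_contDiffOn ((hL.clm_apply contDiffOn_const).prodMk
      (hL.clm_apply contDiffOn_const))
  have hg : ContDiffOn ℝ ∞ (fun y ↦ gramDet (L y 1) (L y Complex.I)) O :=
    ((hT 1 1).mul (hT _ _)).sub ((hT _ _).pow 2)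
  have habs : ContDiffOn ℝ ∞ (fun y ↦ |s y|) O := fun y hy ↦ (hs y hy).abs (hs0 y hy)
  have hpos : ∀ y ∈ O, 0 < gramDet (L y 1) (L y Complex.I) := fun y hy ↦
    gramDet_standard_pos (L y : ℂ →ₗ[ℝ] V₁ × ℝ × V₂) (hinj y hy)
  exact ((hs.div habs fun y hy ↦ abs_ne_zero.2 (hs0 y hy)).div
    (hg.sqrt fun y hy ↦ (hpos y hy).ne') fun y hy ↦ (Real.sqrt_pos.2 (hpos y hy)).ne').smul
    (((hT _ _).smul contDiffOn_const).sub ((hT _ _).smul contDiffOn_const))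

end QuarterTurnComplex

/-! ### Topology of the open book and of its pages. -/

namespace OpenBook

variable {M : Type*} [TopologicalSpace M] [ChartedSpace (EuclideanSpace ℝ (Fin 3)) M]
  [IsManifold (𝓡 3) ∞ M] [T2Space M]
  {F : Type*} [TopologicalSpace F] [ChartedSpace ℂ F] [IsManifold 𝓘(ℝ, ℂ) ∞ F] {n : ℕ}
  (B : OpenBook M F n)

/-- The domain of the parametrisations of the ends of the page. -/
abbrev endDom : Set (ℝ × ℝ) := Ioo 0 B.R ×ˢ univ

theorem isOpen_endDom : IsOpen B.endDom := isOpen_Ioo.prod isOpen_univ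

theorem R_pos : 0 < B.R := one_pos.trans B.one_lt_R

theorem pageEnd_mder (i : Fin n) {x : ℝ × ℝ} (hx : x ∈ B.endDom) :
    Function.Bijective (mder 𝓘(ℝ, ℝ × ℝ) 𝓘(ℝ, ℂ) (B.pageEnd i) x) := B.pageEnd_deriv i x hx

theorem mt_mder (x : F × ℝ) :
    Function.Bijective (mder (𝓘(ℝ, ℂ).prod 𝓘(ℝ, ℝ)) (𝓡 3) B.mt x) := B.mt_deriv x

theorem tube_mder (i : Fin n) {x : ℝ × ℂ} (hx : x.2 ∈ Metric.ball (0 : ℂ) B.R) :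
    Function.Bijective (mder 𝓘(ℝ, ℝ × ℂ) (𝓡 3) (B.tube i) x) := B.tube_deriv i x ⟨mem_univ _, hx⟩

theorem h_zpow_pageEnd (k : ℤ) (i : Fin n) {r : ℝ} (hr : r ∈ Ioo 0 B.R) (θ : ℝ) :
    ((B.h.toEquiv : Equiv.Perm F) ^ k) (B.pageEnd i (r, θ)) = B.pageEnd i (r, θ) := by
  have h1 : (B.h.toEquiv : Equiv.Perm F) (B.pageEnd i (r, θ)) = B.pageEnd i (r, θ) :=
    B.h_pageEnd i r hr θ
  exact Function.IsFixedPt.perm_zpow h1 k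

theorem exists_polar (z : ℂ) : z = ‖z‖ * Complex.exp (z.arg * Complex.I) :=
  (Complex.norm_mul_exp_arg_mul_I z).symm

/-- The tube in terms of the mapping torus. -/
theorem tube_eq_mt (i : Fin n) {z : ℂ} (hz : z ∈ Metric.ball (0 : ℂ) B.R) (hz0 : z ≠ 0) (θ : ℝ) :
    B.tube i (θ, z) = B.mt (B.pageEnd i (‖z‖, θ), z.arg) := by
  rw [B.mt_pageEnd i ‖z‖ ⟨norm_pos_iff.2 hz0, by simpa using hz⟩, ← exists_polar]

theorem mt_ne_tube_zero (x : F) (t : ℝ) (i : Fin n) (θ : ℝ) : B.mt (x, t) ≠ B.tube i (θ, 0) := by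
  intro h
  have h1 : B.tube i (θ, 0) ∈ (range B.mt)ᶜ := by
    rw [B.compl_range_mt]
    exact mem_iUnion.2 ⟨i, (θ, 0), ⟨mem_univ _, rfl⟩, rfl⟩
  exact h1 ⟨_, h⟩

/-- The identifications in the mapping torus are by powers of the monodromy, which fix the ends
pointwise. A point of a tube therefore has only one position on the page, and its angle is
determined up to a period. -/
theorem eq_of_mt_eq_tube {x : F} {t : ℝ} {i : Fin n} {θ : ℝ} {z : ℂ}
    (hz : z ∈ Metric.ball (0 : ℂ) B.R) (h : B.mt (x, t) = B.tube i (θ, z)) :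
    z ≠ 0 ∧ x = B.pageEnd i (‖z‖, θ) ∧ z = ‖z‖ * Complex.exp (t * Complex.I) := by
  have hz0 : z ≠ 0 := by
    rintro rfl
    exact B.mt_ne_tube_zero x t i θ h
  have hr : ‖z‖ ∈ Ioo 0 B.R := ⟨norm_pos_iff.2 hz0, by simpa using hz⟩
  rw [B.tube_eq_mt i hz hz0, eq_comm, B.mt_eq_iff] at h
  obtain ⟨k, hk, hx⟩ := h
  rw [B.h_zpow_pageEnd k i hr] at hx
  refine ⟨hz0, hx, ?_⟩
  conv_lhs => rw [exists_polar z]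
  congr 1
  rw [hk]
  push_cast
  rw [add_mul, Complex.exp_add]
  have : Complex.exp (2 * Real.pi * k * Complex.I) = 1 := by
    rw [Complex.exp_eq_one_iff]; exact ⟨k, by ring⟩
  rw [this, mul_one]

theorem exists_period (θ : ℝ) : ∃ k : ℤ, ∃ θ' ∈ Ico (0 : ℝ) (2 * Real.pi), θ' = θ + 2 * Real.pi * k := by
  have hp := Real.two_pi_pos
  refine ⟨-⌊θ / (2 * Real.pi)⌋, θ + 2 * Real.pi * (-⌊θ / (2 * Real.pi)⌋ : ℤ), ⟨?_, ?_⟩, rfl⟩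
  · have := Int.floor_le (θ / (2 * Real.pi))
    rw [le_div_iff₀ hp] at this
    push_cast; linarith
  · have := Int.lt_floor_add_one (θ / (2 * Real.pi))
    rw [div_lt_iff₀ hp] at this
    push_cast; linarith

theorem pageEnd_add (i : Fin n) {r : ℝ} (hr : r ∈ Ioo 0 B.R) (θ : ℝ) (k : ℤ) :
    B.pageEnd i (r, θ + 2 * Real.pi * k) = B.pageEnd i (r, θ) :=
  ((B.pageEnd_eq_iff i i r hr r hr θ _).2 ⟨rfl, rfl, k, rfl⟩).symm

theorem tube_add (i : Fin n) {z : ℂ} (hz : z ∈ Metric.ball (0 : ℂ) B.R) (θ : ℝ) (k : ℤ) :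
    B.tube i (θ + 2 * Real.pi * k, z) = B.tube i (θ, z) :=
  ((B.tube_eq_iff i i z hz z hz θ _).2 ⟨rfl, rfl, k, rfl⟩).symm

theorem isCompact_tube (i : Fin n) {a : ℝ} (ha : a < B.R) :
    IsCompact (B.tube i '' (univ ×ˢ Metric.closedBall (0 : ℂ) a)) := by
  have hb : Metric.closedBall (0 : ℂ) a ⊆ Metric.ball 0 B.R := Metric.closedBall_subset_ball ha
  have h1 : B.tube i '' (univ ×ˢ Metric.closedBall (0 : ℂ) a) =
      B.tube i '' (Icc 0 (2 * Real.pi) ×ˢ Metric.closedBall (0 : ℂ) a) := by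
    apply Subset.antisymm
    · rintro _ ⟨⟨θ, z⟩, ⟨-, hz⟩, rfl⟩
      obtain ⟨k, θ', hθ', rfl⟩ := exists_period θ
      exact ⟨(θ + 2 * Real.pi * k, z), ⟨⟨hθ'.1, hθ'.2.le⟩, hz⟩, B.tube_add i (hb hz) θ k⟩
    · exact image_mono (prod_mono (subset_univ _) subset_rfl)
  rw [h1]
  refine (isCompact_Icc.prod (isCompact_closedBall 0 a)).image_of_continuousOn
    ((B.tube_smooth i).continuousOn.mono (prod_mono (subset_univ _) hb))

theorem mem_pageEnd_iff_mt_mem_tube (i : Fin n) {a : ℝ} (ha : a < B.R) (x : F) (t : ℝ) :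
    x ∈ B.pageEnd i '' (Ioc 0 a ×ˢ univ) ↔
      B.mt (x, t) ∈ B.tube i '' (univ ×ˢ Metric.closedBall (0 : ℂ) a) := by
  constructor
  · rintro ⟨⟨r, θ⟩, ⟨hr, -⟩, rfl⟩
    refine ⟨(θ, r * Complex.exp (t * Complex.I)), ⟨mem_univ _, ?_⟩,
      (B.mt_pageEnd i r ⟨hr.1, hr.2.trans_lt ha⟩ θ t).symm⟩
    have hr1 : 0 < r := hr.1
    simpa [abs_of_pos hr1, Complex.norm_exp_ofReal_mul_I] using hr.2
  · rintro ⟨⟨θ, z⟩, ⟨-, hz⟩, h⟩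
    obtain ⟨hz0, rfl, -⟩ := B.eq_of_mt_eq_tube (Metric.closedBall_subset_ball ha hz) h.symm
    exact ⟨(‖z‖, θ), ⟨⟨norm_pos_iff.2 hz0, by simpa using hz⟩, mem_univ _⟩, rfl⟩

/-- The set is the preimage, under the inclusion of the page of angle `0`, of a compact solid torus
in `M`; closedness comes from `M` being Hausdorff. -/
theorem isClosed_pageEnd (i : Fin n) {a : ℝ} (ha : a < B.R) :
    IsClosed (B.pageEnd i '' (Ioc 0 a ×ˢ univ)) := by
  have : B.pageEnd i '' (Ioc 0 a ×ˢ univ) =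
      (fun x ↦ B.mt (x, 0)) ⁻¹' (B.tube i '' (univ ×ˢ Metric.closedBall (0 : ℂ) a)) := by
    ext x; exact B.mem_pageEnd_iff_mt_mem_tube i ha x 0
  rw [this]
  exact (B.isCompact_tube i ha).isClosed.preimage
    (B.mt_smooth.continuous.comp (continuous_id.prodMk continuous_const))

theorem isClosed_iUnion_pageEnd {a : ℝ} (ha : a < B.R) :
    IsClosed (⋃ i, B.pageEnd i '' (Ioc 0 a ×ˢ univ)) :=
  isClosed_iUnion_of_finite fun i ↦ B.isClosed_pageEnd i ha

/-- Images of open sets of parameters under a local diffeomorphism are open. -/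
theorem isOpen_pageEnd (i : Fin n) {U : Set (ℝ × ℝ)} (hU : IsOpen U) (hU' : U ⊆ B.endDom) :
    IsOpen (B.pageEnd i '' U) := by
  rw [isOpen_iff_mem_nhds]
  rintro _ ⟨x, hx, rfl⟩
  obtain ⟨e, hxe, heU, hef, -⟩ := exists_localInverse hU hx ((B.pageEnd_smooth i).mono hU')
    (fun x hx ↦ B.pageEnd_mder i (hU' hx))
  rw [← hef]
  refine mem_of_superset (e.open_target.mem_nhds (e.map_source hxe)) ?_
  rw [← e.image_source_eq_target]
  exact image_mono heU

theorem isOpenMap_mt : IsOpenMap B.mt := by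
  intro U hU
  rw [isOpen_iff_mem_nhds]
  rintro _ ⟨x, hx, rfl⟩
  obtain ⟨e, hxe, heU, hef, -⟩ := exists_localInverse hU hx B.mt_smooth.contMDiffOn
    (fun x _ ↦ B.mt_mder x)
  rw [← hef]
  refine mem_of_superset (e.open_target.mem_nhds (e.map_source hxe)) ?_
  rw [← e.image_source_eq_target]
  exact image_mono heU

theorem mt_injective (α : ℝ) : Function.Injective fun x ↦ B.mt (x, α) := by
  intro x y hxy
  obtain ⟨k, hk, rfl⟩ := (B.mt_eq_iff x y α α).1 hxy
  have : (k : ℝ) = 0 := by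
    have hp := Real.two_pi_pos
    have h0 : 2 * Real.pi * (k : ℝ) = 0 := by linarith
    exact (mul_eq_zero.1 h0).resolve_left hp.ne'
  have : k = 0 := by exact_mod_cast this
  simp [this]

/-- `mt` is an open map, and two angles at distance less than `1` cannot differ by a nonzero
multiple of `2π`. So the image of `V ×ˢ Ioo (α - 1) (α + 1)` is an open set that meets the page of
angle `α` in the image of `V` only. -/
theorem isEmbedding_mt (α : ℝ) : IsEmbedding fun x ↦ B.mt (x, α) := by
  have hcont : Continuous fun x ↦ B.mt (x, α) :=
    B.mt_smooth.continuous.comp (continuous_id.prodMk continuous_const)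
  refine ⟨isInducing_iff_nhds.2 fun x ↦ le_antisymm (hcont.continuousAt.le_comap) ?_,
    B.mt_injective α⟩
  intro U hU
  obtain ⟨V, hVU, hV, hxV⟩ := mem_nhds_iff.1 hU
  refine mem_comap.2 ⟨B.mt '' (V ×ˢ Ioo (α - 1) (α + 1)),
    (B.isOpenMap_mt _ (hV.prod isOpen_Ioo)).mem_nhds ⟨(x, α), ⟨hxV, by simp⟩, rfl⟩, ?_⟩
  rintro y ⟨⟨z, s⟩, ⟨hz, hs⟩, hzy⟩
  obtain ⟨k, hk, rfl⟩ := (B.mt_eq_iff z y s α).1 hzy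
  have : k = 0 := by
    have hp : (3 : ℝ) < Real.pi := Real.pi_gt_three
    have h1 : |2 * Real.pi * (k : ℝ)| < 1 := by
      rw [abs_lt]; constructor <;> linarith [hs.1, hs.2]
    by_contra hk0
    have h2 : (1 : ℝ) ≤ |(k : ℝ)| := by exact_mod_cast Int.one_le_abs hk0
    rw [abs_mul, abs_of_pos Real.two_pi_pos] at h1
    nlinarith
  rw [this]
  exact hVU (by simpa using hz)

/-- The complement consists of the compact core and the annuli `a ≤ r ≤ 1`, which are images of
compact rectangles by periodicity in `θ`. -/
theorem isCompact_compl_ends {a : ℝ} (ha : a ∈ Ioc (0 : ℝ) 1) :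
    IsCompact (⋃ i, B.pageEnd i '' (Ioo 0 a ×ˢ univ))ᶜ := by
  have h1 : IsCompact ((⋃ i, B.pageEnd i '' (Ioo 0 1 ×ˢ univ))ᶜ ∪
      ⋃ i, B.pageEnd i '' (Icc a 1 ×ˢ Icc 0 (2 * Real.pi))) := by
    refine B.compact_core.union (isCompact_iUnion fun i ↦ ?_)
    refine (isCompact_Icc.prod isCompact_Icc).image_of_continuousOn
      ((B.pageEnd_smooth i).continuousOn.mono fun x hx ↦ ⟨⟨ha.1.trans_le hx.1.1, ?_⟩, mem_univ _⟩)
    exact hx.1.2.trans_lt B.one_lt_R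
  refine h1.of_isClosed_subset ?_ ?_
  · refine IsOpen.isClosed_compl (isOpen_iUnion fun i ↦ B.isOpen_pageEnd i
      (isOpen_Ioo.prod isOpen_univ) (prod_mono (Ioo_subset_Ioo_right ?_) subset_rfl))
    exact ha.2.trans B.one_lt_R.le
  · intro x hx
    by_cases hx1 : x ∈ ⋃ i, B.pageEnd i '' (Ioo 0 1 ×ˢ univ)
    · right
      obtain ⟨i, ⟨r, θ⟩, ⟨hr, -⟩, rfl⟩ := mem_iUnion.1 hx1
      obtain ⟨k, θ', hθ', rfl⟩ := exists_period θ
      refine mem_iUnion.2 ⟨i, (r, θ + 2 * Real.pi * k), ⟨⟨?_, hr.2.le⟩, hθ'.1, hθ'.2.le⟩,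
        B.pageEnd_add i ⟨hr.1, hr.2.trans B.one_lt_R⟩ θ k⟩
      by_contra hra
      exact hx (mem_iUnion.2 ⟨i, (r, θ), ⟨⟨hr.1, not_le.1 hra⟩, mem_univ _⟩, rfl⟩)
    · exact Or.inl hx1

/-! ### Functions on the page that are given on the ends. -/

section Glue

variable {V : Type*} [NormedAddCommGroup V] [NormedSpace ℝ V]

open Classical in
/-- The function on the page that is given by `g i` on the `i`-th end and by `c` elsewhere. -/
noncomputable def glue (g : Fin n → ℝ × ℝ → V) (c : V) (x : F) : V :=
  if h : ∃ q : Fin n × (ℝ × ℝ), q.2 ∈ B.endDom ∧ x = B.pageEnd q.1 q.2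
    then g h.choose.1 h.choose.2 else c

variable {B} {g : Fin n → ℝ × ℝ → V} {c : V}

/-- The coordinates picked in the definition are determined up to a period of `θ` only; `hper` makes
the choice irrelevant. -/
theorem glue_pageEnd (hper : ∀ i r θ, ∀ k : ℤ, g i (r, θ + 2 * Real.pi * k) = g i (r, θ))
    (i : Fin n) {q : ℝ × ℝ} (hq : q ∈ B.endDom) : B.glue g c (B.pageEnd i q) = g i q := by
  have h : ∃ q' : Fin n × (ℝ × ℝ), q'.2 ∈ B.endDom ∧ B.pageEnd i q = B.pageEnd q'.1 q'.2 :=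
    ⟨(i, q), hq, rfl⟩
  rw [glue, dif_pos h]
  obtain ⟨h1, h2⟩ := h.choose_spec
  obtain ⟨hi, hr, k, hk⟩ :=
    (B.pageEnd_eq_iff _ _ _ hq.1 _ h1.1 _ _).1 h2
  have : h.choose.2 = (q.1, q.2 + 2 * Real.pi * k) := Prod.ext hr.symm hk
  rw [this, hper, ← hi]

theorem glue_of_notMem {x : F} (hx : x ∉ ⋃ i, B.pageEnd i '' B.endDom) : B.glue g c x = c := by
  rw [glue, dif_neg]
  rintro ⟨q, hq, rfl⟩
  exact hx (mem_iUnion.2 ⟨q.1, q.2, hq, rfl⟩)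

theorem glue_eq_of_notMem (hper : ∀ i r θ, ∀ k : ℤ, g i (r, θ + 2 * Real.pi * k) = g i (r, θ))
    {a : ℝ} (hc : ∀ i, ∀ r ∈ Ioo a B.R, ∀ θ, g i (r, θ) = c) {x : F}
    (hx : x ∉ ⋃ i, B.pageEnd i '' (Ioc 0 a ×ˢ univ)) : B.glue g c x = c := by
  by_cases hx' : x ∈ ⋃ i, B.pageEnd i '' B.endDom
  · obtain ⟨i, q, hq, rfl⟩ := mem_iUnion.1 hx'
    rw [glue_pageEnd hper i hq]
    refine hc i q.1 ⟨?_, hq.1.2⟩ q.2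
    by_contra h
    exact hx (mem_iUnion.2 ⟨i, q, ⟨⟨hq.1.1, not_lt.1 h⟩, mem_univ _⟩, rfl⟩)
  · exact glue_of_notMem hx'

/-- No seam arises: the part `r ≤ a` of the ends is closed, and on its open complement the function
is constant. -/
theorem contMDiff_glue (hper : ∀ i r θ, ∀ k : ℤ, g i (r, θ + 2 * Real.pi * k) = g i (r, θ))
    {a : ℝ} (ha : a < B.R) (hc : ∀ i, ∀ r ∈ Ioo a B.R, ∀ θ, g i (r, θ) = c)
    (hg : ∀ i, ContDiffOn ℝ ∞ (g i) B.endDom) : ContMDiff 𝓘(ℝ, ℂ) 𝓘(ℝ, V) ∞ (B.glue g c) := by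
  intro x
  by_cases hx : x ∈ ⋃ i, B.pageEnd i '' (Ioc 0 a ×ˢ univ)
  · obtain ⟨i, q, hq, rfl⟩ := mem_iUnion.1 hx
    have hqD : q ∈ B.endDom := ⟨⟨hq.1.1, hq.1.2.trans_lt ha⟩, mem_univ _⟩
    obtain ⟨e, hqe, heU, hef, hes⟩ := exists_localInverse B.isOpen_endDom hqD (B.pageEnd_smooth i)
      (fun x hx ↦ B.pageEnd_mder i hx)
    have hqt : B.pageEnd i q ∈ e.target := by rw [← hef]; exact e.map_source hqe
    have hq' : e.symm (B.pageEnd i q) = q := by rw [← hef]; exact e.left_inv hqe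
    have h1 : ContMDiffAt 𝓘(ℝ, ℂ) 𝓘(ℝ, V) ∞ (g i ∘ e.symm) (B.pageEnd i q) := by
      refine ContMDiffAt.comp (I' := 𝓘(ℝ, ℝ × ℝ)) _ ?_
        (hes.contMDiffAt (e.open_target.mem_nhds hqt))
      rw [hq']
      exact ((hg i).contDiffAt (B.isOpen_endDom.mem_nhds hqD)).contMDiffAt
    refine h1.congr_of_eventuallyEq ?_
    filter_upwards [e.open_target.mem_nhds hqt] with y hy
    have h2 := glue_pageEnd (c := c) hper i (heU (e.map_target hy))
    have h3 := e.right_inv hy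
    rw [hef] at h3
    rw [h3] at h2
    exact h2
  · have : B.glue g c =ᶠ[𝓝 x] fun _ ↦ c := by
      filter_upwards [(B.isClosed_iUnion_pageEnd ha).isOpen_compl.mem_nhds hx] with y hy
      exact glue_eq_of_notMem hper hc hy
    exact contMDiffAt_const.congr_of_eventuallyEq this

end Glue

end OpenBook

/-! ### Parametrisations of `M` induced by those of the page. -/

namespace OpenBook

variable {M : Type*} [TopologicalSpace M] [ChartedSpace (EuclideanSpace ℝ (Fin 3)) M]
  [IsManifold (𝓡 3) ∞ M] [T2Space M]
  {F : Type*} [TopologicalSpace F] [ChartedSpace ℂ F] [IsManifold 𝓘(ℝ, ℂ) ∞ F] {n : ℕ}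
  (B : OpenBook M F n)
  {E : Type*} [NormedAddCommGroup E] [NormedSpace ℝ E] [FiniteDimensional ℝ E]

/-- The parametrisation of `M` induced by a parametrisation of the page. -/
def slide (σ : E → F) (q : E × ℝ) : M := B.mt (σ q.1, q.2)

variable {B} {σ : E → F} {O : Set E}

theorem contMDiffOn_slide_aux (hσ : ContMDiffOn 𝓘(ℝ, E) 𝓘(ℝ, ℂ) ∞ σ O) :
    ContMDiffOn 𝓘(ℝ, E × ℝ) (𝓘(ℝ, ℂ).prod 𝓘(ℝ, ℝ)) ∞ (fun q : E × ℝ ↦ (σ q.1, q.2))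
      (O ×ˢ univ) :=
  (hσ.comp contDiff_fst.contMDiff.contMDiffOn fun _ hq ↦ hq.1).prodMk
    contDiff_snd.contMDiff.contMDiffOn

theorem contMDiffOn_slide (hσ : ContMDiffOn 𝓘(ℝ, E) 𝓘(ℝ, ℂ) ∞ σ O) :
    ContMDiffOn 𝓘(ℝ, E × ℝ) (𝓡 3) ∞ (B.slide σ) (O ×ˢ univ) :=
  B.mt_smooth.comp_contMDiffOn (contMDiffOn_slide_aux hσ)

theorem mder_slide (hO : IsOpen O) (hσ : ContMDiffOn 𝓘(ℝ, E) 𝓘(ℝ, ℂ) ∞ σ O) {y : E} (hy : y ∈ O)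
    (t : ℝ) (w : E × ℝ) : mder 𝓘(ℝ, E × ℝ) (𝓡 3) (B.slide σ) (y, t) w =
      mder (𝓘(ℝ, ℂ).prod 𝓘(ℝ, ℝ)) (𝓡 3) B.mt (σ y, t)
        (mder 𝓘(ℝ, E) 𝓘(ℝ, ℂ) σ y w.1, w.2) := by
  have h1 : MDifferentiableAt 𝓘(ℝ, E) 𝓘(ℝ, ℂ) σ y :=
    (hσ.contMDiffAt (hO.mem_nhds hy)).mdifferentiableAt (by simp)
  have h2 : MDifferentiableAt 𝓘(ℝ, E × ℝ) 𝓘(ℝ, ℂ) (fun q : E × ℝ ↦ σ q.1) (y, t) :=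
    MDifferentiableAt.comp (I' := 𝓘(ℝ, E)) (y, t) h1 differentiableAt_fst.mdifferentiableAt
  have h3 : MDifferentiableAt 𝓘(ℝ, E × ℝ) 𝓘(ℝ, ℝ) (fun q : E × ℝ ↦ q.2) (y, t) :=
    differentiableAt_snd.mdifferentiableAt
  refine (mder_comp_apply (g := B.mt) (f := fun q : E × ℝ ↦ (σ q.1, q.2)) (y, t)
    (B.mt_smooth.contMDiffAt.mdifferentiableAt (by simp)) (h2.prodMk h3) w).trans ?_
  congr 1
  have h4 : mder 𝓘(ℝ, E × ℝ) (𝓘(ℝ, ℂ).prod 𝓘(ℝ, ℝ)) (fun q : E × ℝ ↦ (σ q.1, q.2)) (y, t) =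
      (mder 𝓘(ℝ, E × ℝ) 𝓘(ℝ, ℂ) (fun q : E × ℝ ↦ σ q.1) (y, t)).prod
        (mder 𝓘(ℝ, E × ℝ) 𝓘(ℝ, ℝ) (fun q : E × ℝ ↦ q.2) (y, t)) := mfderiv_prodMk h2 h3
  rw [h4]
  refine Prod.ext ?_ ?_
  · refine (mder_comp_apply (g := σ) (f := fun q : E × ℝ ↦ q.1) (y, t) h1
      differentiableAt_fst.mdifferentiableAt w).trans ?_
    congr 1
    rw [mder_eq_fderiv, fderiv_fst]; rfl
  · change mder 𝓘(ℝ, E × ℝ) 𝓘(ℝ, ℝ) (fun q : E × ℝ ↦ q.2) (y, t) w = w.2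
    rw [mder_eq_fderiv, fderiv_snd]; rfl

theorem bijective_mder_slide (hO : IsOpen O) (hσ : ContMDiffOn 𝓘(ℝ, E) 𝓘(ℝ, ℂ) ∞ σ O)
    (hd : ∀ y ∈ O, Function.Bijective (mder 𝓘(ℝ, E) 𝓘(ℝ, ℂ) σ y)) {q : E × ℝ}
    (hq : q ∈ O ×ˢ (univ : Set ℝ)) :
    Function.Bijective (mder 𝓘(ℝ, E × ℝ) (𝓡 3) (B.slide σ) q) := by
  have h1 : (mder 𝓘(ℝ, E × ℝ) (𝓡 3) (B.slide σ) q : E × ℝ → _) =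
      mder (𝓘(ℝ, ℂ).prod 𝓘(ℝ, ℝ)) (𝓡 3) B.mt (σ q.1, q.2) ∘
        Prod.map (mder 𝓘(ℝ, E) 𝓘(ℝ, ℂ) σ q.1) id := by
    funext w
    exact mder_slide hO hσ hq.1 q.2 w
  rw [h1]
  exact (B.mt_mder _).comp ((hd _ hq.1).prodMap Function.bijective_id)

/-- The inverse of the preferred chart of the page, as a parametrisation. -/
theorem chart_param (x : F) : ContMDiffOn 𝓘(ℝ, ℂ) 𝓘(ℝ, ℂ) ∞ (extChartAt 𝓘(ℝ, ℂ) x).symm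
      (extChartAt 𝓘(ℝ, ℂ) x).target ∧
    ∀ y ∈ (extChartAt 𝓘(ℝ, ℂ) x).target,
      Function.Bijective (mder 𝓘(ℝ, ℂ) 𝓘(ℝ, ℂ) (extChartAt 𝓘(ℝ, ℂ) x).symm y) := by
  refine ⟨contMDiffOn_extChartAt_symm x, fun y hy ↦ ?_⟩
  have := isInvertible_mfderivWithin_extChartAt_symm (I := 𝓘(ℝ, ℂ)) hy
  rw [ModelWithCorners.range_eq_univ, mfderivWithin_univ] at this
  obtain ⟨e, he⟩ := this
  have h2 : (mder 𝓘(ℝ, ℂ) 𝓘(ℝ, ℂ) (extChartAt 𝓘(ℝ, ℂ) x).symm y : ℂ → ℂ) = e := by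
    funext v
    exact (DFunLike.congr_fun he v).symm
  rw [h2]
  exact e.bijective

end OpenBook

theorem bijective_mder_extChartAt_symm {M : Type*} [TopologicalSpace M]
    [ChartedSpace (EuclideanSpace ℝ (Fin 3)) M] [IsManifold (𝓡 3) ∞ M] (p : M) :
    ∀ y ∈ (extChartAt (𝓡 3) p).target, Function.Bijective
      (mder 𝓘(ℝ, EuclideanSpace ℝ (Fin 3)) (𝓡 3) (extChartAt (𝓡 3) p).symm y) := by
  intro y hy
  have := isInvertible_mfderivWithin_extChartAt_symm (I := 𝓡 3) hy
  rw [ModelWithCorners.range_eq_univ, mfderivWithin_univ] at this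
  obtain ⟨e, he⟩ := this
  have h2 : (mder 𝓘(ℝ, EuclideanSpace ℝ (Fin 3)) (𝓡 3) (extChartAt (𝓡 3) p).symm y :
      EuclideanSpace ℝ (Fin 3) → EuclideanSpace ℝ (Fin 3)) = e := by
    funext v
    exact (DFunLike.congr_fun he v).symm
  rw [h2]
  exact e.bijective

/-! ### The Reeb equations, also in the limit. -/

namespace AdaptedFamily

open OpenBook

variable {M : Type*} [TopologicalSpace M] [ChartedSpace (EuclideanSpace ℝ (Fin 3)) M]
  [IsManifold (𝓡 3) ∞ M] [T2Space M]
  {F : Type*} [TopologicalSpace F] [ChartedSpace ℂ F] [IsManifold 𝓘(ℝ, ℂ) ∞ F] {n : ℕ}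
  {B : OpenBook M F n} (A : AdaptedFamily B)
  {E : Type*} [NormedAddCommGroup E] [NormedSpace ℝ E] [FiniteDimensional ℝ E]

/-- A function that is continuous up to `δ = 0` is determined there by its values for `δ > 0`. -/
theorem eq_of_eq_pos {f : ℝ → ℝ} {c : ℝ} (hf : ContinuousWithinAt f (Ico 0 1) 0)
    (h : ∀ δ ∈ Ioo (0 : ℝ) 1, f δ = c) : f 0 = c := by
  have h1 : Tendsto f (𝓝[>] 0) (𝓝 (f 0)) := by
    refine hf.tendsto.mono_left ?_
    rw [← nhdsWithin_Ioo_eq_nhdsGT one_pos]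
    exact nhdsWithin_mono _ Ioo_subset_Ico_self
  refine tendsto_nhds_unique h1 (tendsto_const_nhds.congr' ?_)
  filter_upwards [Ioo_mem_nhdsGT one_pos] with δ hδ using (h δ hδ).symm

section Param
variable {ψ : E → M} {O : Set E}

/-- The Reeb equations in a parametrisation, for all parameters. -/
theorem reeb_param (hO : IsOpen O) (hψ : ContMDiffOn 𝓘(ℝ, E) (𝓡 3) ∞ ψ O)
    (hd : ∀ y ∈ O, Function.Bijective (mder 𝓘(ℝ, E) (𝓡 3) ψ y)) {δ : ℝ} (hδ : δ ∈ Ico (0 : ℝ) 1)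
    {y : E} (hy : y ∈ O) :
    pullForm (𝓡 3) (A.lam δ) ψ y (pullField (𝓡 3) (A.X δ) ψ y) = 1 ∧
      ∀ w, pullD (A.lam δ) ψ y (pullField (𝓡 3) (A.X δ) ψ y) w = 0 := by
  have hXc : ContDiffOn ℝ ∞ (fun q : ℝ × E ↦ pullField (𝓡 3) (A.X q.1) ψ q.2) (Ico 0 1 ×ˢ O) :=
    contDiffOn_pullField A.X_smooth hO hψ hd
  have hlc : ContDiffOn ℝ ∞ (fun q : ℝ × E ↦ pullForm (𝓡 3) (A.lam q.1) ψ q.2) (Ico 0 1 ×ˢ O) :=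
    contDiffOn_pullForm A.lam_smooth hO hψ
  have hpos : ∀ δ ∈ Ioo (0 : ℝ) 1,
      pullForm (𝓡 3) (A.lam δ) ψ y (pullField (𝓡 3) (A.X δ) ψ y) = 1 ∧
      ∀ w, pullD (A.lam δ) ψ y (pullField (𝓡 3) (A.X δ) ψ y) w = 0 := by
    intro δ hδ
    have hδ' : δ ∈ Ico (0 : ℝ) 1 := Ioo_subset_Ico_self hδ
    have h1 := A.reeb δ hδ (ψ y)
    have h2 := mder_pullField (I' := 𝓡 3) (X := A.X δ) (hd y hy)
    constructor
    · refine Eq.trans ?_ h1.2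
      exact congrArg (A.lam δ (ψ y)) h2
    · intro w
      rw [← extD_mder A.lam_smooth hδ' hO hψ hy]
      refine Eq.trans ?_ (h1.1 (mder 𝓘(ℝ, E) (𝓡 3) ψ y w))
      exact congrArg (fun v ↦ extD (A.lam δ) (ψ y) v _) h2
  -- At `δ = 0` the field is known only as a smooth limit, and the equations pass to the limit by
  -- continuity in `δ`.
  rcases eq_or_lt_of_le hδ.1 with h0 | h0
  · subst h0
    have hsl : ∀ {G : Type _} [NormedAddCommGroup G] [NormedSpace ℝ G] {f : ℝ × E → G},
        ContDiffOn ℝ ∞ f (Ico 0 1 ×ˢ O) → ContinuousWithinAt (fun δ ↦ f (δ, y)) (Ico 0 1) 0 := by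
      intro G _ _ f hf
      exact (hf.continuousOn (0, y) ⟨⟨le_rfl, one_pos⟩, hy⟩).comp (t := Ico 0 1 ×ˢ O)
        (f := fun δ : ℝ ↦ (δ, y)) (by fun_prop) fun δ hδ ↦ ⟨hδ, hy⟩
    constructor
    · exact eq_of_eq_pos (f := fun δ ↦ pullForm (𝓡 3) (A.lam δ) ψ y (pullField (𝓡 3) (A.X δ) ψ y))
        (hsl (f := fun q : ℝ × E ↦ pullForm (𝓡 3) (A.lam q.1) ψ q.2
          (pullField (𝓡 3) (A.X q.1) ψ q.2)) (hlc.clm_apply hXc)) fun δ hδ ↦ (hpos δ hδ).1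
    · intro w
      have hfd := contDiffOn_fderiv_slice hO hlc
      exact eq_of_eq_pos (f := fun δ ↦ pullD (A.lam δ) ψ y (pullField (𝓡 3) (A.X δ) ψ y) w)
        (hsl (f := fun q : ℝ × E ↦ pullD (A.lam q.1) ψ q.2 (pullField (𝓡 3) (A.X q.1) ψ q.2) w)
          (((hfd.clm_apply hXc).clm_apply contDiffOn_const).sub
            ((hfd.clm_apply contDiffOn_const).clm_apply hXc))) fun δ hδ ↦ (hpos δ hδ).2 w
  · exact hpos δ ⟨h0, hδ.2⟩

end Param

/-- `reeb_param` evaluated in the preferred chart. The new information is the value `δ = 0`, where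
the Reeb equations hold although `λ_0` need not be a contact form. -/
theorem reeb_all {δ : ℝ} (hδ : δ ∈ Ico (0 : ℝ) 1) : IsReeb (A.lam δ) (A.X δ) := by
  intro p
  have hp := mem_extChartAt_target (I := 𝓡 3) p
  have hb := bijective_mder_extChartAt_symm p
  have hs := contMDiffOn_extChartAt_symm (I := 𝓡 3) (n := ∞) p
  have ho := isOpen_extChartAt_target (I := 𝓡 3) p
  obtain ⟨h1, h2⟩ := A.reeb_param ho hs hb hδ hp
  have h3 := mder_pullField (I' := 𝓡 3) (X := A.X δ) (hb _ hp)
  have hpp : (extChartAt (𝓡 3) p).symm (extChartAt (𝓡 3) p p) = p := extChartAt_to_inv p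
  have key : ∀ p' : M, p' = p → (∀ v : EuclideanSpace ℝ (Fin 3),
      extD (A.lam δ) p' (A.X δ p') v = 0) ∧ A.lam δ p' (A.X δ p') = 1 →
      (∀ v : TangentSpace (𝓡 3) p, extD (A.lam δ) p (A.X δ p) v = 0) ∧ A.lam δ p (A.X δ p) = 1 := by
    rintro _ rfl h; exact h
  refine key _ hpp ⟨fun v ↦ ?_, ?_⟩
  · obtain ⟨w, rfl⟩ := (hb _ hp).2 v
    refine Eq.trans ?_ (h2 w)
    rw [← extD_mder A.lam_smooth hδ ho hs hp]
    exact congrArg (fun v ↦ extD (A.lam δ) _ v _) h3.symm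
  · refine Eq.trans ?_ h1
    exact congrArg (A.lam δ _) h3.symm

/-! ### Polar coordinates -/

theorem slide_pageEnd (i : Fin n) {r : ℝ} (hr : r ∈ Ioo 0 B.R) (θ φ : ℝ) :
    B.slide (B.pageEnd i) ((r, θ), φ) = B.tube i (θ, r * Complex.exp (φ * Complex.I)) :=
  B.mt_pageEnd i r hr θ φ

theorem polar_mem_ball {r : ℝ} (hr : r ∈ Ioo 0 B.R) (φ : ℝ) :
    (r * Complex.exp (φ * Complex.I) : ℂ) ∈ Metric.ball (0 : ℂ) B.R := by
  simpa [Complex.norm_exp_ofReal_mul_I, abs_of_pos hr.1] using hr.2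

/-- Polar coordinates on the disk. -/
noncomputable def polarMap (q : (ℝ × ℝ) × ℝ) : ℝ × ℂ :=
  (q.1.2, (q.1.1 : ℂ) * Complex.exp ((q.2 : ℂ) * Complex.I))

theorem hasFDerivAt_polarMap (q w : (ℝ × ℝ) × ℝ) :
    DifferentiableAt ℝ polarMap q ∧ fderiv ℝ polarMap q w =
      (w.1.2, ((w.1.1 : ℂ) + q.1.1 * w.2 * Complex.I) * Complex.exp ((q.2 : ℂ) * Complex.I)) := by
  have h1 : HasFDerivAt (fun q : (ℝ × ℝ) × ℝ ↦ ((q.1.1 : ℝ) : ℂ))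
      (Complex.ofRealCLM.comp ((ContinuousLinearMap.fst ℝ ℝ ℝ).comp
        (ContinuousLinearMap.fst ℝ (ℝ × ℝ) ℝ))) q :=
    (Complex.ofRealCLM.comp ((ContinuousLinearMap.fst ℝ ℝ ℝ).comp
        (ContinuousLinearMap.fst ℝ (ℝ × ℝ) ℝ))).hasFDerivAt
  have h2 : HasFDerivAt (fun q : (ℝ × ℝ) × ℝ ↦ ((q.2 : ℝ) : ℂ))
      (Complex.ofRealCLM.comp (ContinuousLinearMap.snd ℝ (ℝ × ℝ) ℝ)) q :=
    (Complex.ofRealCLM.comp (ContinuousLinearMap.snd ℝ (ℝ × ℝ) ℝ)).hasFDerivAt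
  have h3 := h1.mul ((h2.mul_const Complex.I).cexp)
  have h4 : HasFDerivAt (fun q : (ℝ × ℝ) × ℝ ↦ q.1.2)
      ((ContinuousLinearMap.snd ℝ ℝ ℝ).comp (ContinuousLinearMap.fst ℝ (ℝ × ℝ) ℝ)) q :=
    ((ContinuousLinearMap.snd ℝ ℝ ℝ).comp (ContinuousLinearMap.fst ℝ (ℝ × ℝ) ℝ)).hasFDerivAt
  have h5 : HasFDerivAt polarMap _ q := h4.prodMk h3
  refine ⟨h5.differentiableAt, ?_⟩
  rw [h5.fderiv]
  refine Prod.ext rfl ?_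
  simp
  ring

/-- The chain rule through `z = r e^{iφ}`: the vector `∂_r` becomes `e^{iφ}` and `∂_φ` becomes `i r
e^{iφ}`. -/
theorem mder_slide_pageEnd (i : Fin n) {r : ℝ} (hr : r ∈ Ioo 0 B.R) (θ φ : ℝ)
    (w : (ℝ × ℝ) × ℝ) :
    mder 𝓘(ℝ, (ℝ × ℝ) × ℝ) (𝓡 3) (B.slide (B.pageEnd i)) ((r, θ), φ) w =
      mder 𝓘(ℝ, ℝ × ℂ) (𝓡 3) (B.tube i) (θ, r * Complex.exp (φ * Complex.I))
        (w.1.2, ((w.1.1 : ℂ) + r * w.2 * Complex.I) * Complex.exp ((φ : ℂ) * Complex.I)) := by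
  have hev : B.slide (B.pageEnd i) =ᶠ[𝓝 ((r, θ), φ)] fun q ↦ B.tube i (polarMap q) := by
    filter_upwards [(B.isOpen_endDom.prod isOpen_univ).mem_nhds
      (show ((r, θ), φ) ∈ B.endDom ×ˢ (univ : Set ℝ) from ⟨⟨hr, mem_univ _⟩, mem_univ _⟩)] with q hq
    exact slide_pageEnd i hq.1.1 q.1.2 q.2
  obtain ⟨h1, h2⟩ := hasFDerivAt_polarMap ((r, θ), φ) w
  rw [mder_congr hev]
  refine (mder_comp_apply (g := B.tube i) (f := polarMap) _ ?_ h1.mdifferentiableAt w).trans ?_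
  · exact ((B.tube_smooth i).contMDiffAt ((isOpen_univ.prod Metric.isOpen_ball).mem_nhds
      ⟨mem_univ _, polar_mem_ball hr φ⟩)).mdifferentiableAt (by simp)
  · rw [mder_eq_fderiv, h2]
    rfl

/-- In polar coordinates the forms are `γ₁ dθ + γ₂ dφ`. -/
theorem pullForm_polar {δ : ℝ} (hδ : δ ∈ Ico (0 : ℝ) 1) (i : Fin n) {r : ℝ} (hr : r ∈ Ioo 0 B.R)
    (θ φ : ℝ) (w : (ℝ × ℝ) × ℝ) :
    pullForm (𝓡 3) (A.lam δ) (B.slide (B.pageEnd i)) ((r, θ), φ) w =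
      A.γ₁ i δ r * w.1.2 + A.γ₂ i δ r * w.2 := by
  have h1 := mder_slide_pageEnd i hr θ φ w
  have h2 := A.tube_form δ hδ i θ _ (polar_mem_ball hr φ)
    (w.1.2, ((w.1.1 : ℂ) + r * w.2 * Complex.I) * Complex.exp ((φ : ℂ) * Complex.I))
  have hn : ‖(r * Complex.exp (φ * Complex.I) : ℂ)‖ = r := by
    simp [Complex.norm_exp_ofReal_mul_I, abs_of_pos hr.1]
  have key : ∀ p' : M, p' = B.tube i (θ, r * Complex.exp (φ * Complex.I)) →
      ∀ v v' : EuclideanSpace ℝ (Fin 3), v = v' → A.lam δ p' v =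
        A.lam δ (B.tube i (θ, r * Complex.exp (φ * Complex.I))) v' := by
    rintro _ rfl _ _ rfl; rfl
  refine (key _ (slide_pageEnd i hr θ φ) _ _ h1).trans (h2.trans ?_)
  rw [hn]
  have h3 : (starRingEnd ℂ) (r * Complex.exp (φ * Complex.I)) *
      (((w.1.1 : ℂ) + r * w.2 * Complex.I) * Complex.exp ((φ : ℂ) * Complex.I)) =
      r * ((w.1.1 : ℂ) + r * w.2 * Complex.I) := by
    have h4 : (starRingEnd ℂ) (Complex.exp (φ * Complex.I)) * Complex.exp (φ * Complex.I) = 1 := by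
      rw [← Complex.exp_conj, ← Complex.exp_add]
      simp
    rw [map_mul, Complex.conj_ofReal]
    linear_combination (r * ((w.1.1 : ℂ) + r * w.2 * Complex.I)) * h4
  rw [h3]
  have hr0 := hr.1.ne'
  simp
  field_simp

theorem contMDiffOn_polar (i : Fin n) : ContMDiffOn 𝓘(ℝ, (ℝ × ℝ) × ℝ) (𝓡 3) ∞
    (B.slide (B.pageEnd i)) (B.endDom ×ˢ univ) := contMDiffOn_slide (B.pageEnd_smooth i)

theorem bijective_mder_polar (i : Fin n) : ∀ q ∈ B.endDom ×ˢ (univ : Set ℝ), Function.Bijective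
    (mder 𝓘(ℝ, (ℝ × ℝ) × ℝ) (𝓡 3) (B.slide (B.pageEnd i)) q) := fun _ hq ↦
  bijective_mder_slide B.isOpen_endDom (B.pageEnd_smooth i) (fun _ hx ↦ B.pageEnd_mder i hx) hq

theorem isOpen_polarDom : IsOpen (B.endDom ×ˢ (univ : Set ℝ)) := B.isOpen_endDom.prod isOpen_univ

theorem polar_mem {r : ℝ} (hr : r ∈ Ioo 0 B.R) (θ φ : ℝ) :
    ((r, θ), φ) ∈ B.endDom ×ˢ (univ : Set ℝ) := ⟨⟨hr, mem_univ _⟩, mem_univ _⟩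

/-- Joint smoothness in `(δ, r)` is read off from the pulled back family: `γ₁` and `γ₂` are its
values on `∂_θ` and `∂_φ` along the ray `θ = φ = 0`. -/
theorem γ_smooth (i : Fin n) :
    ContDiffOn ℝ ∞ (fun q : ℝ × ℝ ↦ A.γ₁ i q.1 q.2) (Ico 0 1 ×ˢ Ioo 0 B.R) ∧
    ContDiffOn ℝ ∞ (fun q : ℝ × ℝ ↦ A.γ₂ i q.1 q.2) (Ico 0 1 ×ˢ Ioo 0 B.R) := by
  have h := contDiffOn_pullForm A.lam_smooth isOpen_polarDom (contMDiffOn_polar (B := B) i)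
  have hin : ContDiffOn ℝ ∞ (fun q : ℝ × ℝ ↦ (q.1, ((q.2, (0 : ℝ)), (0 : ℝ))))
      (Ico 0 1 ×ˢ Ioo 0 B.R) := by fun_prop
  have h' := h.comp hin fun q hq ↦ ⟨hq.1, polar_mem hq.2 0 0⟩
  constructor
  · refine (h'.clm_apply (contDiffOn_const (c := (((0 : ℝ), (1 : ℝ)), (0 : ℝ))))).congr
      fun q hq ↦ ?_
    simp only [Function.comp]
    rw [A.pullForm_polar hq.1 i hq.2]; simp
  · refine (h'.clm_apply (contDiffOn_const (c := (((0 : ℝ), (0 : ℝ)), (1 : ℝ))))).congr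
      fun q hq ↦ ?_
    simp only [Function.comp]
    rw [A.pullForm_polar hq.1 i hq.2]; simp

theorem contDiffOn_γ₁ {δ : ℝ} (hδ : δ ∈ Ico (0 : ℝ) 1) (i : Fin n) :
    ContDiffOn ℝ ∞ (A.γ₁ i δ) (Ioo 0 B.R) := contDiffOn_slice (A.γ_smooth i).1 hδ

theorem contDiffOn_γ₂ {δ : ℝ} (hδ : δ ∈ Ico (0 : ℝ) 1) (i : Fin n) :
    ContDiffOn ℝ ∞ (A.γ₂ i δ) (Ioo 0 B.R) := contDiffOn_slice (A.γ_smooth i).2 hδ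

theorem hasDerivAt_γ₁ {δ : ℝ} (hδ : δ ∈ Ico (0 : ℝ) 1) (i : Fin n) {r : ℝ} (hr : r ∈ Ioo 0 B.R) :
    HasDerivAt (A.γ₁ i δ) (deriv (A.γ₁ i δ) r) r :=
  (((A.contDiffOn_γ₁ hδ i).contDiffAt (isOpen_Ioo.mem_nhds hr)).differentiableAt
    (by simp)).hasDerivAt

theorem hasDerivAt_γ₂ {δ : ℝ} (hδ : δ ∈ Ico (0 : ℝ) 1) (i : Fin n) {r : ℝ} (hr : r ∈ Ioo 0 B.R) :
    HasDerivAt (A.γ₂ i δ) (deriv (A.γ₂ i δ) r) r :=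
  (((A.contDiffOn_γ₂ hδ i).contDiffAt (isOpen_Ioo.mem_nhds hr)).differentiableAt
    (by simp)).hasDerivAt

theorem pullD_polar {δ : ℝ} (hδ : δ ∈ Ico (0 : ℝ) 1) (i : Fin n) {r : ℝ} (hr : r ∈ Ioo 0 B.R)
    (θ φ : ℝ) (v w : (ℝ × ℝ) × ℝ) :
    pullD (A.lam δ) (B.slide (B.pageEnd i)) ((r, θ), φ) v w =
      deriv (A.γ₁ i δ) r * (v.1.1 * w.1.2 - w.1.1 * v.1.2) +
      deriv (A.γ₂ i δ) r * (v.1.1 * w.2 - w.1.1 * v.2) := by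
  let fr : ((ℝ × ℝ) × ℝ) →L[ℝ] ℝ := (ContinuousLinearMap.fst ℝ ℝ ℝ).comp
    (ContinuousLinearMap.fst ℝ (ℝ × ℝ) ℝ)
  let fθ : ((ℝ × ℝ) × ℝ) →L[ℝ] ℝ := (ContinuousLinearMap.snd ℝ ℝ ℝ).comp
    (ContinuousLinearMap.fst ℝ (ℝ × ℝ) ℝ)
  let fφ : ((ℝ × ℝ) × ℝ) →L[ℝ] ℝ := ContinuousLinearMap.snd ℝ (ℝ × ℝ) ℝ
  have hev : pullForm (𝓡 3) (A.lam δ) (B.slide (B.pageEnd i)) =ᶠ[𝓝 ((r, θ), φ)]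
      fun q ↦ A.γ₁ i δ q.1.1 • fθ + A.γ₂ i δ q.1.1 • fφ := by
    filter_upwards [isOpen_polarDom.mem_nhds (polar_mem hr θ φ)] with q hq
    ext
    · exact (A.pullForm_polar hδ i hq.1.1 q.1.2 q.2 _).trans (by simp [fθ, fφ])
    · exact (A.pullForm_polar hδ i hq.1.1 q.1.2 q.2 _).trans (by simp [fθ, fφ])
    · exact (A.pullForm_polar hδ i hq.1.1 q.1.2 q.2 _).trans (by simp [fθ, fφ])
  have hfr : HasFDerivAt (fun q : (ℝ × ℝ) × ℝ ↦ q.1.1) fr ((r, θ), φ) := fr.hasFDerivAt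
  have h1 := ((A.hasDerivAt_γ₁ hδ i hr).comp_hasFDerivAt ((r, θ), φ) hfr).smul_const fθ
  have h2 := ((A.hasDerivAt_γ₂ hδ i hr).comp_hasFDerivAt ((r, θ), φ) hfr).smul_const fφ
  have h3 := ((h1.add h2).congr_of_eventuallyEq hev).fderiv
  unfold pullD
  rw [h3]
  simp [fr, fθ, fφ]
  ring

/-- The Reeb vector field in polar coordinates. -/
theorem reeb_polar {δ : ℝ} (hδ : δ ∈ Ico (0 : ℝ) 1) (i : Fin n) {r : ℝ} (hr : r ∈ Ioo 0 B.R)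
    (θ φ : ℝ) {x : (ℝ × ℝ) × ℝ}
    (hx : x = pullField (𝓡 3) (A.X δ) (B.slide (B.pageEnd i)) ((r, θ), φ)) :
    A.γ₁ i δ r * x.1.2 + A.γ₂ i δ r * x.2 = 1 ∧
    deriv (A.γ₁ i δ) r * x.1.2 + deriv (A.γ₂ i δ) r * x.2 = 0 ∧
    deriv (A.γ₁ i δ) r * x.1.1 = 0 := by
  obtain ⟨h1, h2⟩ := A.reeb_param isOpen_polarDom (contMDiffOn_polar i) (bijective_mder_polar i) hδ
    (polar_mem hr θ φ)
  rw [← hx] at h1 h2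
  refine ⟨?_, ?_, ?_⟩
  · rw [← h1, A.pullForm_polar hδ i hr]
  · have := h2 ((1, 0), 0)
    rw [A.pullD_polar hδ i hr] at this
    simp at this
    linarith
  · have := h2 ((0, 1), 0)
    rw [A.pullD_polar hδ i hr] at this
    simpa using this

end AdaptedFamily

/-! ### Bilinearity and antisymmetry of `dλ`. -/

section

variable {M : Type*} [TopologicalSpace M] [ChartedSpace (EuclideanSpace ℝ (Fin 3)) M]

theorem extD_comb (lam : OneForm M) (p : M) (a b c d : ℝ) (e f : EuclideanSpace ℝ (Fin 3)) :
    extD lam p (a • e + b • f : EuclideanSpace ℝ (Fin 3))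
      (c • e + d • f : EuclideanSpace ℝ (Fin 3)) = (a * d - b * c) * extD lam p e f := by
  change fderiv ℝ (chartForm lam p) (extChartAt (𝓡 3) p p) (a • e + b • f) (c • e + d • f) -
    fderiv ℝ (chartForm lam p) (extChartAt (𝓡 3) p p) (c • e + d • f) (a • e + b • f) =
    (a * d - b * c) * (fderiv ℝ (chartForm lam p) (extChartAt (𝓡 3) p p) e f -
    fderiv ℝ (chartForm lam p) (extChartAt (𝓡 3) p p) f e)
  simp
  ring

theorem extD_add_left (lam : OneForm M) (p : M) (v v' w : EuclideanSpace ℝ (Fin 3)) :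
    extD lam p (v + v' : EuclideanSpace ℝ (Fin 3)) w = extD lam p v w + extD lam p v' w := by
  change fderiv ℝ (chartForm lam p) (extChartAt (𝓡 3) p p) (v + v') w -
    fderiv ℝ (chartForm lam p) (extChartAt (𝓡 3) p p) w (v + v') =
    (fderiv ℝ (chartForm lam p) (extChartAt (𝓡 3) p p) v w -
    fderiv ℝ (chartForm lam p) (extChartAt (𝓡 3) p p) w v) +
    (fderiv ℝ (chartForm lam p) (extChartAt (𝓡 3) p p) v' w -
    fderiv ℝ (chartForm lam p) (extChartAt (𝓡 3) p p) w v')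
  simp
  ring

theorem extD_smul_left (lam : OneForm M) (p : M) (c : ℝ) (v w : EuclideanSpace ℝ (Fin 3)) :
    extD lam p (c • v : EuclideanSpace ℝ (Fin 3)) w = c * extD lam p v w := by
  change fderiv ℝ (chartForm lam p) (extChartAt (𝓡 3) p p) (c • v) w -
    fderiv ℝ (chartForm lam p) (extChartAt (𝓡 3) p p) w (c • v) =
    c * (fderiv ℝ (chartForm lam p) (extChartAt (𝓡 3) p p) v w -
    fderiv ℝ (chartForm lam p) (extChartAt (𝓡 3) p p) w v)
  simp
  ring

theorem extD_swap (lam : OneForm M) (p : M) (v w : EuclideanSpace ℝ (Fin 3)) :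
    extD lam p v w = -extD lam p w v := by
  change fderiv ℝ (chartForm lam p) (extChartAt (𝓡 3) p p) v w -
    fderiv ℝ (chartForm lam p) (extChartAt (𝓡 3) p p) w v =
    -(fderiv ℝ (chartForm lam p) (extChartAt (𝓡 3) p p) w v -
    fderiv ℝ (chartForm lam p) (extChartAt (𝓡 3) p p) v w)
  ring

end

/-! ### Forms and Reeb fields on the mapping torus; transversality to the pages. -/

namespace AdaptedFamily

open OpenBook

variable {M : Type*} [TopologicalSpace M] [ChartedSpace (EuclideanSpace ℝ (Fin 3)) M]
  [IsManifold (𝓡 3) ∞ M] [T2Space M]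
  {F : Type*} [TopologicalSpace F] [ChartedSpace ℂ F] [IsManifold 𝓘(ℝ, ℂ) ∞ F] {n : ℕ}
  {B : OpenBook M F n} (A : AdaptedFamily B)
  {E : Type*} [NormedAddCommGroup E] [NormedSpace ℝ E] [FiniteDimensional ℝ E]

variable (B) in
/-- The differential of the map from the mapping torus. -/
noncomputable abbrev dmt (q : F × ℝ) : ℂ × ℝ →L[ℝ] EuclideanSpace ℝ (Fin 3) :=
  mder (𝓘(ℝ, ℂ).prod 𝓘(ℝ, ℝ)) (𝓡 3) B.mt q

/-- The forms, pulled back to the mapping torus. -/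
noncomputable def lamHat (δ : ℝ) (q : F × ℝ) : ℂ × ℝ →L[ℝ] ℝ :=
  ContinuousLinearMap.comp (M₂ := EuclideanSpace ℝ (Fin 3)) (A.lam δ (B.mt q)) (dmt B q)

/-- The Reeb vector fields, pulled back to the mapping torus. -/
noncomputable def reebHat (δ : ℝ) (q : F × ℝ) : ℂ × ℝ :=
  (dmt B q).inverse (A.X δ (B.mt q))

theorem dmt_reebHat (δ : ℝ) (q : F × ℝ) : dmt B q (A.reebHat δ q) = A.X δ (B.mt q) :=
  apply_inverse_of_bijective (B.mt_mder q) (A.X δ (B.mt q) : EuclideanSpace ℝ (Fin 3))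

theorem lamHat_reebHat {δ : ℝ} (hδ : δ ∈ Ico (0 : ℝ) 1) (q : F × ℝ) :
    A.lamHat δ q (A.reebHat δ q) = 1 :=
  (congrArg (A.lam δ (B.mt q)) (A.dmt_reebHat δ q)).trans (A.reeb_all hδ _).2

theorem extD_reebHat {δ : ℝ} (hδ : δ ∈ Ico (0 : ℝ) 1) (q : F × ℝ)
    (v : EuclideanSpace ℝ (Fin 3)) :
    extD (A.lam δ) (B.mt q) (dmt B q (A.reebHat δ q)) v = 0 :=
  (congrArg (fun u ↦ extD (A.lam δ) (B.mt q) u v) (A.dmt_reebHat δ q)).trans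
    ((A.reeb_all hδ _).1 v)

section Param
variable {σ : E → F} {O : Set E}

theorem pullForm_slide (hO : IsOpen O) (hσ : ContMDiffOn 𝓘(ℝ, E) 𝓘(ℝ, ℂ) ∞ σ O) {y : E}
    (hy : y ∈ O) (δ t : ℝ) (w : E × ℝ) :
    pullForm (𝓡 3) (A.lam δ) (B.slide σ) (y, t) w =
      A.lamHat δ (σ y, t) (mder 𝓘(ℝ, E) 𝓘(ℝ, ℂ) σ y w.1, w.2) :=
  congrArg (A.lam δ (B.mt (σ y, t))) (mder_slide hO hσ hy t w)

theorem reebHat_slide (hO : IsOpen O) (hσ : ContMDiffOn 𝓘(ℝ, E) 𝓘(ℝ, ℂ) ∞ σ O)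
    (hd : ∀ y ∈ O, Function.Bijective (mder 𝓘(ℝ, E) 𝓘(ℝ, ℂ) σ y)) {y : E} (hy : y ∈ O) (δ t : ℝ) :
    A.reebHat δ (σ y, t) =
      (mder 𝓘(ℝ, E) 𝓘(ℝ, ℂ) σ y (pullField (𝓡 3) (A.X δ) (B.slide σ) (y, t)).1,
        (pullField (𝓡 3) (A.X δ) (B.slide σ) (y, t)).2) := by
  apply (B.mt_mder (σ y, t)).1
  refine (A.dmt_reebHat δ (σ y, t)).trans ?_
  refine Eq.trans ?_ (mder_slide hO hσ hy t _)
  exact (mder_pullField (I' := 𝓡 3) (X := A.X δ)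
    (bijective_mder_slide hO hσ hd (q := (y, t)) ⟨hy, mem_univ _⟩)).symm

theorem extD_slide (hO : IsOpen O) (hσ : ContMDiffOn 𝓘(ℝ, E) 𝓘(ℝ, ℂ) ∞ σ O) {y : E} (hy : y ∈ O)
    {δ : ℝ} (hδ : δ ∈ Ico (0 : ℝ) 1) (t : ℝ) (v w : E × ℝ) :
    extD (A.lam δ) (B.mt (σ y, t)) (dmt B (σ y, t) (mder 𝓘(ℝ, E) 𝓘(ℝ, ℂ) σ y v.1, v.2))
      (dmt B (σ y, t) (mder 𝓘(ℝ, E) 𝓘(ℝ, ℂ) σ y w.1, w.2)) =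
      pullD (A.lam δ) (B.slide σ) (y, t) v w := by
  rw [← extD_mder A.lam_smooth hδ (hO.prod isOpen_univ) (contMDiffOn_slide hσ)
    (y := (y, t)) ⟨hy, mem_univ _⟩, mder_slide hO hσ hy, mder_slide hO hσ hy]
  rfl

end Param

/-- The Reeb vector fields are transverse to the pages. -/
theorem reebHat_snd_ne_zero {δ : ℝ} (hδ : δ ∈ Ico (0 : ℝ) 1) (q : F × ℝ) :
    (A.reebHat δ q).2 ≠ 0 := by
  intro h0
  -- For `δ = 0` there are two regions. Where `r < 1 - ε`, a Reeb vector without `φ`-component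
  -- satisfies `γ₁' x_θ = 0`, so `x_θ = 0`, which contradicts `λ(X) = 1`. Elsewhere `λ_0 = dφ`, and
  -- `λ(X) = 1` is the claim itself.
  rcases eq_or_lt_of_le hδ.1 with h | h
  · subst h
    by_cases hx : q.1 ∈ ⋃ i, B.pageEnd i '' (Ioo 0 (1 - A.ε) ×ˢ univ)
    · obtain ⟨i, ⟨r, θ⟩, ⟨hr, -⟩, hq⟩ := mem_iUnion.1 hx
      have hrR : r ∈ Ioo 0 B.R := ⟨hr.1, by linarith [hr.2, A.ε_pos, B.one_lt_R]⟩
      obtain ⟨h1, h2, -⟩ := A.reeb_polar hδ i hrR θ q.2 rfl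
      have h3 := A.reebHat_slide B.isOpen_endDom (B.pageEnd_smooth i)
        (fun _ hx ↦ B.pageEnd_mder i hx) (y := (r, θ)) ⟨hrR, mem_univ _⟩ 0 q.2
      rw [hq] at h3
      rw [h3] at h0
      simp only at h0
      rw [h0] at h1 h2
      have h4 := (A.turning 0 hδ i r hrR fun _ ↦ hr.2).2
      simp only [mul_zero, add_zero] at h1 h2
      rcases mul_eq_zero.1 h2 with h5 | h5
      · exact h4.ne h5
      · rw [h5] at h1; simp at h1
    · have h1 := A.lam_zero q.1 hx q.2 (A.reebHat 0 q).1 (A.reebHat 0 q).2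
      have h2 := A.lamHat_reebHat hδ q
      rw [h0] at h1
      have h3 : A.lamHat 0 q (A.reebHat 0 q) = 0 := by
        have h4 : A.reebHat 0 q = ((A.reebHat 0 q).1, 0) := Prod.ext rfl h0
        rw [h4]; exact h1
      rw [h3] at h2
      exact zero_ne_one h2
  · have hξ : (A.reebHat δ q).1 ≠ 0 := by
      intro h1
      have h2 := A.lamHat_reebHat hδ q
      rw [show A.reebHat δ q = 0 from Prod.ext h1 h0, map_zero] at h2
      exact zero_ne_one h2
    set ξ := (A.reebHat δ q).1 with hξd
    have hli : LinearIndependent ℝ ![ξ, Complex.I * ξ] := by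
      rw [LinearIndependent.pair_iff]
      intro s t hst
      have h1 : ((s : ℂ) + t * Complex.I) * ξ = 0 := by
        rw [← hst]; simp; ring
      have h2 := (mul_eq_zero.1 h1).resolve_right hξ
      have h3 := congrArg Complex.re h2
      have h4 := congrArg Complex.im h2
      simp at h3 h4
      exact ⟨h3, h4⟩
    -- For `δ > 0`, a Reeb vector tangent to the page would lie in the kernel of `dλ`, which is an
    -- area form on the page.
    refine A.area δ ⟨h, hδ.2⟩ q.1 q.2 ξ (Complex.I * ξ) hli ?_
    have h1 := A.extD_reebHat hδ q (dmt B q (Complex.I * ξ, 0))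
    have h4 : A.reebHat δ q = (ξ, 0) := Prod.ext rfl h0
    rw [h4] at h1
    exact h1

/-- The value of `dλ` on the standard basis of a tangent plane of a page. -/
noncomputable def pageArea (δ : ℝ) (q : F × ℝ) : ℝ :=
  extD (A.lam δ) (B.mt q) (dmt B q (1, 0)) (dmt B q (Complex.I, 0))

theorem extD_page (δ : ℝ) (q : F × ℝ) (v w : ℂ) :
    extD (A.lam δ) (B.mt q) (dmt B q (v, 0)) (dmt B q (w, 0)) =
      planeDet v w * A.pageArea δ q := by
  have h : ∀ v : ℂ, dmt B q (v, 0) =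
      v.re • dmt B q (1, 0) + v.im • dmt B q (Complex.I, 0) := fun v ↦ by
    rw [← map_smul, ← map_smul, ← map_add]
    congr 1
    refine Prod.ext ?_ (by simp)
    simp
  rw [h v, h w, extD_comb]
  rfl

theorem pageArea_ne_zero {δ : ℝ} (hδ : δ ∈ Ioo (0 : ℝ) 1) (q : F × ℝ) : A.pageArea δ q ≠ 0 := by
  refine A.area δ hδ q.1 q.2 1 Complex.I ?_
  rw [LinearIndependent.pair_iff]
  intro s t hst
  have h3 := congrArg Complex.re hst
  have h4 := congrArg Complex.im hst
  simp at h3 h4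
  exact ⟨h3, h4⟩

theorem half_mem : (1 / 2 : ℝ) ∈ Ioo (0 : ℝ) 1 := by norm_num
theorem half_mem' : (1 / 2 : ℝ) ∈ Ico (0 : ℝ) 1 := by norm_num
theorem zero_mem' : (0 : ℝ) ∈ Ico (0 : ℝ) 1 := by norm_num

/-- The orientation of the pages does not depend on the parameter. -/
theorem pageArea_mul_pos {δ : ℝ} (hδ : δ ∈ Ioo (0 : ℝ) 1) (q : F × ℝ) :
    0 < A.pageArea (1 / 2) q * A.pageArea δ q := by
  obtain ⟨x, t⟩ := q
  obtain ⟨hs, hd⟩ := chart_param x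
  have ho := isOpen_extChartAt_target (I := 𝓘(ℝ, ℂ)) x
  set σ := (extChartAt 𝓘(ℝ, ℂ) x).symm with hσ
  set y := extChartAt 𝓘(ℝ, ℂ) x x with hy
  have hyO := mem_extChartAt_target (I := 𝓘(ℝ, ℂ)) x
  have hx : σ y = x := extChartAt_to_inv x
  obtain ⟨v, hv⟩ := (hd y hyO).2 1
  obtain ⟨w, hw⟩ := (hd y hyO).2 Complex.I
  have h1 : ∀ δ ∈ Ico (0 : ℝ) 1, A.pageArea δ (x, t) =
      pullD (A.lam δ) (B.slide σ) (y, t) (v, 0) (w, 0) := by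
    intro δ hδ
    rw [← A.extD_slide ho hs hyO hδ, hv, hw, hx]
    rfl
  have hc : ContinuousOn (fun δ ↦ A.pageArea δ (x, t)) (Ioo 0 1) := by
    have h2 := (contDiffOn_pullD A.lam_smooth (ho.prod isOpen_univ) (contMDiffOn_slide (B := B) hs)
      (v, 0) (w, 0)).continuousOn.comp (s := Ioo (0 : ℝ) 1) (f := fun δ : ℝ ↦ (δ, (y, t)))
      (by fun_prop) fun δ hδ ↦ ⟨Ioo_subset_Ico_self hδ, hyO, mem_univ _⟩
    exact h2.congr fun δ hδ ↦ h1 δ (Ioo_subset_Ico_self hδ)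
  -- Intermediate value theorem in `δ`: at a fixed point the area is continuous and nowhere zero on
  -- the interval `(0, 1)`.
  by_contra hneg
  have hne := mul_ne_zero (A.pageArea_ne_zero half_mem (x, t)) (A.pageArea_ne_zero hδ (x, t))
  have hlt := lt_of_le_of_ne (not_lt.1 hneg) hne
  have h0 : (0 : ℝ) ∈ (fun δ ↦ A.pageArea δ (x, t)) '' Ioo 0 1 := by
    rcases mul_neg_iff.1 hlt with ⟨ha, hb⟩ | ⟨ha, hb⟩
    · exact isPreconnected_Ioo.intermediate_value hδ half_mem hc ⟨hb.le, ha.le⟩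
    · exact isPreconnected_Ioo.intermediate_value half_mem hδ hc ⟨ha.le, hb.le⟩
  obtain ⟨δ', hδ', h⟩ := h0
  exact A.pageArea_ne_zero hδ' (x, t) h

/-! ### The limit form -/

theorem one_sub_ε : 1 - A.ε ∈ Ioo 0 B.R :=
  ⟨by linarith [A.ρ_lt, A.ρ_pos], by linarith [A.ε_pos, B.one_lt_R]⟩

theorem ρ_lt_R : A.ρ < B.R := by linarith [A.ρ_lt, A.one_sub_ε.2]

/-- `γ₁` decreases strictly up to `r = 1 - ε`, where it vanishes. -/
theorem γ₁_zero_pos (i : Fin n) {r : ℝ} (hr : r ∈ Ioo 0 (1 - A.ε)) : 0 < A.γ₁ i 0 r := by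
  have h1 : StrictAntiOn (A.γ₁ i 0) (Icc r (1 - A.ε)) := by
    refine strictAntiOn_of_deriv_neg (convex_Icc _ _) ?_ ?_
    · exact (A.contDiffOn_γ₁ zero_mem' i).continuousOn.mono fun x hx ↦
        ⟨hr.1.trans_le hx.1, hx.2.trans_lt A.one_sub_ε.2⟩
    · rw [interior_Icc]
      intro x hx
      exact (A.turning 0 zero_mem' i x ⟨hr.1.trans hx.1, hx.2.trans A.one_sub_ε.2⟩ fun _ ↦ hx.2).2
  have h2 := h1 ⟨le_rfl, hr.2.le⟩ ⟨hr.2.le, le_rfl⟩ hr.2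
  rwa [A.outer_zero i _ ⟨le_rfl, A.one_sub_ε.2⟩] at h2

theorem deriv_γ₁_zero_nonpos (i : Fin n) {r : ℝ} (hr : r ∈ Ioo 0 B.R) :
    deriv (A.γ₁ i 0) r ≤ 0 := by
  rcases lt_or_ge r (1 - A.ε) with h | h
  · exact (A.turning 0 zero_mem' i r hr fun _ ↦ h).2.le
  -- At `r = 1 - ε` the function is known to vanish on the right side only; the derivative exists,
  -- so it equals the right derivative.
  · have h1 := (A.hasDerivAt_γ₁ zero_mem' i hr).hasDerivWithinAt (s := Ici r)
    have h2 : HasDerivWithinAt (A.γ₁ i 0) 0 (Ici r) r := by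
      refine (hasDerivWithinAt_const r (Ici r) (0 : ℝ)).congr_of_eventuallyEq ?_
        (A.outer_zero i r ⟨h, hr.2⟩)
      filter_upwards [self_mem_nhdsWithin, nhdsWithin_le_nhds (Iio_mem_nhds hr.2)] with x hx hx'
      exact A.outer_zero i x ⟨h.trans hx, hx'⟩
    rw [(uniqueDiffWithinAt_Ici r).eq_deriv _ h1 h2]

theorem antitone_γ₁_zero (i : Fin n) : AntitoneOn (A.γ₁ i 0) (Ioo 0 B.R) := by
  refine antitoneOn_of_deriv_nonpos (convex_Ioo _ _)
    (A.contDiffOn_γ₁ zero_mem' i).continuousOn ?_ ?_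
  · rw [interior_Ioo]
    exact (A.contDiffOn_γ₁ zero_mem' i).differentiableOn (by simp)
  · rw [interior_Ioo]
    exact fun x hx ↦ A.deriv_γ₁_zero_nonpos i hx

theorem γ₁_zero_nonneg (i : Fin n) {r : ℝ} (hr : r ∈ Ioo 0 B.R) : 0 ≤ A.γ₁ i 0 r := by
  rcases lt_or_ge r (1 - A.ε) with h | h
  · exact (A.γ₁_zero_pos i ⟨hr.1, h⟩).le
  · exact (A.outer_zero i r ⟨h, hr.2⟩).ge

/-- Monotonicity together with the limit `γ₁(0)` at the binding. This bound yields both `f → 0` in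
the profile and the estimate of the energy. -/
theorem γ₁_zero_le (i : Fin n) {r : ℝ} (hr : r ∈ Ioo 0 B.R) : A.γ₁ i 0 r ≤ A.γ₁ i 0 0 := by
  refine ge_of_tendsto ((A.local_model i).continuousAt_zero A.ρ_pos).1 ?_
  filter_upwards [Ioo_mem_nhdsGT hr.1] with s hs
  exact A.antitone_γ₁_zero i ⟨hs.1, hs.2.trans hr.2⟩ hr hs.2.le

/-- The limit form is closed outside the ends. -/
theorem extD_zero_of_notMem {x : F} (hx : x ∉ ⋃ i, B.pageEnd i '' (Ioc 0 (1 - A.ε) ×ˢ univ)) (t : ℝ)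
    (v w : EuclideanSpace ℝ (Fin 3)) : extD (A.lam 0) (B.mt (x, t)) v w = 0 := by
  have hopen := (B.isClosed_iUnion_pageEnd A.one_sub_ε.2).isOpen_compl
  obtain ⟨hs, hd⟩ := chart_param x
  have ho := isOpen_extChartAt_target (I := 𝓘(ℝ, ℂ)) x
  set σ := (extChartAt 𝓘(ℝ, ℂ) x).symm with hσ
  set y := extChartAt 𝓘(ℝ, ℂ) x x with hy
  have hyO := mem_extChartAt_target (I := 𝓘(ℝ, ℂ)) x
  have hxy : σ y = x := extChartAt_to_inv x
  have hd2 := bijective_mder_slide (B := B) ho hs hd (q := (y, t)) ⟨hyO, mem_univ _⟩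
  have hO' := hs.continuousOn.isOpen_inter_preimage ho hopen
  have hev : pullForm (𝓡 3) (A.lam 0) (B.slide σ) =ᶠ[𝓝 (y, t)]
      fun _ ↦ ContinuousLinearMap.snd ℝ ℂ ℝ := by
    have hm : (y, t) ∈ ((extChartAt 𝓘(ℝ, ℂ) x).target ∩ σ ⁻¹'
        (⋃ i, B.pageEnd i '' (Ioc 0 (1 - A.ε) ×ˢ univ))ᶜ) ×ˢ (univ : Set ℝ) :=
      ⟨⟨hyO, by rw [mem_preimage, hxy]; exact hx⟩, mem_univ _⟩
    filter_upwards [(hO'.prod isOpen_univ).mem_nhds hm] with q hq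
    refine ContinuousLinearMap.ext fun w ↦ ?_
    refine (A.pullForm_slide ho hs hq.1.1 0 q.2 w).trans (A.lam_zero (σ q.1) ?_ q.2 _ _)
    intro hmem
    refine hq.1.2 (iUnion_mono (fun i ↦ image_mono (prod_mono Ioo_subset_Ioc_self subset_rfl)) hmem)
  have h1 : ∀ v w : EuclideanSpace ℝ (Fin 3),
      extD (A.lam 0) (B.slide σ (y, t)) v w = 0 := by
    intro v w
    obtain ⟨v, rfl⟩ := hd2.2 v
    obtain ⟨w, rfl⟩ := hd2.2 w
    rw [extD_mder A.lam_smooth zero_mem' (ho.prod isOpen_univ) (contMDiffOn_slide hs)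
      ⟨hyO, mem_univ _⟩]
    unfold pullD
    rw [hev.fderiv_eq]
    simp
  have h2 : B.slide σ (y, t) = B.mt (x, t) := by rw [slide, hxy]
  rw [← h2]; exact h1 v w

/-- The limit form is not a contact form. -/
theorem not_isContactForm_zero [Nonempty F] : ¬ IsContactForm (A.lam 0) := by
  obtain ⟨x, hx⟩ : ∃ x : F, x ∉ ⋃ i, B.pageEnd i '' (Ioc 0 (1 - A.ε) ×ˢ univ) := by
    by_cases hn : Nonempty (Fin n)
    · obtain ⟨i⟩ := hn
      have h1 := A.one_sub_ε
      have hr : (1 - A.ε + B.R) / 2 ∈ Ioo 0 B.R := ⟨by linarith [h1.1, B.R_pos], by linarith [h1.2]⟩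
      refine ⟨B.pageEnd i ((1 - A.ε + B.R) / 2, 0), fun h ↦ ?_⟩
      obtain ⟨j, ⟨r, θ⟩, ⟨hr', -⟩, h⟩ := mem_iUnion.1 h
      obtain ⟨-, h2, -⟩ := (B.pageEnd_eq_iff _ _ _ ⟨hr'.1, hr'.2.trans_lt h1.2⟩ _ hr _ _).1 h
      have := hr'.2
      simp only at this h2
      linarith [h1.2]
    · obtain ⟨x⟩ := ‹Nonempty F›
      refine ⟨x, fun h ↦ ?_⟩
      obtain ⟨i, -⟩ := mem_iUnion.1 h
      exact hn ⟨i⟩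
  intro hcon
  obtain ⟨u, v, w, h⟩ := hcon (B.mt (x, 0))
  have hz := A.extD_zero_of_notMem hx 0
  apply h
  unfold wedgeD
  refine (congrArg₂ (· + ·) (congrArg₂ (· + ·) (congrArg (_ * ·) (hz v w))
    (congrArg (_ * ·) (hz w u))) (congrArg (_ * ·) (hz u v))).trans ?_
  simp

end AdaptedFamily

/-! ### Profile functions on the ends. -/

theorem hasDerivAt_primitive {g : ℝ → ℝ} {R b r : ℝ} (hg : ContDiffOn ℝ ∞ g (Ioo 0 R))
    (hb : b ∈ Ioo 0 R) (hr : r ∈ Ioo 0 R) : HasDerivAt (fun r ↦ ∫ s in b..r, g s) (g r) r := by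
  have hsub : uIcc b r ⊆ Ioo 0 R := ordConnected_Ioo.uIcc_subset hb hr
  refine intervalIntegral.integral_hasDerivAt_right
    (hg.continuousOn.mono hsub).intervalIntegrable ?_
    (hg.continuousOn.continuousAt (isOpen_Ioo.mem_nhds hr))
  exact hg.continuousOn.stronglyMeasurableAtFilter isOpen_Ioo r hr

theorem contDiffOn_of_hasDerivAt {F g : ℝ → ℝ} {s : Set ℝ} (hs : IsOpen s)
    (hF : ∀ r ∈ s, HasDerivAt F (g r) r) (hg : ContDiffOn ℝ ∞ g s) : ContDiffOn ℝ ∞ F s := by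
  rw [contDiffOn_infty_iff_deriv_of_isOpen hs]
  exact ⟨fun r hr ↦ (hF r hr).differentiableAt.differentiableWithinAt,
    hg.congr fun r hr ↦ (hF r hr).deriv⟩

/-- The profile functions of the complex structure and of the curves on an end of the page:
`j ∂_r = -β ∂_θ`, the function `f e^{-iθ}` is a holomorphic coordinate, and `a` is the
`ℝ`-component of the curves. -/
structure EndProfile (γ₁ γ₂ : ℝ → ℝ) (R b ρ : ℝ) where
  β : ℝ → ℝ
  f : ℝ → ℝ
  a : ℝ → ℝ
  p : ℝ → ℝ
  ρ₁ : ℝ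
  c : ℝ
  ρ₁_mem : ρ₁ ∈ Ioo 0 ρ
  c_pos : 0 < c
  β_smooth : ContDiffOn ℝ ∞ β (Ioo 0 R)
  β_pos : ∀ r ∈ Ioo 0 R, 0 < β r
  -- With `y = -γ₁'/μ` the `φ`-component of the Reeb field, this says `r β γ₁ y = 1`: the induced
  -- structure on `ker λ` sends `∂_r` to a vector with `φ`-component `1/r`, as multiplication by `i`
  -- on the `z`-plane does.
  β_eq : ∀ r ∈ Ioo 0 ρ₁, β r * γ₁ r * -deriv γ₁ r * r = profileMu γ₁ γ₂ r
  f_deriv : ∀ r ∈ Ioo 0 R, HasDerivAt f (β r * f r) r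
  f_pos : ∀ r, 0 < f r
  -- The end `r < b` thus becomes a disk of radius `2`, which contains the closed unit disk used in
  -- the normal form at the punctures.
  f_eq : f b = 2
  f_lim : Tendsto f (𝓝[>] 0) (𝓝 0)
  a_deriv : ∀ r ∈ Ioo 0 R, HasDerivAt a (-(β r * γ₁ r)) r
  a_eq : ∀ r ∈ Ico b R, a r = 0
  a_log : ∀ r ∈ Ioo 0 ρ₁, a r = -c * Real.log r - p r
  p_smooth : ContDiffOn ℝ ∞ (fun z : ℂ ↦ p ‖z‖) (Metric.ball 0 ρ₁)
  a_lim : Tendsto a (𝓝[>] 0) atTop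

/-- Near `0` the function `β` is forced by `β_eq`; it is interpolated to the constant `1`, which
keeps it positive and smooth beyond the local model, where the forced expression may degenerate.
Then `log f` and `a` are primitives, and the behaviour of `a` at `0` is that found in
`IsLocalModel.exists_primitive`. -/
theorem exists_endProfile {γ₁ γ₂ : ℝ → ℝ} {R b ρ : ℝ} (h : IsLocalModel γ₁ γ₂ ρ) (hρ : 0 < ρ)
    (hρb : ρ < b) (hbR : b < R) (h₁ : ContDiffOn ℝ ∞ γ₁ (Ioo 0 R))
    (h₂ : ContDiffOn ℝ ∞ γ₂ (Ioo 0 R)) (hpos : ∀ r ∈ Ioo 0 b, 0 < γ₁ r)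
    (hzero : ∀ r ∈ Ico b R, γ₁ r = 0) (hle : ∀ r ∈ Ioo 0 R, γ₁ r ≤ γ₁ 0) :
    Nonempty (EndProfile γ₁ γ₂ R b ρ) := by
  obtain ⟨ρ', hρ', c, hc, p₀, hp₀, hp₀', -⟩ := h.exists_primitive hρ
  have hρ'0 : 0 < ρ' := hρ'.1
  -- `η` is `0` for `r ≤ ρ'/2` and `1` for `r ≥ ρ'`. This is why the logarithmic form of `a` is
  -- asserted for `r < ρ'/2`.
  let η : ℝ → ℝ := fun r ↦ Real.smoothTransition ((r - ρ' / 2) / (ρ' / 2))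
  have hη : ContDiff ℝ ∞ η := Real.smoothTransition.contDiff.comp
    ((contDiff_id.sub contDiff_const).div_const _)
  have hη0 : ∀ r, r ≤ ρ' / 2 → η r = 0 := fun r hr ↦
    Real.smoothTransition.zero_of_nonpos (div_nonpos_of_nonpos_of_nonneg (by linarith) (by linarith))
  have hη1 : ∀ r, ρ' ≤ r → η r = 1 := fun r hr ↦
    Real.smoothTransition.one_of_one_le (by rw [le_div_iff₀ (by linarith)]; linarith)
  let β : ℝ → ℝ := fun r ↦ (1 - η r) * (profileMu γ₁ γ₂ r / (r * γ₁ r * -deriv γ₁ r)) + η r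
  have hd₁ : ContDiffOn ℝ ∞ (deriv γ₁) (Ioo 0 R) :=
    ((contDiffOn_infty_iff_deriv_of_isOpen isOpen_Ioo).1 h₁).2
  have hd₂ : ContDiffOn ℝ ∞ (deriv γ₂) (Ioo 0 R) :=
    ((contDiffOn_infty_iff_deriv_of_isOpen isOpen_Ioo).1 h₂).2
  have hρR : ρ < R := hρb.trans hbR
  have hsubρ : Ioo 0 ρ ⊆ Ioo 0 R := Ioo_subset_Ioo_right hρR.le
  have hne : ∀ r ∈ Ioo 0 ρ, 0 < r * γ₁ r * -deriv γ₁ r := fun r hr ↦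
    mul_pos (mul_pos hr.1 (hpos r ⟨hr.1, hr.2.trans hρb⟩)) (neg_pos.2 (h.deriv_neg r hr))
  have hβs : ContDiffOn ℝ ∞ β (Ioo 0 R) := by
    intro r hr
    rcases lt_or_ge r ρ with hrρ | hrρ
    · have h3 : ContDiffOn ℝ ∞ β (Ioo 0 ρ) := by
        refine ((contDiff_const.sub hη).contDiffOn.mul
          (ContDiffOn.div ?_ ?_ fun r hr ↦ (hne r hr).ne')).add hη.contDiffOn
        · exact ((h₁.mul hd₂).sub (hd₁.mul h₂)).mono hsubρ
        · exact ((contDiffOn_id.mul h₁).mul hd₁.neg).mono hsubρ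
      exact (h3.contDiffAt (isOpen_Ioo.mem_nhds ⟨hr.1, hrρ⟩)).contDiffWithinAt
    · have h3 : β =ᶠ[𝓝 r] fun _ ↦ 1 := by
        filter_upwards [Ioi_mem_nhds (hρ'.2.trans_le hrρ)] with s hs
        simp only [β, hη1 s (le_of_lt hs)]
        ring
      exact (contDiffAt_const.congr_of_eventuallyEq h3).contDiffWithinAt
  have hβp : ∀ r ∈ Ioo 0 R, 0 < β r := by
    intro r hr
    have h0 : 0 ≤ η r := Real.smoothTransition.nonneg _
    have h1 : η r ≤ 1 := Real.smoothTransition.le_one _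
    rcases lt_or_ge r ρ' with hrρ | hrρ
    · have hq : 0 < profileMu γ₁ γ₂ r / (r * γ₁ r * -deriv γ₁ r) :=
        div_pos (h.mu_pos r ⟨hr.1, hrρ.trans hρ'.2⟩) (hne r ⟨hr.1, hrρ.trans hρ'.2⟩)
      simp only [β]
      rcases eq_or_lt_of_le h0 with h00 | h00
      · rw [← h00]; simpa using hq
      · have := mul_nonneg (sub_nonneg.2 h1) hq.le
        linarith
    · simp [β, hη1 r hrρ]
  have hb : b ∈ Ioo 0 R := ⟨hρ.trans hρb, hbR⟩
  let f : ℝ → ℝ := fun r ↦ 2 * Real.exp (∫ s in b..r, β s)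
  let a : ℝ → ℝ := fun r ↦ -∫ s in b..r, β s * γ₁ s
  have hβ1 : ∀ r ∈ Ioo 0 (ρ' / 2), β r = profileMu γ₁ γ₂ r / (r * γ₁ r * -deriv γ₁ r) := by
    intro r hr
    simp [β, hη0 r hr.2.le]
  have hf' : ∀ r ∈ Ioo 0 R, HasDerivAt f (β r * f r) r := by
    intro r hr
    have := ((hasDerivAt_primitive hβs hb hr).exp.const_mul 2)
    refine this.congr_deriv ?_
    simp only [f]; ring
  have ha' : ∀ r ∈ Ioo 0 R, HasDerivAt a (-(β r * γ₁ r)) r := fun r hr ↦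
    (hasDerivAt_primitive (g := fun s ↦ β s * γ₁ s) (hβs.mul h₁) hb hr).neg
  have ha0 : ∀ r ∈ Ico b R, a r = 0 := by
    intro r hr
    simp only [a]
    rw [intervalIntegral.integral_congr (g := fun _ ↦ 0)]
    · simp
    · intro s hs
      rw [uIcc_of_le hr.1] at hs
      simp only
      rw [hzero s ⟨hs.1, hs.2.trans_lt hr.2⟩, mul_zero]
  have hsub' : Ioo 0 (ρ' / 2) ⊆ Ioo 0 R := Ioo_subset_Ioo_right (by linarith [hρ'.2])
  -- There `a' = -β γ₁ = -(1/r) μ/(-γ₁')`, which `c/r` and the derivative of `p₀` cancel exactly.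
  have hlog : ∃ C : ℝ, ∀ r ∈ Ioo 0 (ρ' / 2), a r + c * Real.log r + p₀ r = C := by
    have hder : ∀ r ∈ Ioo 0 (ρ' / 2),
        HasDerivAt (fun r ↦ a r + c * Real.log r + p₀ r) 0 r := by
      intro r hr
      have hrρ : r ∈ Ioo 0 ρ := ⟨hr.1, by linarith [hr.2, hρ'.2]⟩
      have h5 := ((ha' r (hsub' hr)).add ((Real.hasDerivAt_log hr.1.ne').const_mul c)).add
        (hp₀' r ⟨hr.1, by linarith [hr.2]⟩)
      refine h5.congr_deriv ?_
      rw [hβ1 r hr]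
      have e1 := hr.1.ne'
      have e2 := (hpos r ⟨hr.1, hrρ.2.trans hρb⟩).ne'
      have e3 := (h.deriv_neg r hrρ).ne
      field_simp
      ring
    refine ⟨a (ρ' / 4) + c * Real.log (ρ' / 4) + p₀ (ρ' / 4), fun r hr ↦ ?_⟩
    exact isOpen_Ioo.is_const_of_deriv_eq_zero isPreconnected_Ioo
      (fun r hr ↦ (hder r hr).differentiableAt.differentiableWithinAt)
      (fun r hr ↦ (hder r hr).deriv) hr
      (show ρ' / 4 ∈ Ioo 0 (ρ' / 2) from ⟨by linarith, by linarith⟩)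
  obtain ⟨C, hC⟩ := hlog
  have hlog' : ∀ r ∈ Ioo 0 (ρ' / 2), a r = -c * Real.log r - (p₀ r - C) := by
    intro r hr
    have := hC r hr
    linarith
  have halim : Tendsto a (𝓝[>] 0) atTop := by
    have h6 : Tendsto (fun r : ℝ ↦ -c * Real.log r) (𝓝[>] 0) atTop :=
      Real.tendsto_log_nhdsGT_zero.const_mul_atBot_of_neg (by linarith)
    have h7 : Tendsto (fun r : ℝ ↦ -(p₀ r - C)) (𝓝[>] 0) (𝓝 (-(p₀ 0 - C))) := by
      have h8 : ContinuousAt (fun z : ℂ ↦ p₀ ‖z‖) 0 :=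
        (hp₀.contDiffAt (Metric.ball_mem_nhds 0 hρ'0)).continuousAt
      have h9 := h8.tendsto.comp tendsto_ofReal_nhdsGT
      simp only [norm_zero] at h9
      refine ((h9.congr' ?_).sub_const C).neg
      filter_upwards [self_mem_nhdsWithin] with r hr
      simp [abs_of_pos (show (0 : ℝ) < r from hr)]
    refine (h6.atTop_add h7).congr' ?_
    filter_upwards [Ioo_mem_nhdsGT (half_pos hρ'0)] with r hr
    rw [hlog' r hr]
    ring
  have hG : 0 < γ₁ 0 := h.zero_pos
  have hflim : Tendsto f (𝓝[>] 0) (𝓝 0) := by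
    -- Since `γ₁ ≤ γ₁(0)`, one has `β ≥ -a'/γ₁(0)`. So `log (f/2) + a/γ₁(0)` is nondecreasing and
    -- vanishes at `b`, and the divergence of `a` forces `f → 0`.
    have hmono : MonotoneOn (fun r ↦ (∫ s in b..r, β s) + a r / γ₁ 0) (Ioo 0 R) := by
      have hd : ∀ r ∈ Ioo 0 R, HasDerivAt (fun r ↦ (∫ s in b..r, β s) + a r / γ₁ 0)
          (β r + -(β r * γ₁ r) / γ₁ 0) r := fun r hr ↦
        (hasDerivAt_primitive hβs hb hr).add ((ha' r hr).div_const _)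
      refine monotoneOn_of_deriv_nonneg (convex_Ioo _ _)
        (fun r hr ↦ (hd r hr).continuousAt.continuousWithinAt) ?_ ?_
      · rw [interior_Ioo]; exact fun r hr ↦ (hd r hr).differentiableAt.differentiableWithinAt
      · rw [interior_Ioo]
        intro r hr
        rw [(hd r hr).deriv]
        have e1 : β r * γ₁ r / γ₁ 0 ≤ β r := by
          rw [div_le_iff₀ hG]
          exact mul_le_mul_of_nonneg_left (hle r hr) (hβp r hr).le
        rw [neg_div]; linarith
    have hub : ∀ r ∈ Ioo 0 b, f r ≤ 2 * Real.exp (-(a r / γ₁ 0)) := by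
      intro r hr
      have := hmono ⟨hr.1, hr.2.trans hbR⟩ hb hr.2.le
      simp only [intervalIntegral.integral_same, ha0 b ⟨le_rfl, hbR⟩, zero_div, add_zero] at this
      have h3 : ∫ s in b..r, β s ≤ -(a r / γ₁ 0) := by linarith
      have := Real.exp_le_exp.2 h3
      simp only [f]; linarith
    have hz : Tendsto (fun r ↦ 2 * Real.exp (-(a r / γ₁ 0))) (𝓝[>] 0) (𝓝 0) := by
      have := (Real.tendsto_exp_neg_atTop_nhds_zero.comp (halim.atTop_div_const hG)).const_mul 2
      simpa using this
    refine tendsto_of_tendsto_of_tendsto_of_le_of_le' tendsto_const_nhds hz ?_ ?_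
    · exact Eventually.of_forall fun r ↦ by positivity
    · filter_upwards [Ioo_mem_nhdsGT hb.1] with r hr using hub r hr
  exact ⟨{
    β := β
    f := f
    a := a
    p := fun r ↦ p₀ r - C
    ρ₁ := ρ' / 2
    c := c
    ρ₁_mem := ⟨half_pos hρ'0, by linarith [hρ'.2]⟩
    c_pos := hc
    β_smooth := hβs
    β_pos := hβp
    β_eq := fun r hr ↦ by
      have hrρ : r ∈ Ioo 0 ρ := ⟨hr.1, by linarith [hr.2, hρ'.2]⟩
      rw [hβ1 r hr]
      have := hne r hrρ
      have e1 := hr.1.ne'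
      have e2 := (hpos r ⟨hr.1, hrρ.2.trans hρb⟩).ne'
      have e3 := (h.deriv_neg r hrρ).ne
      field_simp
    f_deriv := hf'
    f_pos := fun r ↦ by positivity
    f_eq := by simp [f]
    f_lim := hflim
    a_deriv := ha'
    a_eq := ha0
    a_log := hlog'
    p_smooth := (hp₀.mono (Metric.ball_subset_ball (by linarith))).sub contDiffOn_const
    a_lim := halim }⟩

namespace EndProfile

variable {γ₁ γ₂ : ℝ → ℝ} {R b ρ : ℝ} (P : EndProfile γ₁ γ₂ R b ρ)

/-- Bootstrapping in `f' = β f`: each derivative of `f` is a smooth function times `f`. -/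
theorem contDiffOn_f : ContDiffOn ℝ ∞ P.f (Ioo 0 R) := by
  have h : ∀ m : ℕ, ContDiffOn ℝ m P.f (Ioo 0 R) := by
    intro m
    induction m with
    | zero => exact contDiffOn_zero.2 fun r hr ↦ (P.f_deriv r hr).continuousAt.continuousWithinAt
    | succ m ih =>
      have := (contDiffOn_succ_iff_deriv_of_isOpen (n := m) (isOpen_Ioo (a := 0) (b := R))
        (f := P.f)).2 ⟨fun r hr ↦ (P.f_deriv r hr).differentiableAt.differentiableWithinAt,
          by simp, ((P.β_smooth.of_le (by exact_mod_cast le_top)).mul ih).congr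
            fun r hr ↦ (P.f_deriv r hr).deriv⟩
      exact_mod_cast this
  exact contDiffOn_infty.2 h

theorem strictMonoOn_f : StrictMonoOn P.f (Ioo 0 R) := by
  refine strictMonoOn_of_deriv_pos (convex_Ioo _ _) P.contDiffOn_f.continuousOn ?_
  rw [interior_Ioo]
  intro r hr
  rw [(P.f_deriv r hr).deriv]
  exact mul_pos (P.β_pos r hr) (P.f_pos r)

/-- `f` increases from the limit `0` at the puncture to the value `2` at `b`, so polar coordinates
fill the whole punctured disk of radius `2`. -/
theorem f_image (hb : b ∈ Ioo 0 R) : P.f '' Ioo 0 b = Ioo 0 2 := by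
  apply Subset.antisymm
  · rintro _ ⟨r, hr, rfl⟩
    refine ⟨P.f_pos r, ?_⟩
    rw [← P.f_eq]
    exact P.strictMonoOn_f ⟨hr.1, hr.2.trans hb.2⟩ hb hr.2
  · intro y hy
    obtain ⟨r₀, hr₀, hr₀'⟩ := ((P.f_lim.eventually (Iio_mem_nhds hy.1)).and
      (Ioo_mem_nhdsGT hb.1)).exists
    have hc : ContinuousOn P.f (Icc r₀ b) := P.contDiffOn_f.continuousOn.mono fun x hx ↦
      ⟨hr₀'.1.trans_le hx.1, hx.2.trans_lt hb.2⟩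
    obtain ⟨r, hr, hry⟩ := intermediate_value_Ioo hr₀'.2.le hc ⟨hr₀, by rw [P.f_eq]; exact hy.2⟩
    exact ⟨r, ⟨hr₀'.1.trans hr.1, hr.2⟩, hry⟩

theorem contDiffOn_a (h₁ : ContDiffOn ℝ ∞ γ₁ (Ioo 0 R)) : ContDiffOn ℝ ∞ P.a (Ioo 0 R) :=
  contDiffOn_of_hasDerivAt isOpen_Ioo P.a_deriv (P.β_smooth.mul h₁).neg

end EndProfile

/-! ### Quarter turns under changes of coordinates. -/

theorem planeDet_map_ne_zero {E : Type*} [AddCommGroup E] [Module ℝ E] {D : E →ₗ[ℝ] ℂ}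
    (hD : Function.Injective D) {e f : E} (h : ∀ x y : ℝ, x • e + y • f = 0 → x = 0 ∧ y = 0) :
    planeDet (D e) (D f) ≠ 0 := by
  intro h0
  have key : ∀ x y : ℝ, x • D e + y • D f = 0 → x = 0 ∧ y = 0 := fun x y hxy ↦ h x y (hD (by
    rw [map_add, map_smul, map_smul, hxy, map_zero]))
  unfold planeDet at h0
  have h1 := key (D f).re (-(D e).re) (by
    apply Complex.ext
    · simp; ring
    · simp; linarith)
  have h2 := key (D f).im (-(D e).im) (by
    apply Complex.ext
    · simp; linarith
    · simp; ring)
  have h3 : D e = 0 := Complex.ext (by simpa using h1.2) (by simpa using h2.2)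
  exact one_ne_zero (key 1 0 (by simp [h3])).1

theorem one_I_indep : ∀ x y : ℝ, x • (1 : ℂ) + y • Complex.I = 0 → x = 0 ∧ y = 0 := by
  intro x y h
  have h1 := congrArg Complex.re h
  have h2 := congrArg Complex.im h
  simp at h1 h2
  exact ⟨h1, h2⟩

section

variable {V₁ V₂ : Type*} [NormedAddCommGroup V₁] [InnerProductSpace ℝ V₁]
  [NormedAddCommGroup V₂] [InnerProductSpace ℝ V₂]

/-- Naturality under an isomorphism of the plane; the orientation datum `s` has to be multiplied by
the determinant of `D`. -/
theorem quarterTurnCLM_map (L : ℂ →L[ℝ] V₁ × ℝ × V₂) (s : ℝ) {D : ℂ →L[ℝ] ℂ}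
    (hD : Function.Injective D) (v : ℂ) : quarterTurnCLM L s (D v) =
      D (quarterTurnCLM (L.comp D) (s * planeDet (D 1) (D Complex.I)) v) := by
  rw [quarterTurnCLM_eq L s (b₁ := D 1) (b₂ := D Complex.I)
    (planeDet_map_ne_zero (D := (D : ℂ →ₗ[ℝ] ℂ)) hD one_I_indep)]
  exact quarterTurn_map (D : ℂ →ₗ[ℝ] ℂ) L (L.comp D) (fun _ ↦ rfl) _ _ _ _

theorem quarterTurnCLM_sq (L : ℂ →L[ℝ] V₁ × ℝ × V₂) (hL : Function.Injective L) {s : ℝ}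
    (hs : s ≠ 0) (v : ℂ) : quarterTurnCLM L s (quarterTurnCLM L s v) = -v :=
  quarterTurn_quarterTurn (L : ℂ →ₗ[ℝ] V₁ × ℝ × V₂) hL hs v

theorem planeDet_quarterTurnCLM_pos (L : ℂ →L[ℝ] V₁ × ℝ × V₂) (hL : Function.Injective L) {s : ℝ}
    (hs : s ≠ 0) {v : ℂ} (hv : v ≠ 0) : 0 < s * planeDet v (quarterTurnCLM L s v) :=
  planeDet_quarterTurn_pos (L : ℂ →ₗ[ℝ] V₁ × ℝ × V₂) hL hs hv

/-- The area form composed with the rotation is a multiple of the metric. Symmetry of the metric is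
the symmetry demanded of `dλ(v, J w)`. -/
theorem planeDet_quarterTurnCLM (L : ℂ →L[ℝ] V₁ × ℝ × V₂) (s : ℝ) (v w : ℂ) :
    planeDet v (quarterTurnCLM L s w) =
      s / |s| / √(gramDet (L 1) (L Complex.I)) * tripleInner (L w) (L v) := by
  have hLv : L v = v.re • L 1 + v.im • L Complex.I := by
    rw [← map_smul, ← map_smul, ← map_add, smul_one_add_smul_I]
  rw [hLv, tripleInner_add_right, tripleInner_smul_right, tripleInner_smul_right,
    quarterTurnCLM_apply]
  simp only [planeDet, quarterTurn]
  simp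
  ring

end

/-! ### The action of the monodromy. -/

namespace OpenBook

variable {M : Type*} [TopologicalSpace M] [ChartedSpace (EuclideanSpace ℝ (Fin 3)) M]
  [IsManifold (𝓡 3) ∞ M] [T2Space M]
  {F : Type*} [TopologicalSpace F] [ChartedSpace ℂ F] [IsManifold 𝓘(ℝ, ℂ) ∞ F] {n : ℕ}
  {B : OpenBook M F n}

variable (B) in
/-- The powers of the monodromy. -/
noncomputable def hpow (k : ℤ) : F → F := ((B.h.toEquiv : Equiv.Perm F) ^ k : Equiv.Perm F)

theorem contMDiff_hpow (k : ℤ) : ContMDiff 𝓘(ℝ, ℂ) 𝓘(ℝ, ℂ) ∞ (B.hpow k) := by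
  induction k using Int.induction_on with
  | zero => simpa [hpow] using contMDiff_id
  | succ k ih =>
    have : B.hpow (k + 1) = B.hpow k ∘ B.h := by
      funext x; simp only [hpow, zpow_add_one]; rfl
    rw [this]; exact ih.comp B.h.contMDiff
  | pred k ih =>
    have : B.hpow (-k - 1) = B.hpow (-k) ∘ B.h.symm := by
      funext x; simp only [hpow, zpow_sub_one]; rfl
    rw [this]; exact ih.comp B.h.symm.contMDiff

theorem mt_hpow (k : ℤ) (x : F) (t : ℝ) : B.mt (B.hpow k x, t + 2 * Real.pi * k) = B.mt (x, t) :=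
  ((B.mt_eq_iff x _ t _).2 ⟨k, rfl, rfl⟩).symm

/-- The identity `mt(h^k x, t + 2πk) = mt(x, t)`, differentiated. -/
theorem dmt_hpow (k : ℤ) (x : F) (t : ℝ) (w : ℂ × ℝ) :
    mder (𝓘(ℝ, ℂ).prod 𝓘(ℝ, ℝ)) (𝓡 3) B.mt (B.hpow k x, t + 2 * Real.pi * k)
      (mder 𝓘(ℝ, ℂ) 𝓘(ℝ, ℂ) (B.hpow k) x w.1, w.2) =
    mder (𝓘(ℝ, ℂ).prod 𝓘(ℝ, ℝ)) (𝓡 3) B.mt (x, t) w := by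
  have h0 : B.mt = fun q : F × ℝ ↦ B.mt (B.hpow k q.1, q.2 + 2 * Real.pi * k) := by
    funext q; exact (mt_hpow k q.1 q.2).symm
  have h1 : MDifferentiableAt 𝓘(ℝ, ℂ) 𝓘(ℝ, ℂ) (B.hpow k) x :=
    (contMDiff_hpow k).contMDiffAt.mdifferentiableAt (by simp)
  have h2 : MDifferentiableAt (𝓘(ℝ, ℂ).prod 𝓘(ℝ, ℝ)) 𝓘(ℝ, ℂ) (fun q : F × ℝ ↦ B.hpow k q.1) (x, t) :=
    h1.comp (x, t) mdifferentiableAt_fst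
  have h3' : MDifferentiableAt 𝓘(ℝ, ℝ) 𝓘(ℝ, ℝ) (fun s : ℝ ↦ s + 2 * Real.pi * k) t :=
    DifferentiableAt.mdifferentiableAt (by fun_prop)
  have h3 : MDifferentiableAt (𝓘(ℝ, ℂ).prod 𝓘(ℝ, ℝ)) 𝓘(ℝ, ℝ)
      (fun q : F × ℝ ↦ q.2 + 2 * Real.pi * k) (x, t) := h3'.comp (x, t) mdifferentiableAt_snd
  conv_rhs => rw [h0]
  refine ((mder_comp_apply (g := B.mt) (f := fun q : F × ℝ ↦ (B.hpow k q.1, q.2 + 2 * Real.pi * k))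
    (x, t) (B.mt_smooth.contMDiffAt.mdifferentiableAt (by simp)) (h2.prodMk h3) w).trans ?_).symm
  congr 1
  have h4 : mder (𝓘(ℝ, ℂ).prod 𝓘(ℝ, ℝ)) (𝓘(ℝ, ℂ).prod 𝓘(ℝ, ℝ))
      (fun q : F × ℝ ↦ (B.hpow k q.1, q.2 + 2 * Real.pi * k)) (x, t) =
      (mder (𝓘(ℝ, ℂ).prod 𝓘(ℝ, ℝ)) 𝓘(ℝ, ℂ) (fun q : F × ℝ ↦ B.hpow k q.1) (x, t)).prod
        (mder (𝓘(ℝ, ℂ).prod 𝓘(ℝ, ℝ)) 𝓘(ℝ, ℝ) (fun q : F × ℝ ↦ q.2 + 2 * Real.pi * k) (x, t)) :=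
    mfderiv_prodMk h2 h3
  rw [h4]
  refine Prod.ext ?_ ?_
  · refine (mder_comp_apply (g := B.hpow k) (f := fun q : F × ℝ ↦ q.1) (x, t) h1
      mdifferentiableAt_fst w).trans ?_
    congr 1
    exact DFunLike.congr_fun (mfderiv_fst (I := 𝓘(ℝ, ℂ)) (I' := 𝓘(ℝ, ℝ)) (x := (x, t))) w
  · refine (mder_comp_apply (g := fun s : ℝ ↦ s + 2 * Real.pi * k) (f := fun q : F × ℝ ↦ q.2) (x, t)
      h3' mdifferentiableAt_snd w).trans ?_
    rw [mder_eq_fderiv, fderiv_add_const, fderiv_fun_id]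
    exact DFunLike.congr_fun (mfderiv_snd (I := 𝓘(ℝ, ℂ)) (I' := 𝓘(ℝ, ℝ)) (x := (x, t))) w

theorem injective_mder_hpow (k : ℤ) (x : F) :
    Function.Injective (mder 𝓘(ℝ, ℂ) 𝓘(ℝ, ℂ) (B.hpow k) x) := by
  intro v w hvw
  have h1 := dmt_hpow (B := B) k x 0 (v, 0)
  have h2 := dmt_hpow (B := B) k x 0 (w, 0)
  simp only at h1 h2
  rw [hvw] at h1
  exact congrArg Prod.fst ((B.mt_mder (x, 0)).1 (h1.symm.trans h2))

/-- The monodromy fixes the ends pointwise and hence maps their complement, where the function is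
constant, to itself. -/
theorem glue_hpow {V : Type*} [NormedAddCommGroup V] [NormedSpace ℝ V]
    (g : Fin n → ℝ × ℝ → V) (c : V) (k : ℤ) (x : F) : B.glue g c (B.hpow k x) = B.glue g c x := by
  by_cases hx : x ∈ ⋃ i, B.pageEnd i '' B.endDom
  · obtain ⟨i, q, hq, rfl⟩ := mem_iUnion.1 hx
    rw [hpow, B.h_zpow_pageEnd k i hq.1]
  · rw [glue_of_notMem hx, glue_of_notMem]
    intro h
    obtain ⟨i, q, hq, h⟩ := mem_iUnion.1 h
    apply hx
    have h2 : x = B.pageEnd i q := by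
      have h3 : x = ((B.h.toEquiv : Equiv.Perm F) ^ (-k)) (B.hpow k x) := by
        simp [hpow, zpow_neg]
      rw [← h] at h3
      exact h3.trans (B.h_zpow_pageEnd (-k) i hq.1 q.2)
    rw [h2]; exact mem_iUnion.2 ⟨i, q, hq, rfl⟩

end OpenBook

/-! ### Complex structures on the pages. -/

namespace AdaptedFamily

open OpenBook

variable {M : Type*} [TopologicalSpace M] [ChartedSpace (EuclideanSpace ℝ (Fin 3)) M]
  [IsManifold (𝓡 3) ∞ M] [T2Space M]
  {F : Type*} [TopologicalSpace F] [ChartedSpace ℂ F] [IsManifold 𝓘(ℝ, ℂ) ∞ F] {n : ℕ}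
  {B : OpenBook M F n} (A : AdaptedFamily B)
  {E : Type*} [NormedAddCommGroup E] [NormedSpace ℝ E] [FiniteDimensional ℝ E]

/-- A profile on each end of the page. -/
abbrev Profiles : Type := ∀ i, EndProfile (A.γ₁ i 0) (A.γ₂ i 0) B.R (1 - A.ε) A.ρ

theorem nonempty_profiles : Nonempty A.Profiles :=
  ⟨fun i ↦ (exists_endProfile (A.local_model i) A.ρ_pos A.ρ_lt A.one_sub_ε.2
    (A.contDiffOn_γ₁ zero_mem' i) (A.contDiffOn_γ₂ zero_mem' i) (fun _ hr ↦ A.γ₁_zero_pos i hr)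
    (A.outer_zero i) fun _ hr ↦ A.γ₁_zero_le i hr).some⟩

/-- Complex structures on the pages, adapted to the profiles on the ends. -/
structure PageComplex (P : A.Profiles) where
  j : F × ℝ → ℂ →L[ℝ] ℂ
  sq : ∀ q v, j q (j q v) = -v
  symm : ∀ q v w, planeDet v (j q w) = planeDet w (j q v)
  -- The value `1/2` only serves to fix an orientation; every `δ` in `(0, 1)` induces the same one.
  pos : ∀ q v, v ≠ 0 → 0 < A.pageArea (1 / 2) q * planeDet v (j q v)
  -- Invariance under the deck transformations of the mapping torus, so that the structure descends
  -- to the pages in `M`.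
  equivariant : ∀ (k : ℤ) x t v, j (B.hpow k x, t + 2 * Real.pi * k)
    (mder 𝓘(ℝ, ℂ) 𝓘(ℝ, ℂ) (B.hpow k) x v) = mder 𝓘(ℝ, ℂ) 𝓘(ℝ, ℂ) (B.hpow k) x (j (x, t) v)
  polar : ∀ i, ∀ r ∈ Ioo 0 (1 - A.ε), ∀ θ t : ℝ,
    j (B.pageEnd i (r, θ), t) (mder 𝓘(ℝ, ℝ × ℝ) 𝓘(ℝ, ℂ) (B.pageEnd i) (r, θ) (1, 0)) =
      -(P i).β r • mder 𝓘(ℝ, ℝ × ℝ) 𝓘(ℝ, ℂ) (B.pageEnd i) (r, θ) (0, 1) ∧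
    j (B.pageEnd i (r, θ), t) (mder 𝓘(ℝ, ℝ × ℝ) 𝓘(ℝ, ℂ) (B.pageEnd i) (r, θ) (0, 1)) =
      ((P i).β r)⁻¹ • mder 𝓘(ℝ, ℝ × ℝ) 𝓘(ℝ, ℂ) (B.pageEnd i) (r, θ) (1, 0)
  smooth : ∀ (σ : ℂ → F) (O : Set ℂ), IsOpen O → ContMDiffOn 𝓘(ℝ, ℂ) 𝓘(ℝ, ℂ) ∞ σ O →
    (∀ y ∈ O, Function.Bijective (mder 𝓘(ℝ, ℂ) 𝓘(ℝ, ℂ) σ y)) →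
    ∃ j' : ℂ × ℝ → ℂ →L[ℝ] ℂ, ContDiffOn ℝ ∞ j' (O ×ˢ univ) ∧ ∀ y ∈ O, ∀ t v,
      j (σ y, t) (mder 𝓘(ℝ, ℂ) 𝓘(ℝ, ℂ) σ y v) = mder 𝓘(ℝ, ℂ) 𝓘(ℝ, ℂ) σ y (j' (y, t) v)

section Immersion

variable {V : Type*} [NormedAddCommGroup V] [NormedSpace ℝ V] [CompleteSpace V] {Φ : F × ℝ → V}

/-- The derivative of a family of maps on the pages. -/
noncomputable def pageDer (Φ : F × ℝ → V) (q : F × ℝ) : ℂ →L[ℝ] V :=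
  mder 𝓘(ℝ, ℂ) 𝓘(ℝ, V) (fun x ↦ Φ (x, q.2)) q.1

theorem contMDiff_slice (hΦ : ContMDiff (𝓘(ℝ, ℂ).prod 𝓘(ℝ, ℝ)) 𝓘(ℝ, V) ∞ Φ) (t : ℝ) :
    ContMDiff 𝓘(ℝ, ℂ) 𝓘(ℝ, V) ∞ fun x ↦ Φ (x, t) :=
  hΦ.comp (contMDiff_id.prodMk contMDiff_const)

theorem pageDer_param (hΦ : ContMDiff (𝓘(ℝ, ℂ).prod 𝓘(ℝ, ℝ)) 𝓘(ℝ, V) ∞ Φ) {σ : E → F} {O : Set E}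
    (hO : IsOpen O) (hσ : ContMDiffOn 𝓘(ℝ, E) 𝓘(ℝ, ℂ) ∞ σ O) {y : E} (hy : y ∈ O) (t : ℝ) (w : E) :
    pageDer Φ (σ y, t) (mder 𝓘(ℝ, E) 𝓘(ℝ, ℂ) σ y w) = fderiv ℝ (fun y ↦ Φ (σ y, t)) y w := by
  rw [← mder_eq_fderiv]
  exact (mder_comp_apply (g := fun x ↦ Φ (x, t)) (f := σ) y
    ((contMDiff_slice hΦ t).contMDiffAt.mdifferentiableAt (by simp))
    ((hσ.contMDiffAt (hO.mem_nhds hy)).mdifferentiableAt (by simp)) w).symm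

theorem contDiffOn_pageDer (hΦ : ContMDiff (𝓘(ℝ, ℂ).prod 𝓘(ℝ, ℝ)) 𝓘(ℝ, V) ∞ Φ) {σ : E → F}
    {O : Set E} (hO : IsOpen O) (hσ : ContMDiffOn 𝓘(ℝ, E) 𝓘(ℝ, ℂ) ∞ σ O) :
    ContDiffOn ℝ ∞ (fun q : E × ℝ ↦ fderiv ℝ (fun y ↦ Φ (σ y, q.2)) q.1) (O ×ˢ univ) := by
  have h1 : ContDiffOn ℝ ∞ (fun q : E × ℝ ↦ Φ (σ q.1, q.2)) (O ×ˢ univ) := by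
    rw [← contMDiffOn_iff_contDiffOn]
    exact hΦ.comp_contMDiffOn (contMDiffOn_slide_aux hσ)
  have ho : IsOpen (O ×ˢ (univ : Set ℝ)) := hO.prod isOpen_univ
  have h2 := (h1.fderiv_of_isOpen (m := ∞) ho (by simp)).clm_comp
    (contDiffOn_const (c := ContinuousLinearMap.inl ℝ E ℝ))
  refine h2.congr fun q hq ↦ ?_
  have h3 : HasFDerivAt (fun q : E × ℝ ↦ Φ (σ q.1, q.2)) _ (q.1, q.2) :=
    ((h1.contDiffAt (ho.mem_nhds hq)).differentiableAt (by simp)).hasFDerivAt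
  exact (HasFDerivAt.comp (f := fun y ↦ (y, q.2)) q.1 h3
    (hasFDerivAt_prodMk_left (𝕜 := ℝ) q.1 q.2)).fderiv

end Immersion

section Embedding

variable (P : A.Profiles)

/-- The cutoff that is `1` for `r ≤ 1 - ε / 2` and `0` for `r ≥ 1`. -/
noncomputable def cutoff (r : ℝ) : ℝ := 1 - Real.smoothTransition ((r - (1 - A.ε / 2)) / (A.ε / 2))

theorem cutoff_one {r : ℝ} (hr : r ≤ 1 - A.ε / 2) : A.cutoff r = 1 := by
  have := A.ε_pos
  rw [cutoff, Real.smoothTransition.zero_of_nonpos, sub_zero]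
  exact div_nonpos_of_nonpos_of_nonneg (by linarith) (by linarith)

theorem cutoff_zero {r : ℝ} (hr : 1 ≤ r) : A.cutoff r = 0 := by
  have := A.ε_pos
  rw [cutoff, Real.smoothTransition.one_of_one_le, sub_self]
  rw [le_div_iff₀ (by linarith)]; linarith

theorem contDiff_cutoff : ContDiff ℝ ∞ A.cutoff :=
  contDiff_const.sub (Real.smoothTransition.contDiff.comp
    ((contDiff_id.sub contDiff_const).div_const _))

/-- The map to `ℂ` given by the holomorphic coordinates on the ends. -/
noncomputable def endMap : F → ℂ :=
  B.glue (fun i q ↦ ((A.cutoff q.1 * (P i).f q.1 : ℝ) : ℂ) *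
    Complex.exp ((q.2 : ℂ) * Complex.I)) 0

theorem exp_add_period (θ : ℝ) (k : ℤ) :
    Complex.exp (((θ + 2 * Real.pi * k : ℝ) : ℂ) * Complex.I) = Complex.exp (θ * Complex.I) := by
  push_cast
  rw [add_mul, Complex.exp_add]
  have : Complex.exp (2 * Real.pi * k * Complex.I) = 1 := by
    rw [Complex.exp_eq_one_iff]; exact ⟨k, by ring⟩
  rw [this, mul_one]

theorem endMap_pageEnd (i : Fin n) {q : ℝ × ℝ} (hq : q ∈ B.endDom) : A.endMap P (B.pageEnd i q) =
    ((A.cutoff q.1 * (P i).f q.1 : ℝ) : ℂ) * Complex.exp ((q.2 : ℂ) * Complex.I) :=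
  glue_pageEnd (fun i r θ k ↦ by simp only [exp_add_period]) i hq

theorem contMDiff_endMap : ContMDiff 𝓘(ℝ, ℂ) 𝓘(ℝ, ℂ) ∞ (A.endMap P) := by
  refine contMDiff_glue (fun i r θ k ↦ by simp only [exp_add_period]) B.one_lt_R
    (fun i r hr θ ↦ by simp [A.cutoff_zero hr.1.le]) fun i ↦ ?_
  have hf : ContDiffOn ℝ ∞ (fun q : ℝ × ℝ ↦ (P i).f q.1) B.endDom :=
    (P i).contDiffOn_f.comp contDiffOn_fst fun q hq ↦ hq.1
  have hc : ContDiffOn ℝ ∞ (fun q : ℝ × ℝ ↦ A.cutoff q.1) B.endDom :=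
    (A.contDiff_cutoff.comp contDiff_fst).contDiffOn
  have he : ContDiffOn ℝ ∞ (fun q : ℝ × ℝ ↦ Complex.exp ((q.2 : ℂ) * Complex.I)) B.endDom :=
    (((Complex.ofRealCLM.contDiff.comp contDiff_snd).mul contDiff_const).cexp).contDiffOn
  exact (Complex.ofRealCLM.contDiff.comp_contDiffOn (hc.mul hf)).mul he

/-- The function that vanishes for `r ≤ 1 - ε` and is positive elsewhere. -/
noncomputable def coreMap : F → ℝ :=
  B.glue (fun _ q ↦ Real.smoothTransition ((q.1 - (1 - A.ε)) / A.ε)) 1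

theorem coreMap_pageEnd (i : Fin n) {q : ℝ × ℝ} (hq : q ∈ B.endDom) :
    A.coreMap (B.pageEnd i q) = Real.smoothTransition ((q.1 - (1 - A.ε)) / A.ε) :=
  glue_pageEnd (g := fun (_ : Fin n) (q : ℝ × ℝ) ↦
    Real.smoothTransition ((q.1 - (1 - A.ε)) / A.ε)) (fun _ _ _ _ ↦ rfl) i hq

theorem contMDiff_coreMap : ContMDiff 𝓘(ℝ, ℂ) 𝓘(ℝ, ℝ) ∞ (A.coreMap (B := B)) := by
  refine contMDiff_glue (fun _ _ _ _ ↦ rfl) B.one_lt_R (fun i r hr θ ↦ ?_) fun i ↦ ?_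
  · apply Real.smoothTransition.one_of_one_le
    rw [le_div_iff₀ A.ε_pos]; linarith [hr.1]
  · exact (Real.smoothTransition.contDiff.comp
      ((contDiff_fst.sub contDiff_const).div_const _)).contDiffOn

variable {N : ℕ} (e : M → EuclideanSpace ℝ (Fin N))

/-- A map of the mapping torus of the monodromy to a Euclidean space, immersive on the pages. -/
noncomputable def pageMap (q : F × ℝ) : ℂ × ℝ × EuclideanSpace ℝ (Fin N) :=
  (A.endMap P q.1, A.coreMap q.1, A.coreMap q.1 • e (B.mt q))

variable {e}

/-- The first two components depend only on end coordinates, which the monodromy fixes, and the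
third is a function on `M` with an invariant factor. This is why the embedding of `M` is used, and
not one of `F`. -/
theorem pageMap_hpow (k : ℤ) (x : F) (t : ℝ) :
    A.pageMap P e (B.hpow k x, t + 2 * Real.pi * k) = A.pageMap P e (x, t) := by
  simp only [pageMap, mt_hpow]
  rw [endMap, glue_hpow, coreMap, glue_hpow]

theorem contMDiff_pageMap (he : ContMDiff (𝓡 3) (𝓡 N) ∞ e) :
    ContMDiff (𝓘(ℝ, ℂ).prod 𝓘(ℝ, ℝ)) 𝓘(ℝ, ℂ × ℝ × EuclideanSpace ℝ (Fin N)) ∞ (A.pageMap P e) := by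
  have h1 := (A.contMDiff_endMap P).comp
    (contMDiff_fst (M := F) (N := ℝ) (I := 𝓘(ℝ, ℂ)) (J := 𝓘(ℝ, ℝ)) (n := ∞))
  have h2 := (A.contMDiff_coreMap (B := B)).comp
    (contMDiff_fst (M := F) (N := ℝ) (I := 𝓘(ℝ, ℂ)) (J := 𝓘(ℝ, ℝ)) (n := ∞))
  have h3 : ContMDiff (𝓘(ℝ, ℂ).prod 𝓘(ℝ, ℝ)) 𝓘(ℝ, EuclideanSpace ℝ (Fin N)) ∞
      fun q : F × ℝ ↦ e (B.mt q) := he.comp B.mt_smooth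
  exact h1.prodMk_space (h2.prodMk_space (h2.smul h3))

theorem fderiv_endMap (i : Fin n) {q : ℝ × ℝ} (hq : q.1 ∈ Ioo 0 (1 - A.ε / 2)) (w : ℝ × ℝ) :
    fderiv ℝ (fun q ↦ A.endMap P (B.pageEnd i q)) q w =
      (((P i).β q.1 * (P i).f q.1 * w.1 : ℝ) + ((P i).f q.1 * w.2 : ℝ) * Complex.I) *
        Complex.exp ((q.2 : ℂ) * Complex.I) := by
  have hR : 1 - A.ε / 2 < B.R := by linarith [A.ε_pos, B.one_lt_R]
  have hev : (fun q ↦ A.endMap P (B.pageEnd i q)) =ᶠ[𝓝 q] fun q ↦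
      ((P i).f q.1 : ℂ) * Complex.exp ((q.2 : ℂ) * Complex.I) := by
    filter_upwards [(isOpen_Ioo.prod isOpen_univ).mem_nhds
      (show q ∈ Ioo 0 (1 - A.ε / 2) ×ˢ (univ : Set ℝ) from ⟨hq, mem_univ _⟩)] with x hx
    rw [A.endMap_pageEnd P i ⟨⟨hx.1.1, hx.1.2.trans hR⟩, mem_univ _⟩, A.cutoff_one hx.1.2.le, one_mul]
  have h1 : HasFDerivAt (fun q : ℝ × ℝ ↦ (((P i).f q.1 : ℝ) : ℂ)) _ q :=
    Complex.ofRealCLM.hasFDerivAt.comp q (((P i).f_deriv q.1 ⟨hq.1, hq.2.trans hR⟩).comp_hasFDerivAt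
      q (ContinuousLinearMap.fst ℝ ℝ ℝ).hasFDerivAt)
  have h2 : HasFDerivAt (fun q : ℝ × ℝ ↦ ((q.2 : ℝ) : ℂ))
      (Complex.ofRealCLM.comp (ContinuousLinearMap.snd ℝ ℝ ℝ)) q :=
    (Complex.ofRealCLM.comp (ContinuousLinearMap.snd ℝ ℝ ℝ)).hasFDerivAt
  have h3 := h1.mul ((h2.mul_const Complex.I).cexp)
  rw [hev.fderiv_eq]
  refine (congrArg (· w) h3.fderiv).trans ?_
  simp
  ring

/-- For `r ≤ 1 - ε` the first component is the polar coordinate map, an immersion as `β` and `f` are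
positive. Elsewhere `coreMap = χ` is positive, and the vanishing of both `dχ(w)` and the derivative
of `χ · (e ∘ mt)` along `w` forces that of `e ∘ mt`, which is an immersion on the page. -/
theorem injective_pageDer (he : ContMDiff (𝓡 3) (𝓡 N) ∞ e)
    (hinj : ∀ p, Function.Injective (mfderiv (𝓡 3) (𝓡 N) e p)) (q : F × ℝ) :
    Function.Injective (pageDer (A.pageMap P e) q) := by
  rw [injective_iff_map_eq_zero]
  intro v hv
  obtain ⟨x, t⟩ := q
  have hΦ := A.contMDiff_pageMap P he
  have hlt : 1 - A.ε < 1 - A.ε / 2 := by linarith [A.ε_pos]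
  have hR := A.one_sub_ε.2
  by_cases hx : x ∈ ⋃ i, B.pageEnd i '' (Ioc 0 (1 - A.ε) ×ˢ univ)
  · obtain ⟨i, q, hq, rfl⟩ := mem_iUnion.1 hx
    have hqD : q ∈ B.endDom := ⟨⟨hq.1.1, hq.1.2.trans_lt hR⟩, mem_univ _⟩
    obtain ⟨w, rfl⟩ := (B.pageEnd_mder i hqD).2 v
    rw [pageDer_param hΦ B.isOpen_endDom (B.pageEnd_smooth i) hqD] at hv
    have hd : DifferentiableAt ℝ (fun q ↦ A.pageMap P e (B.pageEnd i q, t)) q := by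
      have : ContDiffOn ℝ ∞ (fun q ↦ A.pageMap P e (B.pageEnd i q, t)) B.endDom := by
        rw [← contMDiffOn_iff_contDiffOn]
        exact (contMDiff_slice hΦ t).comp_contMDiffOn (B.pageEnd_smooth i)
      exact (this.contDiffAt (B.isOpen_endDom.mem_nhds hqD)).differentiableAt (by simp)
    have h1 : fderiv ℝ (fun q ↦ A.endMap P (B.pageEnd i q)) q w = 0 := by
      have h2 := (hd.hasFDerivAt.fst).fderiv
      refine (congrArg (· w) h2).trans ?_
      exact congrArg Prod.fst hv
    rw [A.fderiv_endMap P i ⟨hq.1.1, hq.1.2.trans_lt hlt⟩] at h1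
    have h3 := (mul_eq_zero.1 h1).resolve_right (Complex.exp_ne_zero _)
    have h4 := congrArg Complex.re h3
    have h5 := congrArg Complex.im h3
    simp only [Complex.add_re, Complex.ofReal_re, Complex.re_ofReal_mul, Complex.I_re, mul_zero,
      add_zero, Complex.zero_re, Complex.add_im, Complex.ofReal_im, Complex.im_ofReal_mul,
      Complex.I_im, mul_one, zero_add, Complex.zero_im] at h4 h5
    have hf := ((P i).f_pos q.1).ne'
    have hβ := ((P i).β_pos q.1 hqD.1).ne'
    have h6 : w = 0 := Prod.ext ((mul_eq_zero.1 h4).resolve_left (mul_ne_zero hβ hf))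
      ((mul_eq_zero.1 h5).resolve_left hf)
    rw [h6, map_zero]
  · have hpos : A.coreMap x ≠ 0 := by
      by_cases hx' : x ∈ ⋃ i, B.pageEnd i '' B.endDom
      · obtain ⟨i, q, hq, rfl⟩ := mem_iUnion.1 hx'
        rw [A.coreMap_pageEnd i hq]
        refine (Real.smoothTransition.pos_of_pos (div_pos ?_ A.ε_pos)).ne'
        by_contra hneg
        exact hx (mem_iUnion.2 ⟨i, q, ⟨⟨hq.1.1, by linarith⟩, mem_univ _⟩, rfl⟩)
      · rw [coreMap, glue_of_notMem hx']; exact one_ne_zero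
    obtain ⟨hs, hd⟩ := chart_param x
    have ho := isOpen_extChartAt_target (I := 𝓘(ℝ, ℂ)) x
    have hyO := mem_extChartAt_target (I := 𝓘(ℝ, ℂ)) x
    have hxy : (extChartAt 𝓘(ℝ, ℂ) x).symm (extChartAt 𝓘(ℝ, ℂ) x x) = x := extChartAt_to_inv x
    set σ := (extChartAt 𝓘(ℝ, ℂ) x).symm with hσ
    set y := extChartAt 𝓘(ℝ, ℂ) x x with hy
    obtain ⟨w, rfl⟩ := (hd y hyO).2 v
    have hv' : pageDer (A.pageMap P e) (σ y, t) (mder 𝓘(ℝ, ℂ) 𝓘(ℝ, ℂ) σ y w) = 0 := by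
      rw [hxy]; exact hv
    rw [pageDer_param hΦ ho hs hyO] at hv'
    have hdc : DifferentiableAt ℝ (fun y ↦ A.coreMap (B := B) (σ y)) y := by
      have : ContDiffOn ℝ ∞ (fun y ↦ A.coreMap (B := B) (σ y)) (extChartAt 𝓘(ℝ, ℂ) x).target := by
        rw [← contMDiffOn_iff_contDiffOn]
        exact A.contMDiff_coreMap.comp_contMDiffOn hs
      exact (this.contDiffAt (ho.mem_nhds hyO)).differentiableAt (by simp)
    have hde : DifferentiableAt ℝ (fun y ↦ A.endMap P (σ y)) y := by
      have : ContDiffOn ℝ ∞ (fun y ↦ A.endMap P (σ y)) (extChartAt 𝓘(ℝ, ℂ) x).target := by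
        rw [← contMDiffOn_iff_contDiffOn]
        exact (A.contMDiff_endMap P).comp_contMDiffOn hs
      exact (this.contDiffAt (ho.mem_nhds hyO)).differentiableAt (by simp)
    have hem : MDifferentiableAt (𝓡 3) (𝓡 N) e (B.slide σ (y, t)) :=
      he.contMDiffAt.mdifferentiableAt (by simp)
    have hsl : MDifferentiableAt 𝓘(ℝ, ℂ × ℝ) (𝓡 3) (B.slide σ) (y, t) :=
      ((contMDiffOn_slide hs).contMDiffAt ((ho.prod isOpen_univ).mem_nhds
        ⟨hyO, mem_univ _⟩)).mdifferentiableAt (by simp)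
    have hG := (hem.comp (y, t) hsl).differentiableAt
    have hG' : HasFDerivAt (fun y ↦ e (B.mt (σ y, t))) ((fderiv ℝ (e ∘ B.slide σ) (y, t)).comp
      (ContinuousLinearMap.inl ℝ ℂ ℝ)) y :=
      HasFDerivAt.comp (f := fun y ↦ (y, t)) y hG.hasFDerivAt
        (hasFDerivAt_prodMk_left (𝕜 := ℝ) y t)
    have htot : HasFDerivAt (fun y ↦ A.pageMap P e (σ y, t)) _ y :=
      hde.hasFDerivAt.prodMk (hdc.hasFDerivAt.prodMk (hdc.hasFDerivAt.smul hG'))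
    rw [htot.fderiv] at hv'
    have h2 : fderiv ℝ (fun y ↦ A.coreMap (B := B) (σ y)) y w = 0 :=
      congrArg (fun u ↦ u.2.1) hv'
    have h3 := congrArg (fun u ↦ u.2.2) hv'
    simp only [ContinuousLinearMap.prod_apply, add_apply,
      smul_apply, ContinuousLinearMap.smulRight_apply, h2, zero_smul, add_zero,
      Prod.snd_zero, hxy] at h3
    have h4 := (smul_eq_zero.1 h3).resolve_left hpos
    have h5 : mder (𝓡 3) (𝓡 N) e (B.slide σ (y, t))
        (mder 𝓘(ℝ, ℂ × ℝ) (𝓡 3) (B.slide σ) (y, t) (w, 0)) = 0 := by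
      refine (mder_comp_apply (y, t) hem hsl (w, 0)).symm.trans ?_
      rw [mder_eq_fderiv]
      exact h4
    have h6 := hinj (B.slide σ (y, t)) (h5.trans (map_zero _).symm)
    have h7 := (bijective_mder_slide (B := B) ho hs hd (q := (y, t)) ⟨hyO, mem_univ _⟩).1
      (h6.trans (map_zero _).symm)
    have h8 : w = 0 := congrArg Prod.fst h7
    rw [h8, map_zero]

variable (e) in
/-- The rotation by a right angle in the tangent planes of the pages. -/
noncomputable def pageTurn (q : F × ℝ) : ℂ →L[ℝ] ℂ :=
  quarterTurnCLM (pageDer (A.pageMap P e) q) (A.pageArea (1 / 2) q)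

/-- The metric and the orientation are both pulled back from objects on the mapping torus, so the
rotation they define is equivariant. -/
theorem pageTurn_hpow (he : ContMDiff (𝓡 3) (𝓡 N) ∞ e) (k : ℤ) (x : F) (t : ℝ) (v : ℂ) :
    A.pageTurn P e (B.hpow k x, t + 2 * Real.pi * k)
      (mder 𝓘(ℝ, ℂ) 𝓘(ℝ, ℂ) (B.hpow k) x v) =
    mder 𝓘(ℝ, ℂ) 𝓘(ℝ, ℂ) (B.hpow k) x (A.pageTurn P e (x, t) v) := by
  have hΦ := A.contMDiff_pageMap P he
  unfold pageTurn
  rw [quarterTurnCLM_map _ _ (injective_mder_hpow k x)]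
  congr 2
  have e1 : (pageDer (A.pageMap P e) (B.hpow k x, t + 2 * Real.pi * k)).comp
      (mder 𝓘(ℝ, ℂ) 𝓘(ℝ, ℂ) (B.hpow k) x) = pageDer (A.pageMap P e) (x, t) := by
    have h1 : (fun x ↦ (A.pageMap P e) (x, t)) = (fun y ↦ (A.pageMap P e) (y, t + 2 * Real.pi * k)) ∘ B.hpow k := by
      funext y; exact (A.pageMap_hpow P k y t).symm
    unfold pageDer
    simp only
    rw [h1]
    exact (mder_comp x ((contMDiff_slice hΦ _).contMDiffAt.mdifferentiableAt (by simp))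
      ((contMDiff_hpow k).contMDiffAt.mdifferentiableAt (by simp))).symm
  have e2 : A.pageArea (1 / 2) (B.hpow k x, t + 2 * Real.pi * k) *
      planeDet (mder 𝓘(ℝ, ℂ) 𝓘(ℝ, ℂ) (B.hpow k) x 1)
        (mder 𝓘(ℝ, ℂ) 𝓘(ℝ, ℂ) (B.hpow k) x Complex.I) = A.pageArea (1 / 2) (x, t) := by
    rw [mul_comm, ← A.extD_page]
    have h1 := dmt_hpow (B := B) k x t (1, 0)
    have h2 := dmt_hpow (B := B) k x t (Complex.I, 0)
    unfold pageArea
    unfold dmt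
    rw [← h1, ← h2, mt_hpow]
  rw [e1, e2]

/-- For `r < 1 - ε` the last two components of `pageMap` vanish identically, so the metric is that
of the plane in the coordinate `f e^{iθ}`: the vectors `∂_r` and `∂_θ` are orthogonal of lengths `β
f` and `f`. They form a negative basis because `dλ(∂_r, ∂_θ) = γ₁' < 0`. -/
theorem pageTurn_polar (he : ContMDiff (𝓡 3) (𝓡 N) ∞ e) (i : Fin n) {r : ℝ}
    (hr : r ∈ Ioo 0 (1 - A.ε)) (θ t : ℝ) :
    A.pageTurn P e (B.pageEnd i (r, θ), t)
        (mder 𝓘(ℝ, ℝ × ℝ) 𝓘(ℝ, ℂ) (B.pageEnd i) (r, θ) (1, 0)) =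
      -(P i).β r • mder 𝓘(ℝ, ℝ × ℝ) 𝓘(ℝ, ℂ) (B.pageEnd i) (r, θ) (0, 1) ∧
    A.pageTurn P e (B.pageEnd i (r, θ), t)
        (mder 𝓘(ℝ, ℝ × ℝ) 𝓘(ℝ, ℂ) (B.pageEnd i) (r, θ) (0, 1)) =
      ((P i).β r)⁻¹ • mder 𝓘(ℝ, ℝ × ℝ) 𝓘(ℝ, ℂ) (B.pageEnd i) (r, θ) (1, 0) := by
  have hΦ := A.contMDiff_pageMap P he
  unfold pageTurn
  have hrR : r ∈ Ioo 0 B.R := ⟨hr.1, hr.2.trans A.one_sub_ε.2⟩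
  have hqD : (r, θ) ∈ B.endDom := ⟨hrR, mem_univ _⟩
  set D := mder 𝓘(ℝ, ℝ × ℝ) 𝓘(ℝ, ℂ) (B.pageEnd i) (r, θ) with hDd
  have hder : ∀ w, pageDer (A.pageMap P e) (B.pageEnd i (r, θ), t) (D w) =
      (fderiv ℝ (fun q ↦ A.endMap P (B.pageEnd i q)) (r, θ) w, 0, 0) := by
    intro w
    rw [hDd, pageDer_param hΦ B.isOpen_endDom (B.pageEnd_smooth i) hqD]
    have hev : (fun q ↦ (A.pageMap P e) (B.pageEnd i q, t)) =ᶠ[𝓝 (r, θ)] fun q ↦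
        (A.endMap P (B.pageEnd i q), 0, 0) := by
      filter_upwards [(isOpen_Ioo.prod isOpen_univ).mem_nhds
        (show (r, θ) ∈ Ioo 0 (1 - A.ε) ×ˢ (univ : Set ℝ) from ⟨hr, mem_univ _⟩)] with q hq
      have h0 : A.coreMap (B.pageEnd i q) = 0 := by
        rw [A.coreMap_pageEnd i ⟨⟨hq.1.1, hq.1.2.trans A.one_sub_ε.2⟩, mem_univ _⟩]
        exact Real.smoothTransition.zero_of_nonpos
          (div_nonpos_of_nonpos_of_nonneg (by linarith [hq.1.2]) A.ε_pos.le)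
      simp only [pageMap, h0, zero_smul]
    have hdf : DifferentiableAt ℝ (fun q ↦ A.endMap P (B.pageEnd i q)) (r, θ) := by
      have : ContDiffOn ℝ ∞ (fun q ↦ A.endMap P (B.pageEnd i q)) B.endDom := by
        rw [← contMDiffOn_iff_contDiffOn]
        exact (A.contMDiff_endMap P).comp_contMDiffOn (B.pageEnd_smooth i)
      exact (this.contDiffAt (B.isOpen_endDom.mem_nhds hqD)).differentiableAt (by simp)
    rw [hev.fderiv_eq, (hdf.hasFDerivAt.prodMk (hasFDerivAt_const _ _)).fderiv]
    rfl
  have hlt : r ∈ Ioo 0 (1 - A.ε / 2) := ⟨hr.1, by linarith [hr.2, A.ε_pos]⟩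
  have hneg : A.pageArea (1 / 2) (B.pageEnd i (r, θ), t) * planeDet (D (1, 0)) (D (0, 1)) < 0 := by
    have h1 := A.extD_slide B.isOpen_endDom (B.pageEnd_smooth i) hqD half_mem' t
      ((1, 0), 0) ((0, 1), 0)
    rw [A.pullD_polar half_mem' i hrR] at h1
    simp only at h1
    rw [A.extD_page] at h1
    rw [mul_comm, h1]
    have := (A.turning (1 / 2) half_mem' i r hrR (by norm_num)).2
    simpa using this
  have hpd : planeDet (D (1, 0)) (D (0, 1)) ≠ 0 := fun h ↦ by simp [h] at hneg
  have hf := (P i).f_pos r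
  have hβ := (P i).β_pos r hrR
  have hn : ‖Complex.exp ((θ : ℂ) * Complex.I)‖ = 1 := Complex.norm_exp_ofReal_mul_I θ
  have h11 : tripleInner (pageDer (A.pageMap P e) (B.pageEnd i (r, θ), t) (D (1, 0)))
      (pageDer (A.pageMap P e) (B.pageEnd i (r, θ), t) (D (1, 0))) = ((P i).β r * (P i).f r) ^ 2 := by
    rw [hder, A.fderiv_endMap P i hlt]
    simp only [tripleInner, real_inner_self_eq_norm_sq, norm_zero, mul_one, mul_zero,
      Complex.ofReal_zero, zero_mul, add_zero]
    rw [norm_mul, hn, Complex.norm_real, Real.norm_eq_abs, mul_one, sq_abs]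
    simp
  have h22 : tripleInner (pageDer (A.pageMap P e) (B.pageEnd i (r, θ), t) (D (0, 1)))
      (pageDer (A.pageMap P e) (B.pageEnd i (r, θ), t) (D (0, 1))) = ((P i).f r) ^ 2 := by
    rw [hder, A.fderiv_endMap P i hlt]
    simp only [tripleInner, real_inner_self_eq_norm_sq, norm_zero, mul_one, mul_zero,
      Complex.ofReal_zero, zero_add, add_zero]
    rw [norm_mul, norm_mul, hn, Complex.norm_real, Real.norm_eq_abs, Complex.norm_I, mul_one,
      mul_one, sq_abs]
    simp
  have h12 : tripleInner (pageDer (A.pageMap P e) (B.pageEnd i (r, θ), t) (D (1, 0)))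
      (pageDer (A.pageMap P e) (B.pageEnd i (r, θ), t) (D (0, 1))) = 0 := by
    rw [hder, hder, A.fderiv_endMap P i hlt, A.fderiv_endMap P i hlt]
    simp only [tripleInner, mul_one, mul_zero, Complex.ofReal_zero, zero_mul, zero_add, add_zero,
      inner_zero_left]
    rw [Complex.inner]
    simp
    ring
  obtain ⟨h1, h2⟩ := quarterTurn_basis_fst (pageDer (A.pageMap P e) (B.pageEnd i (r, θ), t))
    (b₁ := D (1, 0)) (b₂ := D (0, 1)) hneg (mul_pos hβ hf) hf h11 h22 h12
  rw [quarterTurnCLM_eq _ _ hpd, quarterTurnCLM_eq _ _ hpd]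
  have e1 : (P i).β r * (P i).f r / (P i).f r = (P i).β r := by field_simp
  have e2 : (P i).f r / ((P i).β r * (P i).f r) = ((P i).β r)⁻¹ := by field_simp
  rw [e1] at h1
  rw [e2] at h2
  exact ⟨h1, h2⟩

/-- By naturality the local representative is itself a quarter turn, built from the derivative of
`pageMap` in the parametrisation and from `dλ_{1/2}` in these coordinates, both of which are smooth.
-/
theorem exists_pageTurn_param (he : ContMDiff (𝓡 3) (𝓡 N) ∞ e)
    (hinj : ∀ p, Function.Injective (mfderiv (𝓡 3) (𝓡 N) e p)) {σ : ℂ → F} {O : Set ℂ}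
    (hO : IsOpen O) (hσ : ContMDiffOn 𝓘(ℝ, ℂ) 𝓘(ℝ, ℂ) ∞ σ O)
    (hd : ∀ y ∈ O, Function.Bijective (mder 𝓘(ℝ, ℂ) 𝓘(ℝ, ℂ) σ y)) :
    ∃ j' : ℂ × ℝ → ℂ →L[ℝ] ℂ, ContDiffOn ℝ ∞ j' (O ×ˢ univ) ∧ ∀ y ∈ O, ∀ t v,
      A.pageTurn P e (σ y, t) (mder 𝓘(ℝ, ℂ) 𝓘(ℝ, ℂ) σ y v) =
        mder 𝓘(ℝ, ℂ) 𝓘(ℝ, ℂ) σ y (j' (y, t) v) := by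
  have hΦ := A.contMDiff_pageMap P he
  have hL := A.injective_pageDer P he hinj
  have hs := A.pageArea_ne_zero half_mem
  unfold pageTurn
  refine ⟨fun q ↦ quarterTurnCLM (fderiv ℝ (fun y ↦ (A.pageMap P e) (σ y, q.2)) q.1)
    (pullD (A.lam (1 / 2)) (B.slide σ) q (1, 0) (Complex.I, 0)), ?_, fun y hy t v ↦ ?_⟩
  · have hLs : ∀ q ∈ O ×ˢ (univ : Set ℝ), Function.Injective
        (fderiv ℝ (fun y ↦ (A.pageMap P e) (σ y, q.2)) q.1) := by
      intro q hq v w hvw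
      rw [← pageDer_param hΦ hO hσ hq.1, ← pageDer_param hΦ hO hσ hq.1] at hvw
      exact (hd _ hq.1).1 (hL _ hvw)
    refine ContDiffOn.quarterTurn (contDiffOn_pageDer hΦ hO hσ) ?_ hLs fun q hq ↦ ?_
    · exact contDiffOn_slice (contDiffOn_pullD A.lam_smooth (hO.prod isOpen_univ)
        (contMDiffOn_slide hσ) (1, 0) (Complex.I, 0)) half_mem'
    · rw [← A.extD_slide hO hσ hq.1 half_mem', A.extD_page]
      exact mul_ne_zero (planeDet_map_ne_zero (D := (mder 𝓘(ℝ, ℂ) 𝓘(ℝ, ℂ) σ q.1 : ℂ →ₗ[ℝ] ℂ))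
        (hd _ hq.1).1 one_I_indep) (hs _)
  · rw [quarterTurnCLM_map _ _ (hd y hy).1]
    congr 2
    have e1 : (pageDer (A.pageMap P e) (σ y, t)).comp (mder 𝓘(ℝ, ℂ) 𝓘(ℝ, ℂ) σ y) =
        fderiv ℝ (fun y ↦ (A.pageMap P e) (σ y, t)) y :=
      ContinuousLinearMap.ext fun w ↦ pageDer_param hΦ hO hσ hy t w
    have e2 : A.pageArea (1 / 2) (σ y, t) * planeDet (mder 𝓘(ℝ, ℂ) 𝓘(ℝ, ℂ) σ y 1)
        (mder 𝓘(ℝ, ℂ) 𝓘(ℝ, ℂ) σ y Complex.I) =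
        pullD (A.lam (1 / 2)) (B.slide σ) (y, t) (1, 0) (Complex.I, 0) := by
      rw [mul_comm, ← A.extD_page]
      exact A.extD_slide hO hσ hy half_mem' t (1, 0) (Complex.I, 0)
    rw [e1, e2]

end Embedding

/-- Compactness of `M` provides an embedding in a Euclidean space, which makes `pageMap` immersive
on the pages. -/
theorem nonempty_pageComplex [CompactSpace M] (P : A.Profiles) : Nonempty (A.PageComplex P) := by
  obtain ⟨N, e, he, -, hinj⟩ := exists_embedding_euclidean_of_compact (I := 𝓡 3) (M := M)
  have hL := A.injective_pageDer P he hinj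
  have hs := A.pageArea_ne_zero half_mem
  exact ⟨{
    j := A.pageTurn P e
    sq := fun q v ↦ quarterTurnCLM_sq _ (hL q) (hs q) v
    symm := fun q v w ↦ by
      unfold pageTurn
      rw [planeDet_quarterTurnCLM, planeDet_quarterTurnCLM, tripleInner_comm]
    pos := fun q v hv ↦ planeDet_quarterTurnCLM_pos _ (hL q) (hs q) hv
    equivariant := fun k x t v ↦ A.pageTurn_hpow P he k x t v
    polar := fun i r hr θ t ↦ A.pageTurn_polar P he i hr θ t
    smooth := fun σ O hO hσ hd ↦ A.exists_pageTurn_param P he hinj hO hσ hd }⟩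

end AdaptedFamily

/-! ### Linear algebra of the induced structures on `ker λ`. -/

section Algebra

variable {E : Type*} [NormedAddCommGroup E] [NormedSpace ℝ E]
  {E' : Type*} [NormedAddCommGroup E'] [NormedSpace ℝ E']

/-- The endomorphism of `E × ℝ` that annihilates `X`, has image in the kernel of `l`, and induces
`j` on the quotient by `X`, identified with `E`. -/
noncomputable def hatEndo (l : E × ℝ →L[ℝ] ℝ) (X : E × ℝ) (j : E →L[ℝ] E) :
    E × ℝ →L[ℝ] E × ℝ :=
  let U : E × ℝ →L[ℝ] E × ℝ := (ContinuousLinearMap.inl ℝ E ℝ).comp (j.comp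
    (ContinuousLinearMap.fst ℝ E ℝ - (ContinuousLinearMap.snd ℝ E ℝ).smulRight (X.2⁻¹ • X.1)))
  U - (l.comp U).smulRight X

theorem hatEndo_apply (l : E × ℝ →L[ℝ] ℝ) (X : E × ℝ) (j : E →L[ℝ] E) (w : E × ℝ) :
    hatEndo l X j w = (j (w.1 - w.2 • X.2⁻¹ • X.1), 0) -
      l (j (w.1 - w.2 • X.2⁻¹ • X.1), 0) • X := rfl

variable {l : E × ℝ →L[ℝ] ℝ} {X : E × ℝ} {j : E →L[ℝ] E}

theorem form_hatEndo (h : l X = 1) (w : E × ℝ) : l (hatEndo l X j w) = 0 := by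
  rw [hatEndo_apply, map_sub, map_smul, h]; simp

theorem hatEndo_self (h : X.2 ≠ 0) : hatEndo l X j X = 0 := by
  rw [hatEndo_apply, smul_smul, mul_inv_cancel₀ h, one_smul, sub_self, map_zero]
  simp [show ((0 : E), (0 : ℝ)) = 0 from rfl]

/-- The splitting into a vector tangent to the page and a multiple of `X`, available because `X` is
transverse to the page. -/
theorem hatEndo_decomp (h : X.2 ≠ 0) (w : E × ℝ) :
    w = (w.1 - w.2 • X.2⁻¹ • X.1, 0) + (w.2 * X.2⁻¹) • X := by
  refine Prod.ext ?_ ?_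
  · simp [smul_smul]
  · simp [h]

theorem hatEndo_fst (w : E) : hatEndo l X j (w, 0) = (j w, 0) - l (j w, 0) • X := by
  rw [hatEndo_apply]; simp

/-- On `ker l` the square is `-1`, on `X` it is `0`; the right-hand side is minus the projection to
`ker l` along `X`. -/
theorem hatEndo_hatEndo (h₁ : l X = 1) (h : X.2 ≠ 0) (hj : ∀ v, j (j v) = -v) (w : E × ℝ) :
    hatEndo l X j (hatEndo l X j w) = -w + l w • X := by
  have hw := hatEndo_decomp h w
  set u := w.1 - w.2 • X.2⁻¹ • X.1
  set c := w.2 * X.2⁻¹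
  rw [hw]
  simp only [map_add, map_smul, hatEndo_self h, hatEndo_fst, map_sub, smul_zero, sub_zero,
    add_zero, hj, h₁, smul_eq_mul, mul_one]
  have h2 : l (-u, 0) = -l (u, 0) := by rw [← map_neg]; simp
  have h3 : ((-u, 0) : E × ℝ) = -(u, 0) := by simp
  rw [h2, h3]
  module

theorem hatEndo_map {l' : E' × ℝ →L[ℝ] ℝ} {j' : E' →L[ℝ] E'} (D : E →L[ℝ] E')
    (hl : ∀ v s, l' (D v, s) = l (v, s)) (hj : ∀ v, j' (D v) = D (j v)) (w : E × ℝ) :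
    hatEndo l' (D X.1, X.2) j' (D w.1, w.2) =
      (D (hatEndo l X j w).1, (hatEndo l X j w).2) := by
  rw [hatEndo_apply, hatEndo_apply]
  simp only [← map_smul, ← map_sub, hj, hl]
  refine Prod.ext ?_ ?_ <;> simp

/-- The complex structure of the kernel of `l` on `ℝ × ℂ` that is standard on the projection to
`ℂ`; it is extended by `0` on a vector whose projection to `ℂ` is `V`. -/
noncomputable def tubeEndo (l : ℝ × ℂ →L[ℝ] ℝ) (V : ℂ) : ℝ × ℂ →L[ℝ] ℝ × ℂ :=
  let U : ℝ × ℂ →L[ℝ] ℂ := Complex.I • (ContinuousLinearMap.snd ℝ ℝ ℂ - l.smulRight V)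
  (-(l (1, 0))⁻¹ • (l.comp ((ContinuousLinearMap.inr ℝ ℝ ℂ).comp U))).prod U

theorem tubeEndo_apply (l : ℝ × ℂ →L[ℝ] ℝ) (V : ℂ) (w : ℝ × ℂ) : tubeEndo l V w =
    (-(l (1, 0))⁻¹ * l (0, Complex.I * (w.2 - l w • V)), Complex.I * (w.2 - l w • V)) := rfl

theorem form_prod_decomp (l : ℝ × ℂ →L[ℝ] ℝ) (a : ℝ) (u : ℂ) :
    l (a, u) = a * l (1, 0) + l (0, u) := by
  have : ((a, u) : ℝ × ℂ) = a • (1, 0) + (0, u) := by simp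
  rw [this, map_add, map_smul, smul_eq_mul]

theorem form_tubeEndo {l : ℝ × ℂ →L[ℝ] ℝ} {V : ℂ} (h : l (1, 0) ≠ 0) (w : ℝ × ℂ) :
    l (tubeEndo l V w) = 0 := by
  rw [tubeEndo_apply, form_prod_decomp]
  field_simp
  ring

theorem tubeEndo_self {l : ℝ × ℂ →L[ℝ] ℝ} {X : ℝ × ℂ} (h : l X = 1) :
    tubeEndo l X.2 X = 0 := by
  rw [tubeEndo_apply, h]
  simp [show ((0 : ℝ), (0 : ℂ)) = 0 from rfl]

theorem tubeEndo_tubeEndo {l : ℝ × ℂ →L[ℝ] ℝ} {X : ℝ × ℂ} (h₁ : l X = 1) (h : l (1, 0) ≠ 0)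
    (w : ℝ × ℂ) : tubeEndo l X.2 (tubeEndo l X.2 w) = -w + l w • X := by
  have e1 : (tubeEndo l X.2 (tubeEndo l X.2 w)).2 = -w.2 + l w • X.2 := by
    rw [tubeEndo_apply, form_tubeEndo h, tubeEndo_apply]
    simp only [zero_smul, sub_zero]
    rw [← mul_assoc, Complex.I_mul_I]
    ring
  refine Prod.ext ?_ (by rw [e1]; simp)
  have e2 := form_tubeEndo (V := X.2) h (tubeEndo l X.2 w)
  have e3 : l (-w + l w • X) = 0 := by rw [map_add, map_neg, map_smul, h₁]; simp
  have e4 : (-w + l w • X).2 = -w.2 + l w • X.2 := by simp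
  rw [show tubeEndo l X.2 (tubeEndo l X.2 w) = ((tubeEndo l X.2 (tubeEndo l X.2 w)).1,
    (tubeEndo l X.2 (tubeEndo l X.2 w)).2) from rfl, form_prod_decomp, e1] at e2
  rw [show -w + l w • X = ((-w + l w • X).1, (-w + l w • X).2) from rfl, form_prod_decomp, e4] at e3
  exact mul_right_cancel₀ h (by linarith)

/-- The two descriptions agree in polar coordinates. -/
theorem tubeEndo_polar {l : ℝ × ℂ →L[ℝ] ℝ} {l' : (ℝ × ℝ) × ℝ →L[ℝ] ℝ} {γ₁ γ₂ r φ β y xθ : ℝ}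
    {j : ℝ × ℝ →L[ℝ] ℝ × ℝ} (hr : r ≠ 0) (hβ : β ≠ 0) (hγ : γ₁ ≠ 0) (hy : y ≠ 0)
    (hl' : ∀ w, l' w = γ₁ * w.1.2 + γ₂ * w.2)
    (hl : ∀ w : (ℝ × ℝ) × ℝ, l (w.1.2, ((w.1.1 : ℂ) + r * w.2 * Complex.I) *
      Complex.exp ((φ : ℂ) * Complex.I)) = l' w)
    (hj₁ : j (1, 0) = (0, -β)) (hj₂ : j (0, 1) = (β⁻¹, 0)) (hX : γ₁ * xθ + γ₂ * y = 1)
    (hβy : r * β * γ₁ * y = 1) (w : (ℝ × ℝ) × ℝ) :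
    tubeEndo l (r * y * Complex.I * Complex.exp ((φ : ℂ) * Complex.I))
      (w.1.2, ((w.1.1 : ℂ) + r * w.2 * Complex.I) * Complex.exp ((φ : ℂ) * Complex.I)) =
    ((hatEndo l' ((0, xθ), y) j w).1.2, (((hatEndo l' ((0, xθ), y) j w).1.1 : ℂ) +
      r * (hatEndo l' ((0, xθ), y) j w).2 * Complex.I) * Complex.exp ((φ : ℂ) * Complex.I)) := by
  obtain ⟨⟨a, b⟩, c⟩ := w
  have hj : ∀ p q : ℝ, j (p, q) = (q * β⁻¹, -(p * β)) := by
    intro p q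
    have : ((p, q) : ℝ × ℝ) = p • (1, 0) + q • (0, 1) := by simp
    rw [this, map_add, map_smul, map_smul, hj₁, hj₂]
    simp
  have hH : hatEndo l' ((0, xθ), y) j ((a, b), c) =
      (((b - c * (y⁻¹ * xθ)) * β⁻¹, -(a * β) + γ₁ * (a * β) * xθ), γ₁ * (a * β) * y) := by
    rw [hatEndo_apply]
    simp only [Prod.smul_mk, smul_eq_mul, Prod.mk_sub_mk, sub_zero, hj, hl', mul_zero,
      add_zero, zero_sub]
    refine Prod.ext (Prod.ext rfl ?_) ?_ <;> simp only <;> ring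
  have e0 : l (1, 0) = γ₁ := by
    have := hl ((0, 1), 0)
    simpa [hl'] using this
  have e1 : Complex.I * ((((a : ℂ) + r * c * Complex.I) * Complex.exp ((φ : ℂ) * Complex.I)) -
      (γ₁ * b + γ₂ * c) • (r * y * Complex.I * Complex.exp ((φ : ℂ) * Complex.I))) =
      (((-(r * (c - (γ₁ * b + γ₂ * c) * y)) : ℝ) : ℂ) + r * ((a / r : ℝ) : ℂ) * Complex.I) *
        Complex.exp ((φ : ℂ) * Complex.I) := by
    have hr' : (r : ℂ) ≠ 0 := by exact_mod_cast hr
    rw [Complex.real_smul]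
    push_cast
    field_simp
    ring_nf
    simp only [Complex.I_sq]
    ring
  rw [tubeEndo_apply, hl ((a, b), c), hl', hH]
  simp only
  rw [e1]
  have e2 := hl ((-(r * (c - (γ₁ * b + γ₂ * c) * y)), 0), a / r)
  simp only at e2
  rw [e2, hl', e0]
  simp only [mul_zero, zero_add]
  -- The choice of `β` enters through `hβy`; it makes the `φ`-component of the image of `∂_r` equal
  -- to `1/r`.
  have e3 : γ₁ * (a * β) * y = a / r := by
    rw [eq_div_iff hr]; linear_combination a * hβy
  have e4 : (b - c * (y⁻¹ * xθ)) * β⁻¹ = -(r * (c - (γ₁ * b + γ₂ * c) * y)) := by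
    field_simp
    linear_combination (-(b * y - c * xθ)) * hβy - r * y * β * c * hX
  have e5 : -(a * β) + γ₁ * (a * β) * xθ = -γ₁⁻¹ * (γ₂ * (a / r)) := by
    rw [← e3]
    field_simp
    linear_combination a * hX
  rw [e3, e4, e5]

end Algebra

/-! ### The structure on `ker λ` over pages and binding. -/

namespace AdaptedFamily

open OpenBook

variable {M : Type*} [TopologicalSpace M] [ChartedSpace (EuclideanSpace ℝ (Fin 3)) M]
  [IsManifold (𝓡 3) ∞ M] [T2Space M]
  {F : Type*} [TopologicalSpace F] [ChartedSpace ℂ F] [IsManifold 𝓘(ℝ, ℂ) ∞ F] {n : ℕ}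
  {B : OpenBook M F n} (A : AdaptedFamily B)

/-- The forms, with values in the dual of the model space. -/
noncomputable def lamE (δ : ℝ) (p : M) : EuclideanSpace ℝ (Fin 3) →L[ℝ] ℝ := A.lam δ p

/-- The Reeb vector fields, with values in the model space. -/
noncomputable def reebE (δ : ℝ) (p : M) : EuclideanSpace ℝ (Fin 3) := A.X δ p

variable (B) in
/-- The differential of a tube. -/
noncomputable abbrev dtube (i : Fin n) (x : ℝ × ℂ) : ℝ × ℂ →L[ℝ] EuclideanSpace ℝ (Fin 3) :=
  mder 𝓘(ℝ, ℝ × ℂ) (𝓡 3) (B.tube i) x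

/-- The forms, pulled back to a tube. -/
noncomputable abbrev lamTube (δ : ℝ) (i : Fin n) (x : ℝ × ℂ) : ℝ × ℂ →L[ℝ] ℝ :=
  pullForm (𝓡 3) (A.lam δ) (B.tube i) x

/-- The Reeb vector fields, pulled back to a tube. -/
noncomputable abbrev reebTube (δ : ℝ) (i : Fin n) (x : ℝ × ℂ) : ℝ × ℂ :=
  pullField (𝓡 3) (A.X δ) (B.tube i) x

variable {P : A.Profiles} (C : A.PageComplex P)

open Classical in
/-- The endomorphism of `TM` that annihilates the Reeb vector field and restricts to the complex
structure of the kernel of the form. -/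
noncomputable def kerEndo (δ : ℝ) (p : M) :
    EuclideanSpace ℝ (Fin 3) →L[ℝ] EuclideanSpace ℝ (Fin 3) :=
  -- A preimage in the mapping torus is chosen arbitrarily; `kerEndo_mt` shows that the choice does
  -- not matter.
  if h : ∃ q, B.mt q = p then
    (dmt B h.choose).comp ((hatEndo (A.lamHat δ h.choose) (A.reebHat δ h.choose)
      (C.j h.choose)).comp (dmt B h.choose).inverse)
  else if h : ∃ x : Fin n × ℝ, B.tube x.1 (x.2, 0) = p then
    (dtube B h.choose.1 (h.choose.2, 0)).comp
      ((tubeEndo (A.lamTube δ h.choose.1 (h.choose.2, 0))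
        (A.reebTube δ h.choose.1 (h.choose.2, 0)).2).comp
        (dtube B h.choose.1 (h.choose.2, 0)).inverse)
  else 0

theorem lamHat_hpow (δ : ℝ) (k : ℤ) (x : F) (t : ℝ) (v : ℂ) (s : ℝ) :
    A.lamHat δ (B.hpow k x, t + 2 * Real.pi * k) (mder 𝓘(ℝ, ℂ) 𝓘(ℝ, ℂ) (B.hpow k) x v, s) =
      A.lamHat δ (x, t) (v, s) := by
  change A.lamE δ (B.mt _) (dmt B _ _) = A.lamE δ (B.mt (x, t)) (dmt B (x, t) (v, s))
  rw [mt_hpow]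
  exact congrArg _ (dmt_hpow k x t (v, s))

theorem reebHat_hpow (δ : ℝ) (k : ℤ) (x : F) (t : ℝ) :
    A.reebHat δ (B.hpow k x, t + 2 * Real.pi * k) =
      (mder 𝓘(ℝ, ℂ) 𝓘(ℝ, ℂ) (B.hpow k) x (A.reebHat δ (x, t)).1, (A.reebHat δ (x, t)).2) := by
  apply (B.mt_mder (B.hpow k x, t + 2 * Real.pi * k)).1
  refine (A.dmt_reebHat δ _).trans (Eq.trans ?_ (dmt_hpow k x t (A.reebHat δ (x, t))).symm)
  refine Eq.trans ?_ (A.dmt_reebHat δ (x, t)).symm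
  change A.reebE δ _ = A.reebE δ _
  rw [mt_hpow]

/-- Two preimages of a point differ by a power of the monodromy, under which the form, the Reeb
field and the complex structure of the page are all equivariant; `hatEndo` is natural in these data.
-/
theorem kerEndo_mt (δ : ℝ) (q : F × ℝ) (w : ℂ × ℝ) :
    A.kerEndo C δ (B.mt q) (dmt B q w) =
      dmt B q (hatEndo (A.lamHat δ q) (A.reebHat δ q) (C.j q) w) := by
  have h : ∃ q', B.mt q' = B.mt q := ⟨q, rfl⟩
  rw [kerEndo, dif_pos h]
  obtain ⟨⟨x, t⟩, hq⟩ : ∃ q', q' = h.choose := ⟨_, rfl⟩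
  have hc := h.choose_spec
  rw [← hq] at hc ⊢
  obtain ⟨y, s⟩ := q
  obtain ⟨k, rfl, rfl⟩ := (B.mt_eq_iff x y t s).1 hc
  change (dmt B (x, t)) (hatEndo (A.lamHat δ (x, t)) (A.reebHat δ (x, t)) (C.j (x, t))
    ((dmt B (x, t)).inverse (dmt B (B.hpow k x, t + 2 * Real.pi * k) w))) =
    dmt B (B.hpow k x, t + 2 * Real.pi * k) (hatEndo (A.lamHat δ (B.hpow k x, t + 2 * Real.pi * k))
      (A.reebHat δ (B.hpow k x, t + 2 * Real.pi * k)) (C.j (B.hpow k x, t + 2 * Real.pi * k)) w)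
  obtain ⟨w', hw'⟩ : ∃ w' : ℂ × ℝ, w = (mder 𝓘(ℝ, ℂ) 𝓘(ℝ, ℂ) (B.hpow k) x w'.1, w'.2) := by
    obtain ⟨w', hw'⟩ := (B.mt_mder (x, t)).2 (dmt B (B.hpow k x, t + 2 * Real.pi * k) w)
    refine ⟨w', (B.mt_mder (B.hpow k x, t + 2 * Real.pi * k)).1 ?_⟩
    exact hw'.symm.trans (dmt_hpow k x t w').symm
  rw [hw', A.reebHat_hpow, hatEndo_map (l := A.lamHat δ (x, t)) (X := A.reebHat δ (x, t))
    (j := C.j (x, t)) _ (fun v s ↦ A.lamHat_hpow δ k x t v s) (fun v ↦ C.equivariant k x t v),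
    show dmt B (B.hpow k x, t + 2 * Real.pi * k)
      (mder 𝓘(ℝ, ℂ) 𝓘(ℝ, ℂ) (B.hpow k) x w'.1, w'.2) = dmt B (x, t) w' from dmt_hpow k x t w',
    inverse_apply_of_bijective (B.mt_mder (x, t))]
  exact (dmt_hpow k x t _).symm

/-! ### The structure near the binding -/

theorem lamTube_apply {δ : ℝ} (hδ : δ ∈ Ico (0 : ℝ) 1) (i : Fin n) {x : ℝ × ℂ}
    (hx : x.2 ∈ Metric.ball (0 : ℂ) B.R) (w : ℝ × ℂ) : A.lamTube δ i x w =
      A.γ₁ i δ ‖x.2‖ * w.1 + A.γ₂ i δ ‖x.2‖ / ‖x.2‖ ^ 2 * ((starRingEnd ℂ) x.2 * w.2).im :=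
  A.tube_form δ hδ i x.1 x.2 hx w

theorem lamTube_reebTube {δ : ℝ} (hδ : δ ∈ Ico (0 : ℝ) 1) (i : Fin n) {x : ℝ × ℂ}
    (hx : x.2 ∈ Metric.ball (0 : ℂ) B.R) : A.lamTube δ i x (A.reebTube δ i x) = 1 :=
  (A.reeb_param (isOpen_univ.prod Metric.isOpen_ball) (B.tube_smooth i)
    (fun _ hy ↦ B.tube_mder i hy.2) hδ (y := x) ⟨mem_univ _, hx⟩).1

theorem γ₁_pos {δ : ℝ} (hδ : δ ∈ Ico (0 : ℝ) 1) (i : Fin n) {r : ℝ} (hr : r ∈ Ico 0 A.ρ) :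
    0 < A.γ₁ i δ r := by
  rw [(A.local_const δ hδ i r hr).1]
  rcases eq_or_lt_of_le hr.1 with h | h
  · rw [← h]; exact (A.local_model i).zero_pos
  · exact A.γ₁_zero_pos i ⟨h, hr.2.trans A.ρ_lt⟩

theorem deriv_γ_local {δ : ℝ} (hδ : δ ∈ Ico (0 : ℝ) 1) (i : Fin n) {r : ℝ} (hr : r ∈ Ioo 0 A.ρ) :
    deriv (A.γ₁ i δ) r = deriv (A.γ₁ i 0) r ∧ deriv (A.γ₂ i δ) r = deriv (A.γ₂ i 0) r := by
  constructor <;> apply EventuallyEq.deriv_eq <;>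
    filter_upwards [Ioo_mem_nhds hr.1 hr.2] with s hs
  · exact (A.local_const δ hδ i s ⟨hs.1.le, hs.2⟩).1
  · exact (A.local_const δ hδ i s ⟨hs.1.le, hs.2⟩).2

/-- Near the binding the Reeb vector fields do not depend on the parameter. -/
theorem reeb_local {δ : ℝ} (hδ : δ ∈ Ico (0 : ℝ) 1) (i : Fin n) {r : ℝ} (hr : r ∈ Ioo 0 A.ρ)
    (θ φ : ℝ) : ∃ xθ y : ℝ,
      pullField (𝓡 3) (A.X δ) (B.slide (B.pageEnd i)) ((r, θ), φ) = ((0, xθ), y) ∧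
      A.γ₁ i 0 r * xθ + A.γ₂ i 0 r * y = 1 ∧
      deriv (A.γ₁ i 0) r * xθ + deriv (A.γ₂ i 0) r * y = 0 ∧
      y * profileMu (A.γ₁ i 0) (A.γ₂ i 0) r = -deriv (A.γ₁ i 0) r := by
  have hrR : r ∈ Ioo 0 B.R := ⟨hr.1, hr.2.trans A.ρ_lt_R⟩
  obtain ⟨h1, h2, h3⟩ := A.reeb_polar hδ i hrR θ φ rfl
  rw [(A.local_const δ hδ i r ⟨hr.1.le, hr.2⟩).1, (A.local_const δ hδ i r ⟨hr.1.le, hr.2⟩).2] at h1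
  rw [(A.deriv_γ_local hδ i hr).1, (A.deriv_γ_local hδ i hr).2] at h2
  rw [(A.deriv_γ_local hδ i hr).1] at h3
  have h4 := ((A.local_model i).deriv_neg r hr).ne
  refine ⟨_, _, Prod.ext (Prod.ext ((mul_eq_zero.1 h3).resolve_left h4) rfl) rfl, h1, h2, ?_⟩
  unfold profileMu
  linear_combination A.γ₁ i 0 r * h2 - deriv (A.γ₁ i 0) r * h1

/-- Off the core circle the two descriptions agree by `tubeEndo_polar`; on it the formula is the
definition, up to the choice of `θ` modulo `2π`. The right-hand side has smooth coefficients across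
`z = 0`, and this is how smoothness at the binding is obtained. -/
theorem kerEndo_tube {δ : ℝ} (hδ : δ ∈ Ico (0 : ℝ) 1) (i : Fin n) {x : ℝ × ℂ}
    (hx : x.2 ∈ Metric.ball (0 : ℂ) (P i).ρ₁) (w : ℝ × ℂ) :
    A.kerEndo C δ (B.tube i x) (dtube B i x w) =
      dtube B i x (tubeEndo (A.lamTube δ i x) (A.reebTube δ i x).2 w) := by
  obtain ⟨θ, z⟩ := x
  have hρ₁ := (P i).ρ₁_mem
  have hzρ : ‖z‖ < (P i).ρ₁ := by simpa using hx
  have hzR : z ∈ Metric.ball (0 : ℂ) B.R := by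
    simpa using hzρ.trans (hρ₁.2.trans A.ρ_lt_R)
  by_cases hz : z = 0
  · subst hz
    have hn : ¬ ∃ q, B.mt q = B.tube i (θ, 0) := by
      rintro ⟨⟨x, t⟩, h⟩; exact B.mt_ne_tube_zero x t i θ h
    have h : ∃ x : Fin n × ℝ, B.tube x.1 (x.2, 0) = B.tube i (θ, 0) := ⟨(i, θ), rfl⟩
    rw [kerEndo, dif_neg hn, dif_pos h]
    obtain ⟨⟨i', θ'⟩, hq⟩ : ∃ q', q' = h.choose := ⟨_, rfl⟩
    have hc := h.choose_spec
    rw [← hq] at hc ⊢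
    obtain ⟨hi, -, k, hk⟩ := (B.tube_eq_iff _ _ _ hzR _ hzR _ _).1 hc
    simp only at hi hk hc ⊢
    subst hi
    subst hk
    have hder : dtube B i' (θ' + 2 * Real.pi * k, 0) = dtube B i' (θ', 0) := by
      have h1 : B.tube i' =ᶠ[𝓝 (θ', 0)]
          fun x ↦ B.tube i' ((fun x : ℝ × ℂ ↦ (x.1 + 2 * Real.pi * k, x.2)) x) := by
        filter_upwards [(isOpen_univ.prod Metric.isOpen_ball).mem_nhds
          (⟨mem_univ _, hzR⟩ : (θ', (0 : ℂ)) ∈ (univ : Set ℝ) ×ˢ Metric.ball (0 : ℂ) B.R)] with x hx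
        exact (B.tube_add i' hx.2 x.1 k).symm
      refine ContinuousLinearMap.ext fun w ↦ ?_
      unfold dtube
      have hd : HasFDerivAt (fun x : ℝ × ℂ ↦ (x.1 + 2 * Real.pi * k, x.2))
          (ContinuousLinearMap.id ℝ (ℝ × ℂ)) (θ', 0) := by
        have := (hasFDerivAt_id (𝕜 := ℝ) ((θ', 0) : ℝ × ℂ)).add_const
          ((2 * Real.pi * k, 0) : ℝ × ℂ)
        refine this.congr_of_eventuallyEq (Eventually.of_forall fun x ↦ ?_)
        refine Prod.ext ?_ ?_ <;> simp
      conv_rhs => rw [mder_congr h1]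
      refine Eq.symm ((mder_comp_apply (g := B.tube i')
        (f := fun x : ℝ × ℂ ↦ (x.1 + 2 * Real.pi * k, x.2)) (θ', 0) ?_
        hd.differentiableAt.mdifferentiableAt w).trans ?_)
      · exact ((B.tube_smooth i').contMDiffAt ((isOpen_univ.prod Metric.isOpen_ball).mem_nhds
          ⟨mem_univ _, hzR⟩)).mdifferentiableAt (by simp)
      · rw [mder_eq_fderiv, hd.fderiv]; rfl
    have hform : A.lamTube δ i' (θ' + 2 * Real.pi * k, 0) = A.lamTube δ i' (θ', 0) :=
      ContinuousLinearMap.ext fun w ↦ by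
        rw [A.lamTube_apply hδ i' hzR, A.lamTube_apply hδ i' hzR]
    have hfield : A.reebTube δ i' (θ' + 2 * Real.pi * k, 0) = A.reebTube δ i' (θ', 0) := by
      change (dtube B i' _).inverse (A.reebE δ _) = (dtube B i' _).inverse (A.reebE δ _)
      rw [hder, hc]
    rw [hder, hform, hfield]
    simp only [ContinuousLinearMap.comp_apply]
    rw [inverse_apply_of_bijective (B.tube_mder i' (x := (θ', 0)) hzR)]
  · set r := ‖z‖ with hrd
    set φ := z.arg with hφd
    have hr : r ∈ Ioo 0 (P i).ρ₁ := ⟨norm_pos_iff.2 hz, hzρ⟩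
    have hrρ : r ∈ Ioo 0 A.ρ := ⟨hr.1, hr.2.trans hρ₁.2⟩
    have hrε : r ∈ Ioo 0 (1 - A.ε) := ⟨hr.1, hrρ.2.trans A.ρ_lt⟩
    have hrR : r ∈ Ioo 0 B.R := ⟨hr.1, hrρ.2.trans A.ρ_lt_R⟩
    have hzp : z = r * Complex.exp (φ * Complex.I) := exists_polar z
    have hqD : (r, θ) ∈ B.endDom := ⟨hrR, mem_univ _⟩
    obtain ⟨xθ, y, hX, hX1, -, hX3⟩ := A.reeb_local hδ i hrρ θ φ
    have hβ := (P i).β_pos r hrR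
    have hγ := A.γ₁_pos zero_mem' i (r := r) ⟨hr.1.le, hrρ.2⟩
    have hμ := (A.local_model i).mu_pos r hrρ
    have hd := (A.local_model i).deriv_neg r hrρ
    have hy : y ≠ 0 := by
      rintro rfl; rw [zero_mul] at hX3; linarith
    -- `β_eq` reads `β γ₁ (y μ) r = μ` once `-γ₁'` is written as `y μ`; then `μ` cancels.
    have hβy : r * (P i).β r * A.γ₁ i 0 r * y = 1 := by
      have h1 := (P i).β_eq r hr
      rw [← hX3] at h1
      have h2 : (r * (P i).β r * A.γ₁ i 0 r * y - 1) * profileMu (A.γ₁ i 0) (A.γ₂ i 0) r = 0 := by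
        linear_combination h1
      have := (mul_eq_zero.1 h2).resolve_right hμ.ne'
      linarith
    set D := mder 𝓘(ℝ, ℝ × ℝ) 𝓘(ℝ, ℂ) (B.pageEnd i) (r, θ) with hD
    have hpt : B.tube i (θ, z) = B.mt (B.pageEnd i (r, θ), φ) := by
      rw [B.mt_pageEnd i r hrR, ← hzp]
    have hder : ∀ w : (ℝ × ℝ) × ℝ, dtube B i (θ, z) (w.1.2, ((w.1.1 : ℂ) + r * w.2 * Complex.I) *
        Complex.exp ((φ : ℂ) * Complex.I)) = dmt B (B.pageEnd i (r, θ), φ) (D w.1, w.2) := by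
      intro w
      have h1 := mder_slide_pageEnd (B := B) i hrR θ φ w
      have h2 := mder_slide (B := B) B.isOpen_endDom (B.pageEnd_smooth i) hqD φ w
      rw [← hzp] at h1
      exact h1.symm.trans h2
    obtain ⟨w', rfl⟩ : ∃ w' : (ℝ × ℝ) × ℝ, w = (w'.1.2,
        ((w'.1.1 : ℂ) + r * w'.2 * Complex.I) * Complex.exp ((φ : ℂ) * Complex.I)) := by
      set u := w.2 * Complex.exp (-((φ : ℂ) * Complex.I)) with hu
      refine ⟨((u.re, w.1), u.im / r), Prod.ext rfl ?_⟩
      have hr' : (r : ℂ) ≠ 0 := by exact_mod_cast hr.1.ne'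
      simp only
      have h1 : (u.re : ℂ) + r * ((u.im / r : ℝ) : ℂ) * Complex.I = u := by
        push_cast
        rw [mul_div_cancel₀ _ hr', Complex.re_add_im]
      rw [h1, hu, mul_assoc, ← Complex.exp_add]
      simp
    let j₀ : ℝ × ℝ →L[ℝ] ℝ × ℝ := (((P i).β r)⁻¹ • ContinuousLinearMap.snd ℝ ℝ ℝ).prod
      (-(P i).β r • ContinuousLinearMap.fst ℝ ℝ ℝ)
    have hj₁ : j₀ (1, 0) = (0, -(P i).β r) := by refine Prod.ext ?_ ?_ <;> simp [j₀]
    have hj₂ : j₀ (0, 1) = (((P i).β r)⁻¹, 0) := by refine Prod.ext ?_ ?_ <;> simp [j₀]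
    let l₀ : (ℝ × ℝ) × ℝ →L[ℝ] ℝ :=
      pullForm (𝓡 3) (A.lam δ) (B.slide (B.pageEnd i)) ((r, θ), φ)
    have hl₀ : ∀ w, l₀ w = A.γ₁ i 0 r * w.1.2 + A.γ₂ i 0 r * w.2 := by
      intro w
      refine (A.pullForm_polar hδ i hrR θ φ w).trans ?_
      rw [(A.local_const δ hδ i r ⟨hr.1.le, hrρ.2⟩).1, (A.local_const δ hδ i r ⟨hr.1.le, hrρ.2⟩).2]
    have hlt : ∀ w : (ℝ × ℝ) × ℝ, A.lamTube δ i (θ, z) (w.1.2,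
        ((w.1.1 : ℂ) + r * w.2 * Complex.I) * Complex.exp ((φ : ℂ) * Complex.I)) = l₀ w := by
      intro w
      change A.lamE δ (B.tube i (θ, z)) (dtube B i (θ, z) _) =
        A.lamE δ (B.slide (B.pageEnd i) ((r, θ), φ)) (mder 𝓘(ℝ, (ℝ × ℝ) × ℝ) (𝓡 3)
          (B.slide (B.pageEnd i)) ((r, θ), φ) w)
      rw [hder w, mder_slide (B := B) B.isOpen_endDom (B.pageEnd_smooth i) hqD φ w, hpt]
      rfl
    have hjD : ∀ v, C.j (B.pageEnd i (r, θ), φ) (D v) = D (j₀ v) := by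
      intro v
      obtain ⟨h1, h2⟩ := C.polar i r hrε θ φ
      have hv : v = v.1 • (1, 0) + v.2 • (0, 1) := by refine Prod.ext ?_ ?_ <;> simp
      have hv2 : j₀ v = (((P i).β r)⁻¹ * v.2) • ((1, 0) : ℝ × ℝ) +
          (-(P i).β r * v.1) • ((0, 1) : ℝ × ℝ) := by
        refine Prod.ext ?_ ?_ <;> simp [j₀]
      rw [hv2]
      conv_lhs => rw [hv]
      rw [map_add, map_smul, map_smul, map_add, map_smul, map_smul, h1, h2, map_add, map_smul,
        map_smul, smul_smul, smul_smul, add_comm]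
      congr 2 <;> ring
    have hreeb : A.reebHat δ (B.pageEnd i (r, θ), φ) = (D ((0 : ℝ), xθ), y) := by
      rw [A.reebHat_slide B.isOpen_endDom (B.pageEnd_smooth i) (fun _ hx ↦ B.pageEnd_mder i hx) hqD,
        hX]
    have hV : (A.reebTube δ i (θ, z)).2 =
        r * y * Complex.I * Complex.exp ((φ : ℂ) * Complex.I) := by
      have h1 : A.reebTube δ i (θ, z) = (xθ, ((0 : ℝ) + r * y * Complex.I) *
          Complex.exp ((φ : ℂ) * Complex.I)) := by
        apply (B.tube_mder i (x := (θ, z)) hzR).1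
        refine (mder_pullField (I' := 𝓡 3) (X := A.X δ) (B.tube_mder i (x := (θ, z)) hzR)).trans ?_
        refine Eq.trans ?_ (hder ((0, xθ), y)).symm
        refine Eq.trans ?_ (congrArg (dmt B _) hreeb)
        refine Eq.trans ?_ (A.dmt_reebHat δ _).symm
        change A.reebE δ _ = A.reebE δ _
        rw [hpt]
      rw [h1]; simp
    rw [hder w', hpt, A.kerEndo_mt, hreeb,
      hatEndo_map (l := l₀) (X := ((0, xθ), y)) (j := j₀) D
      (fun v s ↦ (A.pullForm_slide B.isOpen_endDom (B.pageEnd_smooth i) hqD δ φ (v, s)).symm) hjD,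
      hV, tubeEndo_polar hr.1.ne' hβ.ne' hγ.ne' hy hl₀ hlt hj₁ hj₂ hX1 hβy,
      hder]

end AdaptedFamily

theorem ContDiffOn.hatEndo {G E : Type*} [NormedAddCommGroup G] [NormedSpace ℝ G]
    [NormedAddCommGroup E] [NormedSpace ℝ E] {s : Set G} {l : G → E × ℝ →L[ℝ] ℝ} {X : G → E × ℝ}
    {j : G → E →L[ℝ] E} {w : G → E × ℝ} (hl : ContDiffOn ℝ ∞ l s) (hX : ContDiffOn ℝ ∞ X s)
    (hj : ContDiffOn ℝ ∞ j s) (hw : ContDiffOn ℝ ∞ w s) (h0 : ∀ x ∈ s, (X x).2 ≠ 0) :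
    ContDiffOn ℝ ∞ (fun x ↦ hatEndo (l x) (X x) (j x) (w x)) s := by
  simp only [hatEndo_apply]
  have hu : ContDiffOn ℝ ∞ (fun x ↦ j x ((w x).1 - (w x).2 • (X x).2⁻¹ • (X x).1)) s :=
    hj.clm_apply (hw.fst.sub (hw.snd.smul ((hX.snd.inv h0).smul hX.fst)))
  have hu' := hu.prodMk (contDiffOn_const (c := (0 : ℝ)))
  exact hu'.sub ((hl.clm_apply hu').smul hX)

theorem ContDiffOn.tubeEndo {G : Type*} [NormedAddCommGroup G] [NormedSpace ℝ G] {s : Set G}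
    {l : G → ℝ × ℂ →L[ℝ] ℝ} {V : G → ℂ} {w : G → ℝ × ℂ} (hl : ContDiffOn ℝ ∞ l s)
    (hV : ContDiffOn ℝ ∞ V s) (hw : ContDiffOn ℝ ∞ w s) (h0 : ∀ x ∈ s, l x (1, 0) ≠ 0) :
    ContDiffOn ℝ ∞ (fun x ↦ tubeEndo (l x) (V x) (w x)) s := by
  simp only [tubeEndo_apply]
  have hu : ContDiffOn ℝ ∞ (fun x ↦ Complex.I * ((w x).2 - l x (w x) • V x)) s :=
    contDiffOn_const.mul (hw.snd.sub ((hl.clm_apply hw).smul hV))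
  exact (((hl.clm_apply contDiffOn_const).inv h0).neg.mul
    (hl.clm_apply (contDiffOn_const.prodMk hu))).prodMk hu

/-! ### The almost complex structures. -/

namespace AdaptedFamily

open OpenBook

variable {M : Type*} [TopologicalSpace M] [ChartedSpace (EuclideanSpace ℝ (Fin 3)) M]
  [IsManifold (𝓡 3) ∞ M] [T2Space M]
  {F : Type*} [TopologicalSpace F] [ChartedSpace ℂ F] [IsManifold 𝓘(ℝ, ℂ) ∞ F] {n : ℕ}
  {B : OpenBook M F n} (A : AdaptedFamily B) {P : A.Profiles} (C : A.PageComplex P)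

/-- The almost complex structures. -/
noncomputable def acs (δ : ℝ) (p : M) :
    ℝ × EuclideanSpace ℝ (Fin 3) →L[ℝ] ℝ × EuclideanSpace ℝ (Fin 3) :=
  (-(A.lamE δ p).comp (ContinuousLinearMap.snd ℝ ℝ _)).prod
    ((ContinuousLinearMap.fst ℝ ℝ _).smulRight (A.reebE δ p) +
      (A.kerEndo C δ p).comp (ContinuousLinearMap.snd ℝ ℝ _))

theorem acs_apply (δ : ℝ) (p : M) (w : ℝ × EuclideanSpace ℝ (Fin 3)) :
    A.acs C δ p w = (-A.lamE δ p w.2, w.1 • A.reebE δ p + A.kerEndo C δ p w.2) := rfl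

variable (B) in
/-- Every point lies on a page or on the binding. -/
theorem mt_or_binding (p : M) : (∃ q, p = B.mt q) ∨ ∃ i θ, p = B.tube i (θ, 0) := by
  by_cases h : p ∈ range B.mt
  · obtain ⟨q, hq⟩ := h; exact Or.inl ⟨q, hq.symm⟩
  · have h1 : p ∈ (range B.mt)ᶜ := h
    rw [B.compl_range_mt] at h1
    obtain ⟨i, ⟨θ, z⟩, ⟨-, hz⟩, h2⟩ := mem_iUnion.1 h1
    simp only [mem_singleton_iff] at hz
    subst hz
    exact Or.inr ⟨i, θ, h2.symm⟩

theorem zero_mem_ball (i : Fin n) : (0 : ℂ) ∈ Metric.ball (0 : ℂ) (P i).ρ₁ := by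
  simpa using (P i).ρ₁_mem.1

theorem ball_subset (i : Fin n) : Metric.ball (0 : ℂ) (P i).ρ₁ ⊆ Metric.ball 0 B.R :=
  Metric.ball_subset_ball ((P i).ρ₁_mem.2.trans A.ρ_lt_R).le

theorem lamTube_one_pos {δ : ℝ} (hδ : δ ∈ Ico (0 : ℝ) 1) (i : Fin n) {x : ℝ × ℂ}
    (hx : x.2 ∈ Metric.ball (0 : ℂ) (P i).ρ₁) : 0 < A.lamTube δ i x (1, 0) := by
  rw [A.lamTube_apply hδ i (A.ball_subset (P := P) i hx)]
  have h : ‖x.2‖ < (P i).ρ₁ := by simpa using hx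
  simpa using A.γ₁_pos hδ i ⟨norm_nonneg _, h.trans (P i).ρ₁_mem.2⟩

theorem lamE_reebE {δ : ℝ} (hδ : δ ∈ Ico (0 : ℝ) 1) (p : M) : A.lamE δ p (A.reebE δ p) = 1 :=
  (A.reeb_all hδ p).2

/-- The three identities from which the algebra of `J̃` follows. Over the pages they are properties
of `hatEndo`, on the binding of `tubeEndo`. -/
theorem kerEndo_spec {δ : ℝ} (hδ : δ ∈ Ico (0 : ℝ) 1) (p : M) (v : EuclideanSpace ℝ (Fin 3)) :
    A.lamE δ p (A.kerEndo C δ p v) = 0 ∧ A.kerEndo C δ p (A.reebE δ p) = 0 ∧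
      A.kerEndo C δ p (A.kerEndo C δ p v) = -v + A.lamE δ p v • A.reebE δ p := by
  rcases mt_or_binding B p with ⟨q, rfl⟩ | ⟨i, θ, rfl⟩
  · obtain ⟨w, rfl⟩ := (B.mt_mder q).2 v
    have h1 : dmt B q (A.reebHat δ q) = A.reebE δ (B.mt q) := A.dmt_reebHat δ q
    have h2 : ∀ w, A.lamE δ (B.mt q) (dmt B q w) = A.lamHat δ q w := fun _ ↦ rfl
    have h3 := A.lamHat_reebHat hδ q
    have h4 := A.reebHat_snd_ne_zero hδ q
    rw [← h1, A.kerEndo_mt, A.kerEndo_mt, A.kerEndo_mt, h2, form_hatEndo h3, hatEndo_self h4,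
      hatEndo_hatEndo h3 h4 (C.sq q), h2]
    simp
  · have hb := A.zero_mem_ball (P := P) i
    have hb' := A.ball_subset (P := P) i hb
    obtain ⟨w, rfl⟩ := (B.tube_mder i (x := (θ, 0)) hb').2 v
    have h1 : dtube B i (θ, 0) (A.reebTube δ i (θ, 0)) = A.reebE δ (B.tube i (θ, 0)) :=
      mder_pullField (I' := 𝓡 3) (X := A.X δ) (B.tube_mder i (x := (θ, 0)) hb')
    have h2 : ∀ w, A.lamE δ (B.tube i (θ, 0)) (dtube B i (θ, 0) w) = A.lamTube δ i (θ, 0) w :=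
      fun _ ↦ rfl
    have h3 := A.lamTube_reebTube hδ i (x := (θ, 0)) hb'
    have h4 := (A.lamTube_one_pos (P := P) hδ i (x := (θ, 0)) hb).ne'
    rw [← h1, A.kerEndo_tube C hδ i (x := (θ, 0)) hb, A.kerEndo_tube C hδ i (x := (θ, 0)) hb,
      A.kerEndo_tube C hδ i (x := (θ, 0)) hb, h2, form_tubeEndo h4, tubeEndo_self h3,
      tubeEndo_tubeEndo h3 h4, h2]
    simp

theorem acs_acs {δ : ℝ} (hδ : δ ∈ Ico (0 : ℝ) 1) (p : M) (v : ℝ × EuclideanSpace ℝ (Fin 3)) :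
    A.acs C δ p (A.acs C δ p v) = -v := by
  obtain ⟨h1, h2, h3⟩ := A.kerEndo_spec C hδ p v.2
  rw [acs_apply, acs_apply]
  simp only [map_add, map_smul, h1, h2, h3, A.lamE_reebE hδ]
  refine Prod.ext ?_ ?_
  · simp
  · simp

theorem acs_reeb {δ : ℝ} (hδ : δ ∈ Ico (0 : ℝ) 1) (p : M) :
    A.acs C δ p (0, A.reebE δ p) = (-1, 0) := by
  rw [acs_apply]
  simp only [A.lamE_reebE hδ, (A.kerEndo_spec C hδ p 0).2.1, zero_smul, add_zero]

theorem acs_ker {δ : ℝ} (hδ : δ ∈ Ico (0 : ℝ) 1) (p : M) {v : EuclideanSpace ℝ (Fin 3)}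
    (hv : A.lamE δ p v = 0) : A.acs C δ p (0, v) = (0, A.kerEndo C δ p v) ∧
      A.lamE δ p (A.kerEndo C δ p v) = 0 := by
  rw [acs_apply]
  simp only [hv, zero_smul, zero_add, neg_zero, (A.kerEndo_spec C hδ p v).1, and_self]

/-! ### Compatibility -/

/-- Near the core the form is `γ₁ dθ + g · (x dy - y dx)` with `g = γ₂/r²`. At `z = 0` only the
derivative of `x dy - y dx` survives in the disk directions, which gives `2 g(0) dx ∧ dy`. -/
theorem pullD_tube {δ : ℝ} (hδ : δ ∈ Ico (0 : ℝ) 1) (i : Fin n) : ∃ c > (0 : ℝ), ∀ θ : ℝ,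
    ∀ v w : ℂ, pullD (A.lam δ) (B.tube i) (θ, 0) (0, v) (0, w) =
      c * ((starRingEnd ℂ) v * w).im := by
  obtain ⟨g, hg, hg'⟩ := (A.local_model i).smooth₂_div
  have hg0 := (A.local_model i).div_pos A.ρ_pos hg hg'
  refine ⟨2 * g 0, by positivity, fun θ ↦ ?_⟩
  have ho : IsOpen ((univ : Set ℝ) ×ˢ Metric.ball (0 : ℂ) B.R) := isOpen_univ.prod Metric.isOpen_ball
  have h0 : (θ, (0 : ℂ)) ∈ (univ : Set ℝ) ×ˢ Metric.ball (0 : ℂ) B.R :=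
    ⟨mem_univ _, by simpa using B.R_pos⟩
  have hsm : ContDiffOn ℝ ∞ (fun x ↦ pullForm (𝓡 3) (A.lam δ) (B.tube i) x) _ :=
    contDiffOn_slice (contDiffOn_pullForm A.lam_smooth ho (B.tube_smooth i)) hδ
  have hfd := ((hsm.contDiffAt (ho.mem_nhds h0)).differentiableAt (by simp)).hasFDerivAt
  have key : ∀ v w : ℂ, fderiv ℝ (fun x ↦ pullForm (𝓡 3) (A.lam δ) (B.tube i) x) (θ, 0) (0, v)
      (0, w) = g 0 * ((starRingEnd ℂ) v * w).im := by
    intro v w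
    have h1 : HasFDerivAt (fun x ↦ pullForm (𝓡 3) (A.lam δ) (B.tube i) x (0, w)) _ (θ, 0) :=
      hfd.clm_apply (hasFDerivAt_const ((0 : ℝ), w) _)
    have h2 : HasFDerivAt (fun z : ℂ ↦ pullForm (𝓡 3) (A.lam δ) (B.tube i) (θ, z) (0, w)) _ 0 :=
      HasFDerivAt.comp (f := fun z : ℂ ↦ (θ, z)) (0 : ℂ) h1 (hasFDerivAt_prodMk_right (𝕜 := ℝ) θ 0)
    have h3 : (fun z : ℂ ↦ pullForm (𝓡 3) (A.lam δ) (B.tube i) (θ, z) (0, w)) =ᶠ[𝓝 0]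
        fun z ↦ g z * ((starRingEnd ℂ) z * w).im := by
      filter_upwards [Metric.ball_mem_nhds (0 : ℂ) A.ρ_pos] with z hz
      have hz' : ‖z‖ < A.ρ := by simpa using hz
      have hzR : z ∈ Metric.ball (0 : ℂ) B.R := by simpa using hz'.trans A.ρ_lt_R
      refine (A.lamTube_apply hδ i (x := (θ, z)) hzR (0, w)).trans ?_
      simp only [mul_zero, zero_add]
      rw [(A.local_const δ hδ i _ ⟨norm_nonneg _, hz'⟩).2, hg' z hz]
      by_cases hz0 : z = 0
      · simp [hz0]
      · have : ‖z‖ ≠ 0 := norm_ne_zero_iff.2 hz0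
        field_simp
    have h4 : HasFDerivAt g (fderiv ℝ g 0) 0 :=
      ((hg.contDiffAt (Metric.ball_mem_nhds 0 A.ρ_pos)).differentiableAt (by simp)).hasFDerivAt
    let T : ℂ →L[ℝ] ℝ := Complex.imCLM.comp
      (((ContinuousLinearMap.mul ℝ ℂ).flip w).comp (Complex.conjCLE : ℂ →L[ℝ] ℂ))
    have h5 : HasFDerivAt (fun z : ℂ ↦ ((starRingEnd ℂ) z * w).im) T 0 := T.hasFDerivAt
    have h6 := (h4.mul h5).congr_of_eventuallyEq h3
    have h7 := congrArg (fun L ↦ L v) (h2.unique h6)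
    have h8 : ((starRingEnd ℂ) v * w).im = -(w.re * v.im) + w.im * v.re := by simp; ring
    simp [T] at h7
    rw [h8]
    exact h7
  intro v w
  unfold pullD
  refine (congrArg₂ (· - ·) (key v w) (key w v)).trans ?_
  simp
  ring

/-- As `i_X dλ = 0`, only the components tangent to the page count, and `dλ(v, J w)` is the area of
`ζ` and `j η` on the page. Symmetry and sign come from the complex structure, together with the
independence of the orientation from `δ`. On the binding `ker λ` is the tangent plane of the disk
and `J` is multiplication by `i`. -/
theorem extD_kerEndo {δ : ℝ} (hδ : δ ∈ Ioo (0 : ℝ) 1) (p : M) {v w : EuclideanSpace ℝ (Fin 3)}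
    (hv : A.lamE δ p v = 0) (hw : A.lamE δ p w = 0) :
    extD (A.lam δ) p v (A.kerEndo C δ p w) = extD (A.lam δ) p w (A.kerEndo C δ p v) ∧
      (v ≠ 0 → 0 < extD (A.lam δ) p v (A.kerEndo C δ p v)) := by
  have hδ' : δ ∈ Ico (0 : ℝ) 1 := Ioo_subset_Ico_self hδ
  rcases mt_or_binding B p with ⟨q, rfl⟩ | ⟨i, θ, rfl⟩
  · have hy := A.reebHat_snd_ne_zero hδ' q
    set X := A.reebHat δ q with hX
    have hred : ∀ v : EuclideanSpace ℝ (Fin 3), ∃ ζ : ℂ, ∃ c : ℝ,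
        v = dmt B q (ζ, 0) + c • dmt B q X := by
      intro v
      obtain ⟨w, rfl⟩ := (B.mt_mder q).2 v
      refine ⟨w.1 - w.2 • X.2⁻¹ • X.1, w.2 * X.2⁻¹, ?_⟩
      rw [← map_smul, ← map_add]
      exact congrArg (dmt B q) (hatEndo_decomp hy w)
    have hl : A.lamHat δ q X = 1 := A.lamHat_reebHat hδ' q
    have hval : ∀ (ζ η : ℂ) (c d : ℝ), extD (A.lam δ) (B.mt q)
        (dmt B q (ζ, 0) + c • dmt B q X : EuclideanSpace ℝ (Fin 3))
        (A.kerEndo C δ (B.mt q) (dmt B q (η, 0) + d • dmt B q X)) =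
        planeDet ζ (C.j q η) * A.pageArea δ q := by
      intro ζ η c d
      have h1 : A.kerEndo C δ (B.mt q) (dmt B q (η, 0) + d • dmt B q X) =
          dmt B q (C.j q η, 0) + (-A.lamHat δ q (C.j q η, 0)) • dmt B q X := by
        rw [map_add, map_smul, A.kerEndo_mt, A.kerEndo_mt, hatEndo_self hy, hatEndo_fst]
        simp [sub_eq_add_neg, ← hX]
      rw [h1, extD_add_left, extD_smul_left, A.extD_reebHat hδ', mul_zero, add_zero, extD_swap,
        extD_add_left, extD_smul_left, A.extD_reebHat hδ', mul_zero, add_zero, ← extD_swap,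
        A.extD_page]
    obtain ⟨ζ, c, rfl⟩ := hred v
    obtain ⟨η, d, rfl⟩ := hred w
    rw [hval, hval, hval, C.symm]
    refine ⟨rfl, fun hne ↦ ?_⟩
    have hζ : ζ ≠ 0 := by
      rintro rfl
      apply hne
      have h2 : A.lamHat δ q ((0 : ℂ), (0 : ℝ)) + c * A.lamHat δ q X = 0 := by
        have : A.lamE δ (B.mt q) (dmt B q (0, 0) + c • dmt B q X) =
          A.lamHat δ q (0, 0) + c * A.lamHat δ q X := by rw [map_add, map_smul]; rfl
        rw [← this]; exact hv
      rw [show ((0 : ℂ), (0 : ℝ)) = 0 from rfl, map_zero, hl] at h2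
      have h3 : c = 0 := by linarith
      rw [h3, show ((0 : ℂ), (0 : ℝ)) = 0 from rfl, map_zero]
      simp
    have h4 := C.pos q ζ hζ
    have h5 := A.pageArea_mul_pos hδ q
    -- The product of the two sign conditions contains the square of the area at `1/2`, which may be
    -- divided out.
    have h6 : 0 < A.pageArea (1 / 2) q ^ 2 * (planeDet ζ (C.j q ζ) * A.pageArea δ q) := by
      have := mul_pos h4 h5
      nlinarith
    exact (pos_iff_pos_of_mul_pos h6).1 (by
      have := A.pageArea_ne_zero half_mem q
      positivity)
  · have hb := A.zero_mem_ball (P := P) i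
    have hb' := A.ball_subset (P := P) i hb
    obtain ⟨c, hc, hval⟩ := A.pullD_tube hδ' i
    have ho : IsOpen ((univ : Set ℝ) ×ˢ Metric.ball (0 : ℂ) B.R) :=
      isOpen_univ.prod Metric.isOpen_ball
    have h4 := (A.lamTube_one_pos (P := P) hδ' i (x := (θ, 0)) hb).ne'
    have hred : ∀ v : EuclideanSpace ℝ (Fin 3), A.lamE δ (B.tube i (θ, 0)) v = 0 →
        ∃ ζ : ℂ, v = dtube B i (θ, 0) (0, ζ) := by
      intro v hv
      obtain ⟨w, rfl⟩ := (B.tube_mder i (x := (θ, 0)) hb').2 v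
      have h1 : A.lamTube δ i (θ, 0) w = 0 := hv
      rw [A.lamTube_apply hδ' i hb'] at h1 h4
      simp at h1 h4
      refine ⟨w.2, ?_⟩
      have : w = (0, w.2) := Prod.ext (h1.resolve_left h4) rfl
      rw [← this]
    have hker : ∀ ζ : ℂ, A.kerEndo C δ (B.tube i (θ, 0)) (dtube B i (θ, 0) (0, ζ)) =
        dtube B i (θ, 0) (0, Complex.I * ζ) := by
      intro ζ
      have h5 : ∀ u, A.lamTube δ i (θ, 0) (0, u) = 0 := fun u ↦ by
        rw [A.lamTube_apply hδ' i hb']; simp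
      rw [A.kerEndo_tube C hδ' i (x := (θ, 0)) hb, tubeEndo_apply, h5]
      simp only [zero_smul, sub_zero, h5, mul_zero]
    obtain ⟨ζ, rfl⟩ := hred v hv
    obtain ⟨η, rfl⟩ := hred w hw
    have hE : ∀ a b : ℂ, extD (A.lam δ) (B.tube i (θ, 0)) (dtube B i (θ, 0) (0, a))
        (dtube B i (θ, 0) (0, b)) = c * ((starRingEnd ℂ) a * b).im := fun a b ↦ by
      rw [← hval θ a b]
      exact extD_mder A.lam_smooth hδ' ho (B.tube_smooth i) ⟨mem_univ _, hb'⟩ (0, a) (0, b)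
    rw [hker, hker, hE, hE, hE]
    refine ⟨?_, fun hne ↦ ?_⟩
    · congr 1; simp; ring
    · have hζ : ζ ≠ 0 := by
        rintro rfl
        exact hne (by rw [show ((0 : ℝ), (0 : ℂ)) = 0 from rfl, map_zero])
      refine mul_pos hc ?_
      have := Complex.normSq_pos.2 hζ
      rw [Complex.normSq_apply] at this
      simp
      linarith

/-! ### Smoothness -/

/-- The coordinate `τ` of the vector along `ℝ` is treated as a parameter besides `δ`, so that the
`TM`-component of `J̃` becomes a field of maps on `TM` alone. It is represented by `hatEndo` in a
chart of the page and by `tubeEndo` in a tube. -/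
theorem contMDiffWithinAt_kerEndo {δ : ℝ} (hδ : δ ∈ Ico (0 : ℝ) 1) (τ : ℝ)
    (v : TangentBundle (𝓡 3) M) :
    ContMDiffWithinAt (𝓘(ℝ, ℝ × ℝ).prod (𝓡 3).tangent) (𝓡 3).tangent ∞
      (fun q : (ℝ × ℝ) × TangentBundle (𝓡 3) M ↦ (⟨q.2.proj,
        (q.1.2 • A.reebE q.1.1 q.2.proj + A.kerEndo C q.1.1 q.2.proj q.2.snd :
          EuclideanSpace ℝ (Fin 3))⟩ : TangentBundle (𝓡 3) M))
      ((Ico 0 1 ×ˢ univ) ×ˢ univ) ((δ, τ), v) := by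
  have hc1 : ∀ {E : Type} [NormedAddCommGroup E] [NormedSpace ℝ E] {O : Set E},
      ContDiffOn ℝ ∞ (fun q : (ℝ × ℝ) × (E × E) ↦ (q.1.1, q.2.1))
        ((Ico 0 1 ×ˢ univ) ×ˢ (O ×ˢ univ)) := by
    intro E _ _ O; exact ContDiff.contDiffOn (by fun_prop)
  have hc2 : ∀ {E : Type} [NormedAddCommGroup E] [NormedSpace ℝ E] {s : Set _},
      ContDiffOn ℝ ∞ (fun q : (ℝ × ℝ) × (E × E) ↦ q.1.2) s := by
    intro E _ _ s; exact ContDiff.contDiffOn (by fun_prop)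
  have hc3 : ∀ {E : Type} [NormedAddCommGroup E] [NormedSpace ℝ E] {s : Set _},
      ContDiffOn ℝ ∞ (fun q : (ℝ × ℝ) × (E × E) ↦ q.2.2) s := by
    intro E _ _ s; exact ContDiff.contDiffOn (by fun_prop)
  rcases mt_or_binding B v.proj with ⟨⟨x, t⟩, hv⟩ | ⟨i, θ, hv⟩
  · obtain ⟨hs, hd⟩ := chart_param x
    have ho := isOpen_extChartAt_target (I := 𝓘(ℝ, ℂ)) x
    have hxy : (extChartAt 𝓘(ℝ, ℂ) x).symm (extChartAt 𝓘(ℝ, ℂ) x x) = x := extChartAt_to_inv x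
    have hyO := mem_extChartAt_target (I := 𝓘(ℝ, ℂ)) x
    set σ := (extChartAt 𝓘(ℝ, ℂ) x).symm with hσ
    set O := (extChartAt 𝓘(ℝ, ℂ) x).target with hO
    have hd' := fun (q : ℂ × ℝ) (hq : q ∈ O ×ˢ (univ : Set ℝ)) ↦
      bijective_mder_slide (B := B) ho hs hd hq
    obtain ⟨j', hj', hj''⟩ := C.smooth σ O ho hs hd
    have hO' : IsOpen (O ×ˢ (univ : Set ℝ)) := ho.prod isOpen_univ
    have hX : ContDiffOn ℝ ∞ (fun q : (ℝ × ℝ) × ((ℂ × ℝ) × (ℂ × ℝ)) ↦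
        pullField (𝓡 3) (A.X q.1.1) (B.slide σ) q.2.1)
        ((Ico 0 1 ×ˢ univ) ×ˢ ((O ×ˢ univ) ×ˢ univ)) :=
      (contDiffOn_pullField A.X_smooth hO' (contMDiffOn_slide hs) hd').comp hc1
        fun q hq ↦ ⟨hq.1.1, hq.2.1⟩
    have hl : ContDiffOn ℝ ∞ (fun q : (ℝ × ℝ) × ((ℂ × ℝ) × (ℂ × ℝ)) ↦
        pullForm (𝓡 3) (A.lam q.1.1) (B.slide σ) q.2.1)
        ((Ico 0 1 ×ˢ univ) ×ˢ ((O ×ˢ univ) ×ˢ univ)) :=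
      (contDiffOn_pullForm A.lam_smooth hO' (contMDiffOn_slide hs)).comp hc1
        fun q hq ↦ ⟨hq.1.1, hq.2.1⟩
    have hj : ContDiffOn ℝ ∞ (fun q : (ℝ × ℝ) × ((ℂ × ℝ) × (ℂ × ℝ)) ↦ j' q.2.1)
        ((Ico 0 1 ×ˢ univ) ×ˢ ((O ×ˢ univ) ×ˢ univ)) :=
      hj'.comp (contDiff_fst.comp contDiff_snd).contDiffOn fun q hq ↦ hq.2.1
    refine contMDiffWithinAt_endoField (ψ := B.slide σ) (O := O ×ˢ univ) (S := Ico 0 1 ×ˢ univ)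
      (Y := fun (q : ℝ × ℝ) p v ↦ (q.2 • A.reebE q.1 p + A.kerEndo C q.1 p v : EuclideanSpace ℝ (Fin 3)))
      (Y' := fun q : (ℝ × ℝ) × ((ℂ × ℝ) × (ℂ × ℝ)) ↦ q.1.2 • pullField (𝓡 3) (A.X q.1.1) (B.slide σ) q.2.1 +
        hatEndo (pullForm (𝓡 3) (A.lam q.1.1) (B.slide σ) q.2.1)
          (pullField (𝓡 3) (A.X q.1.1) (B.slide σ) q.2.1) (j' q.2.1) q.2.2)
      hO' (contMDiffOn_slide hs) hd' ?_ ?_ ⟨hδ, mem_univ _⟩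
      (y₀ := (extChartAt 𝓘(ℝ, ℂ) x x, t)) ⟨hyO, mem_univ _⟩ ?_
    · refine (hc2.smul hX).add (ContDiffOn.hatEndo hl hX hj hc3 fun q hq ↦ ?_)
      have h1 := A.reebHat_snd_ne_zero hq.1.1 (σ q.2.1.1, q.2.1.2)
      rwa [A.reebHat_slide ho hs hd hq.2.1.1] at h1
    · rintro ⟨δ, τ⟩ hδ ⟨y, t⟩ hy w
      have h1 : mder 𝓘(ℝ, ℂ × ℝ) (𝓡 3) (B.slide σ) (y, t)
          (pullField (𝓡 3) (A.X δ) (B.slide σ) (y, t)) = A.reebE δ (B.slide σ (y, t)) :=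
        mder_pullField (I' := 𝓡 3) (X := A.X δ) (hd' (y, t) hy)
      simp only [map_add, map_smul, h1]
      congr 1
      rw [mder_slide ho hs hy.1, mder_slide ho hs hy.1]
      refine (A.kerEndo_mt C δ (σ y, t) _).trans ?_
      rw [A.reebHat_slide ho hs hd hy.1, hatEndo_map
        (l := pullForm (𝓡 3) (A.lam δ) (B.slide σ) (y, t))
        (X := pullField (𝓡 3) (A.X δ) (B.slide σ) (y, t)) (j := j' (y, t)) _
        (fun v s ↦ (A.pullForm_slide ho hs hy.1 δ t (v, s)).symm) (fun v ↦ hj'' y hy.1 t v)]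
    · rw [hv, slide, hxy]
  · have hb := A.zero_mem_ball (P := P) i
    have hsub := A.ball_subset (P := P) i
    have hO' : IsOpen ((univ : Set ℝ) ×ˢ Metric.ball (0 : ℂ) (P i).ρ₁) :=
      isOpen_univ.prod Metric.isOpen_ball
    have hs : ContMDiffOn 𝓘(ℝ, ℝ × ℂ) (𝓡 3) ∞ (B.tube i)
        ((univ : Set ℝ) ×ˢ Metric.ball (0 : ℂ) (P i).ρ₁) :=
      (B.tube_smooth i).mono (prod_mono subset_rfl hsub)
    have hd' : ∀ x ∈ (univ : Set ℝ) ×ˢ Metric.ball (0 : ℂ) (P i).ρ₁,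
        Function.Bijective (mder 𝓘(ℝ, ℝ × ℂ) (𝓡 3) (B.tube i) x) :=
      fun x hx ↦ B.tube_mder i (hsub hx.2)
    have hX : ContDiffOn ℝ ∞ (fun q : (ℝ × ℝ) × ((ℝ × ℂ) × (ℝ × ℂ)) ↦
        pullField (𝓡 3) (A.X q.1.1) (B.tube i) q.2.1)
        ((Ico 0 1 ×ˢ univ) ×ˢ (((univ : Set ℝ) ×ˢ Metric.ball (0 : ℂ) (P i).ρ₁) ×ˢ univ)) :=
      (contDiffOn_pullField A.X_smooth hO' hs hd').comp hc1 fun q hq ↦ ⟨hq.1.1, hq.2.1⟩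
    have hl : ContDiffOn ℝ ∞ (fun q : (ℝ × ℝ) × ((ℝ × ℂ) × (ℝ × ℂ)) ↦
        pullForm (𝓡 3) (A.lam q.1.1) (B.tube i) q.2.1)
        ((Ico 0 1 ×ˢ univ) ×ˢ (((univ : Set ℝ) ×ˢ Metric.ball (0 : ℂ) (P i).ρ₁) ×ˢ univ)) :=
      (contDiffOn_pullForm A.lam_smooth hO' hs).comp hc1 fun q hq ↦ ⟨hq.1.1, hq.2.1⟩
    refine contMDiffWithinAt_endoField (ψ := B.tube i)
      (O := (univ : Set ℝ) ×ˢ Metric.ball (0 : ℂ) (P i).ρ₁) (S := Ico 0 1 ×ˢ univ)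
      (Y := fun (q : ℝ × ℝ) p v ↦ (q.2 • A.reebE q.1 p + A.kerEndo C q.1 p v : EuclideanSpace ℝ (Fin 3)))
      (Y' := fun q : (ℝ × ℝ) × ((ℝ × ℂ) × (ℝ × ℂ)) ↦ q.1.2 • pullField (𝓡 3) (A.X q.1.1) (B.tube i) q.2.1 +
        tubeEndo (pullForm (𝓡 3) (A.lam q.1.1) (B.tube i) q.2.1)
          (pullField (𝓡 3) (A.X q.1.1) (B.tube i) q.2.1).2 q.2.2)
      hO' hs hd' ?_ ?_ ⟨hδ, mem_univ _⟩ (y₀ := (θ, 0)) ⟨mem_univ _, hb⟩ hv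
    · exact (hc2.smul hX).add (ContDiffOn.tubeEndo hl hX.snd hc3 fun q hq ↦
        (A.lamTube_one_pos (P := P) hq.1.1 i hq.2.1.2).ne')
    · rintro ⟨δ, τ⟩ hδ y hy w
      have h1 : mder 𝓘(ℝ, ℝ × ℂ) (𝓡 3) (B.tube i) y
          (pullField (𝓡 3) (A.X δ) (B.tube i) y) = A.reebE δ (B.tube i y) :=
        mder_pullField (I' := 𝓡 3) (X := A.X δ) (hd' y hy)
      simp only [map_add, map_smul, h1]
      congr 1
      exact A.kerEndo_tube C hδ.1 i hy.2 w

theorem isAlmostComplexFamily_acs :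
    IsAlmostComplexFamily (fun δ p ↦ A.acs C δ p : ℝ → InvEndField M) := by
  refine ⟨fun δ hδ p v ↦ A.acs_acs C hδ p v, ?_⟩
  rintro ⟨δ, τ, v⟩ hq
  have e1 : ContMDiffWithinAt (𝓘(ℝ, ℝ).prod (𝓘(ℝ, ℝ).prod (𝓡 3).tangent)) 𝓘(ℝ, ℝ) ∞
      (fun q : ℝ × (ℝ × TangentBundle (𝓡 3) M) ↦ q.1) (Ico 0 1 ×ˢ univ) (δ, τ, v) :=
    contMDiffWithinAt_fst
  have e2 : ContMDiffWithinAt (𝓘(ℝ, ℝ).prod (𝓘(ℝ, ℝ).prod (𝓡 3).tangent)) 𝓘(ℝ, ℝ) ∞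
      (fun q : ℝ × (ℝ × TangentBundle (𝓡 3) M) ↦ q.2.1) (Ico 0 1 ×ˢ univ) (δ, τ, v) :=
    ContMDiffWithinAt.comp (g := Prod.fst) (f := fun q : ℝ × (ℝ × TangentBundle (𝓡 3) M) ↦ q.2)
      (t := univ) (δ, τ, v)
      contMDiffWithinAt_fst contMDiffWithinAt_snd fun _ _ ↦ mem_univ _
  have e3 : ContMDiffWithinAt (𝓘(ℝ, ℝ).prod (𝓘(ℝ, ℝ).prod (𝓡 3).tangent)) (𝓡 3).tangent ∞
      (fun q : ℝ × (ℝ × TangentBundle (𝓡 3) M) ↦ q.2.2) (Ico 0 1 ×ˢ univ) (δ, τ, v) :=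
    ContMDiffWithinAt.comp (g := Prod.snd) (f := fun q : ℝ × (ℝ × TangentBundle (𝓡 3) M) ↦ q.2)
      (t := univ) (δ, τ, v)
      contMDiffWithinAt_snd contMDiffWithinAt_snd fun _ _ ↦ mem_univ _
  have h1 : ContMDiffWithinAt (𝓘(ℝ, ℝ).prod (𝓘(ℝ, ℝ).prod (𝓡 3).tangent)) 𝓘(ℝ, ℝ) ∞
      (fun q : ℝ × (ℝ × TangentBundle (𝓡 3) M) ↦ -A.lam q.1 q.2.2.proj q.2.2.snd)
      (Ico 0 1 ×ˢ univ) (δ, τ, v) := by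
    have h2 := ContMDiffWithinAt.comp (t := Ico 0 1 ×ˢ univ)
      (g := fun q : ℝ × TangentBundle (𝓡 3) M ↦ A.lam q.1 q.2.proj q.2.snd)
      (f := fun q : ℝ × (ℝ × TangentBundle (𝓡 3) M) ↦ (q.1, q.2.2)) (δ, τ, v)
      (A.lam_smooth (δ, v) ⟨hq.1, mem_univ _⟩)
      (e1.prodMk e3) (s := Ico 0 1 ×ˢ univ) fun q hq ↦ ⟨hq.1, mem_univ _⟩
    exact h2.neg
  have h3 : ContMDiffWithinAt (𝓘(ℝ, ℝ).prod (𝓘(ℝ, ℝ).prod (𝓡 3).tangent)) (𝓡 3).tangent ∞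
      (fun q : ℝ × (ℝ × TangentBundle (𝓡 3) M) ↦ (⟨q.2.2.proj,
        (q.2.1 • A.reebE q.1 q.2.2.proj + A.kerEndo C q.1 q.2.2.proj q.2.2.snd :
          EuclideanSpace ℝ (Fin 3))⟩ : TangentBundle (𝓡 3) M))
      (Ico 0 1 ×ˢ univ) (δ, τ, v) := by
    have h4 := A.contMDiffWithinAt_kerEndo C hq.1 τ v
    exact ContMDiffWithinAt.comp (t := (Ico 0 1 ×ˢ univ) ×ˢ univ)
      (f := fun q : ℝ × (ℝ × TangentBundle (𝓡 3) M) ↦ ((q.1, q.2.1), q.2.2)) (δ, τ, v) h4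
      ((e1.prodMk_space e2).prodMk e3) fun q hq ↦ ⟨⟨hq.1, mem_univ _⟩, mem_univ _⟩
  exact h1.prodMk h3

end AdaptedFamily

/-! ### Filling the punctures of a surface. -/

theorem OpenPartialHomeomorph.bijective_mder {E : Type*} [NormedAddCommGroup E] [NormedSpace ℝ E]
    [CompleteSpace E] {H : Type*} [TopologicalSpace H] {I : ModelWithCorners ℝ E H} [I.Boundaryless]
    {N : Type*} [TopologicalSpace N] [ChartedSpace H N] [IsManifold I ∞ N]
    {E' : Type*} [NormedAddCommGroup E'] [NormedSpace ℝ E'] [CompleteSpace E']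
    {H' : Type*} [TopologicalSpace H'] {I' : ModelWithCorners ℝ E' H'} [I'.Boundaryless]
    {N' : Type*} [TopologicalSpace N'] [ChartedSpace H' N'] [IsManifold I' ∞ N']
    (e : OpenPartialHomeomorph N N') (he : ContMDiffOn I I' ∞ e e.source)
    (he' : ContMDiffOn I' I ∞ e.symm e.target) {x : N} (hx : x ∈ e.source) :
    Function.Bijective (mder I I' e x) := by
  have h1 : MDifferentiableAt I I' e x :=
    (he.contMDiffAt (e.open_source.mem_nhds hx)).mdifferentiableAt (by simp)
  have h2 : MDifferentiableAt I' I e.symm (e x) :=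
    (he'.contMDiffAt (e.open_target.mem_nhds (e.map_source hx))).mdifferentiableAt (by simp)
  have h1' : MDifferentiableAt I I' e (e.symm (e x)) := by rwa [e.left_inv hx]
  constructor
  · refine Function.LeftInverse.injective (g := mder I' I e.symm (e x)) fun v ↦ ?_
    rw [← mder_comp_apply x h2 h1, mder_congr (g := id)]
    · exact DFunLike.congr_fun (mfderiv_id (I := I)) v
    · filter_upwards [e.open_source.mem_nhds hx] with y hy using e.left_inv hy
  · refine Function.RightInverse.surjective (g := mder I' I e.symm (e x)) fun v ↦ ?_
    have h3 := mder_comp_apply (e x) h1' h2 v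
    rw [e.left_inv hx] at h3
    rw [← h3, mder_congr (g := id)]
    · exact DFunLike.congr_fun (mfderiv_id (I := I')) v
    · filter_upwards [e.open_target.mem_nhds (e.map_source hx)] with y hy using e.right_inv hy

universe w'

/-- A surface with ends that are parametrised by punctured disks. -/
structure PuncturedEnds (F : Type w') [TopologicalSpace F] [ChartedSpace ℂ F] (n : ℕ) where
  e : Fin n → OpenPartialHomeomorph F ℂ
  target_eq : ∀ i, (e i).target = Metric.ball 0 2 \ {0}
  smooth : ∀ i, ContMDiffOn 𝓘(ℝ, ℂ) 𝓘(ℝ, ℂ) ∞ (e i) (e i).source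
  smooth_symm : ∀ i, ContMDiffOn 𝓘(ℝ, ℂ) 𝓘(ℝ, ℂ) ∞ (e i).symm (e i).target
  disjoint : Pairwise fun i k ↦ Disjoint (e i).source (e k).source
  -- This keeps the points of `F` away from the punctures and gives the Hausdorff property after
  -- filling, as the next field gives compactness.
  closed : ∀ i, ∀ s < 2, IsClosed ((e i).source ∩ e i ⁻¹' Metric.closedBall 0 s)
  compact : IsCompact (⋃ i, (e i).source ∩ e i ⁻¹' Metric.ball 0 1)ᶜ

namespace PuncturedEnds

variable {F : Type w'} [TopologicalSpace F] [ChartedSpace ℂ F] {n : ℕ} (D : PuncturedEnds F n)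

/-- The surface with the punctures filled in. -/
def Filled (_ : PuncturedEnds F n) : Type w' := F ⊕ Fin n

/-- The inclusion of the punctured surface. -/
def inc (x : F) : D.Filled := Sum.inl x

/-- The punctures. -/
def pt (i : Fin n) : D.Filled := Sum.inr i

open Classical in
/-- The disk around a puncture. -/
noncomputable def cap (i : Fin n) (z : ℂ) : D.Filled :=
  if z = 0 then D.pt i else D.inc ((D.e i).symm z)

theorem cap_zero (i : Fin n) : D.cap i 0 = D.pt i := if_pos rfl

theorem cap_of_ne {i : Fin n} {z : ℂ} (hz : z ≠ 0) : D.cap i z = D.inc ((D.e i).symm z) := if_neg hz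

theorem inc_injective : Function.Injective D.inc := Sum.inl_injective

theorem pt_injective : Function.Injective D.pt := Sum.inr_injective

theorem inc_ne_pt (x : F) (i : Fin n) : D.inc x ≠ D.pt i := Sum.inl_ne_inr

theorem inc_or_pt (z : D.Filled) : (∃ x, z = D.inc x) ∨ ∃ i, z = D.pt i := by
  rcases z with x | i
  exacts [Or.inl ⟨x, rfl⟩, Or.inr ⟨i, rfl⟩]

theorem compl_range_pt : (range D.pt)ᶜ = range D.inc := by
  ext z
  rcases D.inc_or_pt z with ⟨x, rfl⟩ | ⟨i, rfl⟩
  · simpa using fun i ↦ (D.inc_ne_pt x i).symm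
  · simpa using fun x ↦ D.inc_ne_pt x i

theorem mem_target {i : Fin n} {z : ℂ} (hz : z ∈ Metric.ball (0 : ℂ) 2) (hz0 : z ≠ 0) :
    z ∈ (D.e i).target := by rw [D.target_eq]; exact ⟨hz, hz0⟩

theorem map_source {i : Fin n} {x : F} (hx : x ∈ (D.e i).source) :
    D.e i x ∈ Metric.ball (0 : ℂ) 2 ∧ D.e i x ≠ 0 := by
  have := (D.e i).map_source hx
  rw [D.target_eq] at this
  exact this

theorem cap_e {i : Fin n} {x : F} (hx : x ∈ (D.e i).source) : D.cap i (D.e i x) = D.inc x := by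
  rw [D.cap_of_ne (D.map_source hx).2, (D.e i).left_inv hx]

theorem cap_injOn (i : Fin n) : InjOn (D.cap i) (Metric.ball 0 2) := by
  intro z hz w hw h
  by_cases hz0 : z = 0 <;> by_cases hw0 : w = 0
  · rw [hz0, hw0]
  · rw [hz0, cap_zero, D.cap_of_ne hw0] at h
    exact absurd h.symm (D.inc_ne_pt _ _)
  · rw [hw0, cap_zero, D.cap_of_ne hz0] at h
    exact absurd h (D.inc_ne_pt _ _)
  · rw [D.cap_of_ne hz0, D.cap_of_ne hw0] at h
    exact (D.e i).symm.injOn (D.mem_target hz hz0) (D.mem_target hw hw0) (D.inc_injective h)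

theorem disjoint_cap {i k : Fin n} (hik : i ≠ k) {z w : ℂ} (hz : z ∈ Metric.ball (0 : ℂ) 2)
    (hw : w ∈ Metric.ball (0 : ℂ) 2) : D.cap i z ≠ D.cap k w := by
  intro h
  by_cases hz0 : z = 0 <;> by_cases hw0 : w = 0
  · rw [hz0, hw0, cap_zero, cap_zero] at h
    exact hik (D.pt_injective h)
  · rw [hz0, cap_zero, D.cap_of_ne hw0] at h
    exact D.inc_ne_pt _ _ h.symm
  · rw [hw0, cap_zero, D.cap_of_ne hz0] at h
    exact D.inc_ne_pt _ _ h
  · rw [D.cap_of_ne hz0, D.cap_of_ne hw0] at h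
    have h1 := (D.e i).map_target (D.mem_target hz hz0)
    rw [D.inc_injective h] at h1
    exact disjoint_left.1 (D.disjoint hik) h1 ((D.e k).map_target (D.mem_target hw hw0))

/-- The final topology for the inclusion of `F` and the disks of radius `2`; openness is tested on
these pieces. -/
instance : TopologicalSpace D.Filled where
  IsOpen U := IsOpen (D.inc ⁻¹' U) ∧ ∀ i, IsOpen (Metric.ball 0 2 ∩ D.cap i ⁻¹' U)
  isOpen_univ := ⟨isOpen_univ, fun i ↦ by simp⟩
  isOpen_inter U V hU hV := ⟨hU.1.inter hV.1, fun i ↦ by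
    rw [preimage_inter, inter_inter_distrib_left]; exact (hU.2 i).inter (hV.2 i)⟩
  isOpen_sUnion s hs := ⟨by
    rw [preimage_sUnion]; exact isOpen_biUnion fun U hU ↦ (hs U hU).1, fun i ↦ by
    rw [preimage_sUnion, inter_iUnion₂]; exact isOpen_biUnion fun U hU ↦ (hs U hU).2 i⟩

theorem isOpenEmbedding_inc : IsOpenEmbedding D.inc := by
  refine .of_continuous_injective_isOpenMap ⟨fun U hU ↦ hU.1⟩ D.inc_injective fun V hV ↦ ?_
  refine ⟨by rwa [preimage_image_eq _ D.inc_injective], fun i ↦ ?_⟩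
  convert (D.e i).isOpen_inter_preimage_symm hV using 1
  ext z
  by_cases hz0 : z = 0
  · simp [hz0, cap_zero, D.target_eq, D.inc_ne_pt]
  · simp [D.cap_of_ne hz0, D.target_eq, hz0, D.inc_injective.mem_set_image]

theorem continuousOn_cap (i : Fin n) : ContinuousOn (D.cap i) (Metric.ball 0 2) :=
  (continuousOn_open_iff Metric.isOpen_ball).2 fun _ hU ↦ hU.2 i

/-- The trace on `F` is a preimage under `e i`. In the other disks the trace is empty because
distinct ends are disjoint, and in the same disk it is `W`. -/
theorem isOpen_cap_image (i : Fin n) {W : Set ℂ} (hW : IsOpen W) (hWb : W ⊆ Metric.ball 0 2) :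
    IsOpen (D.cap i '' W) := by
  refine ⟨?_, fun k ↦ ?_⟩
  · convert (D.e i).isOpen_inter_preimage hW using 1
    ext x
    constructor
    · rintro ⟨z, hz, h⟩
      by_cases hz0 : z = 0
      · rw [hz0, cap_zero] at h; exact absurd h.symm (D.inc_ne_pt _ _)
      · rw [D.cap_of_ne hz0] at h
        have ht := D.mem_target (i := i) (hWb hz) hz0
        rw [← D.inc_injective h]
        exact ⟨(D.e i).map_target ht, by rw [mem_preimage, (D.e i).right_inv ht]; exact hz⟩
    · rintro ⟨hx, hxW⟩
      exact ⟨_, hxW, D.cap_e hx⟩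
  · by_cases hik : i = k
    · subst hik
      convert hW using 1
      ext z
      constructor
      · rintro ⟨hz, w, hw, h⟩
        rwa [← D.cap_injOn i (hWb hw) hz h]
      · exact fun hz ↦ ⟨hWb hz, z, hz, rfl⟩
    · convert isOpen_empty using 1
      rw [eq_empty_iff_forall_notMem]
      rintro z ⟨hz, w, hw, h⟩
      exact D.disjoint_cap hik (hWb hw) hz h

/-- The disk around a puncture, as a partial homeomorphism. -/
noncomputable def capHomeo (i : Fin n) : OpenPartialHomeomorph ℂ D.Filled :=
  OpenPartialHomeomorph.ofContinuousOpenRestrict ((D.cap_injOn i).toPartialEquiv _ _)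
    (D.continuousOn_cap i) (fun U hU ↦ by
      rw [domRestrict_eq, image_comp]
      exact D.isOpen_cap_image i (Metric.isOpen_ball.isOpenMap_subtype_val U hU) (by
        rintro _ ⟨z, -, rfl⟩; exact z.2)) Metric.isOpen_ball

theorem pt_mem (i : Fin n) : D.pt i ∈ (D.capHomeo i).target :=
  ⟨0, by simp, D.cap_zero i⟩

variable [Nonempty F]

/-- The inclusion of the punctured surface, as a partial homeomorphism. -/
noncomputable def incHomeo : OpenPartialHomeomorph F D.Filled :=
  D.isOpenEmbedding_inc.toOpenPartialHomeomorph D.inc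

theorem incHomeo_target : D.incHomeo.target = range D.inc := by
  rw [← image_univ]; rfl

theorem incHomeo_symm_inc (x : F) : D.incHomeo.symm (D.inc x) = x :=
  D.incHomeo.left_inv (mem_univ x)

noncomputable instance : ChartedSpace ℂ D.Filled where
  atlas := (fun c ↦ D.incHomeo.symm.trans c) '' atlas ℂ F ∪ range fun i ↦ (D.capHomeo i).symm
  chartAt := Sum.elim (fun x ↦ D.incHomeo.symm.trans (chartAt ℂ x)) fun i ↦ (D.capHomeo i).symm
  mem_chart_source z := by
    rcases z with x | i
    · have h : D.inc x ∈ D.incHomeo.target := by rw [incHomeo_target]; exact ⟨x, rfl⟩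
      refine ⟨h, ?_⟩
      have h2 := D.incHomeo_symm_inc x
      exact (congrArg (· ∈ (chartAt ℂ x).source) h2).mpr (mem_chart_source ℂ x)
    · exact D.pt_mem i
  chart_mem_atlas z := by
    rcases z with x | i
    · exact Or.inl ⟨_, chart_mem_atlas ℂ x, rfl⟩
    · exact Or.inr ⟨i, rfl⟩

theorem incChart_mem {c : OpenPartialHomeomorph F ℂ} (hc : c ∈ atlas ℂ F) :
    D.incHomeo.symm.trans c ∈ atlas ℂ D.Filled := Or.inl ⟨c, hc, rfl⟩

theorem capChart_mem (i : Fin n) : (D.capHomeo i).symm ∈ atlas ℂ D.Filled := Or.inr ⟨i, rfl⟩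

variable [IsManifold 𝓘(ℝ, ℂ) ∞ F]

theorem contMDiffOn_atlas {c : OpenPartialHomeomorph F ℂ} (hc : c ∈ atlas ℂ F) :
    ContMDiffOn 𝓘(ℝ, ℂ) 𝓘(ℝ, ℂ) ∞ c c.source ∧ ContMDiffOn 𝓘(ℝ, ℂ) 𝓘(ℝ, ℂ) ∞ c.symm c.target :=
  have h := IsManifold.subset_maximalAtlas (I := 𝓘(ℝ, ℂ)) (n := ∞) hc
  ⟨contMDiffOn_of_mem_maximalAtlas h, contMDiffOn_symm_of_mem_maximalAtlas h⟩

/-- The transition maps are transitions of `F`, the coordinates `e i` or their inverses read in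
charts of `F`, or the identity; distinct disks do not overlap. -/
instance : IsManifold 𝓘(ℝ, ℂ) ∞ D.Filled := by
  refine isManifold_of_contDiffOn _ _ _ ?_
  have key : ∀ e ∈ atlas ℂ D.Filled, ∀ e' ∈ atlas ℂ D.Filled,
      ContDiffOn ℝ ∞ (e' ∘ e.symm) (e.symm.trans e').source := by
    rintro _ (⟨c, hc, rfl⟩ | ⟨i, rfl⟩) _ (⟨c', hc', rfl⟩ | ⟨k, rfl⟩)
    · rw [← contMDiffOn_iff_contDiffOn]
      refine ((contMDiffOn_atlas hc').1.comp ((contMDiffOn_atlas hc).2.mono ?_) ?_).congr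
        (s := ((D.incHomeo.symm.trans c).symm.trans (D.incHomeo.symm.trans c')).source)
        (f := c' ∘ c.symm) fun z hz ↦ ?_
      · intro z hz; exact hz.1.1
      · intro z hz
        have h := hz.2.2
        have h2 := D.incHomeo_symm_inc (c.symm z)
        exact (congrArg (· ∈ c'.source) h2).mp h
      · exact congrArg c' (D.incHomeo_symm_inc (c.symm z))
    · rw [← contMDiffOn_iff_contDiffOn]
      have h0 : ∀ z ∈ ((D.incHomeo.symm.trans c).symm.trans (D.capHomeo k).symm).source,
          z ∈ c.target ∧ c.symm z ∈ (D.e k).source := by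
        intro z hz
        refine ⟨hz.1.1, ?_⟩
        obtain ⟨w, hw, h⟩ : D.inc (c.symm z) ∈ D.cap k '' Metric.ball 0 2 := hz.2
        by_cases hw0 : w = 0
        · rw [hw0, cap_zero] at h; exact absurd h.symm (D.inc_ne_pt _ _)
        · rw [D.cap_of_ne hw0] at h
          rw [← D.inc_injective h]
          exact (D.e k).map_target (D.mem_target hw hw0)
      refine ((D.smooth k).comp ((contMDiffOn_atlas hc).2.mono fun z hz ↦ (h0 z hz).1)
        fun z hz ↦ (h0 z hz).2).congr fun z hz ↦ ?_
      have h1 := (h0 z hz).2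
      change (D.capHomeo k).symm (D.inc (c.symm z)) = D.e k (c.symm z)
      rw [← D.cap_e h1]
      exact (D.capHomeo k).left_inv (D.map_source h1).1
    · rw [← contMDiffOn_iff_contDiffOn]
      have h0 : ∀ z ∈ ((D.capHomeo i).symm.symm.trans (D.incHomeo.symm.trans c')).source,
          z ∈ (D.e i).target ∧ (D.e i).symm z ∈ c'.source ∧
            D.incHomeo.symm (D.cap i z) = (D.e i).symm z := by
        intro z hz
        have hzb : z ∈ Metric.ball (0 : ℂ) 2 := hz.1
        have hz0 : z ≠ 0 := by
          rintro rfl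
          have h1 : D.cap i 0 ∈ D.incHomeo.target := hz.2.1
          rw [incHomeo_target, cap_zero] at h1
          obtain ⟨x, hx⟩ := h1
          exact D.inc_ne_pt _ _ hx
        have h2 : D.incHomeo.symm (D.cap i z) = (D.e i).symm z := by
          rw [D.cap_of_ne hz0, incHomeo_symm_inc]
        refine ⟨D.mem_target hzb hz0, ?_, h2⟩
        have h3 : D.incHomeo.symm (D.cap i z) ∈ c'.source := hz.2.2
        rwa [h2] at h3
      exact ((contMDiffOn_atlas hc').1.comp ((D.smooth_symm i).mono fun z hz ↦ (h0 z hz).1)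
        fun z hz ↦ (h0 z hz).2.1).congr fun z hz ↦ congrArg c' (h0 z hz).2.2
    · have h0 : ∀ z ∈ ((D.capHomeo i).symm.symm.trans (D.capHomeo k).symm).source,
          (D.capHomeo k).symm (D.cap i z) = z := by
        intro z hz
        have hzb : z ∈ Metric.ball (0 : ℂ) 2 := hz.1
        obtain ⟨w, hw, h⟩ : D.cap i z ∈ D.cap k '' Metric.ball 0 2 := hz.2
        by_cases hik : i = k
        · subst hik; exact (D.capHomeo i).left_inv hzb
        · exact absurd h.symm (D.disjoint_cap hik hzb hw)
      exact contDiffOn_id.congr fun z hz ↦ h0 z hz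
  intro e e' he he'
  simpa using key e he e' he'

theorem contMDiffOn_cap (i : Fin n) :
    ContMDiffOn 𝓘(ℝ, ℂ) 𝓘(ℝ, ℂ) ∞ (D.capHomeo i) (D.capHomeo i).source ∧
      ContMDiffOn 𝓘(ℝ, ℂ) 𝓘(ℝ, ℂ) ∞ (D.capHomeo i).symm (D.capHomeo i).target :=
  have h := IsManifold.subset_maximalAtlas (I := 𝓘(ℝ, ℂ)) (n := ∞) (D.capChart_mem i)
  ⟨contMDiffOn_symm_of_mem_maximalAtlas h, contMDiffOn_of_mem_maximalAtlas h⟩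

theorem contMDiff_inc : ContMDiff 𝓘(ℝ, ℂ) 𝓘(ℝ, ℂ) ∞ D.inc := by
  intro x
  have h := IsManifold.subset_maximalAtlas (I := 𝓘(ℝ, ℂ)) (n := ∞)
    (D.incChart_mem (chart_mem_atlas ℂ x))
  have hx := mem_chart_source ℂ x
  have hin : ∀ y ∈ (chartAt ℂ x).source,
      chartAt ℂ x y ∈ (D.incHomeo.symm.trans (chartAt ℂ x)).target := fun y hy ↦
    ⟨(chartAt ℂ x).map_source hy, mem_univ _⟩
  refine ContMDiffAt.congr_of_eventuallyEq (f :=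
    (D.incHomeo.symm.trans (chartAt ℂ x)).symm ∘ chartAt ℂ x) ?_ ?_
  · exact ((contMDiffOn_symm_of_mem_maximalAtlas h).contMDiffAt
      ((D.incHomeo.symm.trans (chartAt ℂ x)).open_target.mem_nhds (hin x hx))).comp x
      ((contMDiffOn_atlas (chart_mem_atlas ℂ x)).1.contMDiffAt
        ((chartAt ℂ x).open_source.mem_nhds hx))
  · filter_upwards [(chartAt ℂ x).open_source.mem_nhds hx] with y hy
    exact (congrArg D.inc ((chartAt ℂ x).left_inv hy)).symm

theorem contMDiffOn_incHomeo_symm :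
    ContMDiffOn 𝓘(ℝ, ℂ) 𝓘(ℝ, ℂ) ∞ D.incHomeo.symm D.incHomeo.target := by
  intro z hz
  apply ContMDiffAt.contMDiffWithinAt
  rw [incHomeo_target] at hz
  obtain ⟨x, rfl⟩ := hz
  have h := IsManifold.subset_maximalAtlas (I := 𝓘(ℝ, ℂ)) (n := ∞)
    (D.incChart_mem (chart_mem_atlas ℂ x))
  have hx := mem_chart_source ℂ x
  have hs : D.inc x ∈ (D.incHomeo.symm.trans (chartAt ℂ x)).source := mem_chart_source ℂ (D.inc x)
  have hv : (D.incHomeo.symm.trans (chartAt ℂ x)) (D.inc x) = chartAt ℂ x x :=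
    congrArg (chartAt ℂ x) (D.incHomeo_symm_inc x)
  refine ContMDiffAt.congr_of_eventuallyEq (f :=
    (chartAt ℂ x).symm ∘ D.incHomeo.symm.trans (chartAt ℂ x)) ?_ ?_
  · refine ContMDiffAt.comp (I' := 𝓘(ℝ, ℂ)) _ ?_ ((contMDiffOn_of_mem_maximalAtlas h).contMDiffAt
      ((D.incHomeo.symm.trans (chartAt ℂ x)).open_source.mem_nhds hs))
    rw [hv]
    exact (contMDiffOn_atlas (chart_mem_atlas ℂ x)).2.contMDiffAt
      ((chartAt ℂ x).open_target.mem_nhds ((chartAt ℂ x).map_source hx))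
  · filter_upwards [(D.incHomeo.symm.trans (chartAt ℂ x)).open_source.mem_nhds hs] with y hy
    exact ((chartAt ℂ x).left_inv hy.2).symm

theorem bijective_mder_inc (x : F) : Function.Bijective (mder 𝓘(ℝ, ℂ) 𝓘(ℝ, ℂ) D.inc x) :=
  D.incHomeo.bijective_mder D.contMDiff_inc.contMDiffOn D.contMDiffOn_incHomeo_symm (mem_univ x)

theorem bijective_mder_cap (i : Fin n) {z : ℂ} (hz : z ∈ Metric.ball (0 : ℂ) 2) :
    Function.Bijective (mder 𝓘(ℝ, ℂ) 𝓘(ℝ, ℂ) (D.cap i) z) :=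
  (D.capHomeo i).bijective_mder (D.contMDiffOn_cap i).1 (D.contMDiffOn_cap i).2 hz

/-! ### Topological properties -/

/-- A point of an end is separated from its puncture by the disk of half its radius. Points off that
end are separated by the disk of radius `1`. In both cases the closed disk without centre is closed
in `F` by `closed`. -/
instance [T2Space F] : T2Space D.Filled := by
  have key : ∀ (x : F) (i : Fin n), ∃ U V : Set D.Filled, IsOpen U ∧ IsOpen V ∧ D.inc x ∈ U ∧
      D.pt i ∈ V ∧ Disjoint U V := by
    intro x i
    obtain ⟨s, hs0, hs2, hs⟩ : ∃ s > 0, s < 2 ∧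
        x ∉ (D.e i).source ∩ D.e i ⁻¹' Metric.closedBall 0 s := by
      by_cases hx : x ∈ (D.e i).source
      · have h1 := D.map_source hx
        have h2 : ‖D.e i x‖ < 2 := by simpa using h1.1
        have h3 : 0 < ‖D.e i x‖ := norm_pos_iff.2 h1.2
        refine ⟨‖D.e i x‖ / 2, by positivity, by linarith, fun h ↦ ?_⟩
        have h4 : ‖D.e i x‖ ≤ ‖D.e i x‖ / 2 := by simpa using h.2
        linarith
      · exact ⟨1, one_pos, one_lt_two, fun h ↦ hx h.1⟩
    have hsub : Metric.ball (0 : ℂ) s ⊆ Metric.ball 0 2 := Metric.ball_subset_ball hs2.le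
    refine ⟨D.inc '' ((D.e i).source ∩ D.e i ⁻¹' Metric.closedBall 0 s)ᶜ, D.cap i '' Metric.ball 0 s,
      D.isOpenEmbedding_inc.isOpenMap _ (D.closed i s hs2).isOpen_compl,
      D.isOpen_cap_image i Metric.isOpen_ball hsub, ⟨x, hs, rfl⟩,
      ⟨0, by simpa using hs0, D.cap_zero i⟩, ?_⟩
    rw [disjoint_left]
    rintro _ ⟨y, hy, rfl⟩ ⟨z, hz, h⟩
    by_cases hz0 : z = 0
    · rw [hz0, cap_zero] at h; exact D.inc_ne_pt _ _ h.symm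
    · rw [D.cap_of_ne hz0] at h
      have ht := D.mem_target (i := i) (hsub hz) hz0
      apply hy
      rw [← D.inc_injective h]
      exact ⟨(D.e i).map_target ht, by
        rw [mem_preimage, (D.e i).right_inv ht]; exact Metric.ball_subset_closedBall hz⟩
  refine ⟨fun z w hzw ↦ ?_⟩
  rcases D.inc_or_pt z with ⟨x, rfl⟩ | ⟨i, rfl⟩ <;> rcases D.inc_or_pt w with ⟨y, rfl⟩ | ⟨k, rfl⟩
  · obtain ⟨U, V, hU, hV, hx, hy, hUV⟩ := t2_separation fun h ↦ hzw (congrArg D.inc h)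
    exact ⟨_, _, D.isOpenEmbedding_inc.isOpenMap U hU, D.isOpenEmbedding_inc.isOpenMap V hV,
      ⟨x, hx, rfl⟩, ⟨y, hy, rfl⟩, (disjoint_image_iff D.inc_injective).2 hUV⟩
  · exact key x k
  · obtain ⟨U, V, hU, hV, hx, hy, hUV⟩ := key y i
    exact ⟨V, U, hV, hU, hy, hx, hUV.symm⟩
  · refine ⟨_, _, D.isOpen_cap_image i Metric.isOpen_ball subset_rfl,
      D.isOpen_cap_image k Metric.isOpen_ball subset_rfl, D.pt_mem i, D.pt_mem k, ?_⟩
    rw [disjoint_left]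
    rintro _ ⟨a, ha, rfl⟩ ⟨b, hb, h⟩
    exact D.disjoint_cap (fun hik ↦ hzw (congrArg D.pt hik)) ha hb h.symm

/-- The surface is the union of the compact complement of the unit disks and the closed unit disks,
which lie inside the charts of radius `2`. -/
instance : CompactSpace D.Filled := by
  have hb : Metric.closedBall (0 : ℂ) 1 ⊆ Metric.ball 0 2 :=
    Metric.closedBall_subset_ball one_lt_two
  refine ⟨((D.compact.image D.isOpenEmbedding_inc.continuous).union (isCompact_iUnion fun i ↦
    (isCompact_closedBall (0 : ℂ) 1).image_of_continuousOn ((D.continuousOn_cap i).mono hb))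
    ).of_isClosed_subset isClosed_univ fun z _ ↦ ?_⟩
  rcases D.inc_or_pt z with ⟨x, rfl⟩ | ⟨i, rfl⟩
  · by_cases hx : x ∈ ⋃ i, (D.e i).source ∩ D.e i ⁻¹' Metric.ball 0 1
    · obtain ⟨i, hi, hi'⟩ := mem_iUnion.1 hx
      exact Or.inr (mem_iUnion.2 ⟨i, _, Metric.ball_subset_closedBall hi', D.cap_e hi⟩)
    · exact Or.inl ⟨x, hx, rfl⟩
  · exact Or.inr (mem_iUnion.2 ⟨i, 0, by simp, D.cap_zero i⟩)

/-- The connected surface `F` is dense, since each puncture is a limit of points in its disk. -/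
instance [ConnectedSpace F] : ConnectedSpace D.Filled := by
  have hd : DenseRange D.inc := by
    intro z
    rcases D.inc_or_pt z with ⟨x, rfl⟩ | ⟨i, rfl⟩
    · exact subset_closure ⟨x, rfl⟩
    · have h1 : Tendsto (D.cap i) (𝓝[≠] 0) (𝓝 (D.pt i)) := by
        rw [← D.cap_zero i]
        exact ((D.continuousOn_cap i).continuousAt
          (Metric.ball_mem_nhds 0 two_pos)).tendsto.mono_left nhdsWithin_le_nhds
      refine mem_closure_of_tendsto h1 ?_
      filter_upwards [self_mem_nhdsWithin] with z hz
      rw [D.cap_of_ne hz]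
      exact ⟨_, rfl⟩
  have := hd.preconnectedSpace D.isOpenEmbedding_inc.continuous
  exact ⟨⟨D.inc (Classical.arbitrary F)⟩⟩

/-- A punctured neighbourhood of a puncture is a punctured disk. -/
theorem tendsto_pt {X : Type*} {l : Filter X} {g : D.Filled → X} {i : Fin n}
    (h : Tendsto (fun z ↦ g (D.inc ((D.e i).symm z))) (𝓝[≠] 0) l) : Tendsto g (𝓝[≠] (D.pt i)) l := by
  intro U hU
  have h1 := h hU
  rw [mem_map, mem_nhdsWithin] at h1 ⊢
  obtain ⟨V, hV, h0, hVU⟩ := h1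
  refine ⟨D.cap i '' (V ∩ Metric.ball 0 2), D.isOpen_cap_image i (hV.inter Metric.isOpen_ball)
    inter_subset_right, ⟨0, ⟨h0, by simp⟩, D.cap_zero i⟩, ?_⟩
  rintro _ ⟨⟨z, hz, rfl⟩, hz'⟩
  have hz0 : z ≠ 0 := by rintro rfl; exact hz' (D.cap_zero i)
  have := hVU ⟨hz.1, hz0⟩
  rw [D.cap_of_ne hz0]
  exact this

end PuncturedEnds

/-! ### Holomorphic coordinates on the ends and the closed surface. -/

namespace AdaptedFamily

open OpenBook

variable {M : Type*} [TopologicalSpace M] [ChartedSpace (EuclideanSpace ℝ (Fin 3)) M]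
  [IsManifold (𝓡 3) ∞ M] [T2Space M]
  {F : Type*} [TopologicalSpace F] [ChartedSpace ℂ F] [IsManifold 𝓘(ℝ, ℂ) ∞ F] {n : ℕ}
  {B : OpenBook M F n} (A : AdaptedFamily B) (P : A.Profiles)

/-- The holomorphic coordinate on the ends of the page. -/
noncomputable def endCoord (x : F) : ℂ := (starRingEnd ℂ) (A.endMap P x)

theorem contMDiff_endCoord : ContMDiff 𝓘(ℝ, ℂ) 𝓘(ℝ, ℂ) ∞ (A.endCoord P) :=
  Complex.conjCLE.contDiff.contMDiff.comp (A.contMDiff_endMap P)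

/-- The domain of the parametrisations of the part of the ends where `λ_0` is not closed. -/
abbrev capDom : Set (ℝ × ℝ) := Ioo 0 (1 - A.ε) ×ˢ univ

theorem capDom_subset : A.capDom ⊆ B.endDom :=
  prod_mono (Ioo_subset_Ioo_right A.one_sub_ε.2.le) subset_rfl

theorem isOpen_capDom : IsOpen A.capDom := isOpen_Ioo.prod isOpen_univ

/-- Complex conjugation is needed for holomorphy: as `j ∂_r = -β ∂_θ`, the coordinate must turn
clockwise in `θ`. -/
theorem endCoord_pageEnd (i : Fin n) {q : ℝ × ℝ} (hq : q ∈ A.capDom) :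
    A.endCoord P (B.pageEnd i q) = (P i).f q.1 * Complex.exp ((-q.2 : ℝ) * Complex.I) := by
  have h : q.1 ≤ 1 - A.ε / 2 := by linarith [hq.1.2, A.ε_pos]
  rw [endCoord, A.endMap_pageEnd P i (A.capDom_subset hq), A.cutoff_one h, one_mul, map_mul,
    ← Complex.exp_conj]
  simp

theorem norm_endCoord_pageEnd (i : Fin n) {q : ℝ × ℝ} (hq : q ∈ A.capDom) :
    ‖A.endCoord P (B.pageEnd i q)‖ = (P i).f q.1 := by
  rw [A.endCoord_pageEnd P i hq, norm_mul, Complex.norm_exp_ofReal_mul_I, mul_one,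
    Complex.norm_real, Real.norm_of_nonneg ((P i).f_pos _).le]

theorem fderiv_endCoord (i : Fin n) {q : ℝ × ℝ} (hq : q ∈ A.capDom) (w : ℝ × ℝ) :
    fderiv ℝ (fun q ↦ A.endCoord P (B.pageEnd i q)) q w =
      (((P i).β q.1 * (P i).f q.1 * w.1 : ℝ) - ((P i).f q.1 * w.2 : ℝ) * Complex.I) *
        Complex.exp ((-q.2 : ℝ) * Complex.I) := by
  have h1 : DifferentiableAt ℝ (fun q ↦ A.endMap P (B.pageEnd i q)) q := by
    have h2 : ContMDiffOn 𝓘(ℝ, ℝ × ℝ) 𝓘(ℝ, ℂ) ∞ (fun q ↦ A.endMap P (B.pageEnd i q)) B.endDom :=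
      (A.contMDiff_endMap P).comp_contMDiffOn (B.pageEnd_smooth i)
    exact ((contMDiffOn_iff_contDiffOn.1 h2).contDiffAt (B.isOpen_endDom.mem_nhds
      (A.capDom_subset hq))).differentiableAt (by simp)
  have h3 := (Complex.conjCLE : ℂ →L[ℝ] ℂ).hasFDerivAt.comp q h1.hasFDerivAt
  refine (congrArg (· w) h3.fderiv).trans ?_
  change (starRingEnd ℂ) (fderiv ℝ (fun q ↦ A.endMap P (B.pageEnd i q)) q w) = _
  rw [A.fderiv_endMap P i ⟨hq.1.1, by linarith [hq.1.2, A.ε_pos]⟩, map_mul, ← Complex.exp_conj]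
  simp [sub_eq_add_neg]

theorem injective_fderiv_endCoord (i : Fin n) {q : ℝ × ℝ} (hq : q ∈ A.capDom) :
    Function.Injective (fderiv ℝ (fun q ↦ A.endCoord P (B.pageEnd i q)) q) := by
  rw [injective_iff_map_eq_zero]
  intro w hw
  rw [A.fderiv_endCoord P i hq, mul_eq_zero] at hw
  have h1 := hw.resolve_right (Complex.exp_ne_zero _)
  have h2 := congrArg Complex.re h1
  have h3 := congrArg Complex.im h1
  have hf := ((P i).f_pos q.1).ne'
  have hb := ((P i).β_pos q.1 (A.capDom_subset hq).1).ne'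
  simp [hf, hb] at h2 h3
  exact Prod.ext h2 h3

theorem mder_endCoord (i : Fin n) {q : ℝ × ℝ} (hq : q ∈ A.capDom) (w : ℝ × ℝ) :
    mder 𝓘(ℝ, ℂ) 𝓘(ℝ, ℂ) (A.endCoord P) (B.pageEnd i q)
      (mder 𝓘(ℝ, ℝ × ℝ) 𝓘(ℝ, ℂ) (B.pageEnd i) q w) =
      fderiv ℝ (fun q ↦ A.endCoord P (B.pageEnd i q)) q w := by
  rw [← mder_eq_fderiv]
  exact (mder_comp_apply q ((A.contMDiff_endCoord P).contMDiffAt.mdifferentiableAt (by simp))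
    (((B.pageEnd_smooth i).contMDiffAt (B.isOpen_endDom.mem_nhds
      (A.capDom_subset hq))).mdifferentiableAt (by simp)) w).symm

theorem bijective_mder_endCoord (i : Fin n) {q : ℝ × ℝ} (hq : q ∈ A.capDom) :
    Function.Bijective (mder 𝓘(ℝ, ℂ) 𝓘(ℝ, ℂ) (A.endCoord P) (B.pageEnd i q)) := by
  have hinj : Function.Injective (mder 𝓘(ℝ, ℂ) 𝓘(ℝ, ℂ) (A.endCoord P) (B.pageEnd i q)) := by
    rw [injective_iff_map_eq_zero]
    intro v hv
    obtain ⟨w, rfl⟩ := (B.pageEnd_mder i (A.capDom_subset hq)).2 v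
    rw [A.mder_endCoord P i hq] at hv
    rw [(injective_iff_map_eq_zero _).1 (A.injective_fderiv_endCoord P i hq) w hv, map_zero]
  exact ⟨hinj, (LinearMap.injective_iff_surjective (f := (mder 𝓘(ℝ, ℂ) 𝓘(ℝ, ℂ) (A.endCoord P)
    (B.pageEnd i q) : ℂ →ₗ[ℝ] ℂ))).1 hinj⟩

theorem f_mem (i : Fin n) {r : ℝ} (hr : r ∈ Ioo 0 (1 - A.ε)) : (P i).f r ∈ Ioo 0 2 :=
  (P i).f_image A.one_sub_ε ▸ mem_image_of_mem _ hr

theorem f_surj (i : Fin n) {s : ℝ} (hs : s ∈ Ioo (0 : ℝ) 2) : ∃ r ∈ Ioo 0 (1 - A.ε), (P i).f r = s := by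
  rwa [← (P i).f_image A.one_sub_ε] at hs

theorem f_le_iff (i : Fin n) {r s : ℝ} (hr : r ∈ Ioo 0 (1 - A.ε)) (hs : s ∈ Ioo 0 (1 - A.ε)) :
    (P i).f r ≤ (P i).f s ↔ r ≤ s :=
  (P i).strictMonoOn_f.le_iff_le ⟨hr.1, hr.2.trans A.one_sub_ε.2⟩ ⟨hs.1, hs.2.trans A.one_sub_ε.2⟩

theorem injOn_endCoord (i : Fin n) : InjOn (A.endCoord P) (B.pageEnd i '' A.capDom) := by
  rintro _ ⟨⟨r, θ⟩, hq, rfl⟩ _ ⟨⟨r', θ'⟩, hq', rfl⟩ h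
  have h1 := congrArg norm h
  rw [A.norm_endCoord_pageEnd P i hq, A.norm_endCoord_pageEnd P i hq'] at h1
  have h2 : r = r' := le_antisymm ((A.f_le_iff P i hq.1 hq'.1).1 h1.le)
    ((A.f_le_iff P i hq'.1 hq.1).1 h1.ge)
  subst h2
  rw [A.endCoord_pageEnd P i hq, A.endCoord_pageEnd P i hq'] at h
  have h3 := mul_left_cancel₀ (by exact_mod_cast ((P i).f_pos r).ne') h
  obtain ⟨k, hk⟩ := Complex.exp_eq_exp_iff_exists_int.1 h3
  refine (B.pageEnd_eq_iff i i r (A.capDom_subset hq).1 r (A.capDom_subset hq).1 θ θ').2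
    ⟨rfl, rfl, k, ?_⟩
  have h4 := congrArg Complex.im hk
  simp at h4
  linarith

theorem image_endCoord (i : Fin n) :
    A.endCoord P '' (B.pageEnd i '' A.capDom) = Metric.ball 0 2 \ {0} := by
  ext z
  constructor
  · rintro ⟨_, ⟨q, hq, rfl⟩, rfl⟩
    have h1 := A.norm_endCoord_pageEnd P i hq
    have h2 := A.f_mem P i hq.1
    refine ⟨by simpa [h1] using h2.2, fun h ↦ ?_⟩
    rw [mem_singleton_iff.1 h, norm_zero] at h1
    exact h2.1.ne h1
  · rintro ⟨hz, hz0⟩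
    obtain ⟨r, hr, hrz⟩ := A.f_surj P i (s := ‖z‖)
      ⟨norm_pos_iff.2 hz0, by simpa using hz⟩
    refine ⟨_, ⟨(r, -z.arg), ⟨hr, mem_univ _⟩, rfl⟩, ?_⟩
    rw [A.endCoord_pageEnd P i ⟨hr, mem_univ _⟩, hrz, neg_neg]
    exact (exists_polar z).symm

variable [Nonempty F]

theorem exists_endHomeo (i : Fin n) : ∃ e : OpenPartialHomeomorph F ℂ,
    e.source = B.pageEnd i '' A.capDom ∧ e.target = Metric.ball 0 2 \ {0} ∧
      (e : F → ℂ) = A.endCoord P ∧ ContMDiffOn 𝓘(ℝ, ℂ) 𝓘(ℝ, ℂ) ∞ e.symm e.target := by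
  rw [← A.image_endCoord P i]
  exact exists_openPartialHomeomorph_of_injOn (B.isOpen_pageEnd i A.isOpen_capDom A.capDom_subset)
    (A.contMDiff_endCoord P).contMDiffOn
    (by rintro _ ⟨q, hq, rfl⟩; exact A.bijective_mder_endCoord P i hq) (A.injOn_endCoord P i)

/-- A radius `s < 2` corresponds to some `r = a < 1 - ε`, so the set is the closed part `r ≤ a` of
the end; for `s ≤ 0` it is empty. -/
theorem isClosed_endCoord (i : Fin n) {s : ℝ} (hs : s < 2) :
    IsClosed (B.pageEnd i '' A.capDom ∩ A.endCoord P ⁻¹' Metric.closedBall 0 s) := by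
  by_cases hs0 : 0 < s
  · obtain ⟨a, ha, hfa⟩ := A.f_surj P i ⟨hs0, hs⟩
    convert B.isClosed_pageEnd i (ha.2.trans A.one_sub_ε.2) using 1
    apply Subset.antisymm
    · rintro _ ⟨⟨q, hq, rfl⟩, h⟩
      rw [mem_preimage, mem_closedBall_zero_iff, A.norm_endCoord_pageEnd P i hq, ← hfa,
        A.f_le_iff P i hq.1 ha] at h
      exact ⟨q, ⟨⟨hq.1.1, h⟩, mem_univ _⟩, rfl⟩
    · rintro _ ⟨q, hq, rfl⟩
      have hq' : q ∈ A.capDom := ⟨⟨hq.1.1, hq.1.2.trans_lt ha.2⟩, mem_univ _⟩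
      refine ⟨⟨q, hq', rfl⟩, ?_⟩
      rw [mem_preimage, mem_closedBall_zero_iff, A.norm_endCoord_pageEnd P i hq', ← hfa,
        A.f_le_iff P i hq'.1 ha]
      exact hq.1.2
  · convert isClosed_empty using 1
    rw [eq_empty_iff_forall_notMem]
    rintro _ ⟨⟨q, hq, rfl⟩, h⟩
    rw [mem_preimage, mem_closedBall_zero_iff, A.norm_endCoord_pageEnd P i hq] at h
    linarith [(P i).f_pos q.1]

theorem isCompact_compl_endCoord :
    IsCompact (⋃ i, B.pageEnd i '' A.capDom ∩ A.endCoord P ⁻¹' Metric.ball 0 1)ᶜ := by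
  have h1 : ∀ i, ∃ r ∈ Ioo 0 (1 - A.ε), (P i).f r = 1 := fun i ↦
    A.f_surj P i ⟨one_pos, one_lt_two⟩
  choose r hr hfr using h1
  have h2 : ∀ᶠ a in 𝓝[>] (0 : ℝ), ∀ i, a < r i := eventually_all.2 fun i ↦ by
    filter_upwards [Ioo_mem_nhdsGT (hr i).1] with a ha using ha.2
  obtain ⟨a, h3, h4⟩ := (h2.and (Ioo_mem_nhdsGT one_pos)).exists
  refine (B.isCompact_compl_ends ⟨h4.1, h4.2.le⟩).of_isClosed_subset ?_ ?_
  · exact (isOpen_iUnion fun i ↦ (B.isOpen_pageEnd i A.isOpen_capDom A.capDom_subset).inter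
      (Metric.isOpen_ball.preimage (A.contMDiff_endCoord P).continuous)).isClosed_compl
  · refine compl_subset_compl.2 (iUnion_mono fun i ↦ ?_)
    rintro _ ⟨q, hq, rfl⟩
    have hq1 : q.1 < r i := hq.1.2.trans (h3 i)
    have hq' : q ∈ A.capDom := ⟨⟨hq.1.1, hq1.trans (hr i).2⟩, mem_univ _⟩
    refine ⟨⟨q, hq', rfl⟩, ?_⟩
    rw [mem_preimage, mem_ball_zero_iff, A.norm_endCoord_pageEnd P i hq']
    refine lt_of_not_ge fun h ↦ hq1.not_ge ((A.f_le_iff P i (hr i) hq'.1).1 ?_)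
    exact (hfr i).trans_le h

/-- The ends of the page, with their holomorphic coordinates. -/
noncomputable def ends : PuncturedEnds F n where
  e i := (A.exists_endHomeo P i).choose
  target_eq i := (A.exists_endHomeo P i).choose_spec.2.1
  smooth i := by
    rw [(A.exists_endHomeo P i).choose_spec.2.2.1]
    exact (A.contMDiff_endCoord P).contMDiffOn
  smooth_symm i := (A.exists_endHomeo P i).choose_spec.2.2.2
  disjoint i k hik := by
    change Disjoint (A.exists_endHomeo P i).choose.source (A.exists_endHomeo P k).choose.source
    rw [(A.exists_endHomeo P i).choose_spec.1, (A.exists_endHomeo P k).choose_spec.1,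
      disjoint_left]
    rintro _ ⟨q, hq, rfl⟩ ⟨q', hq', h⟩
    exact hik ((B.pageEnd_eq_iff k i _ (A.capDom_subset hq').1 _ (A.capDom_subset hq).1 _ _).1
      h).1.symm
  closed i s hs := by
    rw [(A.exists_endHomeo P i).choose_spec.1, (A.exists_endHomeo P i).choose_spec.2.2.1]
    exact A.isClosed_endCoord P i hs
  compact := by
    have h := A.isCompact_compl_endCoord P
    have : ∀ i, (A.exists_endHomeo P i).choose.source ∩
        (A.exists_endHomeo P i).choose ⁻¹' Metric.ball 0 1 =
        B.pageEnd i '' A.capDom ∩ A.endCoord P ⁻¹' Metric.ball 0 1 := fun i ↦ by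
      rw [(A.exists_endHomeo P i).choose_spec.1, (A.exists_endHomeo P i).choose_spec.2.2.1]
    simp only [this]
    exact h

theorem ends_source (i : Fin n) : ((A.ends P).e i).source = B.pageEnd i '' A.capDom :=
  (A.exists_endHomeo P i).choose_spec.1

theorem ends_coe (i : Fin n) : ((A.ends P).e i : F → ℂ) = A.endCoord P :=
  (A.exists_endHomeo P i).choose_spec.2.2.1

theorem cap_endCoord (i : Fin n) {q : ℝ × ℝ} (hq : q ∈ A.capDom) :
    (A.ends P).cap i (A.endCoord P (B.pageEnd i q)) = (A.ends P).inc (B.pageEnd i q) := by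
  rw [← A.ends_coe P i]
  exact (A.ends P).cap_e (by rw [A.ends_source P i]; exact ⟨q, hq, rfl⟩)

theorem endCoord_mem (i : Fin n) {q : ℝ × ℝ} (hq : q ∈ A.capDom) :
    A.endCoord P (B.pageEnd i q) ∈ Metric.ball (0 : ℂ) 2 ∧ A.endCoord P (B.pageEnd i q) ≠ 0 := by
  have : A.endCoord P (B.pageEnd i q) ∈ Metric.ball (0 : ℂ) 2 \ {0} := by
    rw [← A.image_endCoord P i]; exact ⟨_, ⟨q, hq, rfl⟩, rfl⟩
  exact this

theorem exists_endCoord (i : Fin n) {z : ℂ} (hz : z ∈ Metric.ball (0 : ℂ) 2) (hz0 : z ≠ 0) :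
    ∃ q ∈ A.capDom, A.endCoord P (B.pageEnd i q) = z := by
  have : z ∈ Metric.ball (0 : ℂ) 2 \ {0} := ⟨hz, hz0⟩
  rw [← A.image_endCoord P i] at this
  obtain ⟨_, ⟨q, hq, rfl⟩, h⟩ := this
  exact ⟨q, hq, h⟩

theorem mder_cap (i : Fin n) {q : ℝ × ℝ} (hq : q ∈ A.capDom) (w : ℝ × ℝ) :
    mder 𝓘(ℝ, ℂ) 𝓘(ℝ, ℂ) ((A.ends P).cap i) (A.endCoord P (B.pageEnd i q))
      (fderiv ℝ (fun q ↦ A.endCoord P (B.pageEnd i q)) q w) =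
    mder 𝓘(ℝ, ℂ) 𝓘(ℝ, ℂ) (A.ends P).inc (B.pageEnd i q)
      (mder 𝓘(ℝ, ℝ × ℝ) 𝓘(ℝ, ℂ) (B.pageEnd i) q w) := by
  have hp : MDifferentiableAt 𝓘(ℝ, ℝ × ℝ) 𝓘(ℝ, ℂ) (B.pageEnd i) q :=
    ((B.pageEnd_smooth i).contMDiffAt (B.isOpen_endDom.mem_nhds
      (A.capDom_subset hq))).mdifferentiableAt (by simp)
  have he : MDifferentiableAt 𝓘(ℝ, ℝ × ℝ) 𝓘(ℝ, ℂ) (fun q ↦ A.endCoord P (B.pageEnd i q)) q :=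
    MDifferentiableAt.comp (g := A.endCoord P) (f := B.pageEnd i) q
      ((A.contMDiff_endCoord P).contMDiffAt.mdifferentiableAt (by simp)) hp
  have hc : MDifferentiableAt 𝓘(ℝ, ℂ) 𝓘(ℝ, ℂ) ((A.ends P).cap i) (A.endCoord P (B.pageEnd i q)) :=
    (((A.ends P).contMDiffOn_cap i).1.contMDiffAt
      (Metric.isOpen_ball.mem_nhds (A.endCoord_mem P i hq).1)).mdifferentiableAt (by simp)
  have hi : MDifferentiableAt 𝓘(ℝ, ℂ) 𝓘(ℝ, ℂ) (A.ends P).inc (B.pageEnd i q) :=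
    (A.ends P).contMDiff_inc.contMDiffAt.mdifferentiableAt (by simp)
  rw [← mder_eq_fderiv, ← mder_comp_apply q hc he, ← mder_comp_apply q hi hp]
  refine DFunLike.congr_fun (mder_congr (I := 𝓘(ℝ, ℝ × ℝ)) (I' := 𝓘(ℝ, ℂ)) (N' := (A.ends P).Filled) ?_) w
  filter_upwards [A.isOpen_capDom.mem_nhds hq] with q' hq'
  exact A.cap_endCoord P i hq'

/-! ### The complex structures on the closed surface -/

variable {P} (C : A.PageComplex P)

/-- The complex structures on the closed surface. -/
noncomputable def surfJ (α : ℝ) : (A.ends P).Filled → ℂ →L[ℝ] ℂ :=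
  Sum.elim
    (fun x ↦ (mder 𝓘(ℝ, ℂ) 𝓘(ℝ, ℂ) (A.ends P).inc x).comp
      ((C.j (x, α)).comp (mder 𝓘(ℝ, ℂ) 𝓘(ℝ, ℂ) (A.ends P).inc x).inverse))
    fun i ↦ (mder 𝓘(ℝ, ℂ) 𝓘(ℝ, ℂ) ((A.ends P).cap i) 0).comp
      ((ContinuousLinearMap.mul ℝ ℂ Complex.I).comp
        (mder 𝓘(ℝ, ℂ) 𝓘(ℝ, ℂ) ((A.ends P).cap i) 0).inverse)

theorem surfJ_inc (α : ℝ) (x : F) (v : ℂ) :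
    A.surfJ C α ((A.ends P).inc x) (mder 𝓘(ℝ, ℂ) 𝓘(ℝ, ℂ) (A.ends P).inc x v) =
      mder 𝓘(ℝ, ℂ) 𝓘(ℝ, ℂ) (A.ends P).inc x (C.j (x, α) v) := by
  change mder 𝓘(ℝ, ℂ) 𝓘(ℝ, ℂ) (A.ends P).inc x (C.j (x, α)
    ((mder 𝓘(ℝ, ℂ) 𝓘(ℝ, ℂ) (A.ends P).inc x).inverse _)) = _
  rw [inverse_apply_of_bijective ((A.ends P).bijective_mder_inc x)]

/-- Off the centre, `f' = β f` is the Cauchy–Riemann equation for `f e^{-iθ}`; at the centre the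
formula is the definition. -/
theorem surfJ_cap (α : ℝ) (i : Fin n) {z : ℂ} (hz : z ∈ Metric.ball (0 : ℂ) 2) (v : ℂ) :
    A.surfJ C α ((A.ends P).cap i z) (mder 𝓘(ℝ, ℂ) 𝓘(ℝ, ℂ) ((A.ends P).cap i) z v) =
      mder 𝓘(ℝ, ℂ) 𝓘(ℝ, ℂ) ((A.ends P).cap i) z (Complex.I * v) := by
  by_cases hz0 : z = 0
  · subst hz0
    rw [(A.ends P).cap_zero]
    change mder 𝓘(ℝ, ℂ) 𝓘(ℝ, ℂ) ((A.ends P).cap i) 0 (Complex.I *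
      ((mder 𝓘(ℝ, ℂ) 𝓘(ℝ, ℂ) ((A.ends P).cap i) 0).inverse _)) = _
    rw [inverse_apply_of_bijective ((A.ends P).bijective_mder_cap i hz)]
  · obtain ⟨q, hq, rfl⟩ := A.exists_endCoord P i hz hz0
    obtain ⟨h1, h2⟩ := C.polar i q.1 hq.1 q.2 α
    set G := fderiv ℝ (fun q ↦ A.endCoord P (B.pageEnd i q)) q with hG
    have hsurj : Function.Surjective G := by
      have h3 := A.bijective_mder_endCoord P i hq
      have h4 := B.pageEnd_mder i (A.capDom_subset hq)
      intro v
      obtain ⟨u, rfl⟩ := h3.2 v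
      obtain ⟨w, rfl⟩ := h4.2 u
      exact ⟨w, (A.mder_endCoord P i hq w).symm⟩
    obtain ⟨w, rfl⟩ := hsurj v
    have hf := ((P i).f_pos q.1).ne'
    have hb := ((P i).β_pos q.1 (A.capDom_subset hq).1).ne'
    have e1 : Complex.I * G (1, 0) = G (0, -(P i).β q.1) := by
      rw [hG, A.fderiv_endCoord P i hq, A.fderiv_endCoord P i hq]
      push_cast
      ring
    have e2 : Complex.I * G (0, 1) = G (((P i).β q.1)⁻¹, 0) := by
      rw [hG, A.fderiv_endCoord P i hq, A.fderiv_endCoord P i hq]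
      have hb' : ((P i).β q.1 : ℂ) ≠ 0 := by exact_mod_cast hb
      push_cast
      field_simp
      ring_nf
      simp
    have hw : w = w.1 • ((1 : ℝ), (0 : ℝ)) + w.2 • ((0 : ℝ), (1 : ℝ)) := by ext <;> simp
    rw [hw, map_add, map_smul, map_smul, mul_add, mul_smul_comm, mul_smul_comm, e1, e2]
    simp only [map_add, map_smul]
    rw [hG, A.mder_cap P i hq, A.mder_cap P i hq, A.mder_cap P i hq, A.mder_cap P i hq,
      A.cap_endCoord P i hq, surfJ_inc, surfJ_inc]
    have h1' : C.j (B.pageEnd i q, α) (mder 𝓘(ℝ, ℝ × ℝ) 𝓘(ℝ, ℂ) (B.pageEnd i) q (1, 0)) =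
        mder 𝓘(ℝ, ℝ × ℝ) 𝓘(ℝ, ℂ) (B.pageEnd i) q (0, -(P i).β q.1) := by
      refine h1.trans ?_
      rw [← map_smul]; simp
    have h2' : C.j (B.pageEnd i q, α) (mder 𝓘(ℝ, ℝ × ℝ) 𝓘(ℝ, ℂ) (B.pageEnd i) q (0, 1)) =
        mder 𝓘(ℝ, ℝ × ℝ) 𝓘(ℝ, ℂ) (B.pageEnd i) q (((P i).β q.1)⁻¹, 0) := by
      refine h2.trans ?_
      rw [← map_smul]; simp
    rw [h1', h2']

/-- At a puncture the family is the constant structure `i` in the disk, so both smoothness there and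
independence of `α` are clear; elsewhere it is a family on the pages. -/
theorem isComplexFamily_surfJ :
    IsComplexFamily (fun α z ↦ A.surfJ C α z : ℝ → SurfEndField (A.ends P).Filled) := by
  have hb0 : (0 : ℂ) ∈ Metric.ball (0 : ℂ) 2 := by simp
  refine ⟨fun α z v ↦ ?_, ?_⟩
  · change A.surfJ C α z (A.surfJ C α z (v : ℂ)) = -(v : ℂ)
    rcases (A.ends P).inc_or_pt z with ⟨x, rfl⟩ | ⟨i, rfl⟩
    · obtain ⟨w, hw⟩ := ((A.ends P).bijective_mder_inc x).2 v
      rw [← hw, surfJ_inc, surfJ_inc, C.sq, map_neg]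
      rfl
    · obtain ⟨w, hw⟩ := ((A.ends P).bijective_mder_cap i hb0).2 v
      rw [← hw, ← (A.ends P).cap_zero, A.surfJ_cap C α i hb0, A.surfJ_cap C α i hb0, ← mul_assoc,
        Complex.I_mul_I, neg_one_mul, map_neg]
      rfl
  · rw [← contMDiffOn_univ, ← univ_prod_univ]
    rintro ⟨α, v⟩ -
    rcases (A.ends P).inc_or_pt v.proj with ⟨x, hv⟩ | ⟨i, hv⟩
    · obtain ⟨hs, hd⟩ := chart_param x
      have ho := isOpen_extChartAt_target (I := 𝓘(ℝ, ℂ)) x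
      have hxy : (extChartAt 𝓘(ℝ, ℂ) x).symm (extChartAt 𝓘(ℝ, ℂ) x x) = x := extChartAt_to_inv x
      have hyO := mem_extChartAt_target (I := 𝓘(ℝ, ℂ)) x
      set σ := (extChartAt 𝓘(ℝ, ℂ) x).symm with hσ
      set O := (extChartAt 𝓘(ℝ, ℂ) x).target with hO
      obtain ⟨j', hj', hj''⟩ := C.smooth σ O ho hs hd
      have hcomp : ∀ y ∈ O, ∀ v, mder 𝓘(ℝ, ℂ) 𝓘(ℝ, ℂ) (fun y ↦ (A.ends P).inc (σ y)) y v =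
          mder 𝓘(ℝ, ℂ) 𝓘(ℝ, ℂ) (A.ends P).inc (σ y) (mder 𝓘(ℝ, ℂ) 𝓘(ℝ, ℂ) σ y v) := fun y hy v ↦
        mder_comp_apply y ((A.ends P).contMDiff_inc.contMDiffAt.mdifferentiableAt (by simp))
          ((hs.contMDiffAt (ho.mem_nhds hy)).mdifferentiableAt (by simp)) v
      refine contMDiffWithinAt_endoField (ψ := fun y ↦ (A.ends P).inc (σ y)) (O := O) (S := univ)
        (Y := fun (α : ℝ) z v ↦ A.surfJ C α z v)
        (Y' := fun q : ℝ × (ℂ × ℂ) ↦ j' (q.2.1, q.1) q.2.2) ho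
        ((A.ends P).contMDiff_inc.comp_contMDiffOn hs) (fun y hy ↦ ?_) ?_ ?_ (mem_univ _)
        (y₀ := extChartAt 𝓘(ℝ, ℂ) x x) hyO ?_
      · rw [show (mder 𝓘(ℝ, ℂ) 𝓘(ℝ, ℂ) (fun y ↦ (A.ends P).inc (σ y)) y : ℂ → ℂ) =
          mder 𝓘(ℝ, ℂ) 𝓘(ℝ, ℂ) (A.ends P).inc (σ y) ∘ mder 𝓘(ℝ, ℂ) 𝓘(ℝ, ℂ) σ y from
          funext (hcomp y hy)]
        exact ((A.ends P).bijective_mder_inc _).comp (hd y hy)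
      · exact (hj'.comp (t := O ×ˢ univ) (f := fun q : ℝ × (ℂ × ℂ) ↦ (q.2.1, q.1))
          (ContDiff.contDiffOn (by fun_prop)) fun q hq ↦ ⟨hq.2.1, mem_univ _⟩).clm_apply
          (ContDiff.contDiffOn (by fun_prop))
      · intro α _ y hy w
        rw [hcomp y hy, hcomp y hy]
        refine (A.surfJ_inc C α (σ y) _).trans ?_
        rw [hj'' y hy]
      · exact hv.trans (congrArg _ hxy.symm)
    · refine contMDiffWithinAt_endoField (ψ := (A.ends P).cap i) (O := Metric.ball 0 2)
        (S := univ) (Y := fun (α : ℝ) z v ↦ A.surfJ C α z v)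
        (Y' := fun q : ℝ × (ℂ × ℂ) ↦ Complex.I * q.2.2) Metric.isOpen_ball
        ((A.ends P).contMDiffOn_cap i).1 (fun y hy ↦ (A.ends P).bijective_mder_cap i hy) ?_ ?_
        (mem_univ _) hb0 (hv.trans ((A.ends P).cap_zero i).symm)
      · exact ContDiff.contDiffOn (by fun_prop)
      · intro α _ y hy w
        exact A.surfJ_cap C α i hy w

end AdaptedFamily

/-! ### The holomorphic curves over the pages. -/

namespace PuncturedEnds

variable {F : Type*} [TopologicalSpace F] [ChartedSpace ℂ F] {n : ℕ} (D : PuncturedEnds F n)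

/-- The punctured surface as the complement of the punctures. -/
noncomputable def complHomeo : F ≃ₜ ((range D.pt)ᶜ : Set D.Filled) :=
  D.isOpenEmbedding_inc.isEmbedding.toHomeomorph.trans (Homeomorph.setCongr D.compl_range_pt.symm)

end PuncturedEnds

namespace AdaptedFamily

open OpenBook

variable {M : Type*} [TopologicalSpace M] [ChartedSpace (EuclideanSpace ℝ (Fin 3)) M]
  [IsManifold (𝓡 3) ∞ M] [T2Space M]
  {F : Type*} [TopologicalSpace F] [ChartedSpace ℂ F] [IsManifold 𝓘(ℝ, ℂ) ∞ F] {n : ℕ}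
  {B : OpenBook M F n} (A : AdaptedFamily B) (P : A.Profiles)

/-- The height of the holomorphic curves over the page. -/
noncomputable def height : F → ℝ := B.glue (fun i q ↦ (P i).a q.1) 0

theorem height_pageEnd (i : Fin n) {q : ℝ × ℝ} (hq : q ∈ B.endDom) :
    A.height P (B.pageEnd i q) = (P i).a q.1 :=
  glue_pageEnd (g := fun (i : Fin n) (q : ℝ × ℝ) ↦ (P i).a q.1) (fun _ _ _ _ ↦ rfl) i hq

theorem contMDiff_height : ContMDiff 𝓘(ℝ, ℂ) 𝓘(ℝ, ℝ) ∞ (A.height P) :=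
  contMDiff_glue (fun _ _ _ _ ↦ rfl) A.one_sub_ε.2 (fun i r hr _ ↦ (P i).a_eq r ⟨hr.1.le, hr.2⟩)
    fun i ↦ ((P i).contDiffOn_a (A.contDiffOn_γ₁ zero_mem' i)).comp contDiffOn_fst fun _ hq ↦ hq.1

theorem mder_height_pageEnd (i : Fin n) {q : ℝ × ℝ} (hq : q ∈ B.endDom) (w : ℝ × ℝ) :
    mder 𝓘(ℝ, ℂ) 𝓘(ℝ, ℝ) (A.height P) (B.pageEnd i q)
      (mder 𝓘(ℝ, ℝ × ℝ) 𝓘(ℝ, ℂ) (B.pageEnd i) q w) = -((P i).β q.1 * A.γ₁ i 0 q.1) * w.1 := by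
  have h1 := mder_comp_apply (I := 𝓘(ℝ, ℝ × ℝ)) (I' := 𝓘(ℝ, ℂ)) (I'' := 𝓘(ℝ, ℝ)) q
    ((A.contMDiff_height P).contMDiffAt.mdifferentiableAt (by simp))
    (((B.pageEnd_smooth i).contMDiffAt (B.isOpen_endDom.mem_nhds hq)).mdifferentiableAt (by simp)) w
  rw [← h1, mder_eq_fderiv]
  have h2 : (fun q ↦ A.height P (B.pageEnd i q)) =ᶠ[𝓝 q] fun q ↦ (P i).a q.1 := by
    filter_upwards [B.isOpen_endDom.mem_nhds hq] with q' hq' using A.height_pageEnd P i hq'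
  have h3 : HasFDerivAt (fun q : ℝ × ℝ ↦ (P i).a q.1) _ q :=
    ((P i).a_deriv q.1 hq.1).comp_hasFDerivAt q (ContinuousLinearMap.fst ℝ ℝ ℝ).hasFDerivAt
  rw [h2.fderiv_eq, h3.fderiv]
  simp

theorem lamHat_pageEnd {δ : ℝ} (hδ : δ ∈ Ico (0 : ℝ) 1) (i : Fin n) {q : ℝ × ℝ} (hq : q ∈ B.endDom)
    (t : ℝ) (w : ℝ × ℝ) (s : ℝ) : A.lamHat δ (B.pageEnd i q, t)
      (mder 𝓘(ℝ, ℝ × ℝ) 𝓘(ℝ, ℂ) (B.pageEnd i) q w, s) = A.γ₁ i δ q.1 * w.2 + A.γ₂ i δ q.1 * s :=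
  (A.pullForm_slide B.isOpen_endDom (B.pageEnd_smooth i) hq δ t (w, s)).symm.trans
    (A.pullForm_polar hδ i hq.1 q.2 t (w, s))

theorem γ₁_ρ₁ {δ : ℝ} (hδ : δ ∈ Ico (0 : ℝ) 1) (i : Fin n) {r : ℝ} (hr : r ∈ Ioo 0 (P i).ρ₁) :
    A.γ₁ i δ r = A.γ₁ i 0 r :=
  (A.local_const δ hδ i r ⟨hr.1.le, hr.2.trans (P i).ρ₁_mem.2⟩).1

variable {P} (C : A.PageComplex P)

theorem pageComplex_pageEnd (i : Fin n) {q : ℝ × ℝ} (hq : q ∈ A.capDom) (t : ℝ) (w : ℝ × ℝ) :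
    C.j (B.pageEnd i q, t) (mder 𝓘(ℝ, ℝ × ℝ) 𝓘(ℝ, ℂ) (B.pageEnd i) q w) =
      mder 𝓘(ℝ, ℝ × ℝ) 𝓘(ℝ, ℂ) (B.pageEnd i) q
        (((P i).β q.1)⁻¹ * w.2, -((P i).β q.1 * w.1)) := by
  obtain ⟨h1, h2⟩ := C.polar i q.1 hq.1 q.2 t
  have hw : w = w.1 • ((1 : ℝ), (0 : ℝ)) + w.2 • ((0 : ℝ), (1 : ℝ)) := by ext <;> simp
  have hw' : (((P i).β q.1)⁻¹ * w.2, -((P i).β q.1 * w.1)) =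
      (-(P i).β q.1 * w.1) • ((0 : ℝ), (1 : ℝ)) + (((P i).β q.1)⁻¹ * w.2) • ((1 : ℝ), (0 : ℝ)) := by
    ext <;> simp
  rw [hw']
  conv_lhs => rw [hw]
  simp only [map_add, map_smul]
  rw [h1, h2, smul_smul, smul_smul, mul_comm w.1, mul_comm w.2]

/-- The equation `da = λ ∘ j` on the ends. -/
theorem mder_height_end {δ : ℝ} (hδ : δ ∈ Ico (0 : ℝ) 1) (i : Fin n) {q : ℝ × ℝ} (hq : q ∈ A.capDom)
    (hγ : A.γ₁ i δ q.1 = A.γ₁ i 0 q.1) (α : ℝ) (v : ℂ) :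
    mder 𝓘(ℝ, ℂ) 𝓘(ℝ, ℝ) (A.height P) (B.pageEnd i q) v =
      A.lamHat δ (B.pageEnd i q, α) (C.j (B.pageEnd i q, α) v, 0) := by
  obtain ⟨w, rfl⟩ := (B.pageEnd_mder i (A.capDom_subset hq)).2 v
  rw [A.mder_height_pageEnd P i (A.capDom_subset hq), A.pageComplex_pageEnd C i hq,
    A.lamHat_pageEnd hδ i (A.capDom_subset hq), hγ]
  ring

theorem lamHat_zero_of_notMem {x : F} (hx : x ∉ ⋃ i, B.pageEnd i '' A.capDom) (t : ℝ) (v : ℂ)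
    (s : ℝ) : A.lamHat 0 (x, t) (v, s) = s := A.lam_zero x hx t v s

theorem mder_height_of_notMem {x : F} (hx : x ∉ ⋃ i, B.pageEnd i '' A.capDom) (v : ℂ) :
    mder 𝓘(ℝ, ℂ) 𝓘(ℝ, ℝ) (A.height P) x v = 0 := by
  by_cases h : x ∈ ⋃ i, B.pageEnd i '' B.endDom
  · obtain ⟨i, q, hq, rfl⟩ := mem_iUnion.1 h
    obtain ⟨w, rfl⟩ := (B.pageEnd_mder i hq).2 v
    have h1 : 1 - A.ε ≤ q.1 := by
      by_contra h1
      exact hx (mem_iUnion.2 ⟨i, q, ⟨⟨hq.1.1, not_le.1 h1⟩, mem_univ _⟩, rfl⟩)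
    rw [A.mder_height_pageEnd P i hq, A.outer_zero i q.1 ⟨h1, hq.1.2⟩]
    ring
  · have h1 : A.height P =ᶠ[𝓝 x] fun _ ↦ 0 := by
      filter_upwards [(B.isClosed_iUnion_pageEnd A.one_sub_ε.2).isOpen_compl.mem_nhds
        (show x ∈ (⋃ i, B.pageEnd i '' (Ioc 0 (1 - A.ε) ×ˢ univ))ᶜ from fun h' ↦ by
          obtain ⟨i, q, hq, h2⟩ := mem_iUnion.1 h'
          exact h (mem_iUnion.2 ⟨i, q, ⟨⟨hq.1.1, hq.1.2.trans_lt A.one_sub_ε.2⟩, mem_univ _⟩,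
            h2⟩))] with y hy
      exact glue_eq_of_notMem (fun _ _ _ _ ↦ rfl)
        (fun i r hr _ ↦ (P i).a_eq r ⟨hr.1.le, hr.2⟩) hy
    rw [mder_congr h1]
    exact DFunLike.congr_fun (mfderiv_const (I := 𝓘(ℝ, ℂ)) (I' := 𝓘(ℝ, ℝ)) (c := (0 : ℝ))) v

/-- On the ends this is `a' = -β γ₁`. Elsewhere `λ_0 = dφ` vanishes on the pages and the height has
zero derivative. -/
theorem mder_height (x : F) (α : ℝ) (v : ℂ) :
    mder 𝓘(ℝ, ℂ) 𝓘(ℝ, ℝ) (A.height P) x v = A.lamHat 0 (x, α) (C.j (x, α) v, 0) := by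
  by_cases hx : x ∈ ⋃ i, B.pageEnd i '' A.capDom
  · obtain ⟨i, q, hq, rfl⟩ := mem_iUnion.1 hx
    exact A.mder_height_end C zero_mem' i hq rfl α v
  · rw [A.mder_height_of_notMem hx, A.lamHat_zero_of_notMem hx]

variable [Nonempty F]

/-- The height of the holomorphic curves. -/
noncomputable def leafA : (A.ends P).Filled → ℝ := Sum.elim (A.height P) fun _ ↦ 0

/-- The projection of the holomorphic curves. -/
noncomputable def leafU (α : ℝ) : (A.ends P).Filled → M :=
  Sum.elim (fun x ↦ B.mt (x, α)) fun i ↦ B.tube i (0, 0)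

variable (P) in
theorem compl_eq : (range (A.ends P).pt)ᶜ = (A.ends P).incHomeo.target := by
  rw [(A.ends P).compl_range_pt, (A.ends P).incHomeo_target]

theorem leafA_eqOn : EqOn A.leafA (A.height P ∘ (A.ends P).incHomeo.symm) (range (A.ends P).pt)ᶜ := by
  rw [(A.ends P).compl_range_pt]
  rintro _ ⟨x, rfl⟩
  exact congrArg (A.height P) ((A.ends P).incHomeo_symm_inc x).symm

theorem leafU_eqOn (α : ℝ) : EqOn (A.leafU α) (fun z ↦ B.mt ((A.ends P).incHomeo.symm z, α))
    (range (A.ends P).pt)ᶜ := by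
  rw [(A.ends P).compl_range_pt]
  rintro _ ⟨x, rfl⟩
  exact congrArg (fun x ↦ B.mt (x, α)) ((A.ends P).incHomeo_symm_inc x).symm

theorem contMDiffOn_leafA : ContMDiffOn 𝓘(ℝ, ℂ) 𝓘(ℝ, ℝ) ∞ (A.leafA (P := P))
    (range (A.ends P).pt)ᶜ := by
  refine ContMDiffOn.congr ?_ A.leafA_eqOn
  rw [A.compl_eq P]
  exact (A.contMDiff_height P).comp_contMDiffOn (A.ends P).contMDiffOn_incHomeo_symm

theorem contMDiffOn_leafU : ContMDiffOn (𝓘(ℝ, ℝ).prod 𝓘(ℝ, ℂ)) (𝓡 3) ∞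
    (fun q : ℝ × (A.ends P).Filled ↦ A.leafU q.1 q.2) (univ ×ˢ (range (A.ends P).pt)ᶜ) := by
  have h1 : ContMDiffOn (𝓘(ℝ, ℝ).prod 𝓘(ℝ, ℂ)) 𝓘(ℝ, ℂ) ∞
      (fun q : ℝ × (A.ends P).Filled ↦ (A.ends P).incHomeo.symm q.2)
      (univ ×ˢ (A.ends P).incHomeo.target) :=
    (A.ends P).contMDiffOn_incHomeo_symm.comp contMDiffOn_snd fun q hq ↦ hq.2
  have h2 : ContMDiffOn (𝓘(ℝ, ℝ).prod 𝓘(ℝ, ℂ)) (𝓡 3) ∞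
      (fun q : ℝ × (A.ends P).Filled ↦ B.mt ((A.ends P).incHomeo.symm q.2, q.1))
      (univ ×ˢ (A.ends P).incHomeo.target) :=
    B.mt_smooth.comp_contMDiffOn (h1.prodMk contMDiffOn_fst)
  rw [A.compl_eq P]
  refine h2.congr fun q hq ↦ A.leafU_eqOn q.1 ?_
  rw [A.compl_eq P]; exact hq.2

theorem contMDiffOn_leafU_slice (α : ℝ) : ContMDiffOn 𝓘(ℝ, ℂ) (𝓡 3) ∞ (A.leafU (P := P) α)
    (range (A.ends P).pt)ᶜ := by
  refine ContMDiffOn.congr ?_ (A.leafU_eqOn α)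
  rw [A.compl_eq P]
  exact B.mt_smooth.comp_contMDiffOn
    ((A.ends P).contMDiffOn_incHomeo_symm.prodMk contMDiffOn_const)

theorem isOpen_compl : IsOpen (range (A.ends P).pt)ᶜ := by
  rw [A.compl_eq P]; exact (A.ends P).incHomeo.open_target

theorem inc_mem_compl (x : F) : (A.ends P).inc x ∈ (range (A.ends P).pt)ᶜ := by
  rw [(A.ends P).compl_range_pt]; exact ⟨x, rfl⟩

theorem mder_leafA (c : ℝ) (x : F) (v : ℂ) :
    mder 𝓘(ℝ, ℂ) 𝓘(ℝ, ℝ) (fun z ↦ c + A.leafA (P := P) z) ((A.ends P).inc x)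
      (mder 𝓘(ℝ, ℂ) 𝓘(ℝ, ℂ) (A.ends P).inc x v) = mder 𝓘(ℝ, ℂ) 𝓘(ℝ, ℝ) (A.height P) x v := by
  have h1 : ContMDiffOn 𝓘(ℝ, ℂ) 𝓘(ℝ, ℝ) ∞ (fun z ↦ c + A.leafA (P := P) z)
      (range (A.ends P).pt)ᶜ := contMDiffOn_const.add A.contMDiffOn_leafA
  have h2 := mder_comp_apply (I := 𝓘(ℝ, ℂ)) (I' := 𝓘(ℝ, ℂ)) (I'' := 𝓘(ℝ, ℝ)) x
    ((h1.contMDiffAt (A.isOpen_compl.mem_nhds (A.inc_mem_compl x))).mdifferentiableAt (by simp))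
    ((A.ends P).contMDiff_inc.contMDiffAt.mdifferentiableAt (by simp)) v
  rw [← h2]
  have h3 := mder_comp_apply (I := 𝓘(ℝ, ℂ)) (I' := 𝓘(ℝ, ℝ)) (I'' := 𝓘(ℝ, ℝ))
    (g := fun s : ℝ ↦ c + s) x (differentiableAt_id.const_add c).mdifferentiableAt
    ((A.contMDiff_height P).contMDiffAt.mdifferentiableAt (by simp)) v
  rw [mder_eq_fderiv, fderiv_const_add] at h3
  refine h3.trans ?_
  rw [show fderiv ℝ (fun s : ℝ ↦ s) (A.height P x) = ContinuousLinearMap.id ℝ ℝ from fderiv_fun_id]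
  rfl

theorem mder_leafU (α : ℝ) (x : F) (v : ℂ) :
    mder 𝓘(ℝ, ℂ) (𝓡 3) (A.leafU (P := P) α) ((A.ends P).inc x)
      (mder 𝓘(ℝ, ℂ) 𝓘(ℝ, ℂ) (A.ends P).inc x v) = dmt B (x, α) (v, 0) := by
  have h2 := mder_comp_apply (I := 𝓘(ℝ, ℂ)) (I' := 𝓘(ℝ, ℂ)) (I'' := 𝓡 3) x
    (((A.contMDiffOn_leafU_slice α).contMDiffAt
      (A.isOpen_compl.mem_nhds (A.inc_mem_compl x))).mdifferentiableAt (by simp))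
    ((A.ends P).contMDiff_inc.contMDiffAt.mdifferentiableAt (by simp)) v
  rw [← h2]
  have h3 : mder 𝓘(ℝ, ℂ) (𝓘(ℝ, ℂ).prod 𝓘(ℝ, ℝ)) (fun x : F ↦ (x, α)) x =
      ContinuousLinearMap.inl ℝ ℂ ℝ := mfderiv_prod_left
  refine (mder_comp_apply (g := B.mt) (f := fun x : F ↦ (x, α)) x
    (B.mt_smooth.contMDiffAt.mdifferentiableAt (by simp))
    ((contMDiff_id.prodMk contMDiff_const).contMDiffAt.mdifferentiableAt (n := ∞) (by simp)) v).trans ?_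
  rw [h3]
  rfl

/-- The curves in terms of the page. -/
theorem curveDeriv_leaf (c α : ℝ) (x : F) (v : ℂ) :
    curveDeriv (fun z ↦ c + A.leafA (P := P) z) (A.leafU α) ((A.ends P).inc x)
      (mder 𝓘(ℝ, ℂ) 𝓘(ℝ, ℂ) (A.ends P).inc x v) =
      ((mder 𝓘(ℝ, ℂ) 𝓘(ℝ, ℝ) (A.height P) x v, dmt B (x, α) (v, 0)) :
        ℝ × EuclideanSpace ℝ (Fin 3)) :=
  Prod.ext (A.mder_leafA c x v) (A.mder_leafU α x v)

/-- The `ℝ`-component of the equation is `da(jv) = -λ(v)`, which is the hypothesis applied to `jv`.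
In the other component `J` sends the page vector `v` to `jv - λ(jv) X`, and the term `da(v) X`
coming from `∂/∂τ` cancels the multiple of `X`. -/
theorem isHolomorphicAt_of_eq {δ : ℝ} (c α : ℝ) (x : F)
    (h : ∀ v, mder 𝓘(ℝ, ℂ) 𝓘(ℝ, ℝ) (A.height P) x v = A.lamHat δ (x, α) (C.j (x, α) v, 0)) :
    IsHolomorphicAt (fun p ↦ A.acs C δ p : InvEndField M) (fun z ↦ A.surfJ C α z)
      (fun z ↦ c + A.leafA z) (A.leafU α) ((A.ends P).inc x) := by
  intro v
  obtain ⟨v, rfl⟩ := ((A.ends P).bijective_mder_inc x).2 v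
  refine (congrArg (curveDeriv (fun z ↦ c + A.leafA (P := P) z) (A.leafU α) ((A.ends P).inc x))
    (A.surfJ_inc C α x v)).trans ?_
  refine (A.curveDeriv_leaf c α x _).trans ?_
  refine Eq.trans ?_ (congrArg (A.acs C δ (B.mt (x, α))) (A.curveDeriv_leaf c α x v)).symm
  rw [acs_apply]
  refine Prod.ext ?_ ?_
  · change _ = -A.lamHat δ (x, α) (v, 0)
    rw [h, C.sq, show (-v, (0 : ℝ)) = -(v, (0 : ℝ)) by simp, map_neg]
  · change dmt B (x, α) (C.j (x, α) v, 0) = mder 𝓘(ℝ, ℂ) 𝓘(ℝ, ℝ) (A.height P) x v •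
      A.reebE δ (B.mt (x, α)) + A.kerEndo C δ (B.mt (x, α)) (dmt B (x, α) (v, 0))
    rw [h, A.kerEndo_mt, hatEndo_fst, map_sub, map_smul,
      show dmt B (x, α) (A.reebHat δ (x, α)) = A.reebE δ (B.mt (x, α)) from A.dmt_reebHat δ (x, α)]
    abel

theorem injective_curveDeriv (c α : ℝ) (x : F) : Function.Injective
    (curveDeriv (fun z ↦ c + A.leafA (P := P) z) (A.leafU α) ((A.ends P).inc x)) := by
  intro v w h
  obtain ⟨v, rfl⟩ := ((A.ends P).bijective_mder_inc x).2 v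
  obtain ⟨w, rfl⟩ := ((A.ends P).bijective_mder_inc x).2 w
  have h1 := congrArg Prod.snd ((A.curveDeriv_leaf c α x v).symm.trans
    (h.trans (A.curveDeriv_leaf c α x w)))
  exact congrArg (mder 𝓘(ℝ, ℂ) 𝓘(ℝ, ℂ) (A.ends P).inc x)
    (congrArg Prod.fst ((B.mt_mder (x, α)).1 h1))

theorem injective_mfderiv_leafU (α : ℝ) {z : (A.ends P).Filled} (hz : z ∈ (range (A.ends P).pt)ᶜ) :
    Function.Injective (mfderiv 𝓘(ℝ, ℂ) (𝓡 3) (A.leafU α) z) := by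
  rw [(A.ends P).compl_range_pt] at hz
  obtain ⟨x, rfl⟩ := hz
  intro v w h
  obtain ⟨v, rfl⟩ := ((A.ends P).bijective_mder_inc x).2 v
  obtain ⟨w, rfl⟩ := ((A.ends P).bijective_mder_inc x).2 w
  have h1 := (A.mder_leafU α x v).symm.trans (h.trans (A.mder_leafU α x w))
  exact congrArg (mder 𝓘(ℝ, ℂ) 𝓘(ℝ, ℂ) (A.ends P).inc x)
    (congrArg Prod.fst ((B.mt_mder (x, α)).1 h1))

theorem isTransverseTo_leafU (α : ℝ) :
    IsTransverseTo (A.X 0) (range (A.ends P).pt) (A.leafU α) := by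
  intro z hz
  rw [(A.ends P).compl_range_pt] at hz
  obtain ⟨x, rfl⟩ := hz
  rintro ⟨v, hv⟩
  obtain ⟨v, rfl⟩ := ((A.ends P).bijective_mder_inc x).2 v
  have h1 := (A.mder_leafU α x v).symm.trans (hv.trans (A.dmt_reebHat 0 (x, α)).symm)
  exact A.reebHat_snd_ne_zero zero_mem' (x, α)
    (congrArg Prod.snd ((B.mt_mder (x, α)).1 h1)).symm

theorem bijOn_leafU (α : ℝ) : BijOn (A.leafU (P := P) α) (range (A.ends P).pt)ᶜ (B.page α) := by
  rw [(A.ends P).compl_range_pt]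
  refine ⟨?_, ?_, ?_⟩
  · rintro _ ⟨x, rfl⟩; exact ⟨x, rfl⟩
  · rintro _ ⟨x, rfl⟩ _ ⟨y, rfl⟩ h
    rw [B.mt_injective α h]
  · rintro _ ⟨x, rfl⟩; exact ⟨_, ⟨x, rfl⟩, rfl⟩

theorem isEmbedding_leafU (α : ℝ) :
    IsEmbedding fun z : ((range (A.ends P).pt)ᶜ : Set (A.ends P).Filled) ↦ A.leafU (P := P) α z := by
  have h : (fun z : ((range (A.ends P).pt)ᶜ : Set (A.ends P).Filled) ↦ A.leafU (P := P) α z) =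
      (fun x ↦ B.mt (x, α)) ∘ (A.ends P).complHomeo.symm := by
    funext z
    obtain ⟨x, rfl⟩ := (A.ends P).complHomeo.surjective z
    simp only [Function.comp, Homeomorph.symm_apply_apply]
    rfl
  rw [h]
  exact (B.isEmbedding_mt α).comp (A.ends P).complHomeo.symm.isEmbedding

/-- The projection to `M` is already an embedding, so the height only has to be continuous. -/
theorem isEmbedding_leaf (c α : ℝ) :
    IsEmbedding fun z : ((range (A.ends P).pt)ᶜ : Set (A.ends P).Filled) ↦
      (c + A.leafA (P := P) z, A.leafU (P := P) α z) := by
  refine IsEmbedding.of_comp (g := Prod.snd) ?_ continuous_snd (A.isEmbedding_leafU α)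
  exact (continuous_const.add (continuousOn_iff_continuous_domRestrict.1
    A.contMDiffOn_leafA.continuousOn)).prodMk (A.isEmbedding_leafU α).continuous

variable (P) in
/-- The height is proper on the page. -/
theorem exists_le_height (c : ℝ) : ∃ s ∈ Ioo 0 (A.ρ : ℝ), (∀ i, s < (P i).ρ₁) ∧
    ∀ i, ∀ r ∈ Ioo 0 s, c < (P i).a r := by
  have h1 : ∀ i, ∀ᶠ r in 𝓝[>] (0 : ℝ), c < (P i).a r := fun i ↦
    (P i).a_lim.eventually (eventually_gt_atTop c)
  have h2 : ∀ᶠ s in 𝓝[>] (0 : ℝ), s ∈ Ioo 0 A.ρ ∧ ∀ i, s < (P i).ρ₁ ∧ ∀ r ∈ Ioo 0 s, c < (P i).a r := by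
    refine Filter.Eventually.and (Ioo_mem_nhdsGT A.ρ_pos) (eventually_all.2 fun i ↦ ?_)
    obtain ⟨s, hs, h3⟩ := mem_nhdsGT_iff_exists_Ioo_subset.1 (h1 i)
    filter_upwards [Ioo_mem_nhdsGT hs, Ioo_mem_nhdsGT (P i).ρ₁_mem.1] with t ht ht'
    exact ⟨ht'.2, fun r hr ↦ h3 ⟨hr.1, hr.2.trans ht.2⟩⟩
  obtain ⟨s, h3, h4⟩ := h2.exists
  exact ⟨s, h3, fun i ↦ (h4 i).1, fun i ↦ (h4 i).2⟩

/-- On a compact set the first coordinate is bounded above, which keeps `r` away from `0`; the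
remaining part of the page is compact. -/
theorem isProperMap_leaf [CompactSpace M] (c α : ℝ) :
    IsProperMap fun z : ((range (A.ends P).pt)ᶜ : Set (A.ends P).Filled) ↦
      (c + A.leafA (P := P) z, A.leafU (P := P) α z) := by
  have h : (fun z : ((range (A.ends P).pt)ᶜ : Set (A.ends P).Filled) ↦
      (c + A.leafA (P := P) z, A.leafU (P := P) α z)) =
      (fun x ↦ (c + A.height P x, B.mt (x, α))) ∘ (A.ends P).complHomeo.symm := by
    funext z
    obtain ⟨x, rfl⟩ := (A.ends P).complHomeo.surjective z
    simp only [Function.comp, Homeomorph.symm_apply_apply]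
    rfl
  rw [h]
  refine IsProperMap.comp ?_ (A.ends P).complHomeo.symm.isProperMap
  have hcont : Continuous fun x : F ↦ (c + A.height P x, B.mt (x, α)) :=
    (continuous_const.add (A.contMDiff_height P).continuous).prodMk (B.isEmbedding_mt α).continuous
  refine isProperMap_iff_isCompact_preimage.2 ⟨hcont, fun K hK ↦ ?_⟩
  obtain ⟨b, hb⟩ := (hK.image continuous_fst).bddAbove
  obtain ⟨s, hs, -, hs'⟩ := A.exists_le_height P (b - c)
  have hs1 : s ≤ 1 := by linarith [hs.2, A.ρ_lt, A.ε_pos]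
  refine (B.isCompact_compl_ends ⟨hs.1, hs1⟩).of_isClosed_subset (hK.isClosed.preimage hcont) ?_
  intro x hx hx'
  obtain ⟨i, q, hq, rfl⟩ := mem_iUnion.1 hx'
  have h1 : c + A.height P (B.pageEnd i q) ≤ b := hb ⟨_, hx, rfl⟩
  rw [A.height_pageEnd P i ⟨⟨hq.1.1, hq.1.2.trans_le (hs1.trans B.one_lt_R.le)⟩, mem_univ _⟩] at h1
  linarith [hs' i q.1 hq.1]

theorem tendsto_leafA (i : Fin n) : Tendsto (A.leafA (P := P)) (𝓝[≠] ((A.ends P).pt i)) atTop := by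
  refine (A.ends P).tendsto_pt (tendsto_atTop.2 fun c ↦ ?_)
  obtain ⟨s, hs, -, hs'⟩ := A.exists_le_height P c
  have hs1 : s ∈ Ioo 0 (1 - A.ε) := ⟨hs.1, hs.2.trans A.ρ_lt⟩
  filter_upwards [nhdsWithin_le_nhds (Metric.ball_mem_nhds (0 : ℂ) ((P i).f_pos s)),
    self_mem_nhdsWithin] with z hz hz0
  have hz2 : z ∈ Metric.ball (0 : ℂ) 2 :=
    Metric.ball_subset_ball (A.f_mem P i hs1).2.le hz
  obtain ⟨q, hq, rfl⟩ := A.exists_endCoord P i hz2 hz0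
  have h1 : ((A.ends P).e i).symm (A.endCoord P (B.pageEnd i q)) = B.pageEnd i q := by
    rw [← A.ends_coe P i]
    exact ((A.ends P).e i).left_inv (by rw [A.ends_source P i]; exact ⟨q, hq, rfl⟩)
  rw [h1]
  have h2 : q.1 < s := by
    rw [mem_ball_zero_iff, A.norm_endCoord_pageEnd P i hq] at hz
    exact lt_of_not_ge fun h ↦ hz.not_ge ((A.f_le_iff P i hs1 hq.1).2 h)
  exact (hs' i q.1 ⟨hq.1.1, h2⟩).le.trans_eq (A.height_pageEnd P i (A.capDom_subset hq)).symm

/-- Near the punctures the curves are holomorphic for all parameters. -/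
theorem exists_isHolomorphicAt : ∃ U : Set (A.ends P).Filled, IsOpen U ∧ range (A.ends P).pt ⊆ U ∧
    ∀ δ ∈ Ico (0 : ℝ) 1, ∀ α : ℝ, ∀ z ∈ U \ range (A.ends P).pt,
      IsHolomorphicAt (fun p ↦ A.acs C δ p : InvEndField M) (fun z ↦ A.surfJ C α z)
        (fun z ↦ 0 + A.leafA z) (A.leafU α) z := by
  obtain ⟨s, hs, hs', -⟩ := A.exists_le_height P 0
  have hs1 : s ∈ Ioo 0 (1 - A.ε) := ⟨hs.1, hs.2.trans A.ρ_lt⟩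
  have hsub : ∀ i, Metric.ball (0 : ℂ) ((P i).f s) ⊆ Metric.ball 0 2 := fun i ↦
    Metric.ball_subset_ball (A.f_mem P i hs1).2.le
  refine ⟨⋃ i, (A.ends P).cap i '' Metric.ball 0 ((P i).f s), isOpen_iUnion fun i ↦
    (A.ends P).isOpen_cap_image i Metric.isOpen_ball (hsub i), ?_, ?_⟩
  · rintro _ ⟨i, rfl⟩
    exact mem_iUnion.2 ⟨i, 0, by simpa using (P i).f_pos s, (A.ends P).cap_zero i⟩
  · rintro δ hδ α z ⟨hz, hz'⟩
    obtain ⟨i, z, hzb, rfl⟩ := mem_iUnion.1 hz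
    have hz0 : z ≠ 0 := by rintro rfl; exact hz' ⟨i, ((A.ends P).cap_zero i).symm⟩
    obtain ⟨q, hq, rfl⟩ := A.exists_endCoord P i (hsub i hzb) hz0
    have h2 : q.1 < s := by
      rw [mem_ball_zero_iff, A.norm_endCoord_pageEnd P i hq] at hzb
      exact lt_of_not_ge fun h ↦ hzb.not_ge ((A.f_le_iff P i hs1 hq.1).2 h)
    rw [A.cap_endCoord P i hq]
    -- For `r < ρ₁` the function `γ₁` does not depend on `δ`, and neither do `a` and `j`, so the
    -- equation at `δ = 0` is the equation at every `δ`.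
    exact A.isHolomorphicAt_of_eq C 0 α _ fun v ↦ A.mder_height_end C hδ i hq
      (A.γ₁_ρ₁ P hδ i ⟨hq.1.1, h2.trans (hs' i)⟩) α v

end AdaptedFamily

/-! ### Integration of 2-forms over surfaces. -/

theorem det_eq_planeDet (L : ℂ →L[ℝ] ℂ) : L.det = planeDet (L 1) (L Complex.I) := by
  rw [ContinuousLinearMap.det, ← LinearMap.det_toMatrix Complex.basisOneI, Matrix.det_fin_two]
  simp [LinearMap.toMatrix_apply, planeDet]
  ring

section Mass

open MeasureTheory

variable {S : Type*} [TopologicalSpace S] [ChartedSpace ℂ S] [IsManifold 𝓘(ℝ, ℂ) ∞ S]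

/-- Change of variables for 2-forms. -/
theorem lintegral_form_chart {η : S → ℂ → ℂ → ℝ}
    (hη : ∀ z (a b c d : ℝ) v w, η z (a • v + b • w) (c • v + d • w) = (a * d - b * c) * η z v w)
    {T : ℂ → S} {O W : Set ℂ} (hO : IsOpen O) (hW : MeasurableSet W) (hWO : W ⊆ O)
    (hT : ContMDiffOn 𝓘(ℝ, ℂ) 𝓘(ℝ, ℂ) ∞ T O) (hinj : InjOn T W) (c : S) {P : Set ℂ}
    (hP : MeasurableSet P) :
    MeasurableSet {ζ | ζ ∈ W ∧ T ζ ∈ (extChartAt 𝓘(ℝ, ℂ) c).source ∧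
      extChartAt 𝓘(ℝ, ℂ) c (T ζ) ∈ P} ∧
    ∫⁻ x in (fun ζ ↦ extChartAt 𝓘(ℝ, ℂ) c (T ζ)) '' {ζ | ζ ∈ W ∧
        T ζ ∈ (extChartAt 𝓘(ℝ, ℂ) c).source ∧ extChartAt 𝓘(ℝ, ℂ) c (T ζ) ∈ P},
      ENNReal.ofReal |η ((extChartAt 𝓘(ℝ, ℂ) c).symm x)
        (mder 𝓘(ℝ, ℂ) 𝓘(ℝ, ℂ) (extChartAt 𝓘(ℝ, ℂ) c).symm x 1)
        (mder 𝓘(ℝ, ℂ) 𝓘(ℝ, ℂ) (extChartAt 𝓘(ℝ, ℂ) c).symm x Complex.I)| =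
    ∫⁻ ζ in {ζ | ζ ∈ W ∧ T ζ ∈ (extChartAt 𝓘(ℝ, ℂ) c).source ∧
        extChartAt 𝓘(ℝ, ℂ) c (T ζ) ∈ P},
      ENNReal.ofReal |η (T ζ) (mder 𝓘(ℝ, ℂ) 𝓘(ℝ, ℂ) T ζ 1)
        (mder 𝓘(ℝ, ℂ) 𝓘(ℝ, ℂ) T ζ Complex.I)| := by
  set e := extChartAt 𝓘(ℝ, ℂ) c with he
  set A := {ζ | ζ ∈ W ∧ T ζ ∈ e.source ∧ e (T ζ) ∈ P} with hA
  have hV : IsOpen (O ∩ T ⁻¹' e.source) :=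
    hT.continuousOn.isOpen_inter_preimage hO (isOpen_extChartAt_source c)
  have hg : ContMDiffOn 𝓘(ℝ, ℂ) 𝓘(ℝ, ℂ) ∞ (fun ζ ↦ e (T ζ)) (O ∩ T ⁻¹' e.source) := by
    have h1 : ContMDiffOn 𝓘(ℝ, ℂ) 𝓘(ℝ, ℂ) ∞ e (chartAt ℂ c).source := contMDiffOn_extChartAt
    exact h1.comp (hT.mono inter_subset_left) fun ζ hζ ↦ by
      have := hζ.2
      rwa [mem_preimage, he, extChartAt_source] at this
  have hAV : A ⊆ O ∩ T ⁻¹' e.source := fun ζ hζ ↦ ⟨hWO hζ.1, hζ.2.1⟩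
  -- The map `e ∘ T` is continuous only on an open set, so measurability is first proved for its
  -- restriction to that subtype.
  have hmeas : MeasurableSet A := by
    have h1 : MeasurableSet ((O ∩ T ⁻¹' e.source) ∩ (fun ζ ↦ e (T ζ)) ⁻¹' P) := by
      have h2 : Measurable ((O ∩ T ⁻¹' e.source).domRestrict fun ζ ↦ e (T ζ)) :=
        (continuousOn_iff_continuous_domRestrict.1 hg.continuousOn).measurable
      have h3 := hV.measurableSet.subtype_image (h2 hP)
      convert h3 using 1
      ext ζ
      constructor
      · rintro ⟨h4, h5⟩; exact ⟨⟨ζ, h4⟩, h5, rfl⟩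
      · rintro ⟨⟨ζ', h4⟩, h5, rfl⟩; exact ⟨h4, h5⟩
    convert hW.inter h1 using 1
    ext ζ
    exact ⟨fun h ↦ ⟨h.1, hAV h, h.2.2⟩, fun h ↦ ⟨h.1, h.2.1.2, h.2.2⟩⟩
  refine ⟨hmeas, ?_⟩
  have hgd : ∀ ζ ∈ A, DifferentiableAt ℝ (fun ζ ↦ e (T ζ)) ζ := fun ζ hζ ↦
    ((contMDiffOn_iff_contDiffOn.1 hg).contDiffAt (hV.mem_nhds (hAV hζ))).differentiableAt (by simp)
  have hginj : InjOn (fun ζ ↦ e (T ζ)) A := fun ζ hζ ξ hξ h ↦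
    hinj hζ.1 hξ.1 (e.injOn hζ.2.1 hξ.2.1 h)
  rw [lintegral_image_eq_lintegral_abs_det_fderiv_mul volume hmeas
    (fun ζ hζ ↦ (hgd ζ hζ).hasFDerivAt.hasFDerivWithinAt) hginj]
  refine setLIntegral_congr_fun hmeas fun ζ hζ ↦ ?_
  have hψ : MDifferentiableAt 𝓘(ℝ, ℂ) 𝓘(ℝ, ℂ) e.symm (e (T ζ)) :=
    ((contMDiffOn_extChartAt_symm (n := ∞) c).contMDiffAt
      ((isOpen_extChartAt_target c).mem_nhds (e.map_source hζ.2.1))).mdifferentiableAt (by simp)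
  have hT' : ∀ v, mder 𝓘(ℝ, ℂ) 𝓘(ℝ, ℂ) T ζ v =
      mder 𝓘(ℝ, ℂ) 𝓘(ℝ, ℂ) e.symm (e (T ζ)) (fderiv ℝ (fun ζ ↦ e (T ζ)) ζ v) := by
    intro v
    rw [← mder_eq_fderiv, ← mder_comp_apply ζ hψ (hgd ζ hζ).mdifferentiableAt]
    refine DFunLike.congr_fun (mder_congr (I := 𝓘(ℝ, ℂ)) (I' := 𝓘(ℝ, ℂ)) (N' := S) ?_) v
    filter_upwards [hV.mem_nhds (hAV hζ)] with ξ hξ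
    exact (e.left_inv hξ.2).symm
  have hlin : ∀ v : ℂ, mder 𝓘(ℝ, ℂ) 𝓘(ℝ, ℂ) e.symm (e (T ζ)) v =
      v.re • mder 𝓘(ℝ, ℂ) 𝓘(ℝ, ℂ) e.symm (e (T ζ)) 1 +
        v.im • mder 𝓘(ℝ, ℂ) 𝓘(ℝ, ℂ) e.symm (e (T ζ)) Complex.I := fun v ↦ by
    rw [← map_smul, ← map_smul, ← map_add, smul_one_add_smul_I]
  rw [hT', hT', hlin (fderiv ℝ (fun ζ ↦ e (T ζ)) ζ 1),
    hlin (fderiv ℝ (fun ζ ↦ e (T ζ)) ζ Complex.I), hη, abs_mul,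
    ENNReal.ofReal_mul (abs_nonneg _), det_eq_planeDet, e.left_inv hζ.2.1]
  rfl

/-- The mass of a 2-form is bounded by its integral over parametrised pieces. -/
theorem twoFormMass_le {n : ℕ} {η : S → ℂ → ℂ → ℝ}
    (hη : ∀ z (a b c d : ℝ) v w, η z (a • v + b • w) (c • v + d • w) = (a * d - b * c) * η z v w)
    {U : Set S} {T : Fin n → ℂ → S} {O W : Fin n → Set ℂ} (hO : ∀ i, IsOpen (O i))
    (hW : ∀ i, MeasurableSet (W i)) (hWO : ∀ i, W i ⊆ O i)
    (hT : ∀ i, ContMDiffOn 𝓘(ℝ, ℂ) 𝓘(ℝ, ℂ) ∞ (T i) (O i)) (hinj : ∀ i, InjOn (T i) (W i))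
    (hcover : ∀ z ∈ U, (∃ i, z ∈ T i '' W i) ∨ ∀ v w, η z v w = 0) :
    twoFormMass (fun z v w ↦ η z v w) U ≤ ∑ i, ∫⁻ ζ in W i,
      ENNReal.ofReal |η (T i ζ) (mder 𝓘(ℝ, ℂ) 𝓘(ℝ, ℂ) (T i) ζ 1)
        (mder 𝓘(ℝ, ℂ) 𝓘(ℝ, ℂ) (T i) ζ Complex.I)| := by
  refine iSup_le fun N ↦ iSup_le fun c ↦ iSup_le fun P ↦ iSup_le fun hP ↦ iSup_le fun hdis ↦ ?_
  let A : Fin N → Fin n → Set ℂ := fun k i ↦ {ζ | ζ ∈ W i ∧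
    T i ζ ∈ (extChartAt 𝓘(ℝ, ℂ) (c k)).source ∧ extChartAt 𝓘(ℝ, ℂ) (c k) (T i ζ) ∈ P k}
  have key := fun k i ↦ lintegral_form_chart hη (hO i) (hW i) (hWO i) (hT i) (hinj i) (c k) (hP k).1
  let H : Fin n → ℂ → ℝ≥0∞ := fun i ζ ↦ ENNReal.ofReal
    |η (T i ζ) (mder 𝓘(ℝ, ℂ) 𝓘(ℝ, ℂ) (T i) ζ 1) (mder 𝓘(ℝ, ℂ) 𝓘(ℝ, ℂ) (T i) ζ Complex.I)|
  have h1 : ∀ k, ∫⁻ x in P k, ENNReal.ofReal |η ((extChartAt 𝓘(ℝ, ℂ) (c k)).symm x)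
        (mder 𝓘(ℝ, ℂ) 𝓘(ℝ, ℂ) (extChartAt 𝓘(ℝ, ℂ) (c k)).symm x 1)
        (mder 𝓘(ℝ, ℂ) 𝓘(ℝ, ℂ) (extChartAt 𝓘(ℝ, ℂ) (c k)).symm x Complex.I)| ≤
      ∑ i, ∫⁻ ζ in A k i, H i ζ := by
    intro k
    set f : ℂ → ℝ≥0∞ := fun x ↦ ENNReal.ofReal |η ((extChartAt 𝓘(ℝ, ℂ) (c k)).symm x)
        (mder 𝓘(ℝ, ℂ) 𝓘(ℝ, ℂ) (extChartAt 𝓘(ℝ, ℂ) (c k)).symm x 1)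
        (mder 𝓘(ℝ, ℂ) 𝓘(ℝ, ℂ) (extChartAt 𝓘(ℝ, ℂ) (c k)).symm x Complex.I)| with hf
    set V : Set ℂ := ⋃ i, (fun ζ ↦ extChartAt 𝓘(ℝ, ℂ) (c k) (T i ζ)) '' A k i with hV
    calc ∫⁻ x in P k, f x = ∫⁻ x, (P k).indicator f x := (lintegral_indicator (hP k).1 f).symm
      _ ≤ ∫⁻ x, V.indicator f x := by
        refine lintegral_mono fun x ↦ ?_
        by_cases hx : x ∈ P k
        · by_cases hxV : x ∈ V
          · rw [indicator_of_mem hx, indicator_of_mem hxV]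
          -- A point of the piece outside all the parametrised sets contributes nothing, because the
          -- form vanishes there.
          · have hz : ∀ v w, η ((extChartAt 𝓘(ℝ, ℂ) (c k)).symm x) v w = 0 := by
              refine (hcover _ ((hP k).2.2 ⟨x, hx, rfl⟩)).resolve_left ?_
              rintro ⟨i, ζ, hζ, h⟩
              have hxt := (hP k).2.1 hx
              have h2 : extChartAt 𝓘(ℝ, ℂ) (c k) (T i ζ) = x := by
                rw [h]; exact (extChartAt 𝓘(ℝ, ℂ) (c k)).right_inv hxt
              refine hxV (mem_iUnion.2 ⟨i, ζ, ⟨hζ, ?_, ?_⟩, h2⟩)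
              · rw [h]; exact (extChartAt 𝓘(ℝ, ℂ) (c k)).map_target hxt
              · rw [h2]; exact hx
            rw [indicator_of_mem hx, hf]
            simp only [hz, abs_zero, ENNReal.ofReal_zero, zero_le]
        · rw [indicator_of_notMem hx]; exact zero_le
      _ ≤ ∫⁻ x in V, f x := lintegral_indicator_le f V
      _ ≤ ∑' i, ∫⁻ x in (fun ζ ↦ extChartAt 𝓘(ℝ, ℂ) (c k) (T i ζ)) '' A k i, f x :=
        lintegral_iUnion_le _ _
      _ = ∑ i, ∫⁻ x in (fun ζ ↦ extChartAt 𝓘(ℝ, ℂ) (c k) (T i ζ)) '' A k i, f x := tsum_fintype _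
      _ = ∑ i, ∫⁻ ζ in A k i, H i ζ := Finset.sum_congr rfl fun i _ ↦ (key k i).2
  calc _ ≤ ∑ k, ∑ i, ∫⁻ ζ in A k i, H i ζ := Finset.sum_le_sum fun k _ ↦ h1 k
    _ = ∑ i, ∑ k, ∫⁻ ζ in A k i, H i ζ := Finset.sum_comm
    _ ≤ ∑ i, ∫⁻ ζ in W i, H i ζ := by
      refine Finset.sum_le_sum fun i _ ↦ ?_
      -- The pieces on the surface are disjoint, so their preimages in the parameter domain `W i`
      -- are disjoint and the integrals over them add up to at most the integral over `W i`.
      have hd : Pairwise (Function.onFun Disjoint fun k ↦ A k i) := by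
        intro k l hkl
        rw [Function.onFun, disjoint_left]
        rintro ζ ⟨-, h1, h2⟩ ⟨-, h3, h4⟩
        have h5 : T i ζ ∈ (extChartAt 𝓘(ℝ, ℂ) (c k)).symm '' P k :=
          ⟨_, h2, (extChartAt 𝓘(ℝ, ℂ) (c k)).left_inv h1⟩
        exact disjoint_left.1 (hdis hkl) h5 ⟨_, h4, (extChartAt 𝓘(ℝ, ℂ) (c l)).left_inv h3⟩
      have h2 := lintegral_iUnion (μ := volume) (fun k ↦ (key k i).1) hd (H i)
      rw [tsum_fintype] at h2
      have h3 : ⋃ k, A k i ⊆ W i := iUnion_subset fun k ζ hζ ↦ hζ.1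
      exact h2.symm.trans_le (lintegral_mono_set h3)

/-- The variation of a decreasing function is the difference of its boundary values. Nothing is
assumed at the end points, so the interval is exhausted by compact ones. -/
theorem lintegral_abs_deriv_le {G G' : ℝ → ℝ} {R m : ℝ} (hR : 0 < R)
    (hd : ∀ r ∈ Ioo 0 R, HasDerivAt G (G' r) r) (hneg : ∀ r ∈ Ioo 0 R, G' r ≤ 0)
    (hG : ∀ r ∈ Ioo 0 R, G r ∈ Icc 0 m) :
    ∫⁻ r in Ioo 0 R, ENNReal.ofReal |deriv G r| ≤ ENNReal.ofReal m := by
  -- The shift by `3` ensures `u k < R/2` for all `k`, hence `u k ≤ R - u k`.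
  let u : ℕ → ℝ := fun k ↦ R / (k + 3)
  have hu : Tendsto u atTop (𝓝 0) :=
    tendsto_const_nhds.div_atTop (tendsto_atTop_add_const_right _ _ tendsto_natCast_atTop_atTop)
  have hu' : ∀ k, u k ∈ Ioo 0 (R / 2) := fun k ↦ by
    have : (0 : ℝ) ≤ k := Nat.cast_nonneg k
    refine ⟨by positivity, ?_⟩
    exact div_lt_div_of_pos_left hR (by norm_num) (by linarith)
  have hcov : AECover (volume.restrict (Ioo 0 R)) atTop fun k ↦ Ioc (u k) (R - u k) :=
    aecover_Ioo_of_Ioc hu (by simpa using tendsto_const_nhds.sub hu)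
  refine le_of_tendsto' (hcov.lintegral_tendsto_of_countably_generated
    (measurable_deriv G).norm.ennreal_ofReal.aemeasurable) fun k ↦ ?_
  have hk := hu' k
  have hsub : Icc (u k) (R - u k) ⊆ Ioo 0 R := fun r hr ↦
    ⟨hk.1.trans_le hr.1, by linarith [hr.2, hk.1]⟩
  have hle : u k ≤ R - u k := by linarith [hk.2]
  have hcont : ContinuousOn (fun r ↦ -G r) (Icc (u k) (R - u k)) := fun r hr ↦
    (hd r (hsub hr)).continuousAt.continuousWithinAt.neg
  have hder : ∀ r ∈ Ioo (u k) (R - u k), HasDerivAt (fun r ↦ -G r) (-G' r) r := fun r hr ↦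
    (hd r (hsub (Ioo_subset_Icc_self hr))).neg
  have hint := intervalIntegral.integrableOn_deriv_of_nonneg hcont hder fun r hr ↦
    neg_nonneg.2 (hneg r (hsub (Ioo_subset_Icc_self hr)))
  rw [Measure.restrict_restrict measurableSet_Ioc]
  calc ∫⁻ r in Ioc (u k) (R - u k) ∩ Ioo 0 R, ENNReal.ofReal |deriv G r|
      ≤ ∫⁻ r in Ioc (u k) (R - u k), ENNReal.ofReal |deriv G r| := lintegral_mono_set inter_subset_left
    _ = ∫⁻ r in Ioc (u k) (R - u k), ENNReal.ofReal (-G' r) := by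
      refine setLIntegral_congr_fun measurableSet_Ioc fun r hr ↦ ?_
      have hr' := hsub (Ioc_subset_Icc_self hr)
      rw [(hd r hr').deriv, abs_of_nonpos (hneg r hr')]
    _ = ENNReal.ofReal (∫ r in Ioc (u k) (R - u k), -G' r) := by
      refine (ofReal_integral_eq_lintegral_ofReal hint ?_).symm
      filter_upwards [ae_restrict_mem measurableSet_Ioc] with r hr
      exact neg_nonneg.2 (hneg r (hsub (Ioc_subset_Icc_self hr)))
    _ ≤ ENNReal.ofReal m := by
      refine ENNReal.ofReal_le_ofReal ?_
      rw [← intervalIntegral.integral_of_le hle,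
        intervalIntegral.integral_eq_sub_of_hasDerivAt_of_le hle hcont hder
          ((intervalIntegrable_iff_integrableOn_Ioc_of_le hle).2 hint)]
      have h1 := hG _ (hsub ⟨le_rfl, hle⟩)
      have h2 := hG _ (hsub ⟨hle, le_rfl⟩)
      linarith [h1.2, h2.1]

theorem lintegral_re {f : ℝ → ℝ≥0∞} (hf : Measurable f) (R L : ℝ) :
    ∫⁻ ζ in {ζ : ℂ | ζ.re ∈ Ioo 0 R ∧ ζ.im ∈ Ico 0 L}, f ζ.re =
      (∫⁻ r in Ioo 0 R, f r) * ENNReal.ofReal L := by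
  have h1 := Complex.volume_preserving_equiv_real_prod.setLIntegral_comp_preimage
    (s := Ioo 0 R ×ˢ Ico 0 L) (measurableSet_Ioo.prod measurableSet_Ico)
    (f := fun p : ℝ × ℝ ↦ f p.1) (hf.comp measurable_fst)
  refine Eq.trans ?_ (h1.trans ?_)
  · rfl
  · rw [Measure.volume_eq_prod, setLIntegral_prod (fun p : ℝ × ℝ ↦ f p.1) (hf.comp measurable_fst).aemeasurable]
    simp only [lintegral_const, Measure.restrict_apply_univ, Real.volume_Ico, sub_zero]
    rw [lintegral_mul_const _ hf]

end Mass

theorem energyForm_comb {M : Type*} [TopologicalSpace M] [ChartedSpace (EuclideanSpace ℝ (Fin 3)) M]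
    {S : Type*} [TopologicalSpace S] [ChartedSpace ℂ S] (lam : OneForm M) (φ : ℝ → ℝ) (a : S → ℝ)
    (u : S → M) (z : S) (k l m o : ℝ) (v w : ℂ) :
    energyForm lam φ a u z (k • v + l • w : ℂ) (m • v + o • w : ℂ) =
      (k * o - l * m) * energyForm lam φ a u z v w := by
  let La : ℂ →L[ℝ] ℝ := mder 𝓘(ℝ, ℂ) 𝓘(ℝ, ℝ) a z
  let Lu : ℂ →L[ℝ] EuclideanSpace ℝ (Fin 3) := mder 𝓘(ℝ, ℂ) (𝓡 3) u z
  let ℓ : EuclideanSpace ℝ (Fin 3) →L[ℝ] ℝ := lam (u z)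
  change deriv φ (a z) * (La (k • v + l • w) * ℓ (Lu (m • v + o • w)) -
      La (m • v + o • w) * ℓ (Lu (k • v + l • w))) +
      φ (a z) * extD lam (u z) (Lu (k • v + l • w)) (Lu (m • v + o • w)) =
    (k * o - l * m) * (deriv φ (a z) * (La v * ℓ (Lu w) - La w * ℓ (Lu v)) +
      φ (a z) * extD lam (u z) (Lu v) (Lu w))
  simp only [map_add, map_smul, smul_eq_mul]
  rw [extD_comb]
  ring

/-! ### Finite energy of the curves. -/

namespace AdaptedFamily

open OpenBook MeasureTheory

variable {M : Type*} [TopologicalSpace M] [ChartedSpace (EuclideanSpace ℝ (Fin 3)) M]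
  [IsManifold (𝓡 3) ∞ M] [T2Space M]
  {F : Type*} [TopologicalSpace F] [ChartedSpace ℂ F] [IsManifold 𝓘(ℝ, ℂ) ∞ F] {n : ℕ}
  {B : OpenBook M F n} (A : AdaptedFamily B) (P : A.Profiles) [Nonempty F]

theorem energyForm_leaf (φ : ℝ → ℝ) (c α : ℝ) (x : F) (v w : ℂ) :
    energyForm (A.lam 0) φ (fun z ↦ c + A.leafA (P := P) z) (A.leafU α) ((A.ends P).inc x)
      (mder 𝓘(ℝ, ℂ) 𝓘(ℝ, ℂ) (A.ends P).inc x v) (mder 𝓘(ℝ, ℂ) 𝓘(ℝ, ℂ) (A.ends P).inc x w) =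
    deriv φ (c + A.height P x) *
      (mder 𝓘(ℝ, ℂ) 𝓘(ℝ, ℝ) (A.height P) x v * A.lamHat 0 (x, α) (w, 0) -
        mder 𝓘(ℝ, ℂ) 𝓘(ℝ, ℝ) (A.height P) x w * A.lamHat 0 (x, α) (v, 0)) +
      φ (c + A.height P x) *
        extD (A.lam 0) (B.mt (x, α)) (dmt B (x, α) (v, 0)) (dmt B (x, α) (w, 0)) :=
  congrArg₂ (fun V W : ℝ × EuclideanSpace ℝ (Fin 3) ↦ deriv φ (c + A.height P x) *
      (V.1 * A.lam 0 (B.mt (x, α)) W.2 - W.1 * A.lam 0 (B.mt (x, α)) V.2) +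
      φ (c + A.height P x) * extD (A.lam 0) (B.mt (x, α)) V.2 W.2)
    (A.curveDeriv_leaf c α x v) (A.curveDeriv_leaf c α x w)

/-- The coefficient is the `r`-derivative of `φ(c + a) γ₁`: on an end the curve pulls `φ λ_0` back
to `φ(c + a(r)) γ₁(r) dθ`. -/
theorem energyForm_leaf_end (φ : ℝ → ℝ) (c α : ℝ) (i : Fin n) {q : ℝ × ℝ} (hq : q ∈ B.endDom)
    (v w : ℝ × ℝ) :
    energyForm (A.lam 0) φ (fun z ↦ c + A.leafA (P := P) z) (A.leafU α)
      ((A.ends P).inc (B.pageEnd i q))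
      (mder 𝓘(ℝ, ℂ) 𝓘(ℝ, ℂ) (A.ends P).inc (B.pageEnd i q)
        (mder 𝓘(ℝ, ℝ × ℝ) 𝓘(ℝ, ℂ) (B.pageEnd i) q v))
      (mder 𝓘(ℝ, ℂ) 𝓘(ℝ, ℂ) (A.ends P).inc (B.pageEnd i q)
        (mder 𝓘(ℝ, ℝ × ℝ) 𝓘(ℝ, ℂ) (B.pageEnd i) q w)) =
    (deriv φ (c + (P i).a q.1) * -((P i).β q.1 * A.γ₁ i 0 q.1) * A.γ₁ i 0 q.1 +
      φ (c + (P i).a q.1) * deriv (A.γ₁ i 0) q.1) * (v.1 * w.2 - w.1 * v.2) := by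
  rw [energyForm_leaf, A.mder_height_pageEnd P i hq, A.mder_height_pageEnd P i hq,
    A.lamHat_pageEnd zero_mem' i hq, A.lamHat_pageEnd zero_mem' i hq, A.height_pageEnd P i hq]
  have h := A.extD_slide B.isOpen_endDom (B.pageEnd_smooth i) hq zero_mem' α (v, 0) (w, 0)
  rw [show (q, α) = ((q.1, q.2), α) from rfl, A.pullD_polar zero_mem' i hq.1] at h
  rw [show extD (A.lam 0) (B.mt (B.pageEnd i q, α))
    (dmt B (B.pageEnd i q, α) (mder 𝓘(ℝ, ℝ × ℝ) 𝓘(ℝ, ℂ) (B.pageEnd i) q v, 0))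
    (dmt B (B.pageEnd i q, α) (mder 𝓘(ℝ, ℝ × ℝ) 𝓘(ℝ, ℂ) (B.pageEnd i) q w, 0)) = _ from h]
  ring

/-- Both factors of `φ(c + a) γ₁` are nonnegative and nonincreasing in `r`, and the product is at
most `γ₁(0)`. The bound is uniform in `φ` and `c`. -/
theorem lintegral_energyForm_end_le {φ : ℝ → ℝ} (hφ : ContDiff ℝ ∞ φ)
    (hφ1 : ∀ s, φ s ∈ Icc (0 : ℝ) 1) (hφ2 : ∀ s, 0 ≤ deriv φ s) (c : ℝ) (i : Fin n) :
    ∫⁻ ζ in {ζ : ℂ | ζ.re ∈ Ioo 0 B.R ∧ ζ.im ∈ Ico 0 (2 * Real.pi)}, ENNReal.ofReal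
      |deriv φ (c + (P i).a ζ.re) * -((P i).β ζ.re * A.γ₁ i 0 ζ.re) * A.γ₁ i 0 ζ.re +
      φ (c + (P i).a ζ.re) * deriv (A.γ₁ i 0) ζ.re| ≤
    ENNReal.ofReal (A.γ₁ i 0 0) * ENNReal.ofReal (2 * Real.pi) := by
  set G' : ℝ → ℝ := fun r ↦ deriv φ (c + (P i).a r) * -((P i).β r * A.γ₁ i 0 r) * A.γ₁ i 0 r +
    φ (c + (P i).a r) * deriv (A.γ₁ i 0) r with hG'
  set G : ℝ → ℝ := fun r ↦ φ (c + (P i).a r) * A.γ₁ i 0 r with hG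
  have hd : ∀ r ∈ Ioo 0 B.R, HasDerivAt G (G' r) r := fun r hr ↦ by
    have h1 : HasDerivAt (fun r ↦ φ (c + (P i).a r))
        (deriv φ (c + (P i).a r) * -((P i).β r * A.γ₁ i 0 r)) r :=
      (hφ.differentiable (by simp) _).hasDerivAt.comp r (((P i).a_deriv r hr).const_add c)
    exact h1.mul (A.hasDerivAt_γ₁ zero_mem' i hr)
  have h1 := lintegral_re (f := fun r ↦ ENNReal.ofReal |deriv G r|)
    (measurable_deriv G).norm.ennreal_ofReal B.R (2 * Real.pi)
  have hW : MeasurableSet {ζ : ℂ | ζ.re ∈ Ioo 0 B.R ∧ ζ.im ∈ Ico 0 (2 * Real.pi)} :=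
    (Complex.measurable_re measurableSet_Ioo).inter (Complex.measurable_im measurableSet_Ico)
  refine (setLIntegral_congr_fun hW (g := fun ζ : ℂ ↦ ENNReal.ofReal |deriv G ζ.re|)
    fun ζ hζ ↦ ?_).trans_le (h1.trans_le ?_)
  · exact congrArg (fun s : ℝ ↦ ENNReal.ofReal |s|) (hd ζ.re hζ.1).deriv.symm
  · gcongr
    refine lintegral_abs_deriv_le B.R_pos hd (fun r hr ↦ ?_) fun r hr ↦ ?_
    · have h2 := mul_nonneg (hφ2 (c + (P i).a r)) (mul_nonneg ((P i).β_pos r hr).le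
        (mul_self_nonneg (A.γ₁ i 0 r)))
      have h3 := mul_nonneg (hφ1 (c + (P i).a r)).1 (neg_nonneg.2 (A.deriv_γ₁_zero_nonpos i hr))
      simp only [hG']
      linarith
    · have h2 := A.γ₁_zero_nonneg i hr
      have h3 := hφ1 (c + (P i).a r)
      exact ⟨mul_nonneg h3.1 h2, (mul_le_of_le_one_left h2 h3.2).trans (A.γ₁_zero_le i hr)⟩

/-- Each end is parametrised by a fundamental domain `0 ≤ θ < 2π`, on which the parametrisation is
injective. The total bound `2π ∑ γ₁(0)` does not depend on `φ`, so it survives the supremum. -/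
theorem energy_leaf_lt_top (c α : ℝ) :
    energy (A.lam 0) (fun z ↦ c + A.leafA (P := P) z) (A.leafU α) (range (A.ends P).pt)ᶜ < ⊤ := by
  refine lt_of_le_of_lt (b := ∑ i, ENNReal.ofReal (A.γ₁ i 0 0) * ENNReal.ofReal (2 * Real.pi)) ?_
    (ENNReal.sum_lt_top.2 fun i _ ↦ ENNReal.mul_lt_top ENNReal.ofReal_lt_top ENNReal.ofReal_lt_top)
  refine iSup_le fun φ ↦ iSup_le fun hφ ↦ iSup_le fun hφ1 ↦ iSup_le fun hφ2 ↦ ?_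
  let T : Fin n → ℂ → (A.ends P).Filled := fun i ζ ↦ (A.ends P).inc (B.pageEnd i (ζ.re, ζ.im))
  let O : Set ℂ := {ζ | ζ.re ∈ Ioo 0 B.R}
  let W : Set ℂ := {ζ | ζ.re ∈ Ioo 0 B.R ∧ ζ.im ∈ Ico 0 (2 * Real.pi)}
  have hO : IsOpen O := isOpen_Ioo.preimage Complex.continuous_re
  have hW : MeasurableSet W :=
    (Complex.measurable_re measurableSet_Ioo).inter (Complex.measurable_im measurableSet_Ico)
  have hψ : ContMDiff 𝓘(ℝ, ℂ) 𝓘(ℝ, ℝ × ℝ) ∞ fun ζ : ℂ ↦ (ζ.re, ζ.im) :=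
    Complex.equivRealProdCLM.contDiff.contMDiff
  have hpe : ∀ i, ContMDiffOn 𝓘(ℝ, ℂ) 𝓘(ℝ, ℂ) ∞ (fun ζ : ℂ ↦ B.pageEnd i (ζ.re, ζ.im)) O := fun i ↦
    (B.pageEnd_smooth i).comp hψ.contMDiffOn fun ζ hζ ↦ ⟨hζ, mem_univ _⟩
  have hT : ∀ i, ContMDiffOn 𝓘(ℝ, ℂ) 𝓘(ℝ, ℂ) ∞ (T i) O := fun i ↦
    (A.ends P).contMDiff_inc.comp_contMDiffOn (hpe i)
  have hdT : ∀ i, ∀ ζ ∈ O, ∀ v : ℂ, mder 𝓘(ℝ, ℂ) 𝓘(ℝ, ℂ) (T i) ζ v =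
      mder 𝓘(ℝ, ℂ) 𝓘(ℝ, ℂ) (A.ends P).inc (B.pageEnd i (ζ.re, ζ.im))
        (mder 𝓘(ℝ, ℝ × ℝ) 𝓘(ℝ, ℂ) (B.pageEnd i) (ζ.re, ζ.im) (v.re, v.im)) := fun i ζ hζ v ↦ by
    have hζ' : (ζ.re, ζ.im) ∈ B.endDom := ⟨hζ, mem_univ _⟩
    refine (mder_comp_apply (g := (A.ends P).inc) (f := fun ζ : ℂ ↦ B.pageEnd i (ζ.re, ζ.im)) ζ
      ((A.ends P).contMDiff_inc.contMDiffAt.mdifferentiableAt (by simp))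
      (((hpe i).contMDiffAt (hO.mem_nhds hζ)).mdifferentiableAt (by simp)) v).trans ?_
    refine congrArg _ ?_
    refine (mder_comp_apply (I := 𝓘(ℝ, ℂ)) (I' := 𝓘(ℝ, ℝ × ℝ)) (g := B.pageEnd i)
      (f := fun ζ : ℂ ↦ (ζ.re, ζ.im)) ζ
      (((B.pageEnd_smooth i).contMDiffAt (B.isOpen_endDom.mem_nhds hζ')).mdifferentiableAt
        (by simp)) (hψ.contMDiffAt.mdifferentiableAt (by simp)) v).trans ?_
    refine congrArg _ ?_
    rw [mder_eq_fderiv]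
    exact DFunLike.congr_fun Complex.equivRealProdCLM.hasFDerivAt.fderiv v
  have hinj : ∀ i, InjOn (T i) W := fun i ζ hζ ξ hξ h ↦ by
    obtain ⟨-, h1, k, h2⟩ := (B.pageEnd_eq_iff _ _ _ hζ.1 _ hξ.1 _ _).1 ((A.ends P).inc_injective h)
    refine Complex.ext h1 ?_
    have h3 := hζ.2
    have h4 := hξ.2
    have hk : k = 0 := by
      have hp := Real.two_pi_pos
      have h5 : (k : ℝ) < 1 := by by_contra! h; nlinarith [h3.1, h4.2]
      have h6 : (-1 : ℝ) < k := by by_contra! h; nlinarith [h3.2, h4.1]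
      have h7 : k < 1 := by exact_mod_cast h5
      have h8 : -1 < k := by exact_mod_cast h6
      omega
    rw [h2, hk]; simp
  have h1 := twoFormMass_le (U := (range (A.ends P).pt)ᶜ)
    (η := fun z v w ↦ energyForm (A.lam 0) φ (fun z ↦ c + A.leafA (P := P) z) (A.leafU α) z v w)
    (fun z a b c' d v w ↦ energyForm_comb _ _ _ _ z a b c' d v w)
    (fun _ ↦ hO) (fun _ ↦ hW) (fun _ ζ hζ ↦ hζ.1) hT hinj ?_
  · refine h1.trans (Finset.sum_le_sum fun i _ ↦ ?_)
    refine (setLIntegral_congr_fun hW fun ζ hζ ↦ ?_).trans_le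
      (A.lintegral_energyForm_end_le P hφ hφ1 hφ2 c i)
    have h2 := A.energyForm_leaf_end P φ c α i (q := (ζ.re, ζ.im)) ⟨hζ.1, mem_univ _⟩
      ((1 : ℂ).re, (1 : ℂ).im) (Complex.I.re, Complex.I.im)
    rw [← hdT i ζ hζ.1, ← hdT i ζ hζ.1] at h2
    refine congrArg (fun s : ℝ ↦ ENNReal.ofReal |s|) (h2.trans ?_)
    simp
  · rintro z hz
    rw [(A.ends P).compl_range_pt] at hz
    obtain ⟨x, rfl⟩ := hz
    by_cases hx : x ∈ ⋃ i, B.pageEnd i '' B.endDom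
    · obtain ⟨i, q, hq, rfl⟩ := mem_iUnion.1 hx
      refine Or.inl ⟨i, ⟨q.1, toIcoMod Real.two_pi_pos 0 q.2⟩, ⟨hq.1, ?_⟩, ?_⟩
      · simpa using toIcoMod_mem_Ico Real.two_pi_pos 0 q.2
      · refine congrArg (A.ends P).inc ((B.pageEnd_eq_iff _ _ _ hq.1 _ hq.1 _ _).2
          ⟨rfl, rfl, toIcoDiv Real.two_pi_pos 0 q.2, ?_⟩)
        have h := toIcoMod_add_toIcoDiv_zsmul Real.two_pi_pos 0 q.2
        rw [zsmul_eq_mul, mul_comm (_ : ℝ) (2 * Real.pi)] at h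
        exact h.symm
    -- Off the ends the height has zero derivative and `λ_0` is closed, so both terms of the form
    -- vanish.
    · refine Or.inr fun v w ↦ ?_
      obtain ⟨v, rfl⟩ := ((A.ends P).bijective_mder_inc x).2 v
      obtain ⟨w, rfl⟩ := ((A.ends P).bijective_mder_inc x).2 w
      refine (A.energyForm_leaf P φ c α x v w).trans ?_
      have hx1 : x ∉ ⋃ i, B.pageEnd i '' A.capDom := fun h ↦
        hx (iUnion_mono (fun i ↦ image_mono A.capDom_subset) h)
      have hx2 : x ∉ ⋃ i, B.pageEnd i '' (Ioc 0 (1 - A.ε) ×ˢ univ) := fun h ↦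
        hx (iUnion_mono (fun i ↦ image_mono (prod_mono
          (Ioc_subset_Ioo_right A.one_sub_ε.2) subset_rfl)) h)
      rw [A.mder_height_of_notMem (P := P) hx1, A.mder_height_of_notMem (P := P) hx1,
        A.extD_zero_of_notMem hx2]
      ring

variable {P} (C : A.PageComplex P)

theorem isEmbeddedFiniteEnergyCurve_leaf [CompactSpace M] (c α : ℝ) :
    IsEmbeddedFiniteEnergyCurve (A.lam 0) (fun p ↦ A.acs C 0 p : InvEndField M)
      (range (A.ends P).pt) (fun z ↦ A.surfJ C α z) (fun z ↦ c + A.leafA z) (A.leafU α) where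
  smooth_a := contMDiffOn_const.add A.contMDiffOn_leafA
  smooth_u := A.contMDiffOn_leafU_slice α
  holomorphic z hz := by
    rw [(A.ends P).compl_range_pt] at hz
    obtain ⟨x, rfl⟩ := hz
    exact A.isHolomorphicAt_of_eq C c α x fun v ↦ A.mder_height C x α v
  embedding := A.isEmbedding_leaf c α
  immersion z hz := by
    rw [(A.ends P).compl_range_pt] at hz
    obtain ⟨x, rfl⟩ := hz
    exact A.injective_curveDeriv c α x
  proper := A.isProperMap_leaf c α
  finite_energy := A.energy_leaf_lt_top P c α

end AdaptedFamily

/-! ### Foliated charts from adapted parametrisations. -/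

section Charts

variable {M : Type*} [TopologicalSpace M] [ChartedSpace (EuclideanSpace ℝ (Fin 3)) M]
  [IsManifold (𝓡 3) ∞ M]
  {V : Type*} [NormedAddCommGroup V] [NormedSpace ℝ V] [CompleteSpace V]

/-- Injectivity suffices, since both sides have real dimension `4`. -/
theorem bijective_mder_pair {ψ : V → M} {O : Set V} (hO : IsOpen O)
    (hψ : ContMDiffOn 𝓘(ℝ, V) (𝓡 3) ∞ ψ O)
    (hd : ∀ x ∈ O, Function.Bijective (mder 𝓘(ℝ, V) (𝓡 3) ψ x)) {g : ℂ × ℂ → ℝ} {l : ℂ × ℂ → V}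
    {y : ℂ × ℂ} (hg : DifferentiableAt ℝ g y) (hl : DifferentiableAt ℝ l y) (hy : l y ∈ O)
    (hinj : ∀ v, fderiv ℝ l y v = 0 → fderiv ℝ g y v = 0 → v = 0) :
    Function.Bijective
      (mder 𝓘(ℝ, ℂ × ℂ) (𝓘(ℝ, ℝ).prod (𝓡 3)) (fun y ↦ (g y, ψ (l y))) y) := by
  set L := mder 𝓘(ℝ, ℂ × ℂ) (𝓘(ℝ, ℝ).prod (𝓡 3)) (fun y ↦ (g y, ψ (l y))) y with hL
  have hψ' : MDifferentiableAt 𝓘(ℝ, V) (𝓡 3) ψ (l y) :=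
    (hψ.contMDiffAt (hO.mem_nhds hy)).mdifferentiableAt (by simp)
  have h1 : ∀ v, L v = (fderiv ℝ g y v, mder 𝓘(ℝ, V) (𝓡 3) ψ (l y) (fderiv ℝ l y v)) := by
    intro v
    have h2 := mder_comp_apply (g := ψ) (f := l) y hψ' hl.mdifferentiableAt v
    rw [mder_eq_fderiv] at h2
    rw [← h2, ← mder_eq_fderiv]
    exact DFunLike.congr_fun (mfderiv_prodMk hg.mdifferentiableAt
      (hψ'.comp (g := ψ) (f := l) y hl.mdifferentiableAt)) v
  have h3 : Function.Injective L := by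
    refine (injective_iff_map_eq_zero L).2 fun v hv ↦ ?_
    rw [h1] at hv
    refine hinj v ?_ (congrArg Prod.fst hv)
    apply (hd _ hy).1
    rw [map_zero]
    exact congrArg Prod.snd hv
  refine ⟨h3, (LinearMap.injective_iff_surjective_of_finrank_eq_finrank
    (f := (L : ℂ × ℂ →ₗ[ℝ] ℝ × EuclideanSpace ℝ (Fin 3))) ?_).1 h3⟩
  simp [Module.finrank_prod]

/-- A local parametrisation that is adapted to a set of leaves gives a foliated chart. -/
theorem exists_foliatedChart {N : Type*} [TopologicalSpace N] {E H : Type*} [NormedAddCommGroup E]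
    [NormedSpace ℝ E] [CompleteSpace E] [TopologicalSpace H] {I : ModelWithCorners ℝ E H}
    [I.Boundaryless] [ChartedSpace H N] [IsManifold I ∞ N] {f : ℂ × ℂ → N} {U : Set (ℂ × ℂ)}
    (hU : IsOpen U) {y : ℂ × ℂ} (hy : y ∈ U) (hf : ContMDiffOn 𝓘(ℝ, ℂ × ℂ) I ∞ f U)
    (hd : ∀ y ∈ U, Function.Bijective (mder 𝓘(ℝ, ℂ × ℂ) I f y)) {ℱ : Set (Set N)}
    (hℱ : ∀ L ∈ ℱ, ∃ C : Set ℂ, C.Countable ∧ ∀ y ∈ U, f y ∈ L ↔ y.2 ∈ C) :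
    ∃ Θ : OpenPartialHomeomorph N (ℂ × ℂ), f y ∈ Θ.source ∧
      Θ.target = Metric.ball (0 : ℂ) 1 ×ˢ Metric.ball (0 : ℂ) 1 ∧
      ContMDiffOn I 𝓘(ℝ, ℂ × ℂ) ∞ Θ Θ.source ∧
      ContMDiffOn 𝓘(ℝ, ℂ × ℂ) I ∞ Θ.symm Θ.target ∧
      ∀ L ∈ ℱ, ∃ C : Set ℂ, C.Countable ∧ L ∩ Θ.source = Θ.source ∩ Θ ⁻¹' {x | x.2 ∈ C} := by
  obtain ⟨e, hye, heU, hef, hes⟩ := exists_localInverse hU hy hf hd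
  obtain ⟨r, hr, hrs⟩ := Metric.mem_nhds_iff.1 (e.open_source.mem_nhds hye)
  -- An affine rescaling of the unit polydisk into the source of the local inverse. Balls of a
  -- product are products of balls, because the norm on `ℂ × ℂ` is the maximum norm.
  let s : ℂ × ℂ ≃ₜ ℂ × ℂ := (Homeomorph.smulOfNeZero r hr.ne').trans (Homeomorph.addLeft y)
  have hs : ∀ x, s x = y + r • x := fun _ ↦ rfl
  have hs' : ∀ x, s.symm x = r⁻¹ • (-y + x) := fun _ ↦ rfl
  let b : Set (ℂ × ℂ) := Metric.ball (0 : ℂ) 1 ×ˢ Metric.ball (0 : ℂ) 1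
  have hb : IsOpen b := Metric.isOpen_ball.prod Metric.isOpen_ball
  have hb0 : ∀ x ∈ b, s x ∈ e.source := by
    intro x hx
    apply hrs
    have hx' : x ∈ Metric.ball (0 : ℂ × ℂ) 1 := by
      rw [← ball_prod_same]; exact hx
    rw [hs, mem_ball_iff_norm, add_sub_cancel_left, norm_smul, Real.norm_of_nonneg hr.le]
    have := mem_ball_zero_iff.1 hx'
    nlinarith
  let Θ := ((s.toOpenPartialHomeomorph.trans e).restrOpen b hb).symm
  have htar : Θ.target = b := by
    change (univ ∩ s ⁻¹' e.source) ∩ b = b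
    rw [univ_inter]
    exact inter_eq_right.2 hb0
  have hsymm : ∀ x, Θ.symm x = f (s x) := fun x ↦ congrFun hef (s x)
  have hΘ : ∀ p, Θ p = s.symm (e.symm p) := fun _ ↦ rfl
  have hsrc : Θ.source ⊆ e.target := fun p hp ↦ by
    have h1 := Θ.map_source hp
    rw [htar] at h1
    have h2 := e.map_source (hb0 _ h1)
    rw [hef, ← hsymm, Θ.left_inv hp] at h2
    exact h2
  have hsd : ContDiff ℝ ∞ s := contDiff_const.add (contDiff_id.const_smul r)
  have hsd' : ContDiff ℝ ∞ s.symm := (contDiff_const.add contDiff_id).const_smul r⁻¹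
  have h0 : (0 : ℂ × ℂ) ∈ Θ.target := by
    rw [htar]; exact ⟨by simp, by simp⟩
  refine ⟨Θ, ?_, htar, ?_, ?_, fun L hL ↦ ?_⟩
  · have := Θ.map_target h0
    rwa [hsymm, hs, smul_zero, add_zero] at this
  · exact hsd'.contMDiff.comp_contMDiffOn (hes.mono hsrc)
  · have h1 : ContMDiffOn 𝓘(ℝ, ℂ × ℂ) I ∞ (fun x ↦ f (s x)) Θ.target :=
      hf.comp hsd.contMDiff.contMDiffOn fun x hx ↦ heU (hb0 x (by rwa [htar] at hx))
    exact h1.congr fun x _ ↦ hsymm x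
  · obtain ⟨C, hC, hCL⟩ := hℱ L hL
    -- The rescaling acts on the second coordinate by itself, so it turns sets of plaques into sets
    -- of plaques and keeps them countable.
    refine ⟨(fun w ↦ y.2 + r • w) ⁻¹' C, hC.preimage fun w w' h ↦ ?_, ?_⟩
    · exact smul_right_injective ℂ hr.ne' (add_left_cancel h)
    · ext p
      have key : p ∈ Θ.source → (p ∈ L ↔ y.2 + r • (Θ p).2 ∈ C) := fun hp ↦ by
        have h1 := Θ.map_source hp
        rw [htar] at h1
        have h2 := hCL (s (Θ p)) (heU (hb0 _ h1))
        rwa [← hsymm, Θ.left_inv hp] at h2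
      exact ⟨fun h ↦ ⟨h.2, (key h.2).1 h.1⟩, fun h ↦ ⟨(key h.1).2 h.2, h.1⟩⟩

end Charts

/-! ### The foliation. -/

namespace AdaptedFamily

open OpenBook

variable {M : Type*} [TopologicalSpace M] [ChartedSpace (EuclideanSpace ℝ (Fin 3)) M]
  [IsManifold (𝓡 3) ∞ M] [T2Space M]
  {F : Type*} [TopologicalSpace F] [ChartedSpace ℂ F] [IsManifold 𝓘(ℝ, ℂ) ∞ F] {n : ℕ}
  {B : OpenBook M F n} (A : AdaptedFamily B) (P : A.Profiles)

/-- The translates of the holomorphic curves. -/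
def leaf (c α : ℝ) : Set (ℝ × M) := range fun x : F ↦ (c + A.height P x, B.mt (x, α))

/-- The leaves of the foliation. -/
def leaves : Set (Set (ℝ × M)) :=
  {L | ∃ c α, L = A.leaf P c α} ∪ {L | ∃ i, L = univ ×ˢ B.binding i}

/-- The height is invariant under the monodromy, so another representative of the same point on the
page changes only the angle, by a period. -/
theorem mem_leaf {τ c α t : ℝ} {x : F} : (τ, B.mt (x, t)) ∈ A.leaf P c α ↔
    τ = c + A.height P x ∧ ∃ k : ℤ, t = α + 2 * Real.pi * k := by
  constructor
  · rintro ⟨y, h⟩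
    obtain ⟨k, h1, h2⟩ := (B.mt_eq_iff y x α t).1 (congrArg Prod.snd h)
    refine ⟨?_, k, h1⟩
    have h3 : A.height P x = A.height P y := by
      rw [h2]; exact glue_hpow _ _ k y
    rw [h3]
    exact (congrArg Prod.fst h).symm
  · rintro ⟨rfl, k, rfl⟩
    have h : A.height P (B.hpow (-k) x) = A.height P x := glue_hpow _ _ (-k) x
    refine ⟨B.hpow (-k) x, Prod.ext (congrArg (c + ·) h) ?_⟩
    rw [← mt_hpow (-k) x]
    change B.mt (_, α) = B.mt (_, _)
    congr 2
    push_cast; ring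

theorem leaf_add (c α : ℝ) (k : ℤ) : A.leaf P c (α + 2 * Real.pi * k) = A.leaf P c α := by
  apply Subset.antisymm
  · rintro _ ⟨x, rfl⟩
    exact (A.mem_leaf P).2 ⟨rfl, k, rfl⟩
  · rintro _ ⟨x, rfl⟩
    exact (A.mem_leaf P).2 ⟨rfl, -k, by push_cast; ring⟩

theorem tube_notMem_leaf (τ c α : ℝ) (i : Fin n) (θ : ℝ) : (τ, B.tube i (θ, 0)) ∉ A.leaf P c α := by
  rintro ⟨x, h⟩
  exact B.mt_ne_tube_zero x α i θ (congrArg Prod.snd h)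

theorem mt_notMem_binding (q : F × ℝ) (i : Fin n) : B.mt q ∉ B.binding i := by
  rintro ⟨⟨θ, z⟩, ⟨-, hz⟩, h⟩
  rw [mem_singleton_iff] at hz
  subst hz
  exact B.mt_ne_tube_zero q.1 q.2 i θ h.symm

theorem tube_mem_binding_iff {i j : Fin n} {θ : ℝ} {z : ℂ} (hz : z ∈ Metric.ball (0 : ℂ) B.R) :
    B.tube i (θ, z) ∈ B.binding j ↔ z = 0 ∧ i = j := by
  constructor
  · rintro ⟨⟨θ', z'⟩, ⟨-, hz'⟩, h⟩
    rw [mem_singleton_iff] at hz'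
    subst hz'
    obtain ⟨h1, h2, -⟩ := (B.tube_eq_iff _ _ _ (by simpa using B.R_pos) _ hz _ _).1 h
    exact ⟨h2.symm, h1.symm⟩
  · rintro ⟨rfl, rfl⟩
    exact ⟨(θ, 0), ⟨mem_univ _, rfl⟩, rfl⟩

theorem isPathConnected_leaf [ConnectedSpace F] (c α : ℝ) : IsPathConnected (A.leaf P c α) := by
  have : LocallyPathConnectedSpace F := ChartedSpace.locallyPathConnectedSpace ℂ F
  have : PathConnectedSpace F := pathConnectedSpace_iff_connectedSpace.2 inferInstance
  refine isPathConnected_range ?_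
  exact (continuous_const.add (A.contMDiff_height P).continuous).prodMk
    (B.mt_smooth.continuous.comp (continuous_id.prodMk continuous_const))

variable (B) in
theorem isPathConnected_univ_prod_binding (i : Fin n) :
    IsPathConnected ((univ : Set ℝ) ×ˢ B.binding i) := by
  have h1 : (univ : Set ℝ) ×ˢ B.binding i = range fun x : ℝ × ℝ ↦ (x.1, B.tube i (x.2, 0)) := by
    ext ⟨τ, p⟩
    constructor
    · rintro ⟨-, ⟨θ, z⟩, ⟨-, hz⟩, rfl⟩
      rw [mem_singleton_iff] at hz
      subst hz
      exact ⟨(τ, θ), rfl⟩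
    · rintro ⟨⟨τ, θ⟩, h⟩
      rw [← h]
      exact ⟨mem_univ _, (θ, 0), ⟨mem_univ _, rfl⟩, rfl⟩
  rw [h1]
  refine isPathConnected_range (continuous_fst.prodMk ?_)
  exact (B.tube_smooth i).continuousOn.comp_continuous
    (continuous_snd.prodMk continuous_const) fun x ↦ ⟨mem_univ _, by simpa using B.R_pos⟩

theorem existsUnique_leaf (q : ℝ × M) : ∃! L, L ∈ A.leaves P ∧ q ∈ L := by
  obtain ⟨τ, p⟩ := q
  rcases mt_or_binding B p with ⟨⟨x, t⟩, rfl⟩ | ⟨i, θ, rfl⟩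
  · refine ⟨A.leaf P (τ - A.height P x) t, ⟨Or.inl ⟨_, _, rfl⟩,
      (A.mem_leaf P).2 ⟨by ring, 0, by simp⟩⟩, ?_⟩
    rintro L ⟨⟨c, α, rfl⟩ | ⟨i, rfl⟩, h⟩
    · obtain ⟨h1, k, rfl⟩ := (A.mem_leaf P).1 h
      rw [leaf_add, h1, add_sub_cancel_right]
    · exact absurd h.2 (mt_notMem_binding _ i)
  · refine ⟨univ ×ˢ B.binding i, ⟨Or.inr ⟨i, rfl⟩, mem_univ _,
      (tube_mem_binding_iff (by simpa using B.R_pos)).2 ⟨rfl, rfl⟩⟩, ?_⟩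
    rintro L ⟨⟨c, α, rfl⟩ | ⟨j, rfl⟩, h⟩
    · exact absurd h (A.tube_notMem_leaf P _ _ _ _ _)
    · rw [((tube_mem_binding_iff (by simpa using B.R_pos)).1 h.2).2]

/-- Foliated charts at points of the pages. -/
theorem exists_foliatedChart_mt (τ : ℝ) (q : F × ℝ) :
    ∃ Θ : OpenPartialHomeomorph (ℝ × M) (ℂ × ℂ), (τ, B.mt q) ∈ Θ.source ∧
      Θ.target = Metric.ball (0 : ℂ) 1 ×ˢ Metric.ball (0 : ℂ) 1 ∧
      ContMDiffOn (𝓘(ℝ, ℝ).prod (𝓡 3)) 𝓘(ℝ, ℂ × ℂ) ∞ Θ Θ.source ∧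
      ContMDiffOn 𝓘(ℝ, ℂ × ℂ) (𝓘(ℝ, ℝ).prod (𝓡 3)) ∞ Θ.symm Θ.target ∧
      ∀ L ∈ A.leaves P, ∃ C : Set ℂ, C.Countable ∧
        L ∩ Θ.source = Θ.source ∩ Θ ⁻¹' {x | x.2 ∈ C} := by
  obtain ⟨x, t⟩ := q
  obtain ⟨hs, hsd⟩ := chart_param x
  have hO := isOpen_extChartAt_target (I := 𝓘(ℝ, ℂ)) x
  set σ := (extChartAt 𝓘(ℝ, ℂ) x).symm with hσ
  set O := (extChartAt 𝓘(ℝ, ℂ) x).target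
  have hx : σ (extChartAt 𝓘(ℝ, ℂ) x x) = x := extChartAt_to_inv x
  have hH : ContDiffOn ℝ ∞ (fun ζ ↦ A.height P (σ ζ)) O :=
    ((A.contMDiff_height P).comp_contMDiffOn hs).contDiffOn
  let l : ℂ × ℂ →L[ℝ] ℂ × ℝ := (ContinuousLinearMap.fst ℝ ℂ ℂ).prod
    (Complex.imCLM.comp (ContinuousLinearMap.snd ℝ ℂ ℂ))
  have hl : ∀ y, l y = (y.1, y.2.im) := fun _ ↦ rfl
  -- In the parametrisation `(ζ, w) ↦ (Re w + height, mt(ζ, Im w))` the leaf with parameters `c`,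
  -- `α` is the set `w = c + iα`.
  let g : ℂ × ℂ → ℝ := fun y ↦ y.2.re + A.height P (σ y.1)
  have hU : IsOpen (O ×ˢ (univ : Set ℂ)) := hO.prod isOpen_univ
  have hg : ContDiffOn ℝ ∞ g (O ×ˢ univ) :=
    ((Complex.reCLM.contDiff.comp contDiff_snd).contDiffOn).add
      (hH.comp contDiffOn_fst fun y hy ↦ hy.1)
  have hψ : ContMDiffOn 𝓘(ℝ, ℂ × ℝ) (𝓡 3) ∞ (B.slide σ) (O ×ˢ univ) := contMDiffOn_slide hs
  have hψl : ContMDiffOn 𝓘(ℝ, ℂ × ℂ) (𝓡 3) ∞ (fun y ↦ B.slide σ (l y)) (O ×ˢ univ) :=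
    hψ.comp l.contDiff.contMDiff.contMDiffOn fun y hy ↦ ⟨hy.1, mem_univ _⟩
  have h1 := exists_foliatedChart (I := 𝓘(ℝ, ℝ).prod (𝓡 3)) (ℱ := A.leaves P)
    (f := fun y ↦ (g y, B.slide σ (l y))) hU
    (y := (extChartAt 𝓘(ℝ, ℂ) x x, ⟨τ - A.height P x, t⟩))
    ⟨mem_extChartAt_target (I := 𝓘(ℝ, ℂ)) x, mem_univ _⟩ (hg.contMDiffOn.prodMk hψl)
    (fun y hy ↦ bijective_mder_pair (hO.prod isOpen_univ) hψ
      (fun q hq ↦ bijective_mder_slide hO hs hsd hq)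
      ((hg.contDiffAt (hU.mem_nhds hy)).differentiableAt (by simp)) l.differentiableAt
      ⟨hy.1, mem_univ _⟩ fun v hv hv' ↦ ?_) ?_
  · have h2 : (g (extChartAt 𝓘(ℝ, ℂ) x x, ⟨τ - A.height P x, t⟩),
        B.slide σ (l (extChartAt 𝓘(ℝ, ℂ) x x, ⟨τ - A.height P x, t⟩))) = (τ, B.mt (x, t)) := by
      simp only [g, hl, slide, hx]
      rw [sub_add_cancel]
    rwa [h2] at h1
  · rw [l.fderiv, hl] at hv
    have hv1 : v.1 = 0 := congrArg Prod.fst hv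
    have hv2 : v.2.im = 0 := congrArg Prod.snd hv
    have h3 : HasFDerivAt (fun y : ℂ × ℂ ↦ A.height P (σ y.1)) _ y :=
      ((hH.contDiffAt (hO.mem_nhds hy.1)).differentiableAt (by simp)).hasFDerivAt.comp y
        (ContinuousLinearMap.fst ℝ ℂ ℂ).hasFDerivAt
    have h4 : HasFDerivAt g _ y :=
      ((Complex.reCLM.comp (ContinuousLinearMap.snd ℝ ℂ ℂ)).hasFDerivAt (x := y)).add h3
    rw [h4.fderiv] at hv'
    have h5 : v.2.re = 0 := by simpa [hv1] using hv'
    exact Prod.ext hv1 (Complex.ext h5 hv2)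
  · rintro L (⟨c, α, rfl⟩ | ⟨i, rfl⟩)
    -- Since the angle counts modulo `2π` and `Im w` is unrestricted in this chart, a leaf has
    -- countably many plaques.
    · refine ⟨range fun k : ℤ ↦ (⟨c, α + 2 * Real.pi * k⟩ : ℂ), countable_range _, fun y _ ↦ ?_⟩
      refine (A.mem_leaf P (x := σ y.1) (t := y.2.im)).trans ?_
      constructor
      · rintro ⟨h2, k, h3⟩
        exact ⟨k, Complex.ext (add_right_cancel h2).symm h3.symm⟩
      · rintro ⟨k, h2⟩
        rw [← h2]
        exact ⟨congrArg (· + _) (congrArg Complex.re h2).symm, k, rfl⟩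
    · exact ⟨∅, countable_empty, fun y _ ↦
        ⟨fun h ↦ mt_notMem_binding _ i h.2, fun h ↦ h.elim⟩⟩

/-- On the leaf `τ = c₀ + a(r)` with `a = -c log r - p`, so `s = τ + p` satisfies `log r + s/c =
c₀/c`. The left-hand side is `log |w|`, and `w` has the argument of `z`, so `w` is constant along
the leaf. -/
theorem mem_leaf_tube {s c α : ℝ} (i : Fin n) (θ : ℝ) {z w : ℂ}
    (hz : z = Real.exp (-(s / (P i).c)) * w) (hzρ : ‖z‖ < (P i).ρ₁) :
    (s - (P i).p ‖z‖, B.tube i (θ, z)) ∈ A.leaf P c α ↔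
      w = Complex.exp (c / (P i).c + α * Complex.I) := by
  have hcp := (P i).c_pos
  have hzR : ‖z‖ < B.R := (hzρ.trans (P i).ρ₁_mem.2).trans A.ρ_lt_R
  by_cases hw : w = 0
  · rw [hw, mul_zero] at hz
    rw [hz, hw]
    exact ⟨fun h ↦ absurd h (A.tube_notMem_leaf P _ _ _ _ _), fun h ↦ absurd h.symm (Complex.exp_ne_zero _)⟩
  have hz0 : z ≠ 0 := by
    rw [hz]; exact mul_ne_zero (Complex.ofReal_ne_zero.2 (Real.exp_pos _).ne') hw
  have hzn : 0 < ‖z‖ := norm_pos_iff.2 hz0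
  have harg : z.arg = w.arg := by rw [hz, Complex.arg_real_mul _ (Real.exp_pos _)]
  have hlog : Real.log ‖z‖ = -(s / (P i).c) + Real.log ‖w‖ := by
    rw [hz, norm_mul, Complex.norm_real, Real.norm_of_nonneg (Real.exp_pos _).le,
      Real.log_mul (Real.exp_pos _).ne' (norm_ne_zero_iff.2 hw), Real.log_exp]
  have hlogw : Real.log ‖w‖ = Real.log ‖z‖ + s / (P i).c := by rw [hlog]; ring
  rw [B.tube_eq_mt i (by simpa using hzR) hz0, A.mem_leaf P,
    A.height_pageEnd P i ⟨⟨hzn, hzR⟩, mem_univ _⟩, (P i).a_log ‖z‖ ⟨hzn, hzρ⟩, harg]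
  have h1 : s - (P i).p ‖z‖ = c + (-(P i).c * Real.log ‖z‖ - (P i).p ‖z‖) ↔
      Real.log ‖w‖ = c / (P i).c := by
    rw [hlogw]
    field_simp
    constructor <;> intro h <;> linarith
  rw [h1]
  have hlogC : Complex.exp (Real.log ‖w‖ + w.arg * Complex.I) = w := by
    rw [← Complex.log, Complex.exp_log hw]
  rw [← hlogC]
  conv_rhs => rw [Complex.exp_eq_exp_iff_exists_int]
  rw [hlogC]
  constructor
  · rintro ⟨h2, k, h3⟩
    refine ⟨k, ?_⟩
    rw [h2, h3]
    push_cast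
    ring
  · rintro ⟨k, h⟩
    have hre := congrArg Complex.re h
    have him := congrArg Complex.im h
    refine ⟨?_, k, ?_⟩
    · simpa using hre
    · simp at him
      linarith

/-- Foliated charts at points of the binding. -/
theorem exists_foliatedChart_tube (τ : ℝ) (i : Fin n) (θ : ℝ) :
    ∃ Θ : OpenPartialHomeomorph (ℝ × M) (ℂ × ℂ), (τ, B.tube i (θ, 0)) ∈ Θ.source ∧
      Θ.target = Metric.ball (0 : ℂ) 1 ×ˢ Metric.ball (0 : ℂ) 1 ∧
      ContMDiffOn (𝓘(ℝ, ℝ).prod (𝓡 3)) 𝓘(ℝ, ℂ × ℂ) ∞ Θ Θ.source ∧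
      ContMDiffOn 𝓘(ℝ, ℂ × ℂ) (𝓘(ℝ, ℝ).prod (𝓡 3)) ∞ Θ.symm Θ.target ∧
      ∀ L ∈ A.leaves P, ∃ C : Set ℂ, C.Countable ∧
        L ∩ Θ.source = Θ.source ∩ Θ ⁻¹' {x | x.2 ∈ C} := by
  let k : ℂ × ℂ →L[ℝ] ℝ := (-((P i).c)⁻¹) • Complex.reCLM.comp (ContinuousLinearMap.fst ℝ ℂ ℂ)
  have hk : ∀ y, k y = -(y.1.re / (P i).c) := fun y ↦ by
    simp [k, div_eq_inv_mul]
  -- The point of the tube is `z = e^{-s/c} w` with `s = Re ζ`, and `Im ζ` is `θ`. Smoothness of `p`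
  -- as a function on the disk makes this parametrisation smooth across the binding.
  let m : ℂ × ℂ → ℂ := fun y ↦ Real.exp (k y) • y.2
  let l : ℂ × ℂ → ℝ × ℂ := fun y ↦ (y.1.im, m y)
  let g : ℂ × ℂ → ℝ := fun y ↦ y.1.re - (P i).p ‖m y‖
  have hm : ContDiff ℝ ∞ m := k.contDiff.exp.smul contDiff_snd
  have hl : ContDiff ℝ ∞ l := (Complex.imCLM.contDiff.comp contDiff_fst).prodMk hm
  have hp : ContDiffOn ℝ ∞ (fun z : ℂ ↦ (P i).p ‖z‖) (Metric.ball 0 (P i).ρ₁) := (P i).p_smooth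
  let U : Set (ℂ × ℂ) := m ⁻¹' Metric.ball 0 (P i).ρ₁
  have hU : IsOpen U := Metric.isOpen_ball.preimage hm.continuous
  have hg : ContDiffOn ℝ ∞ g U := ((Complex.reCLM.contDiff.comp contDiff_fst).contDiffOn).sub
    (hp.comp hm.contDiffOn fun y hy ↦ hy)
  have hUR : ∀ y ∈ U, l y ∈ (univ : Set ℝ) ×ˢ Metric.ball (0 : ℂ) B.R := fun y hy ↦
    ⟨mem_univ _, Metric.ball_subset_ball ((P i).ρ₁_mem.2.trans A.ρ_lt_R).le hy⟩
  have hψl : ContMDiffOn 𝓘(ℝ, ℂ × ℂ) (𝓡 3) ∞ (fun y ↦ B.tube i (l y)) U :=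
    (B.tube_smooth i).comp hl.contMDiff.contMDiffOn hUR
  have hm0 : ∀ ζ, m (ζ, 0) = 0 := fun ζ ↦ smul_zero _
  have h1 := exists_foliatedChart (I := 𝓘(ℝ, ℝ).prod (𝓡 3)) (ℱ := A.leaves P)
    (f := fun y ↦ (g y, B.tube i (l y))) hU (y := (⟨τ + (P i).p 0, θ⟩, 0))
    (by change m _ ∈ Metric.ball (0 : ℂ) _; rw [hm0]; exact A.zero_mem_ball i) (hg.contMDiffOn.prodMk hψl)
    (fun y hy ↦ bijective_mder_pair (isOpen_univ.prod Metric.isOpen_ball) (B.tube_smooth i)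
      (fun q hq ↦ B.tube_mder i hq.2)
      ((hg.contDiffAt (hU.mem_nhds hy)).differentiableAt (by simp))
      (hl.differentiable (by simp) y) (hUR y hy) fun v hv hv' ↦ ?_) ?_
  · have h2 : (g (⟨τ + (P i).p 0, θ⟩, 0), B.tube i (l (⟨τ + (P i).p 0, θ⟩, 0))) =
        (τ, B.tube i (θ, 0)) := by
      simp only [g, l, hm0, norm_zero, add_sub_cancel_right]
    rwa [h2] at h1
  · have hmd : HasFDerivAt m _ y := (k.hasFDerivAt (x := y)).exp.smul
      ((ContinuousLinearMap.snd ℝ ℂ ℂ).hasFDerivAt (x := y))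
    have hld : HasFDerivAt l _ y := ((Complex.imCLM.comp
      (ContinuousLinearMap.fst ℝ ℂ ℂ)).hasFDerivAt (x := y)).prodMk hmd
    rw [hld.fderiv] at hv
    have hv1 : v.1.im = 0 := congrArg Prod.fst hv
    have hv2 : (Real.exp (k y) • ContinuousLinearMap.snd ℝ ℂ ℂ +
        ContinuousLinearMap.smulRight (Real.exp (k y) • k) y.2) v = 0 := congrArg Prod.snd hv
    have hpd : HasFDerivAt (fun y ↦ (P i).p ‖m y‖) _ y :=
      ((hp.contDiffAt (Metric.isOpen_ball.mem_nhds hy)).differentiableAt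
        (by simp)).hasFDerivAt.comp y hmd
    have hgd : HasFDerivAt g _ y :=
      ((Complex.reCLM.comp (ContinuousLinearMap.fst ℝ ℂ ℂ)).hasFDerivAt (x := y)).sub hpd
    rw [hgd.fderiv] at hv'
    have hv3 : v.1.re = 0 := by
      rw [sub_apply, ContinuousLinearMap.comp_apply, ContinuousLinearMap.comp_apply, hv2, map_zero,
        sub_zero] at hv'
      exact hv'
    have hv4 : k v = 0 := by rw [hk, hv3]; simp
    have hv5 : Real.exp (k y) • v.2 + (Real.exp (k y) * k v) • y.2 = 0 := hv2
    rw [hv4, mul_zero, zero_smul, add_zero] at hv5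
    exact Prod.ext (Complex.ext hv3 hv1) ((smul_eq_zero.1 hv5).resolve_left (Real.exp_pos _).ne')
  · rintro L (⟨c, α, rfl⟩ | ⟨j, rfl⟩)
    · refine ⟨{Complex.exp (c / (P i).c + α * Complex.I)}, countable_singleton _, fun y hy ↦ ?_⟩
      refine A.mem_leaf_tube P i y.1.im (w := y.2) ?_ (mem_ball_zero_iff.1 hy)
      change Real.exp (k y) • y.2 = _
      rw [hk, Complex.real_smul]
    · refine ⟨{w | w = 0 ∧ i = j}, (countable_singleton 0).mono fun w hw ↦ hw.1, fun y hy ↦ ?_⟩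
      refine (and_iff_right (mem_univ _)).trans ((tube_mem_binding_iff (hUR y hy).2).trans ?_)
      refine and_congr_left fun _ ↦ ?_
      exact smul_eq_zero_iff_right (Real.exp_pos _).ne'

theorem isSurfaceFoliation_leaves [ConnectedSpace F] : IsSurfaceFoliation (A.leaves P) where
  connected := by
    rintro L (⟨c, α, rfl⟩ | ⟨i, rfl⟩)
    · exact A.isPathConnected_leaf P c α
    · exact isPathConnected_univ_prod_binding B i
  partition := A.existsUnique_leaf P
  charts := by
    rintro ⟨τ, p⟩
    rcases mt_or_binding B p with ⟨q, rfl⟩ | ⟨i, θ, rfl⟩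
    · exact A.exists_foliatedChart_mt P τ q
    · exact A.exists_foliatedChart_tube P τ i θ

theorem translate_mem_leaves {L : Set (ℝ × M)} (hL : L ∈ A.leaves P) (c : ℝ) :
    (fun q : ℝ × M ↦ (c + q.1, q.2)) '' L ∈ A.leaves P := by
  rcases hL with ⟨c', α, rfl⟩ | ⟨i, rfl⟩
  · refine Or.inl ⟨c + c', α, ?_⟩
    rw [leaf, leaf, ← range_comp]
    congr 1
    funext x
    simp only [Function.comp, add_assoc]
  · refine Or.inr ⟨i, ?_⟩
    ext ⟨τ, p⟩
    constructor
    · rintro ⟨⟨τ', p'⟩, h, h'⟩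
      exact ⟨mem_univ _, congrArg Prod.snd h' ▸ h.2⟩
    · rintro ⟨-, h⟩
      exact ⟨(τ - c, p), ⟨mem_univ _, h⟩, by simp⟩

variable [Nonempty F]

theorem image_leaf (c α : ℝ) : (fun z ↦ (c + A.leafA (P := P) z, A.leafU (P := P) α z)) ''
    (range (A.ends P).pt)ᶜ = A.leaf P c α := by
  rw [(A.ends P).compl_range_pt, ← range_comp]
  rfl

/-- Angles in `[0, 2π]` suffice, because a leaf depends on the angle only modulo `2π`. -/
theorem leaves_eq : {L | ∃ α ∈ Icc 0 (2 * Real.pi), ∃ c : ℝ,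
      L = (fun z ↦ (c + A.leafA (P := P) z, A.leafU (P := P) α z)) '' (range (A.ends P).pt)ᶜ} ∪
    {L | ∃ i, L = univ ×ˢ B.binding i} = A.leaves P := by
  refine congrArg (· ∪ _) (Subset.antisymm ?_ ?_)
  · rintro L ⟨α, -, c, rfl⟩
    exact ⟨c, α, A.image_leaf P c α⟩
  · rintro L ⟨c, α, rfl⟩
    obtain ⟨k, α', hα, rfl⟩ := exists_period α
    exact ⟨_, ⟨hα.1, hα.2.le⟩, c, by rw [image_leaf, leaf_add]⟩

end AdaptedFamily

/-! ### Assembly of the result. -/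

namespace AdaptedFamily

open OpenBook

theorem isComplexFamily_const {S : Type*} [TopologicalSpace S] [ChartedSpace ℂ S]
    [IsManifold 𝓘(ℝ, ℂ) ∞ S] {j : ℝ → SurfEndField S} (h : IsComplexFamily j) (α : ℝ) :
    IsComplexFamily fun _ ↦ j α :=
  ⟨fun _ ↦ h.1 α, h.2.comp (contMDiff_const.prodMk contMDiff_snd :
    ContMDiff (𝓘(ℝ, ℝ).prod 𝓘(ℝ, ℂ).tangent) (𝓘(ℝ, ℝ).prod 𝓘(ℝ, ℂ).tangent) ∞
      fun q : ℝ × TangentBundle 𝓘(ℝ, ℂ) S ↦ (α, q.2))⟩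

variable {M : Type v} [TopologicalSpace M] [ChartedSpace (EuclideanSpace ℝ (Fin 3)) M]
  [IsManifold (𝓡 3) ∞ M] [CompactSpace M] [T2Space M]
  {F : Type w} [TopologicalSpace F] [ChartedSpace ℂ F] [IsManifold 𝓘(ℝ, ℂ) ∞ F] [T2Space F]
  [ConnectedSpace F] {n : ℕ} {B : OpenBook M F n} (A : AdaptedFamily B)
  {P : A.Profiles} (C : A.PageComplex P)

theorem isFiniteEnergyFoliation_leaves : IsFiniteEnergyFoliation.{w} (A.lam 0) (A.X 0)
    (fun p ↦ A.acs C 0 p : InvEndField M) B.binding (A.leaves P) where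
  foliation := A.isSurfaceFoliation_leaves P
  invariant L hL c := A.translate_mem_leaves P hL c
  leaves := by
    rintro L (⟨c, α, rfl⟩ | ⟨i, rfl⟩)
    · exact Or.inr ⟨(A.ends P).Filled, inferInstance, inferInstance, inferInstance, inferInstance,
        inferInstance, inferInstance, range (A.ends P).pt, fun z ↦ A.surfJ C α z,
        fun z ↦ c + A.leafA z, A.leafU α, finite_range _,
        isComplexFamily_const (A.isComplexFamily_surfJ C) α,
        A.isEmbeddedFiniteEnergyCurve_leaf C c α, A.isTransverseTo_leafU α,
        (A.image_leaf P c α).symm⟩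
    · exact Or.inl ⟨i, rfl⟩

end AdaptedFamily

theorem mainTheorem6 {M : Type v} [TopologicalSpace M]
    [ChartedSpace (EuclideanSpace ℝ (Fin 3)) M] [IsManifold (𝓡 3) ∞ M] [CompactSpace M] [T2Space M]
    {F : Type w} [TopologicalSpace F] [ChartedSpace ℂ F] [IsManifold 𝓘(ℝ, ℂ) ∞ F] [T2Space F]
    [ConnectedSpace F] {n : ℕ} (B : OpenBook M F n) (A : AdaptedFamily B) :
    -- the almost complex structures
    ∃ J : ℝ → InvEndField M,
      IsAlmostComplexFamily J ∧
      (∀ δ ∈ Ico (0 : ℝ) 1, ∀ p : M, J δ p (0, A.X δ p) = (-1, 0)) ∧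
      (∀ δ ∈ Ico (0 : ℝ) 1, PreservesKer (A.lam δ) (J δ)) ∧
      (∀ δ ∈ Ico (0 : ℝ) 1, IsContactForm (A.lam δ) → IsCompatible (A.lam δ) (J δ)) ∧
    -- the closed surface, its punctures, the leaves, the functions and the complex structures
    ∃ (S : Type w) (_ : TopologicalSpace S) (_ : ChartedSpace ℂ S)
      (_ : IsManifold 𝓘(ℝ, ℂ) ∞ S) (_ : CompactSpace S) (_ : T2Space S) (_ : ConnectedSpace S)
      (p : Fin n → S) (u : ℝ → S → M) (a : ℝ → S → ℝ) (j : ℝ → SurfEndField S),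
      Function.Injective p ∧
      -- smooth families; `u α` parametrises the page with angle `α`
      ContMDiffOn (𝓘(ℝ, ℝ).prod 𝓘(ℝ, ℂ)) (𝓡 3) ∞ (fun q : ℝ × S ↦ u q.1 q.2)
        (univ ×ˢ (range p)ᶜ) ∧
      ContMDiffOn (𝓘(ℝ, ℝ).prod 𝓘(ℝ, ℂ)) 𝓘(ℝ, ℝ) ∞ (fun q : ℝ × S ↦ a q.1 q.2)
        (univ ×ˢ (range p)ᶜ) ∧
      IsComplexFamily j ∧
      (∀ α : ℝ, BijOn (u α) (range p)ᶜ (B.page α) ∧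
        IsEmbedding (fun z : ((range p)ᶜ : Set S) ↦ u α z) ∧
        ∀ z ∈ (range p)ᶜ, Function.Injective (mfderiv 𝓘(ℝ, ℂ) (𝓡 3) (u α) z)) ∧
      -- standard complex structures near the punctures, in coordinates on disks of radius `R > 1`
      -- (so on the half-cylinders `s ≥ 0` in the coordinates `z = exp (-(s + i t))`)
      (∃ R > (1 : ℝ), ∃ d : Fin n → ℂ → S,
        (∀ i, d i 0 = p i ∧
          ContMDiffOn 𝓘(ℝ, ℂ) 𝓘(ℝ, ℂ) ∞ (d i) (Metric.ball 0 R) ∧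
          InjOn (d i) (Metric.ball 0 R) ∧
          (∀ z ∈ Metric.ball (0 : ℂ) R,
            Function.Bijective (mfderiv 𝓘(ℝ, ℂ) 𝓘(ℝ, ℂ) (d i) z)) ∧
          ∀ α : ℝ, ∀ z ∈ Metric.ball (0 : ℂ) R, ∀ v : ℂ,
            j α (d i z) (mfderiv 𝓘(ℝ, ℂ) 𝓘(ℝ, ℂ) (d i) z v) =
              mfderiv 𝓘(ℝ, ℂ) 𝓘(ℝ, ℂ) (d i) z (Complex.I * v)) ∧
        Pairwise fun i k ↦ Disjoint (d i '' Metric.ball 0 R) (d k '' Metric.ball 0 R)) ∧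
      -- embedded holomorphic curves of finite energy for the confoliation form
      (∀ α : ℝ, IsEmbeddedFiniteEnergyCurve (A.lam 0) (J 0) (range p) (j α) (a α) (u α)) ∧
      -- all punctures are positive
      (∀ (α : ℝ) (i : Fin n), Tendsto (a α) (𝓝[≠] (p i)) atTop) ∧
      -- the translates of the curves, with the cylinders over the binding, form a finite energy
      -- foliation
      (∀ α : ℝ, IsTransverseTo (A.X 0) (range p) (u α)) ∧
      IsFiniteEnergyFoliation.{w} (A.lam 0) (A.X 0) (J 0) B.binding
        ({L | ∃ α ∈ Icc 0 (2 * Real.pi), ∃ c : ℝ,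
            L = (fun z ↦ (c + a α z, u α z)) '' (range p)ᶜ} ∪
          {L | ∃ i, L = univ ×ˢ B.binding i}) ∧
      -- the curves are holomorphic for all parameters near the punctures
      ∃ U : Set S, IsOpen U ∧ range p ⊆ U ∧
        ∀ δ ∈ Ico (0 : ℝ) 1, ∀ α : ℝ, ∀ z ∈ U \ range p,
          IsHolomorphicAt (J δ) (j α) (a α) (u α) z := by
  obtain ⟨P⟩ := A.nonempty_profiles
  obtain ⟨C⟩ := A.nonempty_pageComplex P
  refine ⟨fun δ p ↦ A.acs C δ p, A.isAlmostComplexFamily_acs C, fun δ hδ p ↦ A.acs_reeb C hδ p,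
    fun δ hδ p v hv ↦ ?_, fun δ hδ hc p v w hv hw ↦ ?_, (A.ends P).Filled, inferInstance,
    inferInstance, inferInstance, inferInstance, inferInstance, inferInstance, (A.ends P).pt,
    fun α ↦ A.leafU α, fun _ ↦ A.leafA, fun α z ↦ A.surfJ C α z, (A.ends P).pt_injective,
    A.contMDiffOn_leafU, A.contMDiffOn_leafA.comp contMDiffOn_snd fun q hq ↦ hq.2,
    A.isComplexFamily_surfJ C,
    fun α ↦ ⟨A.bijOn_leafU α, A.isEmbedding_leafU α, fun z hz ↦ A.injective_mfderiv_leafU α hz⟩,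
    ⟨2, one_lt_two, (A.ends P).cap, fun i ↦ ⟨(A.ends P).cap_zero i, ((A.ends P).contMDiffOn_cap i).1,
      (A.ends P).cap_injOn i, fun z hz ↦ (A.ends P).bijective_mder_cap i hz,
      fun α z hz v ↦ A.surfJ_cap C α i hz v⟩, fun i k hik ↦ disjoint_left.2 ?_⟩,
    fun α ↦ ?_, fun α i ↦ A.tendsto_leafA i, fun α ↦ A.isTransverseTo_leafU α, ?_, ?_⟩
  · obtain ⟨h1, h2⟩ := A.acs_ker C hδ p hv
    exact ⟨congrArg Prod.fst h1, (congrArg (A.lam δ p) (congrArg Prod.snd h1)).trans h2⟩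
  -- `λ_0` is closed on the core of the page, hence not a contact form, so compatibility is required
  -- for `δ > 0` only.
  · have hδ0 : δ ≠ 0 := by
      rintro rfl
      exact A.not_isContactForm_zero hc
    obtain ⟨h1, h2⟩ := A.extD_kerEndo C ⟨hδ.1.lt_of_ne hδ0.symm, hδ.2⟩ p hv hw
    have h3 := fun v hv ↦ congrArg Prod.snd (A.acs_ker C hδ p (v := v) hv).1
    refine ⟨(congrArg (extD (A.lam δ) p v) (h3 w hw)).trans
      (h1.trans (congrArg (extD (A.lam δ) p w) (h3 v hv)).symm), fun h0 ↦ ?_⟩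
    exact (h2 h0).trans_eq (congrArg (extD (A.lam δ) p v) (h3 v hv)).symm
  · rintro _ ⟨z, hz, rfl⟩ ⟨z', hz', h⟩
    exact (A.ends P).disjoint_cap hik hz hz' h.symm
  · have h := A.isEmbeddedFiniteEnergyCurve_leaf C 0 α
    simpa only [zero_add] using h
  · rw [A.leaves_eq P]
    exact A.isFiniteEnergyFoliation_leaves C
  · have h := A.exists_isHolomorphicAt C
    simpa only [zero_add] using h
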